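/- **Conventions.** Let $A$ be a $C^*$-algebra, $M(A)$ its multiplier algebra, $A^+$ its proper unitalization (a unit is added even if $A$ is unital), and $U(1+A)$ the group of unitaries of $A^+$ lying in $1+A$, with $U_0(1+A)$ the path component of $1$ in it. Write $\mathrm{Ad}(w)(a)=waw^*$. A *unitary path* is a norm-continuous map $[0,1]\to U(1+A)$, and $\ell(v)\in[0,\infty]$ is the length (total variation) of a path $v$. Two $*$-homomorphisms $\varphi_1,\varphi_2:A\to B$ are *approximately unitarily equivalent* if there is a net $u_\lambda\in U(1+B)$ with $u_\lambda\varphi_1(a)u_\lambda^*\to\varphi_2(a)$ for all $a\in A$; an automorphism of $A$ is *approximately inner* if it is approximately unitarily equivalent to $\mathrm{id}_A$. *Weak inner length.* For $u\in U_0(1+A)$, let $\mathrm{wil}(u)\in[0,\infty]$ be the infimum of all $L>0$ such that for every finite set $F$ of contractions in $A$ and every $\varepsilon>0$ there is a unitary path $v$ with $v_0=1$, $v_1=u$ and $\|v_{t_1}^*av_{t_1}-v_{t_2}^*av_{t_2}\|\le\varepsilon+L|t_1-t_2|$ for all $a\in F$ and $t_1,t_2\in[0,1]$. Put $\mathrm{wil}(A)=\sup_{u\in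 U_0(1+A)}\mathrm{wil}(u)$. *(Weak) approximately central exponential length.* Let $\mathrm{acel}(A)\in[0,\infty]$ be the infimum of all $C>0$ such that for every $\varepsilon>0$ and every finite set $F$ of contractions in $A$ there are $\delta>0$ and a finite set $G$ of contractions in $A$ with the following property: for every unitary path $u$ with $u_0=1$ and $\|[u_t,a]\|\le\delta$ for all $a\in G$, $t\in[0,1]$, there is a unitary path $v$ with $v_0=1$, $v_1=u_1$, $\ell(v)\le C+\varepsilon$, and $\|[v_t,a]\|\le\varepsilon$ for all $a\in F$, $t\in[0,1]$. Let $\mathrm{acel}_w(A)$ be defined in the same way, with the condition $\ell(v)\le C+\varepsilon$ replaced by $\|a(v_{t_1}-v_{t_2})\|\le\varepsilon+C|t_1-t_2|$ for all $a\in F$, $t_1,t_2\in[0,1]$. *Flows.* A *flow* $\alpha$ on $A$ is a group homomorphism $\alpha:\mathbb R\to\mathrm{Aut}(A)$ such that $t\mapsto\alpha_t(a)$ is norm-continuous for every $a\in A$; each $\alpha_t$ is extended canonically to $M(A)$. Let $\ell^\infty_\alpha(\mathbb N,A)$ be the algebra of bounded sequences $(x_n)$ in $A$ for which $t\mapsto(\alpha_t(x_n))_n$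 is norm-continuous, let $A_{\infty,\alpha}=\ell^\infty_\alpha(\mathbb N,A)/c_0(\mathbb N,A)$, which contains $A$ as constant sequences, and let $F_{\infty,\alpha}(A)=(A_{\infty,\alpha}\cap A')/\{x\in A_{\infty,\alpha}: xA=Ax=0\}$, with the action $\tilde\alpha_\infty$ of $\mathbb R$ induced by $\alpha$. If $A$ is separable, then $F_{\infty,\alpha}(A)$ is unital, and $\alpha$ is a *Rokhlin flow* if for every $p>0$ there is a unitary $u\in F_{\infty,\alpha}(A)$ with $\tilde\alpha_{\infty,t}(u)=e^{ipt}u$ for all $t\in\mathbb R$. The *restricted coaction* of $\alpha$ is the $*$-homomorphism $\alpha_{\mathrm{co}}:A\to C([0,1],A)$, $\alpha_{\mathrm{co}}(a)(t)=\alpha_t(a)$. *Cocycle conjugacy.* An *$\alpha$-cocycle* is a strictly continuous map $w:\mathbb R\to U(M(A))$ with $w_s\alpha_s(w_t)=w_{s+t}$ for all $s,t\in\mathbb R$. It is an *approximate coboundary* if there are $x_n\in U(M(A))$ with $\max_{|t|\le1}\|(x_n\alpha_t(x_n^*)-w_t)a\|\to0$ for all $a\in A$, and a *norm-approximate coboundary*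 if there are $x_n\in U(1+A)$ with $\max_{|t|\le1}\|x_n\alpha_t(x_n^*)-w_t\|\to0$. Flows $\alpha,\beta$ on $A$ are *cocycle conjugate via* an automorphism $\psi$ of $A$ if there is an $\alpha$-cocycle $w$ with $\psi^{-1}\circ\beta_t\circ\psi=\mathrm{Ad}(w_t)\circ\alpha_t$ for all $t\in\mathbb R$; they are *strongly* (resp. *norm-strongly*) cocycle conjugate via $\psi$ if $w$ can be chosen to be an approximate (resp. norm-approximate) coboundary. **Theorem.** Let $A$ be a separable $C^*$-algebra with $\mathrm{wil}(A)<\infty$ and $\mathrm{acel}_w(A)<\infty$. Let $\alpha,\beta$ be two Rokhlin flows on $A$. Then the following are equivalent: 1. $\alpha$ and $\beta$ are strongly cocycle conjugate via an approximately inner automorphism; 2. $\alpha$ and $\beta$ are cocycle conjugate via an approximately inner automorphism; 3. the maps $\alpha_{\mathrm{co}}$ and $\beta_{\mathrm{co}}$ are approximately unitarily equivalent. If moreover $\mathrm{acel}(A)<\infty$, then these statements are further equivalent to 4. $\alpha$ and $\beta$ are norm-strongly cocycle conjugate via an approximately inner automorphism. -/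

import Mathlib

open Set Filter Topology
open scoped NNReal ENNReal MultiplierAlgebra

noncomputable section

/-! ### Unitaries in `1 + A` -/

/-- The group `U(1 + A)` of unitaries of the proper unitalization `A⁺` (a unit is added even if `A`
is unital) whose scalar part is `1`. -/
def oneAddUnitary (A : Type*) [NonUnitalCStarAlgebra A] : Submonoid (Unitization ℂ A) where
  carrier := {u | u ∈ unitary (Unitization ℂ A) ∧ u.fst = 1}
  one_mem' := ⟨one_mem _, Unitization.fst_one⟩
  mul_mem' := by
    rintro u v ⟨hu, hu1⟩ ⟨hv, hv1⟩
    exact ⟨mul_mem hu hv, by rw [Unitization.fst_mul, hu1, hv1, one_mul]⟩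

/-- Approximate unitary equivalence of `*`-homomorphisms `φ₁, φ₂ : A → B`: there is a net of
unitaries in `U(1 + B)` conjugating `φ₁` to `φ₂` in the point-norm limit, that is, on every finite
set and up to every `ε > 0` some unitary does. -/
def ApproxUnitarilyEquivalent {A B : Type*} [NonUnitalCStarAlgebra A] [NonUnitalCStarAlgebra B]
    (φ₁ φ₂ : A →⋆ₙₐ[ℂ] B) : Prop :=
  ∀ (F : Finset A) (ε : ℝ), 0 < ε → ∃ u : oneAddUnitary B, ∀ a ∈ F,
    ‖(u : Unitization ℂ B) * (φ₁ a : Unitization ℂ B) * star (u : Unitization ℂ B)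
      - (φ₂ a : Unitization ℂ B)‖ < ε

/-- An automorphism is approximately inner if it is approximately unitarily equivalent to the
identity map. -/
def IsApproxInner {A : Type*} [NonUnitalCStarAlgebra A] (ψ : A ≃⋆ₐ[ℂ] A) : Prop :=
  ApproxUnitarilyEquivalent (NonUnitalStarAlgHom.id ℂ A) (ψ : A →⋆ₙₐ[ℂ] A)

/-! ### Weak inner length -/

/-- The constant `L` is admissible in the definition of the weak inner length of `u`. -/
def WeakInnerLengthBound {A : Type*} [NonUnitalCStarAlgebra A] (u : oneAddUnitary A) (L : ℝ≥0) :
    Prop :=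
  ∀ F : Finset A, (∀ a ∈ F, ‖a‖ ≤ 1) → ∀ ε : ℝ, 0 < ε →
    ∃ v : C(unitInterval, oneAddUnitary A), v 0 = 1 ∧ v 1 = u ∧
      ∀ a ∈ F, ∀ t₁ t₂ : unitInterval,
        ‖star (v t₁ : Unitization ℂ A) * (a : Unitization ℂ A) * (v t₁ : Unitization ℂ A)
          - star (v t₂ : Unitization ℂ A) * (a : Unitization ℂ A) * (v t₂ : Unitization ℂ A)‖
        ≤ ε + L * |(t₁ : ℝ) - t₂|

/-- The weak inner length of a unitary (`∞` if there is no admissible constant). -/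
def weakInnerLengthOf {A : Type*} [NonUnitalCStarAlgebra A] (u : oneAddUnitary A) : ℝ≥0∞ :=
  ⨅ (L : ℝ≥0) (_ : 0 < L) (_ : WeakInnerLengthBound u L), (L : ℝ≥0∞)

/-- The weak inner length of `A`: the supremum of the weak inner lengths of all unitaries in the
path component `U₀(1 + A)` of the unit. -/
def weakInnerLength (A : Type*) [NonUnitalCStarAlgebra A] : ℝ≥0∞ :=
  ⨆ (u : oneAddUnitary A) (_ : Joined 1 u), weakInnerLengthOf u

/-! ### Approximately central exponential length -/

/-- The path `u` of unitaries in `U(1 + A)` commutes with the elements of `F` up to `ε`. -/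
def PathCommutesUpTo {A : Type*} [NonUnitalCStarAlgebra A]
    (u : C(unitInterval, oneAddUnitary A)) (F : Finset A) (ε : ℝ) : Prop :=
  ∀ a ∈ F, ∀ t : unitInterval,
    ‖(u t : Unitization ℂ A) * (a : Unitization ℂ A)
      - (a : Unitization ℂ A) * (u t : Unitization ℂ A)‖ ≤ ε

/-- The constant `C` is admissible in the definition of the approximately central exponential
length. The length `ℓ(v)` of a path is its total variation `eVariationOn v univ`. -/
def ACELBound (A : Type*) [NonUnitalCStarAlgebra A] (C : ℝ≥0) : Prop :=
  ∀ ε : ℝ, 0 < ε → ∀ F : Finset A, (∀ a ∈ F, ‖a‖ ≤ 1) →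
    ∃ δ : ℝ, 0 < δ ∧ ∃ G : Finset A, (∀ a ∈ G, ‖a‖ ≤ 1) ∧
      ∀ u : C(unitInterval, oneAddUnitary A), u 0 = 1 → PathCommutesUpTo u G δ →
        ∃ v : C(unitInterval, oneAddUnitary A), v 0 = 1 ∧ v 1 = u 1 ∧
          eVariationOn v univ ≤ C + ENNReal.ofReal ε ∧ PathCommutesUpTo v F ε

/-- The approximately central exponential length of `A`. -/
def acel (A : Type*) [NonUnitalCStarAlgebra A] : ℝ≥0∞ :=
  ⨅ (C : ℝ≥0) (_ : 0 < C) (_ : ACELBound A C), (C : ℝ≥0∞)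

/-- The constant `C` is admissible in the definition of the weak approximately central exponential
length. -/
def WeakACELBound (A : Type*) [NonUnitalCStarAlgebra A] (C : ℝ≥0) : Prop :=
  ∀ ε : ℝ, 0 < ε → ∀ F : Finset A, (∀ a ∈ F, ‖a‖ ≤ 1) →
    ∃ δ : ℝ, 0 < δ ∧ ∃ G : Finset A, (∀ a ∈ G, ‖a‖ ≤ 1) ∧
      ∀ u : C(unitInterval, oneAddUnitary A), u 0 = 1 → PathCommutesUpTo u G δ →
        ∃ v : C(unitInterval, oneAddUnitary A), v 0 = 1 ∧ v 1 = u 1 ∧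
          PathCommutesUpTo v F ε ∧
          ∀ a ∈ F, ∀ t₁ t₂ : unitInterval,
            ‖(a : Unitization ℂ A) * ((v t₁ : Unitization ℂ A) - (v t₂ : Unitization ℂ A))‖
              ≤ ε + C * |(t₁ : ℝ) - t₂|

/-- The weak approximately central exponential length of `A`. -/
def weakAcel (A : Type*) [NonUnitalCStarAlgebra A] : ℝ≥0∞ :=
  ⨅ (C : ℝ≥0) (_ : 0 < C) (_ : WeakACELBound A C), (C : ℝ≥0∞)

/-! ### Flows -/

/-- A flow on a C⋆-algebra: a point-norm continuous action of `ℝ` by `*`-automorphisms. -/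
structure CStarFlow (A : Type*) [NonUnitalCStarAlgebra A] where
  /-- the automorphism at time `t` -/
  aut : ℝ → (A ≃⋆ₐ[ℂ] A)
  aut_add : ∀ (s t : ℝ) (a : A), aut (s + t) a = aut s (aut t a)
  continuous_aut : ∀ a : A, Continuous fun t : ℝ => aut t a

/-- The restricted coaction `A → C([0,1], A)`, `a ↦ (t ↦ α_t(a))`. -/
def CStarFlow.restrictedCoaction {A : Type*} [NonUnitalCStarAlgebra A] (α : CStarFlow A) :
    A →⋆ₙₐ[ℂ] C(unitInterval, A) where
  toFun a := ⟨fun t => α.aut t a, (α.continuous_aut a).comp continuous_subtype_val⟩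
  map_smul' c a := by ext t; exact map_smul (α.aut t) c a
  map_zero' := by ext t; exact map_zero (α.aut t)
  map_add' a b := by ext t; exact map_add (α.aut t) a b
  map_mul' a b := by ext t; exact map_mul (α.aut t) a b
  map_star' a := by ext t; exact map_star (α.aut t) a

/-! ### Cocycles with values in the multiplier algebra -/

theorem norm_starAlgAut_apply {A : Type*} [NonUnitalCStarAlgebra A] (φ : A ≃⋆ₐ[ℂ] A) (a : A) :
    ‖φ a‖ = ‖a‖ :=
  NonUnitalStarAlgHom.norm_map φ (EquivLike.injective φ) a

/-- A `*`-automorphism as a continuous linear map. -/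
def starAlgAutCLM {A : Type*} [NonUnitalCStarAlgebra A] (φ : A ≃⋆ₐ[ℂ] A) : A →L[ℂ] A :=
  LinearMap.mkContinuous
    { toFun := φ, map_add' := map_add φ, map_smul' := map_smul φ } 1
    (fun a => by rw [one_mul]; exact (norm_starAlgAut_apply φ a).le)

/-- The canonical extension of an automorphism `φ` of `A` to the multiplier algebra: the multiplier
`m` is sent to `φ(m)` with `φ(m) a = φ(m φ⁻¹(a))` and `a φ(m) = φ(φ⁻¹(a) m)`. -/
def multiplierExtend {A : Type*} [NonUnitalCStarAlgebra A] (φ : A ≃⋆ₐ[ℂ] A) (m : 𝓜(ℂ, A)) :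
    𝓜(ℂ, A) where
  fst := (starAlgAutCLM φ).comp (m.fst.comp (starAlgAutCLM φ.symm))
  snd := (starAlgAutCLM φ).comp (m.snd.comp (starAlgAutCLM φ.symm))
  central x y := by
    change φ (m.snd (φ.symm x)) * y = x * φ (m.fst (φ.symm y))
    have h := congrArg φ (m.central (φ.symm x) (φ.symm y))
    rwa [map_mul, map_mul, φ.apply_symm_apply, φ.apply_symm_apply] at h

theorem multiplierExtend_coe {A : Type*} [NonUnitalCStarAlgebra A] (φ : A ≃⋆ₐ[ℂ] A) (a : A) :
    multiplierExtend φ (a : 𝓜(ℂ, A)) = ((φ a : A) : 𝓜(ℂ, A)) := by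
  refine DoubleCentralizer.ext _ _ _ _ (Prod.ext ?_ ?_)
  · ext x
    change φ (a * φ.symm x) = φ a * x
    rw [map_mul, φ.apply_symm_apply]
  · ext x
    change φ (φ.symm x * a) = x * φ a
    rw [map_mul, φ.apply_symm_apply]

/-- The canonical unital `*`-homomorphism `A⁺ → M(A)`, which is injective on `1 + A`. -/
def unitizationToMultiplier (A : Type*) [NonUnitalCStarAlgebra A] :
    Unitization ℂ A →⋆ₐ[ℂ] 𝓜(ℂ, A) :=
  Unitization.starLift (DoubleCentralizer.coeHom (𝕜 := ℂ) (A := A))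

/-- `w : ℝ → U(M(A))` is an `α`-cocycle: it is strictly continuous and satisfies
`w_s α_s(w_t) = w_{s+t}`. Here `m.fst a = m a` and `m.snd a = a m` for a multiplier `m`. -/
structure IsFlowCocycle {A : Type*} [NonUnitalCStarAlgebra A] (α : CStarFlow A)
    (w : ℝ → 𝓜(ℂ, A)) : Prop where
  mem_unitary : ∀ t, w t ∈ unitary 𝓜(ℂ, A)
  continuous_left : ∀ a : A, Continuous fun t => (w t).fst a
  continuous_right : ∀ a : A, Continuous fun t => (w t).snd a
  cocycle : ∀ s t : ℝ, w s * multiplierExtend (α.aut s) (w t) = w (s + t)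

/-- The `α`-cocycle `w` is an approximate coboundary: for some sequence of unitaries `x_n` in `M(A)`,
`max_{|t| ≤ 1} ‖(x_n α_t(x_n^*) - w_t) a‖ → 0` for all `a` in `A`. -/
def IsApproxCoboundary {A : Type*} [NonUnitalCStarAlgebra A] (α : CStarFlow A)
    (w : ℝ → 𝓜(ℂ, A)) : Prop :=
  ∃ x : ℕ → unitary 𝓜(ℂ, A), ∀ (a : A) (ε : ℝ), 0 < ε → ∀ᶠ n in atTop,
    ∀ t ∈ Icc (-1 : ℝ) 1,
      ‖((x n : 𝓜(ℂ, A)) * multiplierExtend (α.aut t) (star (x n : 𝓜(ℂ, A))) - w t).fst a‖ ≤ ε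

/-- The `α`-cocycle `w` is a norm-approximate coboundary: for some sequence of unitaries `x_n` in
`U(1 + A)`, `max_{|t| ≤ 1} ‖x_n α_t(x_n^*) - w_t‖ → 0`. -/
def IsNormApproxCoboundary {A : Type*} [NonUnitalCStarAlgebra A] (α : CStarFlow A)
    (w : ℝ → 𝓜(ℂ, A)) : Prop :=
  ∃ x : ℕ → oneAddUnitary A, ∀ ε : ℝ, 0 < ε → ∀ᶠ n in atTop,
    ∀ t ∈ Icc (-1 : ℝ) 1,
      ‖unitizationToMultiplier A (x n)
          * multiplierExtend (α.aut t) (star (unitizationToMultiplier A (x n))) - w t‖ ≤ ε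

/-- The flow `ψ⁻¹ ∘ β ∘ ψ` is the cocycle perturbation `α^w`, `α^w_t = Ad(w_t) ∘ α_t`, of `α`. -/
def IsCocyclePerturbationVia {A : Type*} [NonUnitalCStarAlgebra A] (α β : CStarFlow A)
    (ψ : A ≃⋆ₐ[ℂ] A) (w : ℝ → 𝓜(ℂ, A)) : Prop :=
  IsFlowCocycle α w ∧ ∀ (t : ℝ) (a : A),
    ((ψ.symm (β.aut t (ψ a)) : A) : 𝓜(ℂ, A)) = w t * ((α.aut t a : A) : 𝓜(ℂ, A)) * star (w t)

/-- `α` and `β` are cocycle conjugate via the automorphism `ψ`. -/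
def CocycleConjugateVia {A : Type*} [NonUnitalCStarAlgebra A] (α β : CStarFlow A)
    (ψ : A ≃⋆ₐ[ℂ] A) : Prop :=
  ∃ w : ℝ → 𝓜(ℂ, A), IsCocyclePerturbationVia α β ψ w

/-- `α` and `β` are strongly cocycle conjugate via the automorphism `ψ`. -/
def StronglyCocycleConjugateVia {A : Type*} [NonUnitalCStarAlgebra A] (α β : CStarFlow A)
    (ψ : A ≃⋆ₐ[ℂ] A) : Prop :=
  ∃ w : ℝ → 𝓜(ℂ, A), IsCocyclePerturbationVia α β ψ w ∧ IsApproxCoboundary α w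

/-- `α` and `β` are norm-strongly cocycle conjugate via the automorphism `ψ`. -/
def NormStronglyCocycleConjugateVia {A : Type*} [NonUnitalCStarAlgebra A] (α β : CStarFlow A)
    (ψ : A ≃⋆ₐ[ℂ] A) : Prop :=
  ∃ w : ℝ → 𝓜(ℂ, A), IsCocyclePerturbationVia α β ψ w ∧ IsNormApproxCoboundary α w

/-! ### The continuous central sequence algebra and the Rokhlin property -/

/-- `ℓ^∞(ℕ, A)`. -/
abbrev BddSeq (A : Type*) [NonUnitalCStarAlgebra A] : Type _ := lp (fun _ : ℕ => A) ∞

/-- Pointwise application of an automorphism to a bounded sequence. -/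
def seqMap {A : Type*} [NonUnitalCStarAlgebra A] (φ : A ≃⋆ₐ[ℂ] A) (x : BddSeq A) : BddSeq A :=
  ⟨fun n => φ (x n), by
    have h := memℓp_infty_iff.1 (lp.memℓp x)
    refine memℓp_infty_iff.2 ?_
    simpa only [norm_starAlgAut_apply] using h⟩

theorem seqMap_apply {A : Type*} [NonUnitalCStarAlgebra A] (φ : A ≃⋆ₐ[ℂ] A) (x : BddSeq A)
    (n : ℕ) : seqMap φ x n = φ (x n) := rfl

/-- The sequences in `ℓ^∞_α(ℕ, A)`, i.e. those with `t ↦ (α_t(x_n))_n` norm continuous, that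
asymptotically commute with every element of `A`. -/
def CStarFlow.centralSeq {A : Type*} [NonUnitalCStarAlgebra A] (α : CStarFlow A) :
    NonUnitalStarSubalgebra ℂ (BddSeq A) where
  carrier := {x | (Continuous fun t : ℝ => seqMap (α.aut t) x) ∧
    ∀ a : A, Tendsto (fun n => x n * a - a * x n) atTop (𝓝 0)}
  zero_mem' := by
    refine ⟨?_, fun a => ?_⟩
    · have : (fun t : ℝ => seqMap (α.aut t) (0 : BddSeq A)) = fun _ => 0 := by
        funext t; ext n; simp [seqMap_apply]
      rw [this]; exact continuous_const
    · simp
  add_mem' := by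
    rintro x y ⟨hx, hx'⟩ ⟨hy, hy'⟩
    refine ⟨?_, fun a => ?_⟩
    · have : (fun t : ℝ => seqMap (α.aut t) (x + y))
          = fun t => seqMap (α.aut t) x + seqMap (α.aut t) y := by
        funext t; ext n; simp [seqMap_apply]
      rw [this]; exact hx.add hy
    · have h := (hx' a).add (hy' a)
      rw [add_zero] at h
      refine h.congr fun n => ?_
      simp only [lp.coeFn_add, Pi.add_apply]
      noncomm_ring
  mul_mem' := by
    rintro x y ⟨hx, hx'⟩ ⟨hy, hy'⟩
    refine ⟨?_, fun a => ?_⟩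
    · have : (fun t : ℝ => seqMap (α.aut t) (x * y))
          = fun t => seqMap (α.aut t) x * seqMap (α.aut t) y := by
        funext t; ext n; simp [seqMap_apply]
      rw [this]; exact hx.mul hy
    · have hxb : IsBoundedUnder (· ≤ ·) atTop (norm ∘ fun n => x n) :=
        isBoundedUnder_of ⟨‖x‖, fun n => lp.norm_apply_le_norm ENNReal.top_ne_zero x n⟩
      have hyb : IsBoundedUnder (· ≤ ·) atTop (norm ∘ fun n => y n) :=
        isBoundedUnder_of ⟨‖y‖, fun n => lp.norm_apply_le_norm ENNReal.top_ne_zero y n⟩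
      have h1 := (isBoundedUnder_le_mul_tendsto_zero hxb (hy' a)).add ((hx' a).zero_mul_isBoundedUnder_le hyb)
      rw [add_zero] at h1
      refine h1.congr fun n => ?_
      simp only [lp.infty_coeFn_mul, Pi.mul_apply]
      noncomm_ring
  smul_mem' := by
    rintro c x ⟨hx, hx'⟩
    refine ⟨?_, fun a => ?_⟩
    · have : (fun t : ℝ => seqMap (α.aut t) (c • x))
          = fun t => c • seqMap (α.aut t) x := by
        funext t; ext n; simp [seqMap_apply]
      rw [this]; exact hx.const_smul c
    · have h := (hx' a).const_smul c
      rw [smul_zero] at h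
      refine h.congr fun n => ?_
      simp only [lp.coeFn_smul, Pi.smul_apply, smul_mul_assoc, mul_smul_comm, smul_sub]
  star_mem' := by
    rintro x ⟨hx, hx'⟩
    refine ⟨?_, fun a => ?_⟩
    · have : (fun t : ℝ => seqMap (α.aut t) (star x))
          = fun t => star (seqMap (α.aut t) x) := by
        funext t; ext n; exact map_star (α.aut t) (x n)
      rw [this]; exact hx.star
    · have h := (hx' (star a)).star.neg
      rw [star_zero, neg_zero] at h
      refine h.congr fun n => ?_
      simp [lp.star_apply]

/-- Congruence modulo the sequences `z` with `z_n a → 0` and `a z_n → 0` for all `a` in `A`, which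
represent the elements of the annihilator of `A`. -/
def CStarFlow.centralCon {A : Type*} [NonUnitalCStarAlgebra A] (α : CStarFlow A) :
    RingCon α.centralSeq where
  r x y := ∀ a : A,
    Tendsto (fun n => ((x : BddSeq A) n - (y : BddSeq A) n) * a) atTop (𝓝 0) ∧
    Tendsto (fun n => a * ((x : BddSeq A) n - (y : BddSeq A) n)) atTop (𝓝 0)
  iseqv :=
    { refl := fun x a => by simp
      symm := fun {x y} h a => by
        refine ⟨?_, ?_⟩
        · have := (h a).1.neg
          rw [neg_zero] at this
          exact this.congr fun n => by noncomm_ring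
        · have := (h a).2.neg
          rw [neg_zero] at this
          exact this.congr fun n => by noncomm_ring
      trans := fun {x y z} h k a => by
        refine ⟨?_, ?_⟩
        · have := (h a).1.add (k a).1
          rw [add_zero] at this
          exact this.congr fun n => by noncomm_ring
        · have := (h a).2.add (k a).2
          rw [add_zero] at this
          exact this.congr fun n => by noncomm_ring }
  add' := fun {w x y z} h k a => by
    refine ⟨?_, ?_⟩
    · have := (h a).1.add (k a).1
      rw [add_zero] at this
      refine this.congr fun n => ?_
      simp only [NonUnitalStarSubalgebra.coe_add, lp.coeFn_add, Pi.add_apply]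
      noncomm_ring
    · have := (h a).2.add (k a).2
      rw [add_zero] at this
      refine this.congr fun n => ?_
      simp only [NonUnitalStarSubalgebra.coe_add, lp.coeFn_add, Pi.add_apply]
      noncomm_ring
  mul' := fun {w x y z} h k a => by
    have bdd : ∀ v : α.centralSeq, IsBoundedUnder (· ≤ ·) atTop
        (norm ∘ fun n => (v : BddSeq A) n) := fun v =>
      isBoundedUnder_of ⟨‖(v : BddSeq A)‖, fun n =>
        lp.norm_apply_le_norm ENNReal.top_ne_zero (v : BddSeq A) n⟩
    have bdd' : IsBoundedUnder (· ≤ ·) atTop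
        (norm ∘ fun n => ((w : BddSeq A) n - (x : BddSeq A) n)) := bdd (w - x)
    have bdd'' : IsBoundedUnder (· ≤ ·) atTop
        (norm ∘ fun n => ((y : BddSeq A) n - (z : BddSeq A) n)) := bdd (y - z)
    refine ⟨?_, ?_⟩
    · have := ((isBoundedUnder_le_mul_tendsto_zero bdd' (y.2.2 a)).add
        ((h a).1.zero_mul_isBoundedUnder_le (bdd y))).add (isBoundedUnder_le_mul_tendsto_zero (bdd x) (k a).1)
      rw [add_zero, add_zero] at this
      refine this.congr fun n => ?_
      simp only [NonUnitalStarSubalgebra.coe_mul, lp.infty_coeFn_mul, Pi.mul_apply]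
      noncomm_ring
    · have := (((h a).2.zero_mul_isBoundedUnder_le (bdd y)).sub
        ((x.2.2 a).zero_mul_isBoundedUnder_le bdd'')).add (isBoundedUnder_le_mul_tendsto_zero (bdd x) (k a).2)
      rw [sub_zero, add_zero] at this
      refine this.congr fun n => ?_
      simp only [NonUnitalStarSubalgebra.coe_mul, lp.infty_coeFn_mul, Pi.mul_apply]
      noncomm_ring

/-- The continuous central sequence algebra
`F_{∞,α}(A) = (A_{∞,α} ∩ A') / Ann(A, A_{∞,α})`. -/
abbrev CStarFlow.CentralSeqAlgebra {A : Type*} [NonUnitalCStarAlgebra A] (α : CStarFlow A) :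
    Type _ :=
  α.centralCon.Quotient

/-- The involution of `F_{∞,α}(A)`, applied entrywise to representing sequences. -/
instance CStarFlow.instStarCentralSeqAlgebra {A : Type*} [NonUnitalCStarAlgebra A]
    (α : CStarFlow A) : Star α.CentralSeqAlgebra where
  star := Quotient.map star fun x y h a => by
    refine ⟨?_, ?_⟩
    · have := (h (star a)).2.star
      rw [star_zero] at this
      refine this.congr fun n => ?_
      simp [lp.star_apply]
    · have := (h (star a)).1.star
      rw [star_zero] at this
      refine this.congr fun n => ?_
      simp [lp.star_apply]

/-- Scalar multiplication on `F_{∞,α}(A)`, applied entrywise to representing sequences. -/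
instance CStarFlow.instSMulCentralSeqAlgebra {A : Type*} [NonUnitalCStarAlgebra A]
    (α : CStarFlow A) : SMul ℂ α.CentralSeqAlgebra where
  smul c := Quotient.map (fun x : α.centralSeq => c • x) fun x y h a => by
    refine ⟨?_, ?_⟩
    · have := (h a).1.const_smul c
      rw [smul_zero] at this
      refine this.congr fun n => ?_
      change c • (((x : BddSeq A) n - (y : BddSeq A) n) * a)
        = (c • (x : BddSeq A) n - c • (y : BddSeq A) n) * a
      rw [← smul_sub, smul_mul_assoc]
    · have := (h a).2.const_smul c
      rw [smul_zero] at this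
      refine this.congr fun n => ?_
      change c • (a * ((x : BddSeq A) n - (y : BddSeq A) n))
        = a * (c • (x : BddSeq A) n - c • (y : BddSeq A) n)
      rw [← smul_sub, mul_smul_comm]

/-- Entrywise application of `α_t` to the sequences that represent elements of `F_{∞,α}(A)`. -/
def CStarFlow.centralSeqMap {A : Type*} [NonUnitalCStarAlgebra A] (α : CStarFlow A) (t : ℝ)
    (x : α.centralSeq) : α.centralSeq :=
  ⟨seqMap (α.aut t) x, by
    refine ⟨?_, fun a => ?_⟩
    · have : (fun s : ℝ => seqMap (α.aut s) (seqMap (α.aut t) (x : BddSeq A)))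
          = fun s => seqMap (α.aut (s + t)) (x : BddSeq A) := by
        funext s; ext n; simp [seqMap_apply, α.aut_add]
      rw [this]
      exact x.2.1.comp (continuous_id.add continuous_const)
    · have h := ((starAlgAutCLM (α.aut t)).continuous.tendsto 0).comp
        (x.2.2 ((α.aut t).symm a))
      rw [map_zero] at h
      refine h.congr fun n => ?_
      change α.aut t ((x : BddSeq A) n * (α.aut t).symm a - (α.aut t).symm a * (x : BddSeq A) n)
        = α.aut t ((x : BddSeq A) n) * a - a * α.aut t ((x : BddSeq A) n)
      rw [map_sub, map_mul, map_mul, StarAlgEquiv.apply_symm_apply]⟩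

/-- The flow induced by `α` on `F_{∞,α}(A)`. -/
def CStarFlow.centralFlow {A : Type*} [NonUnitalCStarAlgebra A] (α : CStarFlow A) (t : ℝ) :
    α.CentralSeqAlgebra → α.CentralSeqAlgebra :=
  Quotient.map (α.centralSeqMap t) fun x y h a => by
    refine ⟨?_, ?_⟩
    · have h1 := ((starAlgAutCLM (α.aut t)).continuous.tendsto 0).comp
        (h ((α.aut t).symm a)).1
      rw [map_zero] at h1
      refine h1.congr fun n => ?_
      change α.aut t (((x : BddSeq A) n - (y : BddSeq A) n) * (α.aut t).symm a)
        = (α.aut t ((x : BddSeq A) n) - α.aut t ((y : BddSeq A) n)) * a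
      rw [map_mul, map_sub, StarAlgEquiv.apply_symm_apply]
    · have h1 := ((starAlgAutCLM (α.aut t)).continuous.tendsto 0).comp
        (h ((α.aut t).symm a)).2
      rw [map_zero] at h1
      refine h1.congr fun n => ?_
      change α.aut t ((α.aut t).symm a * ((x : BddSeq A) n - (y : BddSeq A) n))
        = a * (α.aut t ((x : BddSeq A) n) - α.aut t ((y : BddSeq A) n))
      rw [map_mul, map_sub, StarAlgEquiv.apply_symm_apply]

/-- The element `e` is a two-sided multiplicative unit. -/
def IsTwoSidedUnit {R : Type*} [Mul R] (e : R) : Prop :=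
  ∀ y : R, e * y = y ∧ y * e = y

/-- The Rokhlin property: for every `p > 0` there is a unitary `u` in the algebra `F_{∞,α}(A)` (which
is unital for separable `A`) with `α_t(u) = e^{ipt} u` for all `t`. That `u` is a unitary means that
`u^* u` and `u u^*` are the unit of the algebra. -/
def CStarFlow.IsRokhlin {A : Type*} [NonUnitalCStarAlgebra A] (α : CStarFlow A) : Prop :=
  ∀ p : ℝ, 0 < p → ∃ u : α.CentralSeqAlgebra,
    IsTwoSidedUnit (star u * u) ∧ IsTwoSidedUnit (u * star u) ∧
    ∀ t : ℝ, α.centralFlow t u = Complex.exp (Complex.I * p * t) • u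

end

/-! ### Unitaries of augmentation one

The unitization of a C⋆-algebra is treated as a unital C⋆-algebra `E` with a character `χ`, whose
kernel is the original algebra. -/

/-! The substance is the implication from (3) to (1) (and, for finite `acel`, to (4)). It is an
Evans-Kishimoto intertwining of α with β, fed by an existence statement and a uniqueness statement
for Rokhlin flows, and both of these come out of one construction.

Let c be a path of unitaries with c_{q+T} = c_q α_q(c_T), and let y be a path of unitaries from 1 to
α_{-T}(c_T^*). Then Z_q = c_q α_q(y_q) closes up to a loop of length T, and Z_q α_t(Z_{q-t}^*) = c_q
α_q(y_q y_{q-t}^*) α_t(c_{q-t}^*). If y moves slowly, which is possible for large T as soon as the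
length of y has a bound independent of T, the middle factor is harmless. Inserting a Rokhlin unitary
of frequency 2π/T for the coordinate of the loop turns Z into a single unitary V for which V
α_t(V^*) inherits every uniform estimate on Z_q α_t(Z_{q-t}^*). This is `exists_transfer`; it rests
on a norm estimate for trigonometric polynomials in an asymptotically central unitary,
`IsTrigEval.eventually_norm_le`.

Existence, `exists_unitary_conj_flow_near`: c is iterated from a path that implements the
equivalence of the coactions, so that Ad(c_q) α_q ≈ β_q. It is enough that y is slow under
conjugation, and this is what finite weak inner length supplies. Uniqueness,
`exists_central_unitary_coboundary_near`: c is an approximately central coboundary, and finite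
approximately central length supplies a y that is approximately central and slow (strictly, or in
norm). Then V is approximately central with nearly the same coboundary as c.

The intertwining (`exists_intertwining`) yields unitaries X_n such that the flows Ad(X_n) θ_n
Ad(X_n^*), with θ_n alternately α and β, converge, and unitaries S_n such that along each parity
Ad(S_n) converges to an automorphism and the coboundaries of S_n^* X_n converge strictly to a
cocycle. Comparing the two parities gives ψ and w; `norm_coboundary_combination_sub` shows that w is
a limit of genuine coboundaries (`AugModel.exists_cocyclePerturbation`).

From (2) to (3), a strictly continuous path of unitary multipliers starting at 1 is replaced by a
norm continuous path in U(1 + A) that agrees with it on a local unit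
(`AugModel.exists_path_mul_eq`), and ψ by some Ad(s). Finally (4) implies (1) because norm
convergence is stronger than strict convergence. -/

section Augmented

variable {E : Type*} [CStarAlgebra E]

/-- The unitaries of `E` on which the character `χ` takes the value `1`. -/
def augUnitary (χ : E →⋆ₐ[ℂ] ℂ) : Submonoid E where
  carrier := {u | u ∈ unitary E ∧ χ u = 1}
  one_mem' := ⟨one_mem _, map_one χ⟩
  mul_mem' := by
    rintro u v ⟨hu, hu1⟩ ⟨hv, hv1⟩
    exact ⟨mul_mem hu hv, by rw [map_mul, hu1, hv1, one_mul]⟩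

variable {χ : E →⋆ₐ[ℂ] ℂ}

namespace augUnitary

theorem star_mem {u : E} (hu : u ∈ augUnitary χ) : star u ∈ augUnitary χ :=
  ⟨Unitary.star_mem hu.1, by rw [map_star, hu.2, star_one]⟩

theorem star_mul_self {u : E} (hu : u ∈ augUnitary χ) : star u * u = 1 :=
  Unitary.star_mul_self_of_mem hu.1

theorem mul_star_self {u : E} (hu : u ∈ augUnitary χ) : u * star u = 1 :=
  Unitary.mul_star_self_of_mem hu.1

theorem star_mul_cancel {u : E} (hu : u ∈ augUnitary χ) (x : E) : star u * (u * x) = x := by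
  rw [← mul_assoc, star_mul_self hu, one_mul]

theorem mul_star_cancel {u : E} (hu : u ∈ augUnitary χ) (x : E) : u * (star u * x) = x := by
  rw [← mul_assoc, mul_star_self hu, one_mul]

theorem norm_mul_left {u : E} (hu : u ∈ augUnitary χ) (x : E) : ‖u * x‖ = ‖x‖ :=
  CStarRing.norm_mem_unitary_mul x hu.1

theorem norm_mul_right {u : E} (hu : u ∈ augUnitary χ) (x : E) : ‖x * u‖ = ‖x‖ :=
  CStarRing.norm_mul_mem_unitary x hu.1

theorem norm_le_one {u : E} (hu : u ∈ augUnitary χ) : ‖u‖ ≤ 1 := by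
  have : Nontrivial E := χ.toRingHom.domain_nontrivial
  have := norm_mul_left hu 1
  rw [mul_one, norm_one] at this
  exact this.le

theorem norm_conj {u : E} (hu : u ∈ augUnitary χ) (x : E) : ‖u * x * star u‖ = ‖x‖ := by
  rw [norm_mul_right (star_mem hu), norm_mul_left hu]

theorem norm_star_conj {u : E} (hu : u ∈ augUnitary χ) (x : E) : ‖star u * x * u‖ = ‖x‖ := by
  rw [norm_mul_right hu, norm_mul_left (star_mem hu)]

theorem norm_conj_sub {u : E} (hu : u ∈ augUnitary χ) (x : E) :
    ‖u * x * star u - x‖ = ‖u * x - x * u‖ := by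
  rw [← norm_mul_right hu (u * x * star u - x), sub_mul, mul_assoc (u * x),
    star_mul_self hu, mul_one]

theorem norm_star_conj_sub {u : E} (hu : u ∈ augUnitary χ) (x : E) :
    ‖star u * x * u - x‖ = ‖u * x - x * u‖ := by
  rw [← norm_mul_left hu (star u * x * u - x), mul_sub, ← mul_assoc, ← mul_assoc,
    mul_star_self hu, one_mul, norm_sub_rev]

theorem norm_commutator_star {u : E} (hu : u ∈ augUnitary χ) (x : E) :
    ‖star u * x - x * star u‖ = ‖u * x - x * u‖ := by
  rw [← norm_conj_sub (star_mem hu), star_star, norm_star_conj_sub hu]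

theorem norm_commutator_mul_le {u v : E} (hu : u ∈ augUnitary χ) (hv : v ∈ augUnitary χ) (x : E) :
    ‖u * v * x - x * (u * v)‖ ≤ ‖u * x - x * u‖ + ‖v * x - x * v‖ := by
  have : u * v * x - x * (u * v) = u * (v * x - x * v) + (u * x - x * u) * v := by noncomm_ring
  rw [this]
  refine (norm_add_le _ _).trans ?_
  rw [norm_mul_left hu, norm_mul_right hv, add_comm]

end augUnitary

/-- A flow on the unital C⋆-algebra `E` that preserves the character `χ`. -/
structure AugFlow (χ : E →⋆ₐ[ℂ] ℂ) where
  /-- the automorphism at time `t` -/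
  ext : ℝ → E →⋆ₐ[ℂ] E
  ext_add (s t : ℝ) (x : E) : ext (s + t) x = ext s (ext t x)
  ext_zero (x : E) : ext 0 x = x
  continuous_ext (x : E) : Continuous fun t => ext t x
  map_ext (t : ℝ) (x : E) : χ (ext t x) = χ x

namespace AugFlow

variable (α : AugFlow χ)

attribute [simp] ext_zero map_ext

@[simp] theorem ext_neg_ext (t : ℝ) (x : E) : α.ext (-t) (α.ext t x) = x := by
  rw [← ext_add]; simp

@[simp] theorem ext_ext_neg (t : ℝ) (x : E) : α.ext t (α.ext (-t) x) = x := by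
  rw [← ext_add]; simp

@[simp] theorem norm_ext (t : ℝ) (x : E) : ‖α.ext t x‖ = ‖x‖ := by
  refine NonUnitalStarAlgHom.norm_map (α.ext t) (fun x y h => ?_) x
  have := congrArg (α.ext (-t)) h
  simpa using this

theorem norm_ext_sub (t : ℝ) (x y : E) : ‖α.ext t x - α.ext t y‖ = ‖x - y‖ := by
  rw [← map_sub, norm_ext]

/-- Joint continuity follows from point-norm continuity because the automorphisms are isometric. -/
theorem continuous_ext_prod : Continuous fun p : ℝ × E => α.ext p.1 p.2 := by
  rw [continuous_iff_continuousAt]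
  rintro ⟨t, x⟩
  rw [Metric.continuousAt_iff']
  intro ε hε
  have h1 : ∀ᶠ p : ℝ × E in 𝓝 (t, x), ‖p.2 - x‖ < ε / 2 := by
    have : Tendsto (fun p : ℝ × E => ‖p.2 - x‖) (𝓝 (t, x)) (𝓝 ‖x - x‖) :=
      ((continuous_snd.sub continuous_const).norm).tendsto (t, x)
    rw [sub_self, norm_zero] at this
    exact this.eventually_lt_const (by positivity)
  have h2 : ∀ᶠ p : ℝ × E in 𝓝 (t, x), ‖α.ext p.1 x - α.ext t x‖ < ε / 2 := by
    have : Tendsto (fun p : ℝ × E => ‖α.ext p.1 x - α.ext t x‖) (𝓝 (t, x))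
        (𝓝 ‖α.ext t x - α.ext t x‖) :=
      ((((α.continuous_ext x).comp continuous_fst).sub continuous_const).norm).tendsto (t, x)
    rw [sub_self, norm_zero] at this
    exact this.eventually_lt_const (by positivity)
  filter_upwards [h1, h2] with p hp1 hp2
  rw [dist_eq_norm]
  calc ‖α.ext p.1 p.2 - α.ext t x‖ = ‖α.ext p.1 (p.2 - x) + (α.ext p.1 x - α.ext t x)‖ := by
        rw [map_sub]; congr 1; abel
    _ ≤ ‖p.2 - x‖ + ‖α.ext p.1 x - α.ext t x‖ := by
        refine (norm_add_le _ _).trans ?_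
        rw [norm_ext]
    _ < ε := by linarith

theorem continuous_ext_comp {X : Type*} [TopologicalSpace X] {f : X → ℝ} {g : X → E}
    (hf : Continuous f) (hg : Continuous g) : Continuous fun x => α.ext (f x) (g x) :=
  α.continuous_ext_prod.comp (hf.prodMk hg)

theorem ext_mem (t : ℝ) {u : E} (hu : u ∈ augUnitary χ) : α.ext t u ∈ augUnitary χ :=
  ⟨Unitary.map_mem (α.ext t) hu.1, by rw [map_ext, hu.2]⟩

/-- The coboundary `v α_t(v^*)`. -/
def coboundary (v : E) (t : ℝ) : E := v * α.ext t (star v)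

theorem coboundary_mem {v : E} (hv : v ∈ augUnitary χ) (t : ℝ) :
    α.coboundary v t ∈ augUnitary χ :=
  mul_mem hv (α.ext_mem t (augUnitary.star_mem hv))

theorem continuous_coboundary (v : E) : Continuous (α.coboundary v) :=
  continuous_const.mul (α.continuous_ext _)

theorem coboundary_add {v : E} (hv : v ∈ augUnitary χ) (s t : ℝ) :
    α.coboundary v (s + t) = α.coboundary v s * α.ext s (α.coboundary v t) := by
  simp only [coboundary, map_mul, ext_add, mul_assoc]
  rw [← mul_assoc (α.ext s (star v)), ← map_mul, augUnitary.star_mul_self hv, map_one, one_mul]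

theorem coboundary_zero {v : E} (hv : v ∈ augUnitary χ) : α.coboundary v 0 = 1 := by
  simp [coboundary, augUnitary.mul_star_self hv]

end AugFlow

/-! ### Polar decomposition near the unitaries -/

/-- For h ≥ 0 one has (h + 1)² ≥ 1, and this inequality is conjugated by x. Through h² - 1 = (h +
1)(h - 1), bounds on h² - 1 become bounds on h - 1. -/
theorem norm_le_norm_add_one_mul [PartialOrder E] [StarOrderedRing E]
    {h : E} (hh : 0 ≤ h) (x : E) : ‖x‖ ≤ ‖(h + 1) * x‖ := by
  have hsa : star h = h := (IsSelfAdjoint.of_nonneg hh).star_eq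
  have h1 : (1 : E) ≤ (h + 1) * (h + 1) := by
    have h2 : (0 : E) ≤ h * h := by
      have := star_mul_self_nonneg h
      rwa [hsa] at this
    have : (h + 1) * (h + 1) = 1 + (h + h + h * h) := by noncomm_ring
    rw [this]
    exact le_add_of_nonneg_right (add_nonneg (add_nonneg hh hh) h2)
  have h3 : star x * 1 * x ≤ star x * ((h + 1) * (h + 1)) * x := star_left_conjugate_le_conjugate h1 x
  have h4 : star ((h + 1) * x) * ((h + 1) * x) = star x * ((h + 1) * (h + 1)) * x := by
    rw [star_mul, star_add, hsa, star_one]; noncomm_ring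
  rw [mul_one, ← h4] at h3
  have h5 := CStarAlgebra.norm_le_norm_of_nonneg_of_le (star_mul_self_nonneg x) h3
  rw [CStarRing.norm_star_mul_self, CStarRing.norm_star_mul_self] at h5
  nlinarith [norm_nonneg x, norm_nonneg ((h + 1) * x)]

/-- Here h = b^{-1/2}. With c = h² = b^{-1} the relation c - 1 = c(1 - b) gives ‖c - 1‖ ≤ (‖c - 1‖ +
1)‖b - 1‖, whence the factor 2 when ‖b - 1‖ ≤ 1/2; from h² - 1 one passes to h - 1. -/
theorem exists_nonneg_inverse_sqrt [PartialOrder E] [StarOrderedRing E]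
    {b : E} (hb : 0 ≤ b) (hb1 : ‖b - 1‖ ≤ 1 / 2) :
    ∃ h : E, 0 ≤ h ∧ h * b * h = 1 ∧ h * h * b = 1 ∧ ‖h - 1‖ ≤ 2 * ‖b - 1‖ := by
  have hu : IsUnit b := by
    have := isUnit_one_sub_of_norm_lt_one (x := 1 - b) (by rw [norm_sub_rev]; linarith)
    simpa using this
  have h0 : b ^ (-(1 / 2) : ℝ) * b ^ (-(1 / 2) : ℝ) = b ^ (-1 : ℝ) := by
    rw [← CFC.rpow_add hu]; norm_num
  have h1 : b ^ (-(1 / 2) : ℝ) * b * b ^ (-(1 / 2) : ℝ) = 1 := by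
    nth_rewrite 2 [← CFC.rpow_one b]
    rw [← CFC.rpow_add hu, ← CFC.rpow_add hu]
    norm_num
    exact CFC.rpow_zero b
  have h2 : b ^ (-1 : ℝ) * b = 1 := by
    nth_rewrite 2 [← CFC.rpow_one b]
    rw [← CFC.rpow_add hu]
    norm_num
    exact CFC.rpow_zero b
  refine ⟨b ^ (-(1 / 2) : ℝ), CFC.rpow_nonneg, h1, by rw [h0, h2], ?_⟩
  set c := b ^ (-1 : ℝ) with hc
  have h3 : c - 1 = c * (1 - b) := by rw [mul_sub, h2, mul_one]
  have h4 : ‖c - 1‖ ≤ 2 * ‖b - 1‖ := by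
    have h5 : ‖c - 1‖ ≤ (‖c - 1‖ + 1) * ‖b - 1‖ := by
      calc ‖c - 1‖ = ‖(c - 1) * (1 - b) + (1 - b)‖ := by congr 1; nth_rewrite 1 [h3]; noncomm_ring
        _ ≤ ‖c - 1‖ * ‖1 - b‖ + ‖1 - b‖ := (norm_add_le _ _).trans (by gcongr; exact norm_mul_le _ _)
        _ = _ := by rw [norm_sub_rev 1 b]; ring
    nlinarith [norm_nonneg (c - 1)]
  refine (norm_le_norm_add_one_mul (h := b ^ (-(1 / 2) : ℝ)) CFC.rpow_nonneg _).trans ?_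
  refine le_of_eq_of_le ?_ h4
  rw [← h0]
  congr 1
  noncomm_ring

/-- An element `g` that is almost unitary is close to a unitary `v`; moreover `v` and `g` agree on
every `e` with `g^* g e = e`, and `v` has augmentation one wherever `g` does. -/
theorem exists_unitary_near {g : E} (h1 : ‖star g * g - 1‖ ≤ 1 / 2) (h2 : ‖g * star g - 1‖ ≤ 1 / 2) :
    ∃ v ∈ unitary E, (∀ χ : E →⋆ₐ[ℂ] ℂ, χ g = 1 → χ v = 1) ∧ ‖v - g‖ ≤ 4 * ‖star g * g - 1‖ ∧
      ∀ e, star g * g * e = e → v * e = g * e := by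
  rcases subsingleton_or_nontrivial E with hE | hE
  · refine ⟨1, one_mem _, fun χ _ => map_one χ, ?_, fun e _ => Subsingleton.elim _ _⟩
    rw [Subsingleton.elim (1 - g) 0, norm_zero]
    positivity
  let _ := CStarAlgebra.spectralOrder (E)
  have := CStarAlgebra.spectralOrderedRing (E)
  obtain ⟨h, h0, hbh, hhb, hn⟩ := exists_nonneg_inverse_sqrt (star_mul_self_nonneg g) h1
  have hsa : star h = h := (IsSelfAdjoint.of_nonneg h0).star_eq
  have hgu : IsUnit (g * star g) := by
    have := isUnit_one_sub_of_norm_lt_one (x := 1 - g * star g) (by rw [norm_sub_rev]; linarith)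
    simpa using this
  have hgn : ‖g‖ ≤ 2 := by
    have : ‖g‖ * ‖g‖ ≤ 1 / 2 + 1 := by
      rw [← CStarRing.norm_star_mul_self]
      calc ‖star g * g‖ = ‖(star g * g - 1) + 1‖ := by congr 1; abel
        _ ≤ _ := (norm_add_le _ _).trans (by gcongr; exact norm_one.le)
    nlinarith [norm_nonneg g]
  have hvv : star (g * h) * (g * h) = 1 := by
    rw [star_mul, hsa, ← hbh]; simp only [mul_assoc]
  -- That the isometry g h is also a coisometry is seen after multiplication by the invertible
  -- element g g^*.
  have hvv' : (g * h) * star (g * h) = 1 := by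
    have h3 : (g * h) * star (g * h) * (g * star g) = g * star g := by
      rw [star_mul, hsa]
      calc g * h * (h * star g) * (g * star g) = g * (h * h * (star g * g)) * star g := by
            simp only [mul_assoc]
        _ = g * star g := by rw [hhb, mul_one]
    exact hgu.mul_eq_right.1 h3
  -- χ(h) is a square root of 1 and is nonnegative because h is, so it equals 1.
  have hfst : ∀ χ : E →⋆ₐ[ℂ] ℂ, χ g = 1 → χ (g * h) = 1 := by
    intro χ hg
    have h4 : χ h * χ h = 1 := by
      have := congrArg χ hhb
      simpa [hg, map_star] using this
    have h5 : ∃ c : ℂ, χ h = star c * c := by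
      obtain ⟨k, hk⟩ := CStarAlgebra.nonneg_iff_eq_star_mul_self.1 h0
      exact ⟨χ k, by rw [hk, map_mul, map_star]⟩
    obtain ⟨c, hc⟩ := h5
    rw [map_mul, hg, one_mul]
    rcases mul_self_eq_one_iff.1 h4 with h6 | h6
    · exact h6
    · exfalso
      rw [hc] at h6
      have h7 := congrArg Complex.re h6
      simp only [Complex.star_def, Complex.mul_re, Complex.conj_re, Complex.conj_im,
        Complex.neg_re, Complex.one_re] at h7
      nlinarith [sq_nonneg c.re, sq_nonneg c.im]
  refine ⟨g * h, Unitary.mem_iff.2 ⟨hvv, hvv'⟩, hfst, ?_, fun e he => ?_⟩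
  · calc ‖g * h - g‖ = ‖g * (h - 1)‖ := by rw [mul_sub, mul_one]
      _ ≤ 2 * (2 * ‖star g * g - 1‖) := (norm_mul_le _ _).trans (by gcongr)
      _ = _ := by ring
  -- On e the element h² acts as the identity, so (h + 1)(h - 1)e = 0, and positivity of h forces h
  -- e = e.
  · have h6 : (h + 1) * ((h - 1) * e) = 0 := by
      have : (h + 1) * ((h - 1) * e) = h * h * e - e := by noncomm_ring
      rw [this]
      nth_rewrite 1 [← he]
      rw [← mul_assoc, hhb, one_mul, sub_self]
    have h7 := norm_le_norm_add_one_mul h0 ((h - 1) * e)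
    rw [h6, norm_zero] at h7
    have h8 : (h - 1) * e = 0 := norm_le_zero_iff.1 h7
    have h9 : h * e = e := by rw [sub_mul, one_mul, sub_eq_zero] at h8; exact h8
    rw [mul_assoc, h9]

end Augmented

/-! ### Trigonometric polynomials in an asymptotically central unitary -/

section TrigCalculus

variable {E : Type*} [CStarAlgebra E] {ι : Type*} {l : Filter ι} {u : ι → E}

/-- The elements of `E` with which the sequence `u` asymptotically commutes, and on which it
asymptotically acts as a unitary. -/
def asympCommutant (l : Filter ι) (u : ι → E) : Set E :=
  {b | Tendsto (fun i => u i * b - b * u i) l (𝓝 0) ∧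
    Tendsto (fun i => star (u i) * b - b * star (u i)) l (𝓝 0) ∧
    Tendsto (fun i => star (u i) * u i * b - b) l (𝓝 0) ∧
    Tendsto (fun i => u i * star (u i) * b - b) l (𝓝 0)}

theorem tendsto_bdd_mul_zero {M : ℝ} {x y : ι → E} (hx : ∀ i, ‖x i‖ ≤ M)
    (hy : Tendsto y l (𝓝 0)) : Tendsto (fun i => x i * y i) l (𝓝 0) := by
  refine squeeze_zero_norm (a := fun i => M * ‖y i‖) (fun i => ?_) ?_
  · exact (norm_mul_le _ _).trans (by gcongr; exact hx i)
  · simpa using hy.norm.const_mul M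

theorem tendsto_zero_mul_bdd {M : ℝ} {x y : ι → E} (hx : ∀ i, ‖x i‖ ≤ M)
    (hy : Tendsto y l (𝓝 0)) : Tendsto (fun i => y i * x i) l (𝓝 0) := by
  refine squeeze_zero_norm (a := fun i => M * ‖y i‖) (fun i => ?_) ?_
  · refine (norm_mul_le _ _).trans ?_
    rw [mul_comm]
    gcongr
    exact hx i
  · simpa using hy.norm.const_mul M

namespace asympCommutant

theorem zero_mem : (0 : E) ∈ asympCommutant l u := by
  refine ⟨?_, ?_, ?_, ?_⟩ <;> simpa using tendsto_const_nhds

theorem smul_mem (c : ℂ) {b : E} (hb : b ∈ asympCommutant l u) : c • b ∈ asympCommutant l u := by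
  have key : ∀ f : ι → E, Tendsto f l (𝓝 0) → Tendsto (fun i => c • f i) l (𝓝 0) := fun f hf => by
    simpa using hf.const_smul c
  refine ⟨(key _ hb.1).congr fun i => ?_, (key _ hb.2.1).congr fun i => ?_,
    (key _ hb.2.2.1).congr fun i => ?_, (key _ hb.2.2.2).congr fun i => ?_⟩ <;>
  simp only [smul_sub, mul_smul_comm, smul_mul_assoc]

theorem mul_mem {a b : E} (ha : a ∈ asympCommutant l u) (hb : b ∈ asympCommutant l u) :
    a * b ∈ asympCommutant l u := by
  have hr : ∀ f : ι → E, Tendsto f l (𝓝 0) → Tendsto (fun i => f i * b) l (𝓝 0) := fun f hf => by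
    simpa using hf.mul_const b
  have hl : ∀ f : ι → E, Tendsto f l (𝓝 0) → Tendsto (fun i => a * f i) l (𝓝 0) := fun f hf => by
    simpa using hf.const_mul a
  refine ⟨?_, ?_, ?_, ?_⟩
  · have := (hr _ ha.1).add (hl _ hb.1)
    rw [add_zero] at this
    exact this.congr fun i => by noncomm_ring
  · have := (hr _ ha.2.1).add (hl _ hb.2.1)
    rw [add_zero] at this
    exact this.congr fun i => by noncomm_ring
  · exact (hr _ ha.2.2.1).congr fun i => by noncomm_ring
  · exact (hr _ ha.2.2.2).congr fun i => by noncomm_ring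

/-- Taking adjoints turns the unitarity relations around: one needs b u^* u - b → 0 and b u u^* - b
→ 0. There b is moved past u and u^* with the commutator relations, which is why u has to be
bounded. -/
theorem star_mem {M : ℝ} (hu : ∀ i, ‖u i‖ ≤ M) {b : E} (hb : b ∈ asympCommutant l u) :
    star b ∈ asympCommutant l u := by
  have hu' : ∀ i, ‖star (u i)‖ ≤ M := fun i => by rw [norm_star]; exact hu i
  have hs : ∀ f : ι → E, Tendsto f l (𝓝 0) → Tendsto (fun i => star (f i)) l (𝓝 0) := fun f hf => by
    simpa using hf.star
  refine ⟨?_, ?_, ?_, ?_⟩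
  · have := (hs _ hb.2.1).neg
    rw [neg_zero] at this
    exact this.congr fun i => by simp
  · have := (hs _ hb.1).neg
    rw [neg_zero] at this
    exact this.congr fun i => by simp
  · have h1 := (((tendsto_zero_mul_bdd hu hb.2.1).add (tendsto_bdd_mul_zero hu' hb.1)).neg).add hb.2.2.1
    rw [add_zero, add_zero, neg_zero] at h1
    refine (hs _ h1).congr fun i => ?_
    rw [show -((star (u i) * b - b * star (u i)) * u i + star (u i) * (u i * b - b * u i)) +
      (star (u i) * u i * b - b) = b * star (u i) * u i - b by noncomm_ring]
    simp [mul_assoc]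
  · have h1 := (((tendsto_zero_mul_bdd hu' hb.1).add (tendsto_bdd_mul_zero hu hb.2.1)).neg).add hb.2.2.2
    rw [add_zero, add_zero, neg_zero] at h1
    refine (hs _ h1).congr fun i => ?_
    rw [show -((u i * b - b * u i) * star (u i) + u i * (star (u i) * b - b * star (u i))) +
      (u i * star (u i) * b - b) = b * u i * star (u i) - b by noncomm_ring]
    simp [mul_assoc]

end asympCommutant

/-- The integer powers of `x`, negative powers being powers of `x^*`. -/
def starZPow (x : E) (k : ℤ) : E := x ^ k.toNat * star x ^ (-k).toNat

theorem star_starZPow (x : E) (k : ℤ) : star (starZPow x k) = starZPow x (-k) := by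
  simp [starZPow]

theorem norm_starZPow_le {M : ℝ} (hu : ∀ i, ‖u i‖ ≤ M) (k : ℤ) :
    ∃ C : ℝ, ∀ i, ‖starZPow (u i) k‖ ≤ C := by
  have hp : ∀ n : ℕ, ∃ C : ℝ, ∀ i, ‖u i ^ n‖ ≤ C := by
    intro n
    induction n with
    | zero => exact ⟨‖(1 : E)‖, fun i => by simp⟩
    | succ n ih =>
      obtain ⟨C, hC⟩ := ih
      refine ⟨C * M, fun i => ?_⟩
      rw [pow_succ]
      exact (norm_mul_le _ _).trans (mul_le_mul (hC i) (hu i) (norm_nonneg _)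
        ((norm_nonneg _).trans (hC i)))
  obtain ⟨C, hC⟩ := hp k.toNat
  obtain ⟨D, hD⟩ := hp (-k).toNat
  refine ⟨C * D, fun i => ?_⟩
  rw [starZPow, ← star_pow]
  refine (norm_mul_le _ _).trans ?_
  rw [norm_star]
  exact mul_le_mul (hC i) (hD i) (norm_nonneg _) ((norm_nonneg _).trans (hC i))

theorem tendsto_starZPow_commutator {M : ℝ} (hu : ∀ i, ‖u i‖ ≤ M) {b : E}
    (hb : b ∈ asympCommutant l u) (k : ℤ) :
    Tendsto (fun i => starZPow (u i) k * b - b * starZPow (u i) k) l (𝓝 0) := by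
  have hp : ∀ v : ι → E, (∀ i, ‖v i‖ ≤ M) → Tendsto (fun i => v i * b - b * v i) l (𝓝 0) → ∀ n : ℕ,
      (∃ C : ℝ, ∀ i, ‖v i ^ n‖ ≤ C) ∧ Tendsto (fun i => v i ^ n * b - b * v i ^ n) l (𝓝 0) := by
    intro v hv hvb n
    induction n with
    | zero => exact ⟨⟨‖(1 : E)‖, fun i => by simp⟩, by simpa using tendsto_const_nhds⟩
    | succ n ih =>
      obtain ⟨⟨C, hC⟩, h⟩ := ih
      refine ⟨⟨C * M, fun i => ?_⟩, ?_⟩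
      · rw [pow_succ]
        exact (norm_mul_le _ _).trans (mul_le_mul (hC i) (hv i) (norm_nonneg _)
          ((norm_nonneg _).trans (hC i)))
      · have := (tendsto_bdd_mul_zero hC hvb).add (tendsto_zero_mul_bdd hv h)
        rw [add_zero] at this
        exact this.congr fun i => by rw [pow_succ]; noncomm_ring
  obtain ⟨⟨C, hC⟩, h1⟩ := hp u hu hb.1 k.toNat
  obtain ⟨⟨D, hD⟩, h2⟩ := hp (fun i => star (u i)) (fun i => by rw [norm_star]; exact hu i)
    hb.2.1 (-k).toNat
  have := (tendsto_bdd_mul_zero hC h2).add (tendsto_zero_mul_bdd hD h1)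
  rw [add_zero] at this
  exact this.congr fun i => by rw [starZPow]; noncomm_ring

/-- For k ≥ 0 this is an equality. For k < 0 a factor u u^* appears, which is absorbed by b once b
has been moved past the remaining power. -/
theorem tendsto_mul_starZPow {M : ℝ} (hu : ∀ i, ‖u i‖ ≤ M) {b : E}
    (hb : b ∈ asympCommutant l u) (k : ℤ) :
    Tendsto (fun i => u i * starZPow (u i) k * b - starZPow (u i) (k + 1) * b) l (𝓝 0) := by
  rcases le_or_gt 0 k with hk | hk
  · have h1 : (k + 1).toNat = k.toNat + 1 := by omega
    have h2 : (-k).toNat = 0 := by omega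
    have h3 : (-(k + 1)).toNat = 0 := by omega
    refine tendsto_const_nhds.congr fun i => ?_
    rw [starZPow, starZPow, h1, h2, h3, pow_succ']
    simp
  · obtain ⟨C, hC⟩ := norm_starZPow_le hu (k + 1)
    have h1 : k.toNat = 0 := by omega
    have h2 : (k + 1).toNat = 0 := by omega
    have h3 : (-k).toNat = (-(k + 1)).toNat + 1 := by omega
    have hc := tendsto_starZPow_commutator hu hb (k + 1)
    have hM : ∀ i, ‖u i * star (u i)‖ ≤ M * M := fun i => by
      refine (norm_mul_le _ _).trans ?_
      rw [norm_star]
      exact mul_le_mul (hu i) (hu i) (norm_nonneg _) ((norm_nonneg _).trans (hu i))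
    have := ((tendsto_bdd_mul_zero hM hc).add (tendsto_zero_mul_bdd hC hb.2.2.2)).sub hc
    rw [add_zero, sub_zero] at this
    refine this.congr fun i => ?_
    have h4 : starZPow (u i) k = star (u i) * starZPow (u i) (k + 1) := by
      rw [starZPow, starZPow, h1, h2, h3, pow_succ']
      simp
    rw [h4]
    noncomm_ring

theorem tendsto_star_mul_starZPow {M : ℝ} (hu : ∀ i, ‖u i‖ ≤ M) {b : E}
    (hb : b ∈ asympCommutant l u) (k : ℤ) :
    Tendsto (fun i => star (u i) * starZPow (u i) k * b - starZPow (u i) (k - 1) * b) l (𝓝 0) := by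
  rcases le_or_gt k 0 with hk | hk
  · have h1 : k.toNat = 0 := by omega
    have h2 : (k - 1).toNat = 0 := by omega
    have h3 : (-(k - 1)).toNat = (-k).toNat + 1 := by omega
    refine tendsto_const_nhds.congr fun i => ?_
    rw [starZPow, starZPow, h1, h2, h3, pow_succ']
    simp
  · obtain ⟨C, hC⟩ := norm_starZPow_le hu (k - 1)
    have h1 : (-k).toNat = 0 := by omega
    have h2 : (-(k - 1)).toNat = 0 := by omega
    have h3 : k.toNat = (k - 1).toNat + 1 := by omega
    have hc := tendsto_starZPow_commutator hu hb (k - 1)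
    have hM : ∀ i, ‖star (u i) * u i‖ ≤ M * M := fun i => by
      refine (norm_mul_le _ _).trans ?_
      rw [norm_star]
      exact mul_le_mul (hu i) (hu i) (norm_nonneg _) ((norm_nonneg _).trans (hu i))
    have := ((tendsto_bdd_mul_zero hM hc).add (tendsto_zero_mul_bdd hC hb.2.2.1)).sub hc
    rw [add_zero, sub_zero] at this
    refine this.congr fun i => ?_
    have h4 : starZPow (u i) k = u i * starZPow (u i) (k - 1) := by
      rw [starZPow, starZPow, h1, h2, h3, pow_succ']
      simp
    rw [h4]
    noncomm_ring

theorem tendsto_starZPow_mul_starZPow {M : ℝ} (hu : ∀ i, ‖u i‖ ≤ M) {b : E}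
    (hb : b ∈ asympCommutant l u) (k m : ℤ) :
    Tendsto (fun i => starZPow (u i) k * starZPow (u i) m * b - starZPow (u i) (k + m) * b) l
      (𝓝 0) := by
  have hu' : ∀ i, ‖star (u i)‖ ≤ M := fun i => by rw [norm_star]; exact hu i
  have hpos : ∀ n : ℕ, ∀ m : ℤ, Tendsto (fun i => u i ^ n * starZPow (u i) m * b -
      starZPow (u i) (n + m) * b) l (𝓝 0) := by
    intro n
    induction n with
    | zero => intro m; simpa using tendsto_const_nhds
    | succ n ih =>
      intro m
      have := (tendsto_bdd_mul_zero hu (ih m)).add (tendsto_mul_starZPow hu hb (n + m))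
      rw [add_zero] at this
      refine this.congr fun i => ?_
      rw [pow_succ', show (((n + 1 : ℕ) : ℤ) + m) = n + m + 1 by push_cast; ring]
      noncomm_ring
  have hneg : ∀ n : ℕ, ∀ m : ℤ, Tendsto (fun i => star (u i) ^ n * starZPow (u i) m * b -
      starZPow (u i) (-n + m) * b) l (𝓝 0) := by
    intro n
    induction n with
    | zero => intro m; simpa using tendsto_const_nhds
    | succ n ih =>
      intro m
      have := (tendsto_bdd_mul_zero hu' (ih m)).add (tendsto_star_mul_starZPow hu hb (-n + m))
      rw [add_zero] at this
      refine this.congr fun i => ?_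
      rw [pow_succ', show (-((n + 1 : ℕ) : ℤ) + m) = -n + m - 1 by push_cast; ring]
      noncomm_ring
  rcases le_or_gt 0 k with hk | hk
  · refine (hpos k.toNat m).congr fun i => ?_
    have h1 : (-k).toNat = 0 := by omega
    rw [Int.toNat_of_nonneg hk]
    simp [starZPow, h1]
  · refine (hneg (-k).toNat m).congr fun i => ?_
    have h1 : k.toNat = 0 := by omega
    rw [Int.toNat_of_nonneg (by omega : 0 ≤ -k), neg_neg]
    simp [starZPow, h1]

/-- `f` is a trigonometric polynomial of degree at most `K` with coefficients in the asymptotic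
commutant of `u`, and `x` is asymptotically obtained by inserting `u` into `f`. -/
def IsTrigEval {T : ℝ} (l : Filter ι) (u : ι → E) (K : ℕ) (f : AddCircle T → E) (x : ι → E) : Prop :=
  ∃ a : ℤ → E, (∀ k, a k ∈ asympCommutant l u) ∧
    (∀ z, f z = ∑ k ∈ Finset.Icc (-K : ℤ) K, fourier k z • a k) ∧
    Tendsto (fun i => x i - ∑ k ∈ Finset.Icc (-K : ℤ) K, starZPow (u i) k * a k) l (𝓝 0)

end TrigCalculus

/-! ### The algebra of trigonometric evaluations and its norm estimate -/

section TrigCalculus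

variable {E : Type*} [CStarAlgebra E] {ι : Type*} {l : Filter ι} {u : ι → E} {T : ℝ}

namespace IsTrigEval

theorem congr_eval {K : ℕ} {f : AddCircle T → E} {x y : ι → E} (h : IsTrigEval l u K f x)
    (hxy : Tendsto (fun i => x i - y i) l (𝓝 0)) : IsTrigEval l u K f y := by
  obtain ⟨a, ha, hf, hx⟩ := h
  refine ⟨a, ha, hf, ?_⟩
  have := hx.sub hxy
  rw [sub_zero] at this
  exact this.congr fun i => by abel

theorem zero (K : ℕ) : IsTrigEval l u K (fun _ : AddCircle T => 0) (fun _ => 0) :=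
  ⟨fun _ => 0, fun _ => asympCommutant.zero_mem, fun z => by simp, by simpa using tendsto_const_nhds⟩

theorem single {K : ℕ} {k : ℤ} (hk : |k| ≤ K) {b : E} (hb : b ∈ asympCommutant l u) :
    IsTrigEval l u K (fun z : AddCircle T => fourier k z • b) (fun i => starZPow (u i) k * b) := by
  have hk' : k ∈ Finset.Icc (-K : ℤ) K := by rw [Finset.mem_Icc]; exact abs_le.1 hk
  refine ⟨fun j => if j = k then b else 0, fun j => ?_, fun z => ?_, ?_⟩
  · dsimp only
    split_ifs
    · exact hb
    · exact asympCommutant.zero_mem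
  · rw [Finset.sum_eq_single k (fun j _ hj => by simp [hj]) (fun h => absurd hk' h)]
    simp
  · refine tendsto_const_nhds.congr fun i => ?_
    rw [Finset.sum_eq_single k (fun j _ hj => by simp [hj]) (fun h => absurd hk' h)]
    simp

theorem mono {K L : ℕ} (hKL : K ≤ L) {f : AddCircle T → E} {x : ι → E} (h : IsTrigEval l u K f x) :
    IsTrigEval l u L f x := by
  obtain ⟨a, ha, hf, hx⟩ := h
  have hsub : Finset.Icc (-K : ℤ) K ⊆ Finset.Icc (-L : ℤ) L :=
    Finset.Icc_subset_Icc (by omega) (by omega)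
  refine ⟨fun k => if k ∈ Finset.Icc (-K : ℤ) K then a k else 0, fun j => ?_, fun z => ?_, ?_⟩
  · dsimp only
    split_ifs
    · exact ha j
    · exact asympCommutant.zero_mem
  · rw [hf, ← Finset.sum_subset hsub (fun j _ hj => by simp only [if_neg hj, smul_zero])]
    exact Finset.sum_congr rfl fun j hj => by simp only [if_pos hj]
  · refine hx.congr fun i => ?_
    rw [← Finset.sum_subset hsub (fun j _ hj => by simp only [if_neg hj, mul_zero])]
    congr 1
    exact Finset.sum_congr rfl fun j hj => by simp only [if_pos hj]

end IsTrigEval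

theorem asympCommutant.add_mem {a b : E} (ha : a ∈ asympCommutant l u)
    (hb : b ∈ asympCommutant l u) : a + b ∈ asympCommutant l u := by
  refine ⟨?_, ?_, ?_, ?_⟩
  · have := ha.1.add hb.1
    rw [add_zero] at this
    exact this.congr fun i => by noncomm_ring
  · have := ha.2.1.add hb.2.1
    rw [add_zero] at this
    exact this.congr fun i => by noncomm_ring
  · have := ha.2.2.1.add hb.2.2.1
    rw [add_zero] at this
    exact this.congr fun i => by noncomm_ring
  · have := ha.2.2.2.add hb.2.2.2
    rw [add_zero] at this
    exact this.congr fun i => by noncomm_ring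

namespace IsTrigEval

theorem add {K : ℕ} {f g : AddCircle T → E} {x y : ι → E} (h : IsTrigEval l u K f x)
    (h' : IsTrigEval l u K g y) :
    IsTrigEval l u K (fun z => f z + g z) (fun i => x i + y i) := by
  obtain ⟨a, ha, hf, hx⟩ := h
  obtain ⟨b, hb, hg, hy⟩ := h'
  refine ⟨fun k => a k + b k, fun k => asympCommutant.add_mem (ha k) (hb k), fun z => ?_, ?_⟩
  · simp only [hf, hg, smul_add, Finset.sum_add_distrib]
  · have := hx.add hy
    rw [add_zero] at this
    refine this.congr fun i => ?_
    simp only [mul_add, Finset.sum_add_distrib]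
    abel

theorem sum {κ : Type*} (s : Finset κ) {K : ℕ} {f : κ → AddCircle T → E} {x : κ → ι → E}
    (h : ∀ j ∈ s, IsTrigEval l u K (f j) (x j)) :
    IsTrigEval l u K (fun z => ∑ j ∈ s, f j z) (fun i => ∑ j ∈ s, x j i) := by
  classical
  induction s using Finset.induction_on with
  | empty => simpa using zero K
  | insert j s hj ih =>
    simp only [Finset.sum_insert hj]
    exact (h j (Finset.mem_insert_self j s)).add (ih fun i hi => h i (Finset.mem_insert_of_mem hi))

variable {M : ℝ}

theorem exists_bound (hu : ∀ i, ‖u i‖ ≤ M) (a : ℤ → E) (s : Finset ℤ) :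
    ∃ C : ℝ, ∀ i, ‖∑ k ∈ s, starZPow (u i) k * a k‖ ≤ C := by
  choose C hC using fun k => norm_starZPow_le hu k
  refine ⟨∑ k ∈ s, C k * ‖a k‖, fun i => (norm_sum_le _ _).trans (Finset.sum_le_sum fun k _ => ?_)⟩
  exact (norm_mul_le _ _).trans (mul_le_mul_of_nonneg_right (hC k i) (norm_nonneg _))

/-- Reordering u^k a u^m b into u^{k+m} a b costs one commutator of a with u^m and one use of the
asymptotic group law, for each of the finitely many pairs of coefficients. -/
theorem mul (hu : ∀ i, ‖u i‖ ≤ M) {K L : ℕ} {f g : AddCircle T → E} {x y : ι → E}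
    (h : IsTrigEval l u K f x) (h' : IsTrigEval l u L g y) :
    IsTrigEval l u (K + L) (fun z => f z * g z) (fun i => x i * y i) := by
  obtain ⟨a, ha, hf, hx⟩ := h
  obtain ⟨b, hb, hg, hy⟩ := h'
  have h1 : IsTrigEval l u (K + L)
      (fun z : AddCircle T => ∑ k ∈ Finset.Icc (-K : ℤ) K, ∑ m ∈ Finset.Icc (-L : ℤ) L,
        fourier (k + m) z • (a k * b m))
      (fun i => ∑ k ∈ Finset.Icc (-K : ℤ) K, ∑ m ∈ Finset.Icc (-L : ℤ) L,
        starZPow (u i) (k + m) * (a k * b m)) := by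
    refine IsTrigEval.sum _ fun k hk => IsTrigEval.sum _ fun m hm => ?_
    refine single ?_ (asympCommutant.mul_mem (ha k) (hb m))
    rw [Finset.mem_Icc] at hk hm
    rw [abs_le]
    push_cast
    omega
  have h2 : (fun z => f z * g z) = fun z : AddCircle T =>
      ∑ k ∈ Finset.Icc (-K : ℤ) K, ∑ m ∈ Finset.Icc (-L : ℤ) L,
        fourier (k + m) z • (a k * b m) := by
    funext z
    rw [hf, hg, Finset.sum_mul_sum]
    refine Finset.sum_congr rfl fun k _ => Finset.sum_congr rfl fun m _ => ?_
    rw [smul_mul_smul_comm, fourier_add]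
  rw [h2]
  refine h1.congr_eval ?_
  have h3 : Tendsto (fun i => ∑ k ∈ Finset.Icc (-K : ℤ) K, ∑ m ∈ Finset.Icc (-L : ℤ) L,
      (starZPow (u i) (k + m) * (a k * b m) - starZPow (u i) k * a k * (starZPow (u i) m * b m)))
      l (𝓝 0) := by
    rw [show (0 : E) = ∑ k ∈ Finset.Icc (-K : ℤ) K, ∑ m ∈ Finset.Icc (-L : ℤ) L, (0 : E) by simp]
    refine tendsto_finsetSum _ fun k _ => tendsto_finsetSum _ fun m _ => ?_
    obtain ⟨C, hC⟩ := norm_starZPow_le hu k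
    have e1 := tendsto_bdd_mul_zero hC (tendsto_starZPow_commutator hu (ha k) m)
    have e2 := (e1.mul_const (b m)).sub
      (tendsto_starZPow_mul_starZPow hu (asympCommutant.mul_mem (ha k) (hb m)) k m)
    rw [zero_mul, sub_zero] at e2
    exact e2.congr fun i => by noncomm_ring
  obtain ⟨C, hC⟩ := exists_bound hu a (Finset.Icc (-K : ℤ) K)
  obtain ⟨D, hD⟩ := exists_bound hu b (Finset.Icc (-L : ℤ) L)
  have h4 := ((h3.sub (tendsto_zero_mul_bdd hD hx)).sub (tendsto_bdd_mul_zero hC hy)).sub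
    (hx.mul hy)
  rw [mul_zero, sub_zero, sub_zero, sub_zero] at h4
  refine h4.congr fun i => ?_
  simp only [Finset.sum_sub_distrib]
  rw [← Finset.sum_mul_sum]
  noncomm_ring

theorem star (hu : ∀ i, ‖u i‖ ≤ M) {K : ℕ} {f : AddCircle T → E} {x : ι → E}
    (h : IsTrigEval l u K f x) : IsTrigEval l u K (fun z => star (f z)) (fun i => star (x i)) := by
  obtain ⟨a, ha, hf, hx⟩ := h
  have h1 : IsTrigEval l u K
      (fun z : AddCircle T => ∑ k ∈ Finset.Icc (-K : ℤ) K, fourier (-k) z • Star.star (a k))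
      (fun i => ∑ k ∈ Finset.Icc (-K : ℤ) K, starZPow (u i) (-k) * Star.star (a k)) := by
    refine IsTrigEval.sum _ fun k hk => single ?_ (asympCommutant.star_mem hu (ha k))
    rw [Finset.mem_Icc] at hk
    rw [abs_le]
    omega
  have h2 : (fun z => Star.star (f z)) = fun z : AddCircle T =>
      ∑ k ∈ Finset.Icc (-K : ℤ) K, fourier (-k) z • Star.star (a k) := by
    funext z
    rw [hf, star_sum]
    refine Finset.sum_congr rfl fun k _ => ?_
    rw [star_smul, fourier_neg]
    rfl
  rw [h2]
  refine h1.congr_eval ?_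
  have h3 : Tendsto (fun i => ∑ k ∈ Finset.Icc (-K : ℤ) K,
      (starZPow (u i) (-k) * Star.star (a k) - Star.star (a k) * starZPow (u i) (-k))) l (𝓝 0) := by
    rw [show (0 : E) = ∑ k ∈ Finset.Icc (-K : ℤ) K, (0 : E) by simp]
    exact tendsto_finsetSum _ fun k _ => tendsto_starZPow_commutator hu (asympCommutant.star_mem hu (ha k)) (-k)
  have h4 := h3.sub hx.star
  rw [star_zero, sub_zero] at h4
  refine h4.congr fun i => ?_
  simp only [Finset.sum_sub_distrib, star_sub, star_sum, star_mul, star_starZPow]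
  abel

theorem pow (hu : ∀ i, ‖u i‖ ≤ M) {K : ℕ} {f : AddCircle T → E} {x : ι → E}
    (h : IsTrigEval l u K f x) (n : ℕ) :
    IsTrigEval l u ((n + 1) * K) (fun z => f z ^ (n + 1)) (fun i => x i ^ (n + 1)) := by
  induction n with
  | zero => simpa using h
  | succ n ih =>
    simp only [pow_succ _ (n + 1)]
    rw [show (n + 1 + 1) * K = (n + 1) * K + K by ring]
    exact ih.mul hu h

/-- a_k is the k-th Fourier coefficient, that is, an average of values of the function multiplied by
scalars of modulus one. -/
theorem norm_coeff_le [Fact (0 < T)] {K : ℕ} {a : ℤ → E} {κ : ℝ}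
    (hf : ∀ z : AddCircle T, ‖∑ k ∈ Finset.Icc (-K : ℤ) K, fourier k z • a k‖ ≤ κ) {k : ℤ}
    (hk : k ∈ Finset.Icc (-K : ℤ) K) : ‖a k‖ ≤ κ := by
  have h1 : fourierCoeff (fun z : AddCircle T => ∑ m ∈ Finset.Icc (-K : ℤ) K, fourier m z • a m) k
      = a k := by
    have h2 : ∀ m : ℤ, fourierCoeff (fun z : AddCircle T => fourier m z • a m) k
        = fourierCoeff (fourier m : AddCircle T → ℂ) k • a m := by
      intro m
      simp only [fourierCoeff, smul_smul, smul_eq_mul]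
      exact integral_smul_const (𝕜 := ℂ) _ _
    have h3 := fourierCoeff.sum (Finset.Icc (-K : ℤ) K)
      (fun (m : ℤ) (z : AddCircle T) => fourier m z • a m) (fun m _ => by
        refine Continuous.integrable_of_hasCompactSupport
          ((fourier m).continuous.smul continuous_const) (HasCompactSupport.of_compactSpace _))
    have h4 : (∑ m ∈ Finset.Icc (-K : ℤ) K, fun z : AddCircle T => fourier m z • a m)
        = fun z : AddCircle T => ∑ m ∈ Finset.Icc (-K : ℤ) K, fourier m z • a m := by
      funext z; simp only [Finset.sum_apply]
    rw [← h4, h3, Finset.sum_apply, Finset.sum_eq_single k]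
    · rw [h2, fourierCoeff_fourier]; simp
    · intro m _ hm
      rw [h2, fourierCoeff_fourier]; simp [hm.symm]
    · exact fun h => absurd hk h
  rw [← h1, fourierCoeff]
  refine (MeasureTheory.norm_integral_le_of_norm_le_const (C := κ) (Eventually.of_forall fun z => ?_)).trans ?_
  · rw [norm_smul, fourier_apply, Circle.norm_coe, one_mul]
    exact hf z
  · simp

/-- A crude bound obtained by summing the coefficients. Its factor, linear in the degree, is removed
in `IsTrigEval.eventually_norm_le`. -/
theorem eventually_norm_le_mul [Fact (0 < T)] (hu : ∀ i, ‖u i‖ ≤ M) {K : ℕ} {f : AddCircle T → E}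
    {x : ι → E} (h : IsTrigEval l u K f x) {κ : ℝ} (hf : ∀ z, ‖f z‖ ≤ κ) {ε : ℝ} (hε : 0 < ε) :
    ∀ᶠ i in l, ‖x i‖ ≤ (2 * K + 1) * κ + ε := by
  obtain ⟨a, ha, hfa, hx⟩ := h
  have h1 : ∀ k ∈ Finset.Icc (-K : ℤ) K, ‖a k‖ ≤ κ := fun k hk =>
    norm_coeff_le (fun z => by rw [← hfa]; exact hf z) hk
  have hκ : 0 ≤ κ := (norm_nonneg _).trans (h1 0 (by rw [Finset.mem_Icc]; omega))
  set δ : ℝ := ε / (2 * K + 2) with hδ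
  have hδ0 : 0 < δ := by positivity
  -- By the C⋆-identity ‖u^k a‖² = ‖a^* u^{-k} u^k a‖, and u^{-k} u^k acts asymptotically as the
  -- identity on a.
  have h2 : ∀ k, ∀ᶠ i in l, ‖starZPow (u i) k * a k‖ ≤ ‖a k‖ + δ := by
    intro k
    have e1 := tendsto_starZPow_mul_starZPow hu (ha k) (-k) k
    have e2 := (e1.const_mul (Star.star (a k))).norm
    rw [mul_zero, norm_zero] at e2
    filter_upwards [e2.eventually_lt_const (show (0 : ℝ) < δ ^ 2 by positivity)] with i hi
    have e3 : ‖starZPow (u i) k * a k‖ * ‖starZPow (u i) k * a k‖ ≤ ‖a k‖ * ‖a k‖ + δ ^ 2 := by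
      rw [← CStarRing.norm_star_mul_self, ← CStarRing.norm_star_mul_self, star_mul, star_starZPow]
      have e4 : starZPow (u i) (-k + k) = 1 := by simp [starZPow]
      rw [e4, one_mul] at hi
      calc ‖Star.star (a k) * starZPow (u i) (-k) * (starZPow (u i) k * a k)‖
          = ‖Star.star (a k) * a k
            + Star.star (a k) * (starZPow (u i) (-k) * starZPow (u i) k * a k - a k)‖ := by
            congr 1; noncomm_ring
        _ ≤ _ := (norm_add_le _ _).trans (by gcongr)
    nlinarith [norm_nonneg (a k), norm_nonneg (starZPow (u i) k * a k)]
  have h3 := hx.norm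
  rw [norm_zero] at h3
  filter_upwards [h3.eventually_lt_const hδ0,
    (Filter.eventually_all_finset (Finset.Icc (-K : ℤ) K)).2 fun k _ => h2 k] with i hi hi'
  have h4 : ‖∑ k ∈ Finset.Icc (-K : ℤ) K, starZPow (u i) k * a k‖ ≤ (2 * K + 1) * (κ + δ) := by
    refine (norm_sum_le _ _).trans ((Finset.sum_le_card_nsmul _ _ (κ + δ) fun k hk => ?_).trans ?_)
    · exact (hi' k hk).trans (by linarith [h1 k hk])
    · rw [Int.card_Icc, nsmul_eq_mul]
      refine le_of_eq ?_
      congr 1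
      have : ((K : ℤ) + 1 - -K).toNat = 2 * K + 1 := by omega
      rw [this]; push_cast; ring
  have h5 := norm_le_norm_sub_add (x i) (∑ k ∈ Finset.Icc (-K : ℤ) K, starZPow (u i) k * a k)
  have h6 : δ * (2 * K + 2) = ε := by rw [hδ]; field_simp
  nlinarith

/-- Power trick: (x^* x)^N has degree 2NK, so that the crude bound costs the factor 4NK + 1, which
grows linearly in N, whereas ‖(x^* x)^N‖ = ‖x‖^{2N} grows exponentially. For large N the factor is
swallowed by replacing κ with κ + ε. -/
theorem eventually_norm_le [Fact (0 < T)] (hu : ∀ i, ‖u i‖ ≤ M) {K : ℕ} {f : AddCircle T → E}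
    {x : ι → E} (h : IsTrigEval l u K f x) {κ : ℝ} (hf : ∀ z, ‖f z‖ ≤ κ) {ε : ℝ} (hε : 0 < ε) :
    ∀ᶠ i in l, ‖x i‖ ≤ κ + ε := by
  have hκ : 0 ≤ κ := (norm_nonneg _).trans (hf 0)
  -- Enlarging κ to κ' keeps the ratio q strictly between 0 and 1, even when κ = 0.
  set κ' := κ + ε / 2 with hκ'
  have hκ0 : 0 < κ' := by positivity
  set q := κ' / (κ + ε) with hq
  have hq0 : 0 < q := by positivity
  have hq1 : q < 1 := by rw [hq, div_lt_one (by positivity)]; linarith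
  have hlim : Tendsto (fun N : ℕ => (4 * K : ℝ) * ((N : ℝ) * q ^ N) + q ^ N) atTop (𝓝 0) := by
    have := ((tendsto_self_mul_const_pow_of_lt_one hq0.le hq1).const_mul (4 * K : ℝ)).add
      (tendsto_pow_atTop_nhds_zero_of_lt_one hq0.le hq1)
    simpa using this
  have hlim2 := hlim.comp (tendsto_pow_atTop_atTop_of_one_lt (r := 2) one_lt_two)
  obtain ⟨n, hn⟩ := (hlim2.eventually_lt_const (show (0 : ℝ) < 1 by norm_num)).exists
  simp only [Function.comp_apply] at hn
  -- For an exponent that is a power of 2, the C⋆-identity applied repeatedly gives ‖b^N‖ = ‖b‖^N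
  -- for self-adjoint b.
  set N : ℕ := 2 ^ n with hN
  have hN1 : N = (N - 1) + 1 := (Nat.sub_add_cancel Nat.one_le_two_pow).symm
  have hp := ((h.star hu).mul hu h).pow hu (N - 1)
  rw [← hN1] at hp
  have hf' : ∀ z : AddCircle T, ‖(Star.star (f z) * f z) ^ N‖ ≤ (κ' ^ N) ^ 2 := by
    intro z
    rw [hN, (IsSelfAdjoint.star_mul_self (f z)).norm_pow_two_pow, CStarRing.norm_star_mul_self,
      ← pow_two, ← pow_mul, ← pow_mul, mul_comm]
    exact pow_le_pow_left₀ (norm_nonneg _) ((hf z).trans (by linarith)) _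
  set D : ℝ := ((κ + ε) ^ N) ^ 2 with hD
  have hqN : q ^ N * (κ + ε) ^ N = κ' ^ N := by
    rw [← mul_pow, hq, div_mul_cancel₀ _ (by positivity)]
  have hlt : (2 * (N * (K + K) : ℕ) + 1) * (κ' ^ N) ^ 2 < D := by
    have h0 : 0 < q ^ N := by positivity
    have h1 : q ^ N ≤ 1 := pow_le_one₀ hq0.le hq1.le
    rw [hD, ← hqN, mul_pow, ← mul_assoc]
    refine mul_lt_of_lt_one_left (by positivity) ?_
    push_cast
    have h2 : (2 * (N * (K + K) : ℝ) + 1) * (q ^ N) ^ 2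
        ≤ (4 * K : ℝ) * ((N : ℝ) * q ^ N) + q ^ N := by
      have : (2 * (N * (K + K) : ℝ) + 1) * (q ^ N) ^ 2
        = ((4 * K : ℝ) * ((N : ℝ) * q ^ N) + q ^ N) * q ^ N := by ring
      rw [this]
      exact mul_le_of_le_one_right (by positivity) h1
    exact h2.trans_lt hn
  filter_upwards [hp.eventually_norm_le_mul hu hf' (sub_pos.2 hlt)] with i hi
  rw [add_sub_cancel, hN, (IsSelfAdjoint.star_mul_self (x i)).norm_pow_two_pow,
    CStarRing.norm_star_mul_self, ← hN, ← pow_two, ← pow_mul, hD, ← pow_mul, mul_comm N] at hi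
  exact (pow_le_pow_iff_left₀ (norm_nonneg _) (by positivity) (by positivity)).1 hi

end IsTrigEval

/-- `x` asymptotically represents the function `f` on the circle when the asymptotically central
unitary `u` is inserted for the coordinate. -/
def Represents (l : Filter ι) (u : ι → E) (f : AddCircle T → E) (x : ι → E) : Prop :=
  ∀ ε : ℝ, 0 < ε → ∃ (K : ℕ) (g : AddCircle T → E) (y : ι → E), IsTrigEval l u K g y ∧
    (∀ z, ‖f z - g z‖ ≤ ε) ∧ ∀ᶠ i in l, ‖x i - y i‖ ≤ ε

namespace Represents

variable {M : ℝ} {f g : AddCircle T → E} {x y : ι → E}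

theorem eventually_norm_le [Fact (0 < T)] (hu : ∀ i, ‖u i‖ ≤ M) (h : Represents l u f x) {κ : ℝ}
    (hf : ∀ z, ‖f z‖ ≤ κ) {ε : ℝ} (hε : 0 < ε) : ∀ᶠ i in l, ‖x i‖ ≤ κ + ε := by
  obtain ⟨K, g, y, hg, hfg, hxy⟩ := h (ε / 3) (by positivity)
  have h1 : ∀ z, ‖g z‖ ≤ κ + ε / 3 := fun z => by
    have := norm_le_norm_sub_add (g z) (f z)
    rw [norm_sub_rev] at this
    linarith [hf z, hfg z]
  filter_upwards [hxy, hg.eventually_norm_le hu h1 (show 0 < ε / 3 by positivity)] with i hi hi'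
  have := norm_le_norm_sub_add (x i) (y i)
  linarith

/-- This carries algebraic identities between functions on the circle over to asymptotic identities
between the sequences that represent them. -/
theorem tendsto_zero [Fact (0 < T)] (hu : ∀ i, ‖u i‖ ≤ M)
    (h : Represents l u (fun _ : AddCircle T => (0 : E)) x) : Tendsto x l (𝓝 0) := by
  rw [Metric.tendsto_nhds]
  intro ε hε
  filter_upwards [h.eventually_norm_le hu (κ := 0) (fun z => by simp) (half_pos hε)] with i hi
  rw [dist_zero_right]
  linarith

theorem congr_eval (h : Represents l u f x) (hxy : Tendsto (fun i => x i - y i) l (𝓝 0)) :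
    Represents l u f y := by
  intro ε hε
  obtain ⟨K, g, y', hg, hfg, hxy'⟩ := h (ε / 2) (by positivity)
  have h1 := hxy.norm
  rw [norm_zero] at h1
  refine ⟨K, g, y', hg, fun z => (hfg z).trans (by linarith), ?_⟩
  filter_upwards [hxy', h1.eventually_lt_const (half_pos hε)] with i hi hi'
  calc ‖y i - y' i‖ = ‖(x i - y' i) - (x i - y i)‖ := by congr 1; abel
    _ ≤ _ := (norm_sub_le _ _).trans (by linarith)

theorem _root_.IsTrigEval.represents {K : ℕ} (h : IsTrigEval l u K f x) : Represents l u f x :=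
  fun ε hε => ⟨K, f, x, h, fun z => by simpa using hε.le, Eventually.of_forall fun i => by
    simpa using hε.le⟩

theorem const {b : E} (hb : b ∈ asympCommutant l u) :
    Represents l u (fun _ : AddCircle T => b) fun _ => b := by
  have := (IsTrigEval.single (T := T) (K := 0) (k := 0) (by simp) hb).represents
  simpa [starZPow] using this

theorem add (h : Represents l u f x) (h' : Represents l u g y) :
    Represents l u (fun z => f z + g z) fun i => x i + y i := by
  intro ε hε
  obtain ⟨K, p, x', hp, hfp, hx⟩ := h (ε / 2) (by positivity)
  obtain ⟨L, q, y', hq, hgq, hy⟩ := h' (ε / 2) (by positivity)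
  refine ⟨max K L, fun z => p z + q z, fun i => x' i + y' i,
    (hp.mono (le_max_left _ _)).add (hq.mono (le_max_right _ _)), fun z => ?_, ?_⟩
  · rw [add_sub_add_comm]
    exact (norm_add_le _ _).trans (by linarith [hfp z, hgq z])
  · filter_upwards [hx, hy] with i hi hi'
    rw [add_sub_add_comm]
    exact (norm_add_le _ _).trans (by linarith)

theorem star (hu : ∀ i, ‖u i‖ ≤ M) (h : Represents l u f x) :
    Represents l u (fun z => star (f z)) fun i => star (x i) := by
  intro ε hε
  obtain ⟨K, p, x', hp, hfp, hx⟩ := h ε hε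
  refine ⟨K, _, _, hp.star hu, fun z => ?_, ?_⟩
  · rw [← star_sub, norm_star]; exact hfp z
  · filter_upwards [hx] with i hi
    rw [← star_sub, norm_star]; exact hi

theorem exists_bound [Fact (0 < T)] (h : Represents l u f x) : ∃ C : ℝ, 0 ≤ C ∧ ∀ z, ‖f z‖ ≤ C := by
  obtain ⟨K, p, x', ⟨a, ha, hp, -⟩, hfp, hx⟩ := h 1 one_pos
  refine ⟨1 + ∑ k ∈ Finset.Icc (-K : ℤ) K, ‖a k‖, by positivity, fun z => ?_⟩
  have h1 : ‖p z‖ ≤ ∑ k ∈ Finset.Icc (-K : ℤ) K, ‖a k‖ := by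
    rw [hp]
    refine norm_sum_le_of_le _ fun k _ => ?_
    rw [norm_smul, fourier_apply, Circle.norm_coe, one_mul]
  have := norm_le_norm_sub_add (f z) (p z)
  linarith [hfp z]

theorem mul [Fact (0 < T)] (hu : ∀ i, ‖u i‖ ≤ M) (h : Represents l u f x)
    (h' : Represents l u g y) : Represents l u (fun z => f z * g z) fun i => x i * y i := by
  intro ε hε
  obtain ⟨C, hC0, hC⟩ := h.exists_bound
  obtain ⟨D, hD0, hD⟩ := h'.exists_bound
  set δ : ℝ := min 1 (ε / (C + D + 4)) with hδ
  have hδ0 : 0 < δ := by positivity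
  have hδ1 : δ ≤ 1 := min_le_left _ _
  have hδ2 : δ * (C + D + 4) ≤ ε := by
    have : δ ≤ ε / (C + D + 4) := min_le_right _ _
    rwa [le_div_iff₀ (by positivity)] at this
  obtain ⟨K, p, x', hp, hfp, hx⟩ := h δ hδ0
  obtain ⟨L, q, y', hq, hgq, hy⟩ := h' δ hδ0
  refine ⟨K + L, _, _, hp.mul hu hq, fun z => ?_, ?_⟩
  · have h1 : ‖p z‖ ≤ C + δ := by
      have := norm_le_norm_sub_add (p z) (f z)
      rw [norm_sub_rev] at this
      linarith [hC z, hfp z]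
    calc ‖f z * g z - p z * q z‖ = ‖(f z - p z) * g z + p z * (g z - q z)‖ := by
          congr 1; noncomm_ring
      _ ≤ δ * D + (C + δ) * δ := (norm_add_le _ _).trans (add_le_add
          ((norm_mul_le _ _).trans (mul_le_mul (hfp z) (hD z) (norm_nonneg _) hδ0.le))
          ((norm_mul_le _ _).trans (mul_le_mul h1 (hgq z) (norm_nonneg _) (by positivity))))
      _ ≤ ε := by nlinarith
  · filter_upwards [hx, hy, h.eventually_norm_le hu hC one_pos,
      h'.eventually_norm_le hu hD one_pos] with i hxi hyi hxi' hyi'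
    have h1 : ‖x' i‖ ≤ C + 1 + δ := by
      have := norm_le_norm_sub_add (x' i) (x i)
      rw [norm_sub_rev] at this
      linarith
    calc ‖x i * y i - x' i * y' i‖ = ‖(x i - x' i) * y i + x' i * (y i - y' i)‖ := by
          congr 1; noncomm_ring
      _ ≤ δ * (D + 1) + (C + 1 + δ) * δ := (norm_add_le _ _).trans (add_le_add
          ((norm_mul_le _ _).trans (mul_le_mul hxi hyi' (norm_nonneg _) hδ0.le))
          ((norm_mul_le _ _).trans (mul_le_mul h1 hyi (norm_nonneg _) (by positivity))))
      _ ≤ ε := by nlinarith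

theorem neg (h : Represents l u f x) :
    Represents l u (fun z => -f z) fun i => -x i := by
  intro ε hε
  obtain ⟨K, p, x', ⟨a, ha, hp, hx'⟩, hfp, hx⟩ := h ε hε
  refine ⟨K, fun z => -p z, fun i => -x' i, ⟨fun k => (-1 : ℂ) • a k,
    fun k => asympCommutant.smul_mem _ (ha k), fun z => ?_, ?_⟩, fun z => ?_, ?_⟩
  · simp [hp]
  · have := hx'.neg
    rw [neg_zero] at this
    refine this.congr fun i => ?_
    simp
    abel
  · rw [← neg_sub', norm_neg]; exact hfp z
  · filter_upwards [hx] with i hi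
    rw [← neg_sub', norm_neg]; exact hi

theorem sub (h : Represents l u f x) (h' : Represents l u g y) :
    Represents l u (fun z => f z - g z) fun i => x i - y i := by
  simpa only [sub_eq_add_neg] using h.add h'.neg

end Represents

end TrigCalculus

/-! ### Trigonometric approximation of vector-valued functions on the circle -/

section TrigApproximation

variable {T : ℝ}

theorem exists_trigSum_of_mem_span {p : C(AddCircle T, ℂ)}
    (hp : p ∈ Submodule.span ℂ (range (@fourier T))) :
    ∃ (K : ℕ) (c : ℤ → ℂ), (∀ k ∉ Finset.Icc (-K : ℤ) K, c k = 0) ∧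
      ∀ z, p z = ∑ k ∈ Finset.Icc (-K : ℤ) K, c k * fourier k z := by
  have hext : ∀ {K L : ℕ} {c : ℤ → ℂ}, K ≤ L → (∀ k ∉ Finset.Icc (-K : ℤ) K, c k = 0) →
      ∀ z : AddCircle T, ∑ k ∈ Finset.Icc (-K : ℤ) K, c k * fourier k z
        = ∑ k ∈ Finset.Icc (-L : ℤ) L, c k * fourier k z := fun hKL hc z =>
    Finset.sum_subset (Finset.Icc_subset_Icc (by omega) (by omega))
      fun k _ hk => by rw [hc k hk, zero_mul]
  induction hp using Submodule.span_induction with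
  | mem p hp =>
    obtain ⟨m, rfl⟩ := hp
    refine ⟨m.natAbs, fun k => if k = m then 1 else 0, fun k hk => if_neg ?_, fun z => ?_⟩
    · rintro rfl
      rw [Finset.mem_Icc] at hk
      omega
    · rw [Finset.sum_eq_single m (fun j _ hj => by simp [hj]) (fun h => ?_)]
      · simp
      · rw [Finset.mem_Icc] at h
        omega
  | zero => exact ⟨0, fun _ => 0, fun _ _ => rfl, fun z => by simp⟩
  | add p q _ _ hp hq =>
    obtain ⟨K, c, hc, hp⟩ := hp
    obtain ⟨L, d, hd, hq⟩ := hq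
    refine ⟨max K L, fun k => c k + d k, fun k hk => ?_, fun z => ?_⟩
    · rw [Finset.mem_Icc] at hk
      dsimp only
      rw [hc k (by rw [Finset.mem_Icc]; omega), hd k (by rw [Finset.mem_Icc]; omega), add_zero]
    · rw [ContinuousMap.add_apply, hp, hq, hext (le_max_left K L) hc, hext (le_max_right K L) hd,
        ← Finset.sum_add_distrib]
      simp only [add_mul]
  | smul a p _ hp =>
    obtain ⟨K, c, hc, hp⟩ := hp
    refine ⟨K, fun k => a * c k, fun k hk => by simp only [hc k hk, mul_zero], fun z => ?_⟩
    rw [ContinuousMap.smul_apply, hp, smul_eq_mul, Finset.mul_sum]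
    simp only [mul_assoc]

variable [hT : Fact (0 < T)]

theorem exists_trigSum_near (p : C(AddCircle T, ℂ)) {ε : ℝ} (hε : 0 < ε) :
    ∃ (K : ℕ) (c : ℤ → ℂ), (∀ k ∉ Finset.Icc (-K : ℤ) K, c k = 0) ∧
      ∀ z, ‖p z - ∑ k ∈ Finset.Icc (-K : ℤ) K, c k * fourier k z‖ ≤ ε := by
  have h : p ∈ (Submodule.span ℂ (range (@fourier T))).topologicalClosure := by
    rw [span_fourier_closure_eq_top]; trivial
  obtain ⟨q, hq, hpq⟩ := Metric.mem_closure_iff.1 h ε hε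
  obtain ⟨K, c, hc, hqc⟩ := exists_trigSum_of_mem_span hq
  refine ⟨K, c, hc, fun z => ?_⟩
  rw [← hqc, ← ContinuousMap.sub_apply]
  rw [dist_eq_norm] at hpq
  exact (ContinuousMap.norm_coe_le_norm _ z).trans hpq.le

/-- A continuous function on the circle with values in a subspace `S` is uniformly approximated by
trigonometric polynomials with coefficients in `S`. -/
theorem exists_trigSum_near_of_mem {E : Type*} [NormedAddCommGroup E] [NormedSpace ℂ E]
    (S : Submodule ℂ E) (f : C(AddCircle T, E)) (hf : ∀ z, f z ∈ S) {ε : ℝ} (hε : 0 < ε) :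
    ∃ (K : ℕ) (a : ℤ → E), (∀ k, a k ∈ S) ∧
      ∀ z, ‖f z - ∑ k ∈ Finset.Icc (-K : ℤ) K, fourier k z • a k‖ ≤ ε := by
  have hnhds : ∀ z ∈ (univ : Set (AddCircle T)), {w | ‖f w - f z‖ < ε / 2} ∈ 𝓝 z := by
    intro z _
    refine (isOpen_lt ((f.continuous.sub continuous_const).norm) continuous_const).mem_nhds ?_
    simpa using hε
  obtain ⟨t, -, ht⟩ := isCompact_univ.elim_nhds_subcover (fun z => {w | ‖f w - f z‖ < ε / 2}) hnhds
  -- A partition of unity replaces f by a finite sum of ρ_j f(j), whose vectors f(j) lie in S; only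
  -- the scalar functions ρ_j remain to be approximated, which is the density of the trigonometric
  -- polynomials.
  obtain ⟨ρ, hρ⟩ := PartitionOfUnity.exists_isSubordinate (isClosed_univ (X := AddCircle T))
    (fun j : t => {w | ‖f w - f j‖ < ε / 2})
    (fun j => isOpen_lt ((f.continuous.sub continuous_const).norm) continuous_const)
    (fun z hz => by
      obtain ⟨j, hj, hz⟩ := mem_iUnion₂.1 (ht hz)
      exact mem_iUnion.2 ⟨⟨j, hj⟩, hz⟩)
  set δ : ℝ := ε / 2 / (∑ j : t, (‖f j‖ + 1) + 1) with hδ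
  have hδ0 : 0 < δ := by positivity
  choose K c hc hK using fun j : t => exists_trigSum_near
    (⟨fun z => ((ρ j z : ℝ) : ℂ), Complex.continuous_ofReal.comp (ρ j).continuous⟩ :
      C(AddCircle T, ℂ)) hδ0
  refine ⟨Finset.univ.sup K, fun k => ∑ j : t, c j k • f j,
    fun k => S.sum_mem fun j _ => S.smul_mem _ (hf j), fun z => ?_⟩
  have h1 : ‖f z - ∑ j : t, ρ j z • f j‖ ≤ ε / 2 := by
    have h2 := ρ.finsum_smul_mem_convex (mem_univ z) (g := fun j _ => f (j : AddCircle T))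
      (t := Metric.closedBall (f z) (ε / 2)) (fun j hj => by
        have : z ∈ {w | ‖f w - f j‖ < ε / 2} := hρ j (subset_tsupport _ hj)
        rw [mem_closedBall_iff_norm']
        exact this.le) (convex_closedBall _ _)
    rw [finsum_eq_sum_of_fintype, mem_closedBall_iff_norm'] at h2
    exact h2
  have h3 : ∑ k ∈ Finset.Icc (-(Finset.univ.sup K : ℕ) : ℤ) (Finset.univ.sup K : ℕ),
      fourier k z • ∑ j : t, c j k • f j
      = ∑ j : t, (∑ k ∈ Finset.Icc (-K j : ℤ) (K j), c j k * fourier k z) • f j := by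
    simp only [Finset.smul_sum, Finset.sum_smul]
    rw [Finset.sum_comm]
    refine Finset.sum_congr rfl fun j _ => ?_
    have hle : K j ≤ Finset.univ.sup K := Finset.le_sup (Finset.mem_univ j)
    symm
    refine (Finset.sum_subset (Finset.Icc_subset_Icc (by omega) (by omega)) fun k _ hk => ?_).trans
      (Finset.sum_congr rfl fun k _ => ?_)
    · rw [hc j k hk, zero_mul, zero_smul]
    · rw [smul_smul, mul_comm]
  rw [h3]
  have h4 : ‖∑ j : t, ρ j z • f j
      - ∑ j : t, (∑ k ∈ Finset.Icc (-K j : ℤ) (K j), c j k * fourier k z) • f j‖ ≤ ε / 2 := by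
    rw [← Finset.sum_sub_distrib]
    have h5 : ∀ j : t, ‖ρ j z • f j
        - (∑ k ∈ Finset.Icc (-K j : ℤ) (K j), c j k * fourier k z) • f j‖ ≤ δ * (‖f j‖ + 1) := by
      intro j
      rw [← Complex.coe_smul (ρ j z), ← sub_smul, norm_smul]
      exact mul_le_mul (hK j z) (by linarith) (norm_nonneg _) hδ0.le
    refine (norm_sum_le_of_le _ fun j _ => h5 j).trans ?_
    rw [← Finset.mul_sum, hδ, div_mul_eq_mul_div, div_le_iff₀ (by positivity)]
    nlinarith
  calc _ = ‖(f z - ∑ j : t, ρ j z • f j) + (∑ j : t, ρ j z • f j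
      - ∑ j : t, (∑ k ∈ Finset.Icc (-K j : ℤ) (K j), c j k * fourier k z) • f j)‖ := by
        congr 1; abel
    _ ≤ ε := (norm_add_le _ _).trans (by linarith)

end TrigApproximation

/-! ### Behaviour of the calculus under the flow along a Rokhlin sequence -/

section Transfer

/-- A uniformly Lipschitz sequence of additive maps that converges to `0` on every point of a compact
set converges to `0` uniformly on it. -/
theorem eventually_forall_mem_compact_norm_le {E G ι : Type*} [SeminormedAddCommGroup E]
    [SeminormedAddCommGroup G] {l : Filter ι} {K : Set E} (hK : IsCompact K) {C : ℝ} {Φ : ι → E → G}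
    (hΦ : ∀ i x y, ‖Φ i x - Φ i y‖ ≤ C * ‖x - y‖)
    (h : ∀ x ∈ K, Tendsto (fun i => Φ i x) l (𝓝 0)) {ε : ℝ} (hε : 0 < ε) :
    ∀ᶠ i in l, ∀ x ∈ K, ‖Φ i x‖ ≤ ε := by
  set δ : ℝ := ε / 2 / (|C| + 1) with hδ
  have hδ0 : 0 < δ := by positivity
  obtain ⟨t, htK, htfin, ht⟩ := hK.finite_cover_balls hδ0
  have h1 : ∀ᶠ i in l, ∀ x ∈ t, ‖Φ i x‖ < ε / 2 := by
    rw [Filter.eventually_all_finite htfin]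
    intro x hx
    have := (h x (htK hx)).norm
    rw [norm_zero] at this
    exact this.eventually_lt_const (half_pos hε)
  filter_upwards [h1] with i hi x hx
  obtain ⟨y, hy, hxy⟩ := mem_iUnion₂.1 (ht hx)
  rw [mem_ball_iff_norm] at hxy
  have h2 : ‖Φ i x - Φ i y‖ ≤ ε / 2 := by
    refine (hΦ i x y).trans ?_
    have h3 : δ * (|C| + 1) = ε / 2 := by rw [hδ]; field_simp
    nlinarith [le_abs_self C, norm_nonneg (x - y), abs_nonneg C]
  have := norm_le_norm_sub_add (Φ i x) (Φ i y)
  linarith [hi y hy]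

variable {E : Type*} [CStarAlgebra E]

/-- Telescoping. Only differences multiplied by b from the right are small, so b has to be moved
past the powers of y, and this uses the two commutator hypotheses. -/
theorem tendsto_starZPow_sub {ι : Type*} {l : Filter ι} {x y : ι → E} {M : ℝ}
    (hx : ∀ i, ‖x i‖ ≤ M) (hy : ∀ i, ‖y i‖ ≤ M) {b : E}
    (h1 : Tendsto (fun i => y i * b - b * y i) l (𝓝 0))
    (h2 : Tendsto (fun i => star (y i) * b - b * star (y i)) l (𝓝 0))
    (h3 : Tendsto (fun i => (x i - y i) * b) l (𝓝 0))
    (h4 : Tendsto (fun i => (star (x i) - star (y i)) * b) l (𝓝 0)) (k : ℤ) :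
    Tendsto (fun i => (starZPow (x i) k - starZPow (y i) k) * b) l (𝓝 0) := by
  have hp : ∀ v w : ι → E, (∀ i, ‖v i‖ ≤ M) → (∀ i, ‖w i‖ ≤ M) →
      Tendsto (fun i => w i * b - b * w i) l (𝓝 0) → Tendsto (fun i => (v i - w i) * b) l (𝓝 0) →
      ∀ n : ℕ, (∃ C : ℝ, ∀ i, ‖v i ^ n‖ ≤ C) ∧ (∃ C : ℝ, ∀ i, ‖v i ^ n - w i ^ n‖ ≤ C) ∧
        Tendsto (fun i => (v i ^ n - w i ^ n) * b) l (𝓝 0) := by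
    intro v w hv hw hwb hvw n
    have hb : ∀ v : ι → E, (∀ i, ‖v i‖ ≤ M) → ∀ n : ℕ, ∃ C : ℝ, ∀ i, ‖v i ^ n‖ ≤ C := by
      intro v hv n
      obtain ⟨C, hC⟩ := norm_starZPow_le hv n
      exact ⟨C, fun i => by simpa [starZPow] using hC i⟩
    have hb2 : ∀ n : ℕ, ∃ C : ℝ, ∀ i, ‖v i ^ n - w i ^ n‖ ≤ C := by
      intro n
      obtain ⟨C, hC⟩ := hb v hv n
      obtain ⟨D, hD⟩ := hb w hw n
      exact ⟨C + D, fun i => (norm_sub_le _ _).trans (add_le_add (hC i) (hD i))⟩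
    refine ⟨hb v hv n, hb2 n, ?_⟩
    induction n with
    | zero => simpa using tendsto_const_nhds
    | succ n ih =>
      obtain ⟨C, hC⟩ := hb v hv n
      obtain ⟨D, hD⟩ := hb2 n
      have := ((tendsto_bdd_mul_zero hC hvw).add (tendsto_bdd_mul_zero hD hwb)).add
        (tendsto_zero_mul_bdd hw ih)
      rw [add_zero, add_zero] at this
      refine this.congr fun i => ?_
      rw [pow_succ, pow_succ]
      noncomm_ring
  obtain ⟨⟨C, hC⟩, ⟨D, hD⟩, hn⟩ := hp x y hx hy h1 h3 k.toNat
  obtain ⟨⟨C', hC'⟩, ⟨D', hD'⟩, hn'⟩ := hp (fun i => star (x i)) (fun i => star (y i))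
    (fun i => by rw [norm_star]; exact hx i) (fun i => by rw [norm_star]; exact hy i) h2 h4 (-k).toNat
  have hcomm' : Tendsto (fun i => star (y i) ^ (-k).toNat * b - b * star (y i) ^ (-k).toNat) l
      (𝓝 0) := by
    induction (-k).toNat with
    | zero => simpa using tendsto_const_nhds
    | succ n ih =>
      obtain ⟨C, hC⟩ := norm_starZPow_le (u := fun i => star (y i)) (M := M)
        (fun i => by rw [norm_star]; exact hy i) n
      have := (tendsto_bdd_mul_zero (x := fun i => star (y i) ^ n)
        (fun i => by simpa [starZPow] using hC i) h2).add
        (tendsto_zero_mul_bdd (x := fun i => star (y i)) (M := M)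
          (fun i => by rw [norm_star]; exact hy i) ih)
      rw [add_zero] at this
      exact this.congr fun i => by rw [pow_succ]; noncomm_ring
  obtain ⟨B, hB⟩ := norm_starZPow_le (u := fun i => star (y i)) (M := M)
        (fun i => by rw [norm_star]; exact hy i) (-k).toNat
  have hB' : ∀ i, ‖star (y i) ^ (-k).toNat‖ ≤ B := by
    revert hB
    generalize (-k).toNat = n
    exact fun hB i => by simpa [starZPow] using hB i
  have := ((tendsto_bdd_mul_zero hC hn').add (tendsto_bdd_mul_zero hD hcomm')).add
    (tendsto_zero_mul_bdd hB' hn)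
  rw [add_zero, add_zero] at this
  refine this.congr fun i => ?_
  rw [starZPow, starZPow]
  noncomm_ring

theorem starZPow_smul_fourier {T : ℝ} (z : AddCircle T) (x : E) (k : ℤ) :
    starZPow ((fourier 1 z : ℂ) • x) k = (fourier k z : ℂ) • starZPow x k := by
  have hn : ∀ n : ℕ, (fourier 1 z : ℂ) ^ n = fourier (n : ℤ) z := by
    intro n
    induction n with
    | zero => simp
    | succ n ih => rw [pow_succ, ih, Nat.cast_succ, fourier_add]
  have hs : star (fourier 1 z : ℂ) = fourier (-1) z := by rw [fourier_neg]; rfl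
  have hn' : ∀ n : ℕ, (fourier (-1) z : ℂ) ^ n = fourier (-n : ℤ) z := by
    intro n
    rw [← hs, ← star_pow, hn, fourier_neg]; rfl
  rw [starZPow, starZPow, star_smul, smul_pow, smul_pow, hs, hn, hn', smul_mul_smul_comm, ← fourier_add]
  congr 2
  congr 1
  omega

variable {χ : E →⋆ₐ[ℂ] ℂ}

/-- A sequence in the kernel of `χ` that represents a unitary in the central sequence algebra of the
flow `α` on this kernel, with eigenvalue `e^{2πit/T}`. -/
structure AugFlow.IsRokhlinSeq (α : AugFlow χ) (T : ℝ) (u : ℕ → E) : Prop where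
  bdd : ∃ M : ℝ, ∀ n, ‖u n‖ ≤ M
  map_eq_zero : ∀ n, χ (u n) = 0
  mem_asympCommutant : ∀ a, χ a = 0 → a ∈ asympCommutant atTop u
  eigen : ∀ a, χ a = 0 → ∀ R ε : ℝ, 0 < ε → ∀ᶠ n in atTop, ∀ t ∈ Icc (-R) R,
    ‖(α.ext t (u n) - (fourier 1 (t : AddCircle T) : ℂ) • u n) * a‖ ≤ ε ∧
    ‖a * (α.ext t (u n) - (fourier 1 (t : AddCircle T) : ℂ) • u n)‖ ≤ ε

variable (α : AugFlow χ)

/-- The function `t ↦ α_t(x)` on `[-R, R]`. -/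
def AugFlow.orbit (R : ℝ) (x : E) : C(Icc (-R) R, E) :=
  ⟨fun t => α.ext t x, (α.continuous_ext x).comp continuous_subtype_val⟩

@[simp] theorem AugFlow.orbit_apply (R : ℝ) (x : E) (t : Icc (-R) R) : α.orbit R x t = α.ext t x := rfl

theorem norm_orbit_le (R : ℝ) (x : E) : ‖α.orbit R x‖ ≤ ‖x‖ := by
  rw [ContinuousMap.norm_le _ (norm_nonneg _)]
  intro t
  rw [AugFlow.orbit_apply, AugFlow.norm_ext]

variable {α}

/-- Pointwise membership suffices because b has compact range and the four defining expressions are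
Lipschitz in b uniformly along the sequence. -/
theorem const_mem_asympCommutant {u : ℕ → E} {M : ℝ} (hu : ∀ n, ‖u n‖ ≤ M) {I : Type*}
    [TopologicalSpace I] [CompactSpace I] {b : C(I, E)}
    (hb : ∀ t, b t ∈ asympCommutant atTop u) :
    b ∈ asympCommutant atTop fun n => ContinuousMap.const I (u n) := by
  have hK : IsCompact (range b) := isCompact_range b.continuous
  have key : ∀ {C : ℝ} {Φ : ℕ → E → E} {y : ℕ → C(I, E)},
      (∀ i x y, ‖Φ i x - Φ i y‖ ≤ C * ‖x - y‖) → (∀ t, Tendsto (fun i => Φ i (b t)) atTop (𝓝 0)) →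
      (∀ i t, y i t = Φ i (b t)) → Tendsto y atTop (𝓝 0) := by
    intro C Φ y h1 h2 h3
    rw [Metric.tendsto_nhds]
    intro ε hε
    have := eventually_forall_mem_compact_norm_le hK h1 (by rintro _ ⟨t, rfl⟩; exact h2 t) (half_pos hε)
    filter_upwards [this] with i hi
    rw [dist_zero_right]
    refine lt_of_le_of_lt ?_ (half_lt_self hε)
    rw [ContinuousMap.norm_le _ (half_pos hε).le]
    intro t
    rw [h3]
    exact hi _ ⟨t, rfl⟩
  have hM : 0 ≤ M := (norm_nonneg _).trans (hu 0)
  have hu' : ∀ n, ‖star (u n)‖ ≤ M := fun n => by rw [norm_star]; exact hu n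
  have hc : ∀ v : ℕ → E, (∀ n, ‖v n‖ ≤ M) → ∀ i x y,
      ‖(v i * x - x * v i) - (v i * y - y * v i)‖ ≤ (2 * M) * ‖x - y‖ := by
    intro v hv i x y
    rw [show (v i * x - x * v i) - (v i * y - y * v i) = v i * (x - y) - (x - y) * v i by
      noncomm_ring]
    refine (norm_sub_le _ _).trans ?_
    have h1 := norm_mul_le (v i) (x - y)
    have h2 := norm_mul_le (x - y) (v i)
    nlinarith [hv i, norm_nonneg (x - y)]
  have hc' : ∀ v w : ℕ → E, (∀ n, ‖v n‖ ≤ M) → (∀ n, ‖w n‖ ≤ M) → ∀ i x y,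
      ‖(v i * w i * x - x) - (v i * w i * y - y)‖ ≤ (M * M + 1) * ‖x - y‖ := by
    intro v w hv hw i x y
    rw [show (v i * w i * x - x) - (v i * w i * y - y) = v i * (w i * (x - y)) - (x - y) by
      noncomm_ring]
    refine (norm_sub_le _ _).trans ?_
    have h1 := norm_mul_le (v i) (w i * (x - y))
    have h2 := norm_mul_le (w i) (x - y)
    have h3 : ‖w i‖ * ‖x - y‖ ≤ M * ‖x - y‖ := by gcongr; exact hw i
    have h4 : ‖v i‖ * ‖w i * (x - y)‖ ≤ M * (M * ‖x - y‖) :=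
      mul_le_mul (hv i) (h2.trans h3) (norm_nonneg _) hM
    linarith
  refine ⟨key (hc u hu) (fun t => (hb t).1) fun i t => rfl,
    key (hc _ hu') (fun t => (hb t).2.1) fun i t => rfl,
    key (hc' _ _ hu' hu) (fun t => (hb t).2.2.1) fun i t => rfl,
    key (hc' _ _ hu hu') (fun t => (hb t).2.2.2) fun i t => rfl⟩

theorem tendsto_mul_of_forall_const {I : Type*} [TopologicalSpace I] [CompactSpace I]
    {d : ℕ → C(I, E)} {C : ℝ} (hd : ∀ n, ‖d n‖ ≤ C) {b : C(I, E)}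
    (h : ∀ t, Tendsto (fun n => d n * ContinuousMap.const I (b t)) atTop (𝓝 0)) :
    Tendsto (fun n => d n * b) atTop (𝓝 0) := by
  have hK : IsCompact (range b) := isCompact_range b.continuous
  rw [Metric.tendsto_nhds]
  intro ε hε
  have := eventually_forall_mem_compact_norm_le hK (C := C)
    (Φ := fun n x => d n * ContinuousMap.const I x) (fun n x y => by
      rw [← mul_sub]
      refine (norm_mul_le _ _).trans (mul_le_mul (hd n) ?_ (norm_nonneg _)
        ((norm_nonneg _).trans (hd n)))
      rw [ContinuousMap.norm_le _ (norm_nonneg _)]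
      exact fun t => le_rfl) (by rintro _ ⟨t, rfl⟩; exact h t) (half_pos hε)
  filter_upwards [this] with n hn
  rw [dist_zero_right]
  refine lt_of_le_of_lt ?_ (half_lt_self hε)
  rw [ContinuousMap.norm_le _ (half_pos hε).le]
  intro t
  exact (ContinuousMap.norm_coe_le_norm (d n * ContinuousMap.const I (b t)) t).trans
    (hn _ ⟨t, rfl⟩)

/-- The function `t ↦ e^{2πikt/T} f(t)`. -/
noncomputable def fourierTwist (T R : ℝ) (k : ℤ) (f : C(Icc (-R) R, E)) : C(Icc (-R) R, E) :=
  ⟨fun t => (fourier k ((t : ℝ) : AddCircle T) : ℂ) • f t,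
    ((fourier k).continuous.comp
      ((AddCircle.continuous_mk' T).comp continuous_subtype_val)).smul f.continuous⟩

theorem fourierTwist_apply (T R : ℝ) (k : ℤ) (f : C(Icc (-R) R, E)) (t : Icc (-R) R) :
    fourierTwist T R k f t = (fourier k ((t : ℝ) : AddCircle T) : ℂ) • f t := rfl

theorem norm_fourierTwist_le (T R : ℝ) (k : ℤ) (f : C(Icc (-R) R, E)) :
    ‖fourierTwist T R k f‖ ≤ ‖f‖ := by
  rw [ContinuousMap.norm_le _ (norm_nonneg _)]
  intro t
  rw [fourierTwist_apply, norm_smul, fourier_apply, Circle.norm_coe, one_mul]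
  exact f.norm_coe_le_norm t

theorem tendsto_fourierTwist {T R : ℝ} {k : ℤ} {f : ℕ → C(Icc (-R) R, E)}
    (hf : Tendsto f atTop (𝓝 0)) : Tendsto (fun n => fourierTwist T R k (f n)) atTop (𝓝 0) :=
  squeeze_zero_norm (fun n => norm_fourierTwist_le T R k (f n)) (by simpa using hf.norm)

theorem orbit_starZPow (R : ℝ) (x : E) (k : ℤ) :
    α.orbit R (starZPow x k) = starZPow (α.orbit R x) k := by
  ext t
  simp only [starZPow, AugFlow.orbit_apply, ContinuousMap.mul_apply, ContinuousMap.pow_apply,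
    ContinuousMap.star_apply, map_mul, map_pow, map_star]

theorem starZPow_apply {I : Type*} [TopologicalSpace I] [CompactSpace I] (f : C(I, E)) (k : ℤ)
    (t : I) : starZPow f k t = starZPow (f t) k := by
  simp only [starZPow, ContinuousMap.mul_apply, ContinuousMap.pow_apply, ContinuousMap.star_apply]

/-- α_t(u^k a) = α_t(u)^k α_t(a), and α_t(u) may be replaced by e^{2πit/T} u next to elements of the
ideal; the k-th power produces the k-th character. -/
theorem AugFlow.IsRokhlinSeq.tendsto_orbit {T R : ℝ} {u : ℕ → E} (hu : α.IsRokhlinSeq T u) {a : E}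
    (ha : χ a = 0) (k : ℤ) :
    Tendsto (fun n => α.orbit R (starZPow (u n) k * a) -
      starZPow (ContinuousMap.const _ (u n)) k * fourierTwist T R k (α.orbit R a)) atTop (𝓝 0) := by
  obtain ⟨M, hM⟩ := hu.bdd
  set b := α.orbit R a with hb
  have hM0 : 0 ≤ M := (norm_nonneg _).trans (hM 0)
  have hcM : ∀ n, ‖ContinuousMap.const (Icc (-R) R) (u n)‖ ≤ M := fun n =>
    (ContinuousMap.norm_le _ hM0).2 fun t => hM n
  have hb0 : ∀ t, χ (b t) = 0 := fun t => by rw [hb, orbit_apply, α.map_ext, ha]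
  have hmem := const_mem_asympCommutant (b := b) hM (fun t => hu.mem_asympCommutant _ (hb0 t))
  set y : ℕ → C(Icc (-R) R, E) := fun n => fourierTwist T R 1 (ContinuousMap.const _ (u n)) with hy
  have hyM : ∀ n, ‖y n‖ ≤ M := fun n => (norm_fourierTwist_le _ _ _ _).trans (hcM n)
  have hxM : ∀ n, ‖α.orbit R (u n)‖ ≤ M := fun n => (norm_orbit_le _ R _).trans (hM n)
  have hs : ∀ z : AddCircle T, star (fourier 1 z : ℂ) = fourier (-1) z := fun z => by
    rw [fourier_neg]; rfl
  have hd : ∀ n, ‖α.orbit R (u n) - y n‖ ≤ M + M := fun n =>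
    (norm_sub_le _ _).trans (add_le_add (hxM n) (hyM n))
  have hc : ∀ c, χ c = 0 → Tendsto (fun n => (α.orbit R (u n) - y n) * ContinuousMap.const _ c)
      atTop (𝓝 0) ∧ Tendsto (fun n => star (α.orbit R (u n) - y n) * ContinuousMap.const _ c)
      atTop (𝓝 0) := by
    intro c hc
    constructor <;> rw [Metric.tendsto_nhds] <;> intro ε hε
    · filter_upwards [hu.eigen c hc R (ε / 2) (half_pos hε)] with n hn
      rw [dist_zero_right]
      refine lt_of_le_of_lt ?_ (half_lt_self hε)
      rw [ContinuousMap.norm_le _ (half_pos hε).le]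
      exact fun t => (hn t t.2).1
    · filter_upwards [hu.eigen (star c) (by rw [map_star, hc, star_zero]) R (ε / 2)
        (half_pos hε)] with n hn
      rw [dist_zero_right]
      refine lt_of_le_of_lt ?_ (half_lt_self hε)
      rw [ContinuousMap.norm_le _ (half_pos hε).le]
      intro t
      have := (hn t t.2).2
      rw [← norm_star] at this
      rw [star_mul, star_star] at this
      exact this
  -- The eigenvalue relation is given next to one fixed element at a time; compactness of the orbit
  -- of a makes it uniform along b.
  have h3 := tendsto_mul_of_forall_const hd fun t => (hc _ (hb0 t)).1
  have h4 := tendsto_mul_of_forall_const (d := fun n => star (α.orbit R (u n) - y n))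
    (fun n => (norm_star _).le.trans (hd n)) fun t => (hc _ (hb0 t)).2
  have h1 : Tendsto (fun n => y n * b - b * y n) atTop (𝓝 0) := by
    refine (tendsto_fourierTwist (T := T) (k := 1) hmem.1).congr fun n => ?_
    ext t
    simp [hy, fourierTwist_apply, smul_sub]
  have h2 : Tendsto (fun n => star (y n) * b - b * star (y n)) atTop (𝓝 0) := by
    refine (tendsto_fourierTwist (T := T) (k := -1) hmem.2.1).congr fun n => ?_
    ext t
    simp [hy, fourierTwist_apply, smul_sub, star_smul, ← hs]
  have := tendsto_starZPow_sub hxM hyM h1 h2 h3 (by simpa only [star_sub] using h4) k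
  refine this.congr fun n => ?_
  have h5 : α.orbit R (starZPow (u n) k * a) = starZPow (α.orbit R (u n)) k * b := by
    rw [← orbit_starZPow]
    ext t
    simp [hb]
  rw [h5, sub_mul]
  congr 1
  ext t
  simp only [hy, ContinuousMap.mul_apply, starZPow_apply, fourierTwist_apply,
    ContinuousMap.const_apply, starZPow_smul_fourier, smul_mul_assoc, mul_smul_comm]

end Transfer

/-! ### Unitaries obtained by inserting a Rokhlin sequence into a loop -/

section TransferMain

/-- The iterated filter `lim_m lim_n` on pairs. -/
abbrev iterLim : Filter (ℕ × ℕ) := (atTop : Filter ℕ).curry atTop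

instance neBot_iterLim : iterLim.NeBot := by
  refine ⟨fun h => ?_⟩
  have h1 : ∀ᶠ p in iterLim, (fun _ : ℕ × ℕ => False) p := by rw [h]; exact eventually_bot
  rw [eventually_curry_iff] at h1
  obtain ⟨m, hm⟩ := h1.exists
  obtain ⟨n, hn⟩ := hm.exists
  exact hn

theorem tendsto_snd_iterLim : Tendsto Prod.snd iterLim atTop := by
  intro s hs
  rw [mem_map]
  change ∀ᶠ p in iterLim, p.2 ∈ s
  rw [eventually_curry_iff]
  exact Eventually.of_forall fun _ => hs

theorem IsTrigEval.comp {G : Type*} [CStarAlgebra G] {ι κ : Type*} {l : Filter ι} {l' : Filter κ}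
    {T : ℝ} {w : ι → G} {K : ℕ} {f : AddCircle T → G} {x : ι → G} (h : IsTrigEval l w K f x)
    {φ : κ → ι} (hφ : Tendsto φ l' l) :
    IsTrigEval l' (fun j => w (φ j)) K f (fun j => x (φ j)) := by
  obtain ⟨a, ha, hf, hx⟩ := h
  exact ⟨a, fun k => ⟨(ha k).1.comp hφ, (ha k).2.1.comp hφ, (ha k).2.2.1.comp hφ,
    (ha k).2.2.2.comp hφ⟩, hf, hx.comp hφ⟩

/-- The index m counts trigonometric approximations of f, the index n the Rokhlin sequence. The
functions g m and g m₀ are uniformly close, so the norm estimate makes their evaluations close for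
all large n; how large depends on m, which explains the iterated filter. -/
theorem represents_of_approx {G : Type*} [CStarAlgebra G] {T : ℝ} [Fact (0 < T)] {w : ℕ → G} {M : ℝ}
    (hw : ∀ n, ‖w n‖ ≤ M) {f : AddCircle T → G} {g : ℕ → AddCircle T → G} {K : ℕ → ℕ}
    {x : ℕ × ℕ → G} (h : ∀ m, IsTrigEval atTop w (K m) (g m) fun n => x (m, n))
    (hfg : ∀ m z, ‖f z - g m z‖ ≤ 1 / ((m : ℝ) + 1)) :
    Represents iterLim (fun p => w p.2) f x := by
  intro ε hε
  obtain ⟨m₀, hm₀⟩ := exists_nat_one_div_lt (show 0 < ε / 3 by positivity)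
  refine ⟨K m₀, g m₀, fun p => x (m₀, p.2), (h m₀).comp tendsto_snd_iterLim,
    fun z => (hfg m₀ z).trans (by linarith), ?_⟩
  rw [eventually_curry_iff]
  filter_upwards [eventually_ge_atTop m₀] with m hm
  have h1 : 1 / ((m : ℝ) + 1) ≤ ε / 3 := by
    refine le_trans ?_ hm₀.le
    gcongr
  have h2 := ((h m).represents.sub (h m₀).represents).eventually_norm_le hw (κ := ε / 3 + ε / 3)
    (fun z => by
      calc ‖g m z - g m₀ z‖ = ‖(f z - g m₀ z) - (f z - g m z)‖ := by congr 1; abel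
        _ ≤ _ := (norm_sub_le _ _).trans (by linarith [hfg m z, hfg m₀ z]))
    (show 0 < ε / 3 by positivity)
  filter_upwards [h2] with n hn
  linarith

/-- The inserted sequence acts as a unitary only on the ideal, so that constants outside the ideal,
such as 1, need not be representable. Unitarity of Z is therefore first expanded in powers of Z - 1.
-/
theorem tendsto_star_mul_self_of_represents {G : Type*} [CStarAlgebra G] {T : ℝ} [Fact (0 < T)]
    {ι : Type*} {l : Filter ι} {w x : ι → G} {M : ℝ} (hw : ∀ i, ‖w i‖ ≤ M) {Z : AddCircle T → G}
    (h : Represents l w (fun z => Z z - 1) x) (hZ : ∀ z, star (Z z) * Z z = 1) :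
    Tendsto (fun i => star (1 + x i) * (1 + x i) - 1) l (𝓝 0) := by
  have h1 := ((h.star hw).mul hw h).add ((h.star hw).add h)
  have h2 : (fun z : AddCircle T => star (Z z - 1) * (Z z - 1) + (star (Z z - 1) + (Z z - 1)))
      = fun _ => 0 := by
    funext z
    have h3 : star (Z z - 1) * (Z z - 1) + (star (Z z - 1) + (Z z - 1)) = star (Z z) * Z z - 1 := by
      rw [star_sub, star_one]
      noncomm_ring
    rw [h3, hZ, sub_self]
  rw [h2] at h1
  refine (h1.tendsto_zero hw).congr fun p => ?_
  rw [star_add, star_one]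
  noncomm_ring

theorem tendsto_mul_star_self_of_represents {G : Type*} [CStarAlgebra G] {T : ℝ} [Fact (0 < T)]
    {ι : Type*} {l : Filter ι} {w x : ι → G} {M : ℝ} (hw : ∀ i, ‖w i‖ ≤ M) {Z : AddCircle T → G}
    (h : Represents l w (fun z => Z z - 1) x) (hZ : ∀ z, Z z * star (Z z) = 1) :
    Tendsto (fun i => (1 + x i) * star (1 + x i) - 1) l (𝓝 0) := by
  have h1 := (h.mul hw (h.star hw)).add ((h.star hw).add h)
  have h2 : (fun z : AddCircle T => (Z z - 1) * star (Z z - 1) + (star (Z z - 1) + (Z z - 1)))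
      = fun _ => 0 := by
    funext z
    have h3 : (Z z - 1) * star (Z z - 1) + (star (Z z - 1) + (Z z - 1)) = Z z * star (Z z) - 1 := by
      rw [star_sub, star_one]
      noncomm_ring
    rw [h3, hZ, sub_self]
  rw [h2] at h1
  refine (h1.tendsto_zero hw).congr fun p => ?_
  rw [star_add, star_one]
  noncomm_ring

variable {E : Type*} [CStarAlgebra E] {χ : E →⋆ₐ[ℂ] ℂ} {α : AugFlow χ}

/-- The function `t ↦ α_t(Z(z + t))` on `[-R, R]`. -/
def AugFlow.translate (α : AugFlow χ) {T : ℝ} (R : ℝ) (Z : C(AddCircle T, E)) (z : AddCircle T) :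
    C(Icc (-R) R, E) :=
  ⟨fun t => α.ext t (Z (z + ((t : ℝ) : AddCircle T))),
    α.continuous_ext_comp continuous_subtype_val (Z.continuous.comp (continuous_const.add
      ((AddCircle.continuous_mk' T).comp continuous_subtype_val)))⟩

theorem AugFlow.translate_apply (α : AugFlow χ) {T : ℝ} (R : ℝ) (Z : C(AddCircle T, E))
    (z : AddCircle T) (t : Icc (-R) R) :
    α.translate R Z z t = α.ext t (Z (z + ((t : ℝ) : AddCircle T))) := rfl

theorem norm_constMap_le {I : Type*} [TopologicalSpace I] [CompactSpace I] (x : E) :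
    ‖ContinuousMap.const I x‖ ≤ ‖x‖ := (ContinuousMap.norm_le _ (norm_nonneg _)).2 fun _ => le_rfl

theorem tendsto_constMap {I : Type*} [TopologicalSpace I] [CompactSpace I] {ι : Type*} {l : Filter ι}
    {x : ι → E} (hx : Tendsto x l (𝓝 0)) :
    Tendsto (fun i => ContinuousMap.const I (x i)) l (𝓝 0) :=
  squeeze_zero_norm (fun _ => norm_constMap_le _) (by simpa using hx.norm)

theorem tendsto_orbit_zero (R : ℝ) {ι : Type*} {l : Filter ι}
    {x : ι → E} (hx : Tendsto x l (𝓝 0)) : Tendsto (fun i => α.orbit R (x i)) l (𝓝 0) :=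
  squeeze_zero_norm (fun _ => norm_orbit_le _ _ _) (by simpa using hx.norm)

theorem represents_const {T : ℝ} [Fact (0 < T)] {u : ℕ → E} {M : ℝ} (hM : ∀ n, ‖u n‖ ≤ M)
    {a : ℕ → ℤ → E} (ha : ∀ m k, a m k ∈ asympCommutant atTop u) {K : ℕ → ℕ} {f : AddCircle T → E}
    (h : ∀ m z, ‖f z - ∑ k ∈ Finset.Icc (-(K m) : ℤ) (K m), fourier k z • a m k‖
      ≤ 1 / ((m : ℝ) + 1))
    (I : Type*) [TopologicalSpace I] [CompactSpace I] :
    Represents iterLim (fun p => ContinuousMap.const I (u p.2)) (fun z => ContinuousMap.const I (f z))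
      fun p => ContinuousMap.const I
        (∑ k ∈ Finset.Icc (-(K p.1) : ℤ) (K p.1), starZPow (u p.2) k * a p.1 k) := by
  have hM' : ∀ n, ‖ContinuousMap.const I (u n)‖ ≤ M := fun n => (norm_constMap_le _).trans (hM n)
  have h1 : ∀ m, IsTrigEval atTop (fun n => ContinuousMap.const I (u n)) (K m)
      (fun z : AddCircle T => ∑ k ∈ Finset.Icc (-(K m) : ℤ) (K m),
        fourier k z • ContinuousMap.const I (a m k))
      fun n => ContinuousMap.const I
        (∑ k ∈ Finset.Icc (-(K m) : ℤ) (K m), starZPow (u n) k * a m k) := by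
    intro m
    refine ⟨fun k => ContinuousMap.const _ (a m k), fun k => const_mem_asympCommutant hM
      fun t => ha m k, fun z => rfl, ?_⟩
    refine tendsto_const_nhds.congr fun n => ?_
    rw [eq_comm, sub_eq_zero]
    ext t
    rw [ContinuousMap.const_apply, ContinuousMap.sum_apply]
    refine Finset.sum_congr rfl fun k _ => ?_
    rw [ContinuousMap.mul_apply, starZPow_apply, ContinuousMap.const_apply, ContinuousMap.const_apply]
  have h2 : ∀ (m : ℕ) (z : AddCircle T),
      ‖ContinuousMap.const I (f z) - ∑ k ∈ Finset.Icc (-(K m) : ℤ) (K m),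
        fourier k z • ContinuousMap.const I (a m k)‖ ≤ 1 / ((m : ℝ) + 1) := by
    intro m z
    rw [ContinuousMap.norm_le _ (by positivity)]
    intro t
    refine le_trans (le_of_eq ?_) (h m z)
    rw [ContinuousMap.sub_apply, ContinuousMap.sum_apply]
    rfl
  exact represents_of_approx hM' h1 h2

/-- Since α_t multiplies the inserted sequence by e^{2πit/T}, it translates the coordinate of the
circle by t; the twisted coefficients are those of the translated function. -/
theorem represents_orbit {T : ℝ} [Fact (0 < T)] {u : ℕ → E} (hu : α.IsRokhlinSeq T u) (R : ℝ)
    {a : ℕ → ℤ → E} (ha : ∀ m k, χ (a m k) = 0) {K : ℕ → ℕ} {f : C(AddCircle T, E)}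
    (h : ∀ m z, ‖f z - ∑ k ∈ Finset.Icc (-(K m) : ℤ) (K m), fourier k z • a m k‖
      ≤ 1 / ((m : ℝ) + 1)) :
    Represents iterLim (fun p => ContinuousMap.const (Icc (-R) R) (u p.2)) (α.translate R f)
      fun p => α.orbit R
        (∑ k ∈ Finset.Icc (-(K p.1) : ℤ) (K p.1), starZPow (u p.2) k * a p.1 k) := by
  obtain ⟨M, hM⟩ := hu.bdd
  have hM' : ∀ n, ‖ContinuousMap.const (Icc (-R) R) (u n)‖ ≤ M := fun n =>
    (norm_constMap_le _).trans (hM n)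
  have h1 : ∀ m, IsTrigEval atTop (fun n => ContinuousMap.const (Icc (-R) R) (u n)) (K m)
      (fun z : AddCircle T => ∑ k ∈ Finset.Icc (-(K m) : ℤ) (K m),
        fourier k z • fourierTwist T R k (α.orbit R (a m k)))
      fun n => α.orbit R
        (∑ k ∈ Finset.Icc (-(K m) : ℤ) (K m), starZPow (u n) k * a m k) := by
    intro m
    refine ⟨fun k => fourierTwist T R k (α.orbit R (a m k)), fun k => ?_, fun z => rfl, ?_⟩
    · refine const_mem_asympCommutant hM fun t => hu.mem_asympCommutant _ ?_
      rw [fourierTwist_apply, map_smul, AugFlow.orbit_apply, α.map_ext, ha, smul_zero]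
    · have := tendsto_finsetSum (Finset.Icc (-(K m) : ℤ) (K m)) fun k _ =>
        hu.tendsto_orbit (R := R) (ha m k) k
      rw [Finset.sum_const_zero] at this
      refine this.congr fun n => ?_
      rw [Finset.sum_sub_distrib]
      congr 1
      ext t
      rw [ContinuousMap.sum_apply, AugFlow.orbit_apply, map_sum]
      rfl
  have h2 : ∀ (m : ℕ) (z : AddCircle T),
      ‖α.translate R f z - ∑ k ∈ Finset.Icc (-(K m) : ℤ) (K m),
        fourier k z • fourierTwist T R k (α.orbit R (a m k))‖ ≤ 1 / ((m : ℝ) + 1) := by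
    intro m z
    rw [ContinuousMap.norm_le _ (by positivity)]
    intro t
    have := h m (z + ((t : ℝ) : AddCircle T))
    rw [← α.norm_ext t] at this
    refine le_trans (le_of_eq ?_) this
    rw [ContinuousMap.sub_apply, AugFlow.translate_apply, ContinuousMap.sum_apply, map_sub, map_sum]
    congr 2
    refine Finset.sum_congr rfl fun k _ => ?_
    rw [ContinuousMap.smul_apply, fourierTwist_apply, AugFlow.orbit_apply, map_smul, smul_smul]
    congr 1
    simp only [fourier_apply, smul_add, AddCircle.toCircle_add, Circle.coe_mul]
  exact represents_of_approx hM' h1 h2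

theorem exists_trigApprox {T : ℝ} [Fact (0 < T)] (f : C(AddCircle T, E)) (hf : ∀ z, χ (f z) = 0) :
    ∃ (K : ℕ → ℕ) (a : ℕ → ℤ → E), (∀ m k, χ (a m k) = 0) ∧ ∀ m z,
      ‖f z - ∑ k ∈ Finset.Icc (-(K m) : ℤ) (K m), fourier k z • a m k‖ ≤ 1 / ((m : ℝ) + 1) := by
  set S : Submodule ℂ E := LinearMap.ker (χ : E →ₐ[ℂ] ℂ).toLinearMap with hS
  have hSmem : ∀ x, x ∈ S ↔ χ x = 0 := fun x => Iff.rfl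
  have happ := fun m : ℕ => exists_trigSum_near_of_mem S f
    (fun z => (hSmem _).2 (hf z)) (ε := 1 / ((m : ℝ) + 1)) (by positivity)
  choose K a haS ha using happ
  exact ⟨K, a, fun m k => (hSmem _).1 (haS m k), ha⟩

/-- A total form of the polar decomposition: where it does not apply the value 1 is taken and
nothing is claimed. -/
theorem exists_augUnitary_near {x : E} (hx : χ x = 0) : ∃ v ∈ augUnitary χ,
    (‖star (1 + x) * (1 + x) - 1‖ ≤ 1 / 2 → ‖(1 + x) * star (1 + x) - 1‖ ≤ 1 / 2 →
      ‖v - (1 + x)‖ ≤ 4 * ‖star (1 + x) * (1 + x) - 1‖) := by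
  by_cases h : ‖star (1 + x) * (1 + x) - 1‖ ≤ 1 / 2 ∧ ‖(1 + x) * star (1 + x) - 1‖ ≤ 1 / 2
  · obtain ⟨v, hv, hvχ, hvg, -⟩ := exists_unitary_near h.1 h.2
    exact ⟨v, ⟨hv, hvχ χ (by rw [map_add, map_one, hx, add_zero])⟩, fun _ _ => hvg⟩
  · exact ⟨1, one_mem _, fun h1 h2 => absurd ⟨h1, h2⟩ h⟩

/-- Z - 1 takes values in the kernel of χ, hence so do the coefficients of its trigonometric
approximations. Their evaluations x make 1 + x asymptotically unitary, and polar decomposition makes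
it unitary at an asymptotically vanishing cost. -/
theorem exists_represents {T : ℝ} [Fact (0 < T)] {u : ℕ → E} (hu : α.IsRokhlinSeq T u) (R : ℝ)
    (Z : C(AddCircle T, E)) (hZ : ∀ z, Z z ∈ augUnitary χ) :
    ∃ V : ℕ × ℕ → E, (∀ p, V p ∈ augUnitary χ) ∧
      Represents iterLim (fun p => ContinuousMap.const (Icc (-R) R) (u p.2))
        (fun z => ContinuousMap.const (Icc (-R) R) (Z z - 1))
        (fun p => ContinuousMap.const (Icc (-R) R) (V p - 1)) ∧
      Represents iterLim (fun p => ContinuousMap.const (Icc (-R) R) (u p.2))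
        (fun z => α.translate R (Z - 1) z) (fun p => α.orbit R (V p - 1)) := by
  obtain ⟨M, hM⟩ := hu.bdd
  have hM' : ∀ p : ℕ × ℕ, ‖u p.2‖ ≤ M := fun p => hM p.2
  obtain ⟨K, a, ha0, ha⟩ := exists_trigApprox (χ := χ) (Z - 1) fun z => by
    rw [ContinuousMap.sub_apply, ContinuousMap.one_apply, map_sub, (hZ z).2, map_one, sub_self]
  have haJ : ∀ m k, a m k ∈ asympCommutant atTop u := fun m k => hu.mem_asympCommutant _ (ha0 m k)
  obtain ⟨x, hx⟩ : ∃ x : ℕ × ℕ → E, x = fun p => ∑ k ∈ Finset.Icc (-(K p.1) : ℤ) (K p.1),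
    starZPow (u p.2) k * a p.1 k := ⟨_, rfl⟩
  have hCr : Represents iterLim (fun p => ContinuousMap.const (Icc (-R) R) (u p.2))
      (fun z => ContinuousMap.const (Icc (-R) R) (Z z - 1))
      (fun p => ContinuousMap.const (Icc (-R) R) (x p)) := by
    rw [hx]; exact represents_const hM haJ ha (Icc (-R) R)
  have hOr : Represents iterLim (fun p => ContinuousMap.const (Icc (-R) R) (u p.2))
      (fun z => α.translate R (Z - 1) z) (fun p => α.orbit R (x p)) := by
    rw [hx]; exact represents_orbit hu R ha0 ha
  have hEr : Represents iterLim (fun p => u p.2) (fun z => Z z - 1) x := by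
    rw [hx]
    exact represents_of_approx hM (K := K)
      (fun m => ⟨a m, haJ m, fun z => rfl, by simp⟩) ha
  have hx0 : ∀ p, χ (x p) = 0 := fun p => by
    rw [hx]
    simp only [map_sum, map_mul, ha0, mul_zero, Finset.sum_const_zero]
  have hg1 := tendsto_star_mul_self_of_represents hM' hEr fun z => augUnitary.star_mul_self (hZ z)
  have hg2 := tendsto_mul_star_self_of_represents hM' hEr fun z => augUnitary.mul_star_self (hZ z)
  choose V hVmem hVg using fun p => exists_augUnitary_near (hx0 p)
  have hVx : Tendsto (fun p => x p - (V p - 1)) iterLim (𝓝 0) := by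
    have h1 := hg1.norm
    have h2 := hg2.norm
    rw [norm_zero] at h1 h2
    refine squeeze_zero_norm' (a := fun p => 4 * ‖star (1 + x p) * (1 + x p) - 1‖) ?_
      (by simpa using h1.const_mul 4)
    filter_upwards [h1.eventually_le_const (show (0 : ℝ) < 1 / 2 by norm_num),
      h2.eventually_le_const (show (0 : ℝ) < 1 / 2 by norm_num)] with p hp1 hp2
    refine le_trans (le_of_eq ?_) (hVg p hp1 hp2)
    rw [norm_sub_rev]
    congr 1
    abel
  refine ⟨V, hVmem, hCr.congr_eval ?_, hOr.congr_eval ?_⟩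
  · exact tendsto_constMap hVx
  · refine (tendsto_orbit_zero (α := α) R hVx).congr fun p => ?_
    ext t
    simp

end TransferMain

/-! ### Transfer of estimates from a loop to a single unitary -/

section TransferReal

variable {E : Type*} [CStarAlgebra E] {χ : E →⋆ₐ[ℂ] ℂ} {α : AugFlow χ}

theorem Represents.eventually_forall_norm_le {T R : ℝ} [Fact (0 < T)] (hR : 0 ≤ R) {ι : Type*}
    {l : Filter ι} {w x : ι → C(Icc (-R) R, E)} {M : ℝ} (hw : ∀ i, ‖w i‖ ≤ M)
    {f : AddCircle T → C(Icc (-R) R, E)} (h : Represents l w f x) {κ : ℝ}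
    (hf : ∀ z t, ‖f z t‖ ≤ κ) {ε : ℝ} (hε : 0 < ε) : ∀ᶠ i in l, ∀ t, ‖x i t‖ ≤ κ + ε := by
  have hκ : 0 ≤ κ := (norm_nonneg _).trans (hf 0 ⟨0, by constructor <;> linarith⟩)
  filter_upwards [h.eventually_norm_le hw (fun z => (ContinuousMap.norm_le _ hκ).2 (hf z)) hε]
    with i hi t
  exact ((x i).norm_coe_le_norm t).trans hi

/-- Each estimate concerns a polynomial in Z - 1, its translates under the flow, and fixed functions
with values in the ideal. The same polynomial in V - 1 and its orbit represents it, so that a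
uniform bound over the circle passes to V. Every expression is arranged so as to lie in the ideal.
-/
theorem exists_transfer_circle {T : ℝ} [Fact (0 < T)] {u : ℕ → E} (hu : α.IsRokhlinSeq T u) {R : ℝ}
    (hR : 0 ≤ R) (Z : C(AddCircle T, E)) (hZ : ∀ z, Z z ∈ augUnitary χ) {D : AddCircle T → ℝ → E}
    (hD : ∀ z t, D z t = Z z * α.ext t (star (Z (z + (t : AddCircle T))))) :
    ∃ V : ℕ × ℕ → E, (∀ p, V p ∈ augUnitary χ) ∧
      (∀ a κ ε, χ a = 0 → 0 < ε → (∀ z, ‖Z z * a - a * Z z‖ ≤ κ) →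
        ∀ᶠ p in iterLim, ‖V p * a - a * V p‖ ≤ κ + ε) ∧
      (∀ b c : C(Icc (-R) R, E), ∀ κ ε, (∀ t, χ (b t) = 0) → (∀ t, χ (c t) = 0) → 0 < ε →
        (∀ z, ∀ t : Icc (-R) R, ‖D z t * b t * star (D z t) - c t‖ ≤ κ) →
        ∀ᶠ p in iterLim, ∀ t : Icc (-R) R,
          ‖α.coboundary (V p) t * b t * star (α.coboundary (V p) t) - c t‖ ≤ κ + ε) ∧
      (∀ m b : C(Icc (-R) R, E), ∀ κ ε, (∀ t, χ (m t) = 1) → (∀ t, χ (b t) = 0) → 0 < ε →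
        (∀ z, ∀ t : Icc (-R) R, ‖(D z t - m t) * b t‖ ≤ κ) →
        ∀ᶠ p in iterLim, ∀ t : Icc (-R) R, ‖(α.coboundary (V p) t - m t) * b t‖ ≤ κ + ε) ∧
      (∀ m : C(Icc (-R) R, E), ∀ κ ε, (∀ t, χ (m t) = 1) → 0 < ε →
        (∀ z, ∀ t : Icc (-R) R, ‖D z t - m t‖ ≤ κ) →
        ∀ᶠ p in iterLim, ∀ t : Icc (-R) R, ‖α.coboundary (V p) t - m t‖ ≤ κ + ε) := by
  obtain ⟨M, hM⟩ := hu.bdd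
  have hw : ∀ p : ℕ × ℕ, ‖ContinuousMap.const (Icc (-R) R) (u p.2)‖ ≤ M := fun p =>
    (norm_constMap_le _).trans (hM _)
  have hJ : ∀ b : C(Icc (-R) R, E), (∀ t, χ (b t) = 0) →
      b ∈ asympCommutant iterLim fun p : ℕ × ℕ => ContinuousMap.const (Icc (-R) R) (u p.2) := by
    intro b hb
    have := const_mem_asympCommutant hM fun t => hu.mem_asympCommutant _ (hb t)
    exact ⟨this.1.comp tendsto_snd_iterLim, this.2.1.comp tendsto_snd_iterLim,
      this.2.2.1.comp tendsto_snd_iterLim, this.2.2.2.comp tendsto_snd_iterLim⟩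
  obtain ⟨V, hV, hC, hO⟩ := exists_represents hu R Z hZ
  refine ⟨V, hV, ?_⟩
  -- With a = Z(z) - 1 and b = α_t(Z(z + t)) - 1 the coboundary minus 1 is a + b^* + a b^*.
  have hW := (hC.add (hO.star hw)).add (hC.mul hw (hO.star hw))
  obtain ⟨f, hf⟩ : ∃ f : AddCircle T → C(Icc (-R) R, E), f = fun z =>
    ContinuousMap.const (Icc (-R) R) (Z z - 1) + star (α.translate R (Z - 1) z) +
      ContinuousMap.const (Icc (-R) R) (Z z - 1) * star (α.translate R (Z - 1) z) := ⟨_, rfl⟩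
  obtain ⟨x, hx⟩ : ∃ x : ℕ × ℕ → C(Icc (-R) R, E), x = fun p =>
    ContinuousMap.const (Icc (-R) R) (V p - 1) + star (α.orbit R (V p - 1)) +
      ContinuousMap.const (Icc (-R) R) (V p - 1) * star (α.orbit R (V p - 1)) := ⟨_, rfl⟩
  rw [← hf, ← hx] at hW
  have hft : ∀ z t, f z t = D z t - 1 := by
    intro z t
    rw [hf, hD]
    simp only [ContinuousMap.add_apply, ContinuousMap.mul_apply, ContinuousMap.star_apply,
      ContinuousMap.const_apply, AugFlow.translate_apply, ContinuousMap.sub_apply,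
      ContinuousMap.one_apply, map_sub, map_one, star_sub, star_one, map_star]
    noncomm_ring
  have hxt : ∀ p t, x p t = α.coboundary (V p) t - 1 := by
    intro p t
    rw [hx]
    simp only [ContinuousMap.add_apply, ContinuousMap.mul_apply, ContinuousMap.star_apply,
      ContinuousMap.const_apply, AugFlow.orbit_apply, AugFlow.coboundary,
      map_sub, map_one, star_sub, star_one, map_star]
    noncomm_ring
  clear hf hx hO
  refine ⟨fun a κ ε ha hε h => ?_, fun b c κ ε hb hc hε h => ?_, fun m b κ ε hm hb hε h => ?_,
    fun m κ ε hm hε h => ?_⟩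
  · have ha' := Represents.const (T := T) (hJ (ContinuousMap.const _ a) fun t => ha)
    have h1 := ((hC.mul hw ha').sub (ha'.mul hw hC)).eventually_forall_norm_le hR hw (κ := κ)
      (fun z t => by
        refine le_trans (le_of_eq ?_) (h z)
        simp only [ContinuousMap.sub_apply, ContinuousMap.mul_apply, ContinuousMap.const_apply]
        congr 1
        noncomm_ring) hε
    filter_upwards [h1] with p hp
    refine le_trans (le_of_eq ?_) (hp ⟨0, by constructor <;> linarith⟩)
    simp only [ContinuousMap.sub_apply, ContinuousMap.mul_apply, ContinuousMap.const_apply]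
    congr 1
    noncomm_ring
  · have hb' := Represents.const (T := T) (hJ b hb)
    have hbc := Represents.const (T := T) (hJ (b - c) fun t => by
      rw [ContinuousMap.sub_apply, map_sub, hb, hc, sub_zero])
    have hs := hW.star hw
    have h1 := (((hbc.add (hW.mul hw hb')).add (hb'.mul hw hs)).add
      ((hW.mul hw hb').mul hw hs)).eventually_forall_norm_le hR hw (κ := κ) (fun z t => by
        refine le_trans (le_of_eq ?_) (h z t)
        simp only [ContinuousMap.sub_apply, ContinuousMap.add_apply, ContinuousMap.mul_apply,
          ContinuousMap.star_apply, hft, star_sub, star_one]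
        congr 1
        noncomm_ring) hε
    filter_upwards [h1] with p hp t
    refine le_trans (le_of_eq ?_) (hp t)
    simp only [ContinuousMap.sub_apply, ContinuousMap.add_apply, ContinuousMap.mul_apply,
      ContinuousMap.star_apply, hxt, star_sub, star_one]
    congr 1
    noncomm_ring
  · have hb' := Represents.const (T := T) (hJ b hb)
    have hmb := Represents.const (T := T) (hJ ((1 - m) * b) fun t => by
      rw [ContinuousMap.mul_apply, map_mul, hb, mul_zero])
    have h1 := ((hW.mul hw hb').add hmb).eventually_forall_norm_le hR hw (κ := κ) (fun z t => by
        refine le_trans (le_of_eq ?_) (h z t)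
        simp only [ContinuousMap.sub_apply, ContinuousMap.add_apply, ContinuousMap.mul_apply,
          ContinuousMap.one_apply, hft]
        congr 1
        noncomm_ring) hε
    filter_upwards [h1] with p hp t
    refine le_trans (le_of_eq ?_) (hp t)
    simp only [ContinuousMap.sub_apply, ContinuousMap.add_apply, ContinuousMap.mul_apply,
      ContinuousMap.one_apply, hxt]
    congr 1
    noncomm_ring
  · have hm' := Represents.const (T := T) (hJ (1 - m) fun t => by
      rw [ContinuousMap.sub_apply, map_sub, hm, ContinuousMap.one_apply, map_one, sub_self])
    have h1 := (hW.add hm').eventually_forall_norm_le hR hw (κ := κ) (fun z t => by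
        refine le_trans (le_of_eq ?_) (h z t)
        simp only [ContinuousMap.sub_apply, ContinuousMap.add_apply, 
          ContinuousMap.one_apply, hft]
        congr 1
        noncomm_ring) hε
    filter_upwards [h1] with p hp t
    refine le_trans (le_of_eq ?_) (hp t)
    simp only [ContinuousMap.sub_apply, ContinuousMap.add_apply, 
      ContinuousMap.one_apply, hxt]
    congr 1
    noncomm_ring

/-- Transfer along a Rokhlin sequence: a path of unitaries `Z` which is `T`-periodic near the ends of
`[R, R + T]` can be replaced by a single unitary. -/
theorem exists_transfer {T : ℝ} {u : ℕ → E} (hu : α.IsRokhlinSeq T u) {R : ℝ}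
    (hR : 0 ≤ R) (hRT : R < T) {Z : ℝ → E} (hZc : Continuous Z) (hZ : ∀ q, Z q ∈ augUnitary χ)
    (hper : ∀ q ∈ Icc 0 (2 * R), Z (q + T) = Z q) {D : ℝ → ℝ → E}
    (hD : ∀ q t, D q t = Z q * α.ext t (star (Z (q - t)))) :
    ∃ V : ℕ × ℕ → E, (∀ p, V p ∈ augUnitary χ) ∧
      (∀ a κ ε, χ a = 0 → 0 < ε → (∀ q ∈ Icc R (R + T), ‖Z q * a - a * Z q‖ ≤ κ) →
        ∀ᶠ p in iterLim, ‖V p * a - a * V p‖ ≤ κ + ε) ∧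
      (∀ b c : ℝ → E, ∀ κ ε, Continuous b → Continuous c → (∀ t, χ (b t) = 0) → (∀ t, χ (c t) = 0) →
        0 < ε → (∀ q ∈ Icc R (R + T), ∀ t ∈ Icc (-R) R, ‖D q t * b t * star (D q t) - c t‖ ≤ κ) →
        ∀ᶠ p in iterLim, ∀ t ∈ Icc (-R) R,
          ‖α.coboundary (V p) t * b t * star (α.coboundary (V p) t) - c t‖ ≤ κ + ε) ∧
      (∀ m b : ℝ → E, ∀ κ ε, Continuous m → Continuous b → (∀ t, χ (m t) = 1) → (∀ t, χ (b t) = 0) →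
        0 < ε → (∀ q ∈ Icc R (R + T), ∀ t ∈ Icc (-R) R, ‖(D q t - m t) * b t‖ ≤ κ) →
        ∀ᶠ p in iterLim, ∀ t ∈ Icc (-R) R, ‖(α.coboundary (V p) t - m t) * b t‖ ≤ κ + ε) ∧
      (∀ m : ℝ → E, ∀ κ ε, Continuous m → (∀ t, χ (m t) = 1) → 0 < ε →
        (∀ q ∈ Icc R (R + T), ∀ t ∈ Icc (-R) R, ‖D q t - m t‖ ≤ κ) →
        ∀ᶠ p in iterLim, ∀ t ∈ Icc (-R) R, ‖α.coboundary (V p) t - m t‖ ≤ κ + ε) := by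
  have : Fact (0 < T) := ⟨hR.trans_lt hRT⟩
  have hRp : Z R = Z (R + T) := (hper R ⟨hR, by linarith⟩).symm
  -- The fundamental domain is [R, R + T]. As |t| ≤ R, the points q - t run through [0, 2R + T],
  -- which is why periodicity is required on [0, 2R].
  set L : AddCircle T → E := AddCircle.liftIco T R Z with hL
  have hLc : Continuous L := AddCircle.liftIco_continuous hRp hZc.continuousOn
  have hL1 : ∀ q ∈ Icc R (R + T), L (q : AddCircle T) = Z q := by
    intro q hq
    rcases hq.2.lt_or_eq with h | h
    · exact AddCircle.liftIco_coe_apply ⟨hq.1, h⟩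
    · rw [h, AddCircle.coe_add_period, ← hRp]
      exact AddCircle.liftIco_coe_apply ⟨le_rfl, by linarith⟩
  have hL2 : ∀ q ∈ Icc R (R + T), ∀ t ∈ Icc (-R) R, L ((q - t : ℝ) : AddCircle T) = Z (q - t) := by
    rintro q ⟨hq1, hq2⟩ t ⟨ht1, ht2⟩
    rcases lt_or_ge (q - t) R with h | h
    · rw [← AddCircle.coe_add_period, hL1 _ ⟨by linarith, by linarith⟩, hper _ ⟨by linarith, by linarith⟩]
    rcases le_or_gt (q - t) (R + T) with h' | h'
    · exact hL1 _ ⟨h, h'⟩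
    · have h1 := hper (q - t - T) ⟨by linarith, by linarith⟩
      rw [sub_add_cancel] at h1
      rw [h1, ← hL1 _ ⟨by linarith, by linarith⟩, AddCircle.coe_sub, AddCircle.coe_sub,
        AddCircle.coe_sub, AddCircle.coe_period, sub_zero]
  have hrep : ∀ z : AddCircle T, ∃ q ∈ Icc R (R + T), z = -(q : AddCircle T) := by
    intro z
    refine ⟨AddCircle.equivIco T R (-z), Ico_subset_Icc_self (AddCircle.equivIco T R (-z)).2, ?_⟩
    rw [AddCircle.coe_equivIco, neg_neg]
  -- The circle is reversed: the flow translates the coordinate by t, whereas here Z at q is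
  -- compared with Z at q - t.
  obtain ⟨V, hV, h1, h2, h3, h4⟩ := exists_transfer_circle hu hR
    ⟨fun z => L (-z), hLc.comp continuous_neg⟩ (fun z => by
      obtain ⟨q, hq, rfl⟩ := hrep z
      rw [ContinuousMap.coe_mk, neg_neg, hL1 q hq]
      exact hZ q) (fun z t => rfl)
  have hDz : ∀ q ∈ Icc R (R + T), ∀ t ∈ Icc (-R) R,
      L (-(-(q : AddCircle T))) * α.ext t (star (L (-(-(q : AddCircle T) + (t : AddCircle T))))) = D q t := by
    intro q hq t ht
    rw [neg_neg, hL1 q hq, hD, ← hL2 q hq t ht, AddCircle.coe_sub]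
    congr 4
    abel
  refine ⟨V, hV, fun a κ ε ha hε h => ?_, fun b c κ ε hbc hcc hb hc hε h => ?_,
    fun m b κ ε hmc hbc hm hb hε h => ?_, fun m κ ε hmc hm hε h => ?_⟩
  · refine h1 a κ ε ha hε fun z => ?_
    obtain ⟨q, hq, rfl⟩ := hrep z
    rw [ContinuousMap.coe_mk, neg_neg, hL1 q hq]
    exact h q hq
  · filter_upwards [h2 ⟨fun t => b t, hbc.comp continuous_subtype_val⟩
      ⟨fun t => c t, hcc.comp continuous_subtype_val⟩ κ ε (fun t => hb t) (fun t => hc t) hε fun z t => by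
        obtain ⟨q, hq, rfl⟩ := hrep z
        simp only [ContinuousMap.coe_mk]
        rw [hDz q hq t t.2]
        exact h q hq t t.2] with p hp t ht
    exact hp ⟨t, ht⟩
  · filter_upwards [h3 ⟨fun t => m t, hmc.comp continuous_subtype_val⟩
      ⟨fun t => b t, hbc.comp continuous_subtype_val⟩ κ ε (fun t => hm t) (fun t => hb t) hε fun z t => by
        obtain ⟨q, hq, rfl⟩ := hrep z
        simp only [ContinuousMap.coe_mk]
        rw [hDz q hq t t.2]
        exact h q hq t t.2] with p hp t ht
    exact hp ⟨t, ht⟩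
  · filter_upwards [h4 ⟨fun t => m t, hmc.comp continuous_subtype_val⟩
      κ ε (fun t => hm t) hε fun z t => by
        obtain ⟨q, hq, rfl⟩ := hrep z
        simp only [ContinuousMap.coe_mk]
        rw [hDz q hq t t.2]
        exact h q hq t t.2] with p hp t ht
    exact hp ⟨t, ht⟩

end TransferReal

/-! ### Reparametrization of rectifiable paths -/

section Reparam

/-- Every path of length at most `C` can be reparametrized so that it is, up to `ε`, Lipschitz with
constant `C + ε`. -/
theorem exists_reparam {X : Type*} [PseudoMetricSpace X] {v : ℝ → X} (hv : Continuous v) {C : ℝ}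
    (hC : 0 ≤ C) (hvC : eVariationOn v (Icc 0 1) ≤ ENNReal.ofReal C) {ε : ℝ} (hε : 0 < ε) :
    ∃ φ : ℝ → ℝ, Continuous φ ∧ φ 0 = 0 ∧ φ 1 = 1 ∧ (∀ t ∈ Icc (0 : ℝ) 1, φ t ∈ Icc (0 : ℝ) 1) ∧
      ∀ t ∈ Icc (0 : ℝ) 1, ∀ t' ∈ Icc (0 : ℝ) 1,
        dist (v (φ t)) (v (φ t')) ≤ ε + (C + ε) * |t - t'| := by
  have huc : UniformContinuousOn v (Icc 0 1) :=
    isCompact_Icc.uniformContinuousOn_of_continuous hv.continuousOn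
  rw [Metric.uniformContinuousOn_iff] at huc
  obtain ⟨δ, hδ0, hδ⟩ := huc (ε / 2) (half_pos hε)
  obtain ⟨M', hM'⟩ := exists_nat_one_div_lt hδ0
  set M : ℕ := M' + 1 with hM
  have hM0 : (0 : ℝ) < M := by rw [hM]; positivity
  have hMδ : 1 / (M : ℝ) < δ := by rw [hM]; exact_mod_cast hM'
  set f : ℕ → X := fun i => v (i / M) with hf
  -- The partition points are frozen at 1 after index M, so that the sequence is monotone on all of
  -- ℕ as the definition of the variation demands.
  have hmono : Monotone fun i : ℕ => (min (i : ℝ) M) / M := fun i j hij => by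
    have : (i : ℝ) ≤ j := Nat.cast_le.2 hij
    dsimp only
    gcongr
  have hsum : ∑ i ∈ Finset.range M, dist (f i) (f (i + 1)) ≤ C := by
    have h1 := eVariationOn.sum_le (f := v) (s := Icc 0 1) (u := fun i : ℕ => (min (i : ℝ) M) / M) (n := M)
      hmono (fun i => ⟨by positivity, by rw [div_le_one hM0]; exact min_le_right _ _⟩)
    have h2 := h1.trans hvC
    have h3 : ∑ i ∈ Finset.range M, edist (v ((min ((i + 1 : ℕ) : ℝ) M) / M)) (v ((min (i : ℝ) M) / M))
        = ENNReal.ofReal (∑ i ∈ Finset.range M, dist (f i) (f (i + 1))) := by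
      rw [ENNReal.ofReal_sum_of_nonneg fun _ _ => dist_nonneg]
      refine Finset.sum_congr rfl fun i hi => ?_
      have hi' : i + 1 ≤ M := Finset.mem_range.1 hi
      have hi1 : ((i + 1 : ℕ) : ℝ) ≤ M := Nat.cast_le.2 hi'
      have hi2 : (i : ℝ) ≤ M := Nat.cast_le.2 (by omega)
      rw [min_eq_left hi1, min_eq_left hi2, edist_dist, dist_comm]
    rw [h3] at h2
    exact (ENNReal.ofReal_le_ofReal_iff hC).1 h2
  set κ : ℝ → ℝ := fun x => max 0 (min x 1) with hκ
  have hκm : Monotone κ := fun x y h => by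
    simp only [hκ]
    gcongr
  have hκc : Continuous κ := by fun_prop
  -- Up to ετ, this is the length of the inscribed polygon with nodes i/M, interpolated linearly by
  -- the clamp κ. The term ετ makes g strictly increasing; the reparametrization is the inverse of
  -- g, rescaled to [0, 1].
  set g : ℝ → ℝ := fun τ => ε * τ + ∑ i ∈ Finset.range M, dist (f i) (f (i + 1)) * κ (M * τ - i) with hg
  have hgc : Continuous g := by
    simp only [hg]
    fun_prop
  have hsm : ∀ x y, x ≤ y → ∀ s ⊆ Finset.range M, ε * (y - x) +
      ∑ i ∈ s, dist (f i) (f (i + 1)) * (κ (M * y - i) - κ (M * x - i)) ≤ g y - g x := by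
    intro x y hxy s hs
    have h0 : ∀ i : ℕ, 0 ≤ κ (M * y - i) - κ (M * x - i) := fun i =>
      sub_nonneg.2 (hκm (by gcongr))
    have h1 : ∑ i ∈ s, dist (f i) (f (i + 1)) * (κ (M * y - i) - κ (M * x - i)) ≤
        ∑ i ∈ Finset.range M, dist (f i) (f (i + 1)) * (κ (M * y - i) - κ (M * x - i)) :=
      Finset.sum_le_sum_of_subset_of_nonneg hs fun i _ _ => mul_nonneg dist_nonneg (h0 i)
    have h2 : g y - g x = ε * (y - x) +
        ∑ i ∈ Finset.range M, dist (f i) (f (i + 1)) * (κ (M * y - i) - κ (M * x - i)) := by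
      simp only [hg, mul_sub, Finset.sum_sub_distrib]
      ring
    linarith
  have hgs : StrictMono g := fun x y hxy => by
    have h1 := hsm x y hxy.le ∅ (Finset.empty_subset _)
    rw [Finset.sum_empty] at h1
    have : 0 < ε * (y - x) := mul_pos hε (sub_pos.2 hxy)
    linarith
  have hg0 : g 0 = 0 := by
    simp only [hg, mul_zero, zero_sub, zero_add]
    refine Finset.sum_eq_zero fun i _ => ?_
    have : κ (-i) = 0 := by
      simp only [hκ]
      rw [max_eq_left]
      exact (min_le_left _ _).trans (neg_nonpos.2 (Nat.cast_nonneg i))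
    rw [this, mul_zero]
  have hg1 : g 1 ≤ C + ε := by
    have h1 : ∑ i ∈ Finset.range M, dist (f i) (f (i + 1)) * κ (M * 1 - i) ≤
        ∑ i ∈ Finset.range M, dist (f i) (f (i + 1)) := by
      refine Finset.sum_le_sum fun i _ => mul_le_of_le_one_right dist_nonneg ?_
      exact max_le zero_le_one (min_le_right _ _)
    simp only [hg]
    linarith
  have hg1' : 0 < g 1 := by rw [← hg0]; exact hgs zero_lt_one
  have hest : ∀ x ∈ Icc (0 : ℝ) 1, ∀ y ∈ Icc (0 : ℝ) 1, x ≤ y → dist (v x) (v y) ≤ ε + (g y - g x) := by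
    rintro x ⟨hx0, hx1⟩ y ⟨hy0, hy1⟩ hxy
    have hgxy : 0 ≤ g y - g x := sub_nonneg.2 (hgs.monotone hxy)
    set i := ⌊(M : ℝ) * x⌋₊ with hi
    set j := ⌊(M : ℝ) * y⌋₊ with hj
    have hi1 : (i : ℝ) ≤ M * x := Nat.floor_le (by positivity)
    have hi2 : M * x < i + 1 := Nat.lt_floor_add_one _
    have hj1 : (j : ℝ) ≤ M * y := Nat.floor_le (by positivity)
    have hj2 : M * y < j + 1 := Nat.lt_floor_add_one _
    have hij : i ≤ j := Nat.floor_mono (by gcongr)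
    have hjM : j ≤ M := by
      have : (j : ℝ) ≤ M := hj1.trans (mul_le_of_le_one_right hM0.le hy1)
      exact_mod_cast this
    have hMc : (M : ℝ) * (1 / M) = 1 := by field_simp
    -- Within one cell uniform continuity is enough. Otherwise x and y are moved to the nodes i + 1
    -- and j at a cost of ε/2 each, and the polygon between these nodes is controlled by g.
    rcases hij.eq_or_lt with h | h
    · have : dist (v x) (v y) < ε / 2 := by
        refine hδ x ⟨hx0, hx1⟩ y ⟨hy0, hy1⟩ ?_
        refine lt_trans ?_ hMδ
        rw [dist_comm, Real.dist_eq, abs_of_nonneg (sub_nonneg.2 hxy)]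
        have : (i : ℝ) = j := by rw [h]
        nlinarith
      linarith
    · have hjM' : (j : ℝ) ≤ M := Nat.cast_le.2 hjM
      have hij' : ((i + 1 : ℕ) : ℝ) ≤ j := Nat.cast_le.2 h
      have e1 : dist (v x) (f (i + 1)) < ε / 2 := by
        refine hδ x ⟨hx0, hx1⟩ _ ⟨by positivity, by rw [div_le_one hM0]; linarith⟩ ?_
        refine lt_of_le_of_lt ?_ hMδ
        have h3 : x ≤ ((i + 1 : ℕ) : ℝ) / M := by
          rw [le_div_iff₀ hM0]; push_cast; linarith
        rw [dist_comm, Real.dist_eq, abs_of_nonneg (sub_nonneg.2 h3), sub_le_iff_le_add,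
          div_le_iff₀ hM0, add_mul, div_mul_cancel₀ _ hM0.ne']
        push_cast; linarith
      have e2 : dist (f j) (v y) < ε / 2 := by
        refine hδ _ ⟨by positivity, by rw [div_le_one hM0]; linarith⟩ y ⟨hy0, hy1⟩ ?_
        refine lt_of_le_of_lt ?_ hMδ
        have h3 : (j : ℝ) / M ≤ y := by
          rw [div_le_iff₀ hM0]; linarith
        rw [dist_comm, Real.dist_eq, abs_of_nonneg (sub_nonneg.2 h3), sub_le_iff_le_add, ← add_div,
          le_div_iff₀ hM0]
        linarith
      have e3 := dist_le_Ico_sum_dist f (Nat.succ_le_of_lt h)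
      have e4 := hsm x y hxy (Finset.Ico (i + 1) j) (fun k hk => by
        rw [Finset.mem_Ico] at hk
        rw [Finset.mem_range]
        omega)
      have e5 : ∑ k ∈ Finset.Ico (i + 1) j, dist (f k) (f (k + 1)) * (κ (M * y - k) - κ (M * x - k))
          = ∑ k ∈ Finset.Ico (i + 1) j, dist (f k) (f (k + 1)) := by
        refine Finset.sum_congr rfl fun k hk => ?_
        rw [Finset.mem_Ico] at hk
        have hk1 : ((i + 1 : ℕ) : ℝ) ≤ k := Nat.cast_le.2 hk.1
        have hk2 : ((k + 1 : ℕ) : ℝ) ≤ j := Nat.cast_le.2 hk.2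
        push_cast at hk1 hk2
        have f1 : κ (M * y - k) = 1 := by
          simp only [hκ]
          rw [min_eq_right (by linarith), max_eq_right zero_le_one]
        have f2 : κ (M * x - k) = 0 := by
          simp only [hκ]
          rw [max_eq_left]
          exact (min_le_left _ _).trans (by linarith)
        rw [f1, f2, sub_zero, mul_one]
      rw [e5] at e4
      have e6 : 0 ≤ ε * (y - x) := mul_nonneg hε.le (sub_nonneg.2 hxy)
      have := dist_triangle4 (v x) (f (i + 1)) (f j) (v y)
      change dist (f (i + 1)) (f j) ≤ _ at e3
      linarith
  have hgsurj : Function.Surjective g := by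
    refine hgc.surjective ?_ ?_
    · refine tendsto_atTop_mono' atTop (f₁ := fun x => ε * x) ?_ (tendsto_id.const_mul_atTop hε)
      filter_upwards [eventually_ge_atTop 0] with x hx
      have := hsm 0 x hx ∅ (Finset.empty_subset _)
      rw [hg0, Finset.sum_empty] at this
      linarith
    · refine tendsto_atBot_mono' atBot (f₂ := g) (f₁ := fun x => ε * x) ?_
        (tendsto_id.const_mul_atBot hε)
      filter_upwards [eventually_le_atBot 0] with x hx
      have := hsm x 0 hx ∅ (Finset.empty_subset _)
      rw [hg0, Finset.sum_empty] at this
      linarith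
  set e : ℝ ≃o ℝ := hgs.orderIsoOfSurjective g hgsurj with he
  have hee : ∀ t, g (e.symm t) = t := fun t => e.apply_symm_apply t
  have hmem : ∀ t ∈ Icc (0 : ℝ) 1, e.symm (g 1 * t) ∈ Icc (0 : ℝ) 1 := by
    rintro t ⟨h0, h1⟩
    constructor
    · rw [← hgs.le_iff_le, hee, hg0]; positivity
    · rw [← hgs.le_iff_le, hee]; exact mul_le_of_le_one_right hg1'.le h1
  have hmain : ∀ t ∈ Icc (0 : ℝ) 1, ∀ t' ∈ Icc (0 : ℝ) 1, t ≤ t' →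
      dist (v (e.symm (g 1 * t))) (v (e.symm (g 1 * t'))) ≤ ε + (C + ε) * |t - t'| := by
    intro t ht t' ht' h
    refine (hest _ (hmem t ht) _ (hmem t' ht') (e.symm.monotone (by gcongr))).trans ?_
    rw [hee, hee, ← mul_sub, abs_sub_comm, abs_of_nonneg (sub_nonneg.2 h)]
    gcongr
  refine ⟨fun t => e.symm (g 1 * t), e.symm.continuous.comp (continuous_const.mul continuous_id),
    hgs.injective ?_, hgs.injective ?_, hmem, fun t ht t' ht' => ?_⟩
  · rw [hee, mul_zero, hg0]
  · rw [hee, mul_one]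
  · rcases le_total t t' with h | h
    · exact hmain t ht t' ht' h
    · rw [dist_comm, abs_sub_comm]
      exact hmain t' ht' t ht h

end Reparam

/-! ### Slow paths from finite weak inner length and finite central length -/

section CentralPaths

theorem IsCompact.exists_finset_net {E : Type*} [SeminormedAddCommGroup E] {K : Set E}
    (hK : IsCompact K) {ε : ℝ} (hε : 0 < ε) :
    ∃ F : Finset E, (∀ a ∈ F, a ∈ K) ∧ ∀ a ∈ K, ∃ b ∈ F, ‖a - b‖ ≤ ε := by
  obtain ⟨t, htK, htfin, ht⟩ := hK.finite_cover_balls hε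
  refine ⟨htfin.toFinset, fun a ha => htK (htfin.mem_toFinset.1 ha), fun a ha => ?_⟩
  obtain ⟨y, hy, hxy⟩ := mem_iUnion₂.1 (ht ha)
  rw [mem_ball_iff_norm] at hxy
  exact ⟨y, htfin.mem_toFinset.2 hy, hxy.le⟩

variable {E : Type*} [CStarAlgebra E]

/-- A norm continuous path of unitaries in `1 + ker χ`. -/
structure IsUnitaryPath (χ : E →⋆ₐ[ℂ] ℂ) (u : ℝ → E) : Prop where
  continuous : Continuous u
  mem : ∀ q, u q ∈ augUnitary χ

/-- All unitaries in the path component of `1` have weak inner length at most `L`. -/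
def HasWeakInnerLength (χ : E →⋆ₐ[ℂ] ℂ) (L : ℝ) : Prop :=
  ∀ γ, IsUnitaryPath χ γ → γ 0 = 1 → ∀ F : Finset E, (∀ a ∈ F, χ a = 0 ∧ ‖a‖ ≤ 1) →
    ∀ ε : ℝ, 0 < ε → ∃ v, IsUnitaryPath χ v ∧ (∀ q ≤ 0, v q = 1) ∧ (∀ q, 1 ≤ q → v q = γ 1) ∧
      ∀ a ∈ F, ∀ s t, ‖star (v s) * a * v s - star (v t) * a * v t‖ ≤ ε + L * |s - t|

/-- Approximately central paths can be replaced by approximately central paths that are approximately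
Lipschitz with constant `C`, in the strict topology or, if `N` holds, in norm. -/
def HasCentralLength (χ : E →⋆ₐ[ℂ] ℂ) (N : Prop) (C : ℝ) : Prop :=
  ∀ ε : ℝ, 0 < ε → ∀ F : Finset E, (∀ a ∈ F, χ a = 0 ∧ ‖a‖ ≤ 1) →
    ∃ δ : ℝ, 0 < δ ∧ ∃ G : Finset E, (∀ a ∈ G, χ a = 0) ∧
      ∀ u, IsUnitaryPath χ u → u 0 = 1 → (∀ a ∈ G, ∀ t ∈ Icc (0 : ℝ) 1, ‖u t * a - a * u t‖ ≤ δ) →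
        ∃ v, IsUnitaryPath χ v ∧ (∀ q ≤ 0, v q = 1) ∧ (∀ q, 1 ≤ q → v q = u 1) ∧
          (∀ a ∈ F, ∀ t, ‖v t * a - a * v t‖ ≤ ε) ∧
          (∀ a ∈ F, ∀ s t, ‖a * (v s - v t)‖ ≤ ε + C * |s - t|) ∧
          (N → ∀ s t, ‖v s - v t‖ ≤ ε + C * |s - t|)

variable {χ : E →⋆ₐ[ℂ] ℂ}

theorem IsUnitaryPath.comp {u : ℝ → E} (hu : IsUnitaryPath χ u) {f : ℝ → ℝ} (hf : Continuous f) :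
    IsUnitaryPath χ fun q => u (f q) := ⟨hu.continuous.comp hf, fun _ => hu.mem _⟩

theorem norm_sub_le_two {v w : E} (hv : v ∈ augUnitary χ) (hw : w ∈ augUnitary χ) : ‖v - w‖ ≤ 2 :=
  (norm_sub_le _ _).trans
    (by linarith [augUnitary.norm_le_one hv, augUnitary.norm_le_one hw])

theorem norm_star_conj_sub_star_conj_le {v w a b : E} (hv : v ∈ augUnitary χ)
    (hw : w ∈ augUnitary χ) : ‖star v * a * v - star w * a * w‖ ≤
      ‖star v * b * v - star w * b * w‖ + 2 * ‖a - b‖ := by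
  have h1 : star v * a * v - star w * a * w = (star v * b * v - star w * b * w) +
      star v * (a - b) * v - star w * (a - b) * w := by noncomm_ring
  rw [h1]
  refine (norm_sub_le _ _).trans ?_
  rw [augUnitary.norm_star_conj hw]
  have := norm_add_le (star v * b * v - star w * b * w) (star v * (a - b) * v)
  rw [augUnitary.norm_star_conj hv] at this
  linarith

theorem norm_commutator_le_add {v a b : E} (hv : v ∈ augUnitary χ) :
    ‖v * a - a * v‖ ≤ ‖v * b - b * v‖ + 2 * ‖a - b‖ := by
  have h1 : v * a - a * v = (v * b - b * v) + v * (a - b) - (a - b) * v := by noncomm_ring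
  rw [h1]
  refine (norm_sub_le _ _).trans ?_
  rw [augUnitary.norm_mul_right hv]
  have := norm_add_le (v * b - b * v) (v * (a - b))
  rw [augUnitary.norm_mul_left hv] at this
  linarith

theorem norm_smul_inv_le_one {B : ℝ} (hB : 0 < B) {a : E} (ha : ‖a‖ ≤ B) :
    ‖((B : ℂ)⁻¹) • a‖ ≤ 1 := by
  rw [norm_smul, norm_inv, Complex.norm_real, Real.norm_eq_abs, abs_of_pos hB,
    inv_mul_le_iff₀ hB, mul_one]
  exact ha

theorem norm_smul_inv_mul {B : ℝ} (hB : 0 < B) (x : E) : B * ‖((B : ℂ)⁻¹) • x‖ = ‖x‖ := by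
  rw [norm_smul, norm_inv, Complex.norm_real, Real.norm_eq_abs, abs_of_pos hB]
  field_simp

/-- Stretching a path from [0, 1] to [0, S] divides its Lipschitz constant by S. The threshold for S
depends on K only through the norm bound B, so that S can be fixed before K; this matters because
the compact set it is applied to depends on the period, hence on S. -/
theorem HasWeakInnerLength.exists_path {L : ℝ} (hL : HasWeakInnerLength χ L) (hL0 : 0 ≤ L)
    {R B ε : ℝ} (hε : 0 < ε) :
    ∃ S₀ : ℝ, ∀ S, S₀ ≤ S → 0 < S → ∀ K : Set E, IsCompact K → (∀ a ∈ K, χ a = 0 ∧ ‖a‖ ≤ B) →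
      ∀ γ, IsUnitaryPath χ γ → γ 0 = 1 → ∃ y, IsUnitaryPath χ y ∧ (∀ q ≤ 0, y q = 1) ∧
        (∀ q, S ≤ q → y q = γ 1) ∧ ∀ a ∈ K, ∀ s t, |s - t| ≤ R →
          ‖star (y s) * a * y s - star (y t) * a * y t‖ ≤ ε := by
  set B' : ℝ := |B| + 1 with hB'
  have hB0 : 0 < B' := by positivity
  have hBB : B ≤ B' := (le_abs_self B).trans (by linarith)
  refine ⟨4 * B' * L * R / ε, fun S hS hS0 K hK hKB γ hγ hγ0 => ?_⟩
  classical
  obtain ⟨F, hFK, hF⟩ := hK.exists_finset_net (show 0 < ε / 4 by positivity)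
  obtain ⟨v, hv, hv0, hv1, hvF⟩ := hL γ hγ hγ0 (F.image fun a => ((B' : ℂ)⁻¹) • a) (by
    intro a ha
    obtain ⟨b, hb, rfl⟩ := Finset.mem_image.1 ha
    exact ⟨by rw [map_smul, (hKB b (hFK b hb)).1, smul_zero],
      norm_smul_inv_le_one hB0 ((hKB b (hFK b hb)).2.trans hBB)⟩) (ε / (4 * B')) (by positivity)
  refine ⟨fun q => v (q / S), hv.comp (by fun_prop), fun q hq => hv0 _ (div_nonpos_of_nonpos_of_nonneg hq hS0.le),
    fun q hq => hv1 _ ((one_le_div hS0).2 hq), fun a ha s t hst => ?_⟩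
  obtain ⟨b, hb, hab⟩ := hF a ha
  have h1 := hvF _ (Finset.mem_image_of_mem _ hb) (s / S) (t / S)
  have h2 : star (v (s / S)) * (((B' : ℂ)⁻¹) • b) * v (s / S) -
      star (v (t / S)) * (((B' : ℂ)⁻¹) • b) * v (t / S)
      = ((B' : ℂ)⁻¹) • (star (v (s / S)) * b * v (s / S) - star (v (t / S)) * b * v (t / S)) := by
    simp only [mul_smul_comm, smul_mul_assoc, smul_sub]
  rw [h2] at h1
  have h3 := mul_le_mul_of_nonneg_left h1 hB0.le
  rw [norm_smul_inv_mul hB0] at h3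
  refine (norm_star_conj_sub_star_conj_le (b := b) (hv.mem _) (hv.mem _)).trans ?_
  have h4 : |s / S - t / S| ≤ R / S := by
    rw [← sub_div, abs_div, abs_of_pos hS0]
    gcongr
  have h5 : B' * (ε / (4 * B') + L * |s / S - t / S|) ≤ ε / 4 + ε / 4 := by
    have h6 : B' * (ε / (4 * B')) = ε / 4 := by field_simp
    have h7 : B' * (L * |s / S - t / S|) ≤ B' * (L * (R / S)) := by gcongr
    have h8 : B' * (L * (R / S)) ≤ ε / 4 := by
      rw [div_le_iff₀ hε] at hS
      rw [show B' * (L * (R / S)) = B' * L * R / S by ring, div_le_iff₀ hS0]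
      linarith
    rw [mul_add, h6]
    linarith
  linarith

/-- Again a matter of stretching; S depends on K only through B, and only δ and G are chosen after
K. -/
theorem HasCentralLength.exists_path {N : Prop} {C : ℝ} (hC : HasCentralLength χ N C) (hC0 : 0 ≤ C)
    {R B ε : ℝ} (hR : 0 ≤ R) (hε : 0 < ε) :
    ∃ S : ℝ, 0 < S ∧ ∀ K : Set E, IsCompact K → (∀ a ∈ K, χ a = 0 ∧ ‖a‖ ≤ B) →
      ∃ δ : ℝ, 0 < δ ∧ ∃ G : Finset E, (∀ a ∈ G, χ a = 0) ∧
      ∀ u, IsUnitaryPath χ u → u 0 = 1 → (∀ a ∈ G, ∀ t ∈ Icc (0 : ℝ) 1, ‖u t * a - a * u t‖ ≤ δ) →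
        ∃ y, IsUnitaryPath χ y ∧ (∀ q ≤ 0, y q = 1) ∧ (∀ q, S ≤ q → y q = u 1) ∧
          (∀ a ∈ K, ∀ q, ‖y q * a - a * y q‖ ≤ ε) ∧
          (∀ a ∈ K, ∀ s t, |s - t| ≤ R → ‖(y s - y t) * a‖ ≤ ε) ∧
          (N → ∀ s t, |s - t| ≤ R → ‖y s - y t‖ ≤ ε) := by
  set B' : ℝ := |B| + 1 with hB'
  have hB0 : 0 < B' := by positivity
  have hB1 : 1 ≤ B' := by rw [hB']; linarith [abs_nonneg B]
  have hBB : B ≤ B' := (le_abs_self B).trans (by linarith)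
  set S : ℝ := 4 * B' * C * R / ε + 1 with hS
  have hS0 : 0 < S := by positivity
  have hSe : C * (R / S) * B' ≤ ε / 4 := by
    have h1 : S * ε = 4 * B' * C * R + ε := by rw [hS]; field_simp
    rw [show C * (R / S) * B' = B' * C * R / S by ring, div_le_iff₀ hS0]
    linarith
  refine ⟨S, hS0, fun K hK hKB => ?_⟩
  classical
  obtain ⟨F, hFK, hF⟩ := hK.exists_finset_net (show 0 < ε / 8 by positivity)
  obtain ⟨δ, hδ, G, hG, hGu⟩ := hC (ε / (8 * B')) (by positivity)
    (F.image fun a => ((B' : ℂ)⁻¹) • a) (by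
    intro a ha
    obtain ⟨b, hb, rfl⟩ := Finset.mem_image.1 ha
    exact ⟨by rw [map_smul, (hKB b (hFK b hb)).1, smul_zero],
      norm_smul_inv_le_one hB0 ((hKB b (hFK b hb)).2.trans hBB)⟩)
  refine ⟨δ, hδ, G, hG, fun u hu hu0 huG => ?_⟩
  obtain ⟨v, hv, hv0, hv1, hvc, hvF, hvN⟩ := hGu u hu hu0 huG
  have hB8 : B' * (ε / (8 * B')) = ε / 8 := by field_simp
  have hcomm : ∀ b ∈ F, ∀ t, ‖v t * b - b * v t‖ ≤ ε / 8 := by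
    intro b hb t
    have h1 := hvc _ (Finset.mem_image_of_mem _ hb) t
    rw [mul_smul_comm, smul_mul_assoc, ← smul_sub] at h1
    have h3 := mul_le_mul_of_nonneg_left h1 hB0.le
    rwa [norm_smul_inv_mul hB0, hB8] at h3
  have hRS : ∀ s t : ℝ, |s - t| ≤ R → |s / S - t / S| ≤ R / S := by
    intro s t hst
    rw [← sub_div, abs_div, abs_of_pos hS0]
    gcongr
  refine ⟨fun q => v (q / S), hv.comp (by fun_prop),
    fun q hq => hv0 _ (div_nonpos_of_nonpos_of_nonneg hq hS0.le),
    fun q hq => hv1 _ ((one_le_div hS0).2 hq), fun a ha q => ?_, fun a ha s t hst => ?_,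
    fun hN s t hst => ?_⟩
  · obtain ⟨b, hb, hab⟩ := hF a ha
    refine (norm_commutator_le_add (b := b) (hv.mem _)).trans ?_
    linarith [hcomm b hb (q / S)]
  · obtain ⟨b, hb, hab⟩ := hF a ha
    have h1 := hvF _ (Finset.mem_image_of_mem _ hb) (s / S) (t / S)
    rw [smul_mul_assoc] at h1
    have h3 := mul_le_mul_of_nonneg_left h1 hB0.le
    rw [norm_smul_inv_mul hB0, mul_add, hB8] at h3
    have h4 : B' * (C * |s / S - t / S|) ≤ ε / 4 := by
      refine le_trans ?_ hSe
      rw [mul_comm]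
      gcongr
      exact hRS s t hst
    -- The Lipschitz hypothesis concerns multiplication by b from the left; approximate centrality
    -- carries it to the right.
    have h5 : (v (s / S) - v (t / S)) * a = (v (s / S) - v (t / S)) * (a - b) +
        (b * (v (s / S) - v (t / S)) + (v (s / S) * b - b * v (s / S)) -
          (v (t / S) * b - b * v (t / S))) := by noncomm_ring
    have h6 : ‖(v (s / S) - v (t / S)) * (a - b)‖ ≤ 2 * (ε / 8) :=
      (norm_mul_le _ _).trans (mul_le_mul (norm_sub_le_two (hv.mem _) (hv.mem _)) hab (norm_nonneg _)
        zero_le_two)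
    have h7 := norm_add_le ((v (s / S) - v (t / S)) * (a - b))
        (b * (v (s / S) - v (t / S)) + (v (s / S) * b - b * v (s / S)) -
          (v (t / S) * b - b * v (t / S)))
    have h8 := norm_sub_le (b * (v (s / S) - v (t / S)) + (v (s / S) * b - b * v (s / S)))
          (v (t / S) * b - b * v (t / S))
    have h9 := norm_add_le (b * (v (s / S) - v (t / S))) (v (s / S) * b - b * v (s / S))
    dsimp only
    rw [h5]
    linarith [hcomm b hb (s / S), hcomm b hb (t / S)]
  · refine (hvN hN _ _).trans ?_
    have h1 : ε / (8 * B') ≤ ε / 8 := by gcongr; linarith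
    have h2 : C * |s / S - t / S| ≤ C * (R / S) := by gcongr; exact hRS s t hst
    have h3 : C * (R / S) ≤ C * (R / S) * B' := le_mul_of_one_le_right (by positivity) hB1
    linarith

end CentralPaths

/-! ### Approximate conjugacy of flows and approximate vanishing of cohomology -/

section Existence

variable {E : Type*} [CStarAlgebra E] {χ : E →⋆ₐ[ℂ] ℂ} {α β : AugFlow χ}

/-- The restriction of the flow to the kernel of `χ` is a Rokhlin flow. -/
def AugFlow.HasRokhlin (α : AugFlow χ) : Prop := ∀ T : ℝ, 0 < T → ∃ u, α.IsRokhlinSeq T u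

/-- The restricted coactions of `α` and `β` are approximately unitarily equivalent. -/
def AugFlow.CoactionEquiv (α β : AugFlow χ) : Prop :=
  ∀ K : Set E, IsCompact K → (∀ a ∈ K, χ a = 0) → ∀ ε : ℝ, 0 < ε →
    ∃ u, IsUnitaryPath χ u ∧ u 0 = 1 ∧ ∀ s ∈ Icc (0 : ℝ) 1, ∀ a ∈ K,
      ‖u s * α.ext s a * star (u s) - β.ext s a‖ ≤ ε

theorem norm_conj_mul_sub_le {u v x y z : E} (hu : u ∈ augUnitary χ) :
    ‖(u * v) * x * star (u * v) - z‖ ≤ ‖v * x * star v - y‖ + ‖u * y * star u - z‖ := by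
  have h1 : (u * v) * x * star (u * v) - z = u * (v * x * star v - y) * star u +
      (u * y * star u - z) := by
    rw [star_mul]
    noncomm_ring
  rw [h1]
  refine (norm_add_le _ _).trans ?_
  rw [augUnitary.norm_conj hu]

theorem norm_conj_sub_le_add {u x y z w : E} (hu : u ∈ augUnitary χ) :
    ‖u * x * star u - z‖ ≤ ‖u * y * star u - w‖ + ‖x - y‖ + ‖z - w‖ := by
  have h1 : u * x * star u - z = (u * y * star u - w) + u * (x - y) * star u - (z - w) := by
    noncomm_ring
  rw [h1]
  refine (norm_sub_le _ _).trans ?_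
  have := norm_add_le (u * y * star u - w) (u * (x - y) * star u)
  rw [augUnitary.norm_conj hu] at this
  linarith

theorem AugFlow.CoactionEquiv.symm (h : α.CoactionEquiv β) : β.CoactionEquiv α := by
  intro K hK hK0 ε hε
  obtain ⟨u, hu, hu0, huK⟩ := h K hK hK0 ε hε
  refine ⟨fun s => star (u s), ⟨hu.continuous.star, fun q => augUnitary.star_mem (hu.mem q)⟩,
    by simp only [hu0, star_one], fun s hs a ha => ?_⟩
  refine le_trans (le_of_eq ?_) (huK s hs a ha)
  have h1 : star (u s) * β.ext s a * star (star (u s)) - α.ext s a =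
      star (u s) * (β.ext s a - u s * α.ext s a * star (u s)) * star (star (u s)) := by
    rw [star_star, mul_sub, sub_mul]
    congr 1
    rw [mul_assoc (u s), augUnitary.star_mul_cancel (hu.mem s), mul_assoc,
      augUnitary.star_mul_self (hu.mem s), mul_one]
  rw [h1, augUnitary.norm_conj (augUnitary.star_mem (hu.mem s)), norm_sub_rev]

/-- The approximate cocycle on `[0, n]` that is determined by a path on `[0, 1]`. -/
def AugFlow.iterate (α : AugFlow χ) (u : ℝ → E) : ℕ → ℝ → E
  | 0 => fun _ => 1
  | n + 1 => fun q => α.iterate u n (max (q - 1) 0) * α.ext (max (q - 1) 0) (u (max 0 (min q 1)))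

theorem AugFlow.iterate_succ (u : ℝ → E) (n : ℕ) (q : ℝ) : α.iterate u (n + 1) q =
    α.iterate u n (max (q - 1) 0) * α.ext (max (q - 1) 0) (u (max 0 (min q 1))) := rfl

theorem AugFlow.isUnitaryPath_iterate {u : ℝ → E} (hu : IsUnitaryPath χ u) (n : ℕ) :
    IsUnitaryPath χ (α.iterate u n) := by
  induction n with
  | zero => exact ⟨continuous_const, fun _ => one_mem _⟩
  | succ n ih =>
    refine ⟨?_, fun q => mul_mem (ih.mem _) (α.ext_mem _ (hu.mem _))⟩
    refine (ih.continuous.comp ?_).mul (α.continuous_ext_comp ?_ (hu.continuous.comp ?_)) <;> fun_prop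

theorem AugFlow.iterate_zero {u : ℝ → E} (hu0 : u 0 = 1) (n : ℕ) : α.iterate u n 0 = 1 := by
  induction n with
  | zero => rfl
  | succ n ih => simp [iterate, ih, hu0]

/-- Successive iterates extend one another. The recursion, which lowers the index n, thereby becomes
a cocycle relation for a fixed n. -/
theorem AugFlow.iterate_succ_eq {u : ℝ → E} (hu0 : u 0 = 1) (n : ℕ) :
    ∀ q ∈ Icc (0 : ℝ) n, α.iterate u (n + 1) q = α.iterate u n q := by
  induction n with
  | zero =>
    rintro q ⟨h0, h1⟩
    have : q = 0 := le_antisymm (by simpa using h1) h0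
    rw [this, iterate_zero hu0, iterate_zero hu0]
  | succ n ih =>
    rintro q ⟨h0, h1⟩
    push_cast at h1
    rw [iterate_succ, ih (max (q - 1) 0) ⟨le_max_right _ _, max_le (by linarith) (Nat.cast_nonneg n)⟩]
    rfl

theorem AugFlow.iterate_add_one {u : ℝ → E} (hu0 : u 0 = 1) {n : ℕ} {q : ℝ} (h0 : 0 ≤ q)
    (h1 : q + 1 ≤ n) : α.iterate u n (q + 1) = α.iterate u n q * α.ext q (u 1) := by
  obtain ⟨m, rfl⟩ : ∃ m, n = m + 1 := by
    rcases n with _ | m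
    · rw [Nat.cast_zero] at h1; linarith
    · exact ⟨m, rfl⟩
  push_cast at h1
  rw [iterate_succ_eq hu0 m q ⟨h0, by linarith⟩, iterate_succ, add_sub_cancel_right, max_eq_left h0,
    min_eq_right (by linarith), max_eq_right zero_le_one]

theorem AugFlow.iterate_add {u : ℝ → E} (hu0 : u 0 = 1) {n : ℕ} {q : ℝ} (h0 : 0 ≤ q) (k : ℕ)
    (h1 : q + k ≤ n) : α.iterate u n (q + k) = α.iterate u n q * α.ext q (α.iterate u n k) := by
  induction k with
  | zero => simp [iterate_zero hu0]
  | succ k ih =>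
    push_cast at h1 ⊢
    rw [← add_assoc, iterate_add_one hu0 (by positivity) (by linarith), ih (by linarith),
      iterate_add_one hu0 (by positivity) (by linarith), map_mul, mul_assoc, α.ext_add]

/-- Write q = r + s with s in [0, 1]. The factor u_s, sitting inside α_r, turns α_s into β_s, and
the inductive hypothesis at the point β_{s+p}(a) turns α_r into β_r; each unit of time costs ε. The
shift by p is present to make the induction run. -/
theorem AugFlow.norm_iterate_sub_le {u : ℝ → E} (hu : IsUnitaryPath χ u) {ε : ℝ} {a : E} (N : ℝ)
    (h : ∀ s ∈ Icc (0 : ℝ) 1, ∀ p ∈ Icc 0 N,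
      ‖u s * α.ext s (β.ext p a) * star (u s) - β.ext s (β.ext p a)‖ ≤ ε) (n : ℕ) :
    ∀ q ∈ Icc (0 : ℝ) n, ∀ p, 0 ≤ p → p + q ≤ N →
      ‖α.iterate u n q * α.ext q (β.ext p a) * star (α.iterate u n q) - β.ext q (β.ext p a)‖ ≤ n * ε := by
  induction n with
  | zero =>
    rintro q ⟨h0, h1⟩ p hp hpq
    have : q = 0 := le_antisymm (by simpa using h1) h0
    simp [this, iterate, α.ext_zero, β.ext_zero]
  | succ n ih =>
    rintro q ⟨h0, h1⟩ p hp hpq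
    push_cast at h1
    set r := max (q - 1) 0 with hr
    set s := max 0 (min q 1) with hs
    have hrs : q = r + s := by
      rcases le_total q 1 with h | h
      · rw [hr, hs, max_eq_right (by linarith), min_eq_left h, max_eq_right h0, zero_add]
      · rw [hr, hs, max_eq_left (by linarith), min_eq_right h, max_eq_right zero_le_one]
        ring
    have hs01 : s ∈ Icc (0 : ℝ) 1 := ⟨le_max_left _ _, max_le zero_le_one (min_le_right _ _)⟩
    have hr0 : r ∈ Icc (0 : ℝ) n := ⟨le_max_right _ _, max_le (by linarith) (Nat.cast_nonneg n)⟩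
    have e1 := h s hs01 p ⟨hp, by linarith [hr0.1, hs01.1]⟩
    have e2 := ih r hr0 (s + p) (by linarith [hs01.1]) (by linarith)
    rw [iterate_succ, ← hr, ← hs, hrs]
    refine (norm_conj_mul_sub_le (y := α.ext r (β.ext (s + p) a))
      ((isUnitaryPath_iterate hu n).mem r)).trans ?_
    rw [α.ext_add, ← map_star, ← map_mul, ← map_mul, α.norm_ext_sub, β.ext_add r s, ← β.ext_add s p]
    rw [← β.ext_add s p] at e1
    push_cast
    linarith

/-- A product of the form `c_q α_q(y_q)`. -/
def AugFlow.twist (α : AugFlow χ) (c y : ℝ → E) (q : ℝ) : E := c q * α.ext q (y q)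

theorem AugFlow.isUnitaryPath_twist {c y : ℝ → E} (hc : IsUnitaryPath χ c) (hy : IsUnitaryPath χ y) :
    IsUnitaryPath χ (α.twist c y) :=
  ⟨hc.continuous.mul (α.continuous_ext_comp continuous_id hy.continuous),
    fun q => mul_mem (hc.mem q) (α.ext_mem q (hy.mem q))⟩

/-- As α_t α_{q-t} = α_q, the factors y_q and y_{q-t}^* meet inside a single α_q, where slowness of
y makes their product nearly trivial. -/
theorem AugFlow.twist_mul_ext_star (c y : ℝ → E) (q t : ℝ) :
    α.twist c y q * α.ext t (star (α.twist c y (q - t))) =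
      c q * (α.ext q (y q * star (y (q - t))) * α.ext t (star (c (q - t)))) := by
  have : α.ext t (α.ext (q - t) (star (y (q - t)))) = α.ext q (star (y (q - t))) := by
    rw [← α.ext_add]; congr 1; ring_nf
  rw [twist, twist, star_mul, map_mul, ← map_star, this, map_mul]
  simp only [mul_assoc]

/-- The end value of y is dictated by closing the loop: at time q + T the cocycle relation produces
α_q(c_T), which it cancels. -/
theorem AugFlow.twist_add_eq {c y : ℝ → E} (hc : ∀ q, c q ∈ augUnitary χ) {q T : ℝ}
    (hcq : c (q + T) = c q * α.ext q (c T)) (hy1 : y (q + T) = α.ext (-T) (star (c T)))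
    (hy0 : y q = 1) : α.twist c y (q + T) = α.twist c y q := by
  rw [twist, twist, hcq, hy1, hy0, map_one, ← α.ext_add, add_neg_cancel_right, mul_assoc, ← map_mul,
    augUnitary.mul_star_self (hc T), map_one]

/-- The path `s ↦ α_{-sT}(c_{sT}^*)`. -/
def AugFlow.backPath (α : AugFlow χ) (c : ℝ → E) (T s : ℝ) : E := α.ext (-(s * T)) (star (c (s * T)))

theorem AugFlow.isUnitaryPath_backPath {c : ℝ → E} (hc : IsUnitaryPath χ c) (T : ℝ) :
    IsUnitaryPath χ (α.backPath c T) :=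
  ⟨α.continuous_ext_comp (by fun_prop) (hc.continuous.comp (by fun_prop)).star,
    fun _ => α.ext_mem _ (augUnitary.star_mem (hc.mem _))⟩

theorem AugFlow.backPath_zero {c : ℝ → E} (hc : c 0 = 1) (T : ℝ) : α.backPath c T 0 = 1 := by
  simp [backPath, hc]

/-- So the end value needed to close the loop is joined to 1 by a path of unitaries, and the length
hypotheses apply to it. -/
theorem AugFlow.backPath_one (c : ℝ → E) (T : ℝ) :
    α.backPath c T 1 = α.ext (-T) (star (c T)) := by simp [backPath]

/-- The union of the images of `K` under `α_t`, `|t| ≤ R`. -/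
def AugFlow.orbitSet (α : AugFlow χ) (R : ℝ) (K : Set E) : Set E :=
  (fun p : ℝ × E => α.ext p.1 p.2) '' (Icc (-R) R ×ˢ K)

theorem AugFlow.isCompact_orbitSet (R : ℝ) {K : Set E} (hK : IsCompact K) :
    IsCompact (α.orbitSet R K) :=
  (isCompact_Icc.prod hK).image α.continuous_ext_prod

theorem AugFlow.mem_orbitSet {R t : ℝ} {K : Set E} (ht : t ∈ Icc (-R) R) {a : E} (ha : a ∈ K) :
    α.ext t a ∈ α.orbitSet R K := ⟨(t, a), ⟨ht, ha⟩, rfl⟩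

theorem AugFlow.forall_mem_orbitSet {R B : ℝ} {K : Set E} (h : ∀ a ∈ K, χ a = 0 ∧ ‖a‖ ≤ B) :
    ∀ a ∈ α.orbitSet R K, χ a = 0 ∧ ‖a‖ ≤ B := by
  rintro _ ⟨⟨t, a⟩, ⟨-, ha⟩, rfl⟩
  rw [α.map_ext, α.norm_ext]
  exact h a ha

theorem AugFlow.map_orbitSet_eq_zero {R : ℝ} {K : Set E} (h : ∀ a ∈ K, χ a = 0) :
    ∀ a ∈ α.orbitSet R K, χ a = 0 := by
  rintro _ ⟨⟨t, a⟩, ⟨-, ha⟩, rfl⟩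
  rw [α.map_ext]
  exact h a ha

theorem IsCompact.exists_map_eq_zero_norm_le {K : Set E} (hK : IsCompact K) (hK0 : ∀ a ∈ K, χ a = 0) :
    ∃ B, ∀ a ∈ K, χ a = 0 ∧ ‖a‖ ≤ B := by
  obtain ⟨B, hB⟩ := hK.isBounded.exists_norm_le
  exact ⟨B, fun a ha => ⟨hK0 a ha, hB a ha⟩⟩

/-- If the restricted coactions of two flows, the first of which has the Rokhlin property, are
approximately unitarily equivalent, then the flows are approximately conjugate via unitaries. -/
theorem exists_unitary_conj_flow_near {L : ℝ} (hL0 : 0 ≤ L) (hL : HasWeakInnerLength χ L)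
    (hα : α.HasRokhlin) (hαβ : α.CoactionEquiv β) {K : Set E} (hK : IsCompact K)
    (hK0 : ∀ a ∈ K, χ a = 0) {R ε : ℝ} (hR : 0 ≤ R) (hε : 0 < ε) :
    ∃ v ∈ augUnitary χ, ∀ a ∈ K, ∀ t ∈ Icc (-R) R,
      ‖α.coboundary v t * α.ext t a * star (α.coboundary v t) - β.ext t a‖ ≤ ε := by
  obtain ⟨B, hB⟩ := hK.exists_map_eq_zero_norm_le hK0
  obtain ⟨S₀, hS₀⟩ := hL.exists_path hL0 (R := R) (B := B) (show 0 < ε / 8 by positivity)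
  -- T is an integer because c satisfies the cocycle relation only for integer shifts; T - 2R, the
  -- time left for y to move, has to exceed S₀. The path c is then needed on [0, 2R + T], hence N.
  obtain ⟨T, hT⟩ := exists_nat_ge (2 * R + max S₀ 0 + 1)
  obtain ⟨N, hN⟩ := exists_nat_ge (2 * R + T)
  have hT1 : S₀ ≤ T - 2 * R := by linarith [le_max_left S₀ 0]
  have hT2 : 0 < T - 2 * R := by linarith [le_max_right S₀ 0]
  have hT0 : (0 : ℝ) < T := by linarith
  have hN0 : (0 : ℝ) < N := by linarith
  set K₁ := β.orbitSet N K with hK₁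
  have hK₁c : IsCompact K₁ := AugFlow.isCompact_orbitSet _ hK
  have hK₁B : ∀ a ∈ K₁, χ a = 0 ∧ ‖a‖ ≤ B := AugFlow.forall_mem_orbitSet hB
  -- The N iterations of the path contribute an error ε' each.
  set ε' : ℝ := ε / (8 * N) with hε'
  have hNε : N * ε' = ε / 8 := by rw [hε']; field_simp
  obtain ⟨u, hu, hu0, huK⟩ := hαβ (β.orbitSet N K₁) (AugFlow.isCompact_orbitSet _ hK₁c)
    (AugFlow.map_orbitSet_eq_zero fun a ha => (hK₁B a ha).1) ε' (by positivity)
  set c := α.iterate u N with hc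
  have hcp : IsUnitaryPath χ c := AugFlow.isUnitaryPath_iterate hu N
  have hc0 : c 0 = 1 := AugFlow.iterate_zero hu0 N
  have hcK : ∀ q ∈ Icc (0 : ℝ) N, ∀ b ∈ K₁, ‖c q * α.ext q b * star (c q) - β.ext q b‖ ≤ ε / 8 := by
    intro q hq b hb
    have := AugFlow.norm_iterate_sub_le (α := α) (β := β) hu (a := b) N (fun s hs p hp =>
      huK s hs _ (AugFlow.mem_orbitSet ⟨by linarith [hp.1], hp.2⟩ hb)) N q hq 0 le_rfl
      (by linarith [hq.2])
    rwa [β.ext_zero, hNε] at this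
  obtain ⟨y', hy', hy'0, hy'1, hy'K⟩ := hS₀ (T - 2 * R) hT1 hT2 K₁ hK₁c hK₁B (α.backPath c T)
    (AugFlow.isUnitaryPath_backPath hcp T) (AugFlow.backPath_zero hc0 T)
  -- The path y rests at 1 up to time 2R and at its end value from time T on, as periodicity of the
  -- loop on [0, 2R] demands.
  set y : ℝ → E := fun q => y' (q - 2 * R) with hy
  have hyp : IsUnitaryPath χ y := hy'.comp (by fun_prop)
  obtain ⟨w, hw⟩ := hα T hT0
  have hZ : IsUnitaryPath χ (α.twist c y) := AugFlow.isUnitaryPath_twist hcp hyp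
  obtain ⟨V, hV, -, hVb, -, -⟩ := exists_transfer hw hR (by linarith) hZ.continuous hZ.mem (by
    rintro q ⟨hq0, hq1⟩
    refine AugFlow.twist_add_eq hcp.mem (AugFlow.iterate_add hu0 hq0 T (by linarith)) ?_ ?_
    · simp only [hy]
      rw [hy'1 _ (by linarith), AugFlow.backPath_one]
    · simp only [hy]
      exact hy'0 _ (by linarith)) (fun q t => rfl)
  obtain ⟨F, hFK, hF⟩ := hK.exists_finset_net (show 0 < ε / 8 by positivity)
  have hD : ∀ a ∈ K, ∀ q ∈ Icc R (R + T), ∀ t ∈ Icc (-R) R,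
      ‖α.twist c y q * α.ext t (star (α.twist c y (q - t))) * α.ext t a *
        star (α.twist c y q * α.ext t (star (α.twist c y (q - t)))) - β.ext t a‖ ≤ 3 * ε / 8 := by
    rintro a ha q ⟨hq0, hq1⟩ t ⟨ht0, ht1⟩
    rw [AugFlow.twist_mul_ext_star]
    set p := q - t with hp
    have hp0 : 0 ≤ p := by linarith
    have hpN : p ≤ N := by linarith
    -- Chain of estimates: a = β_p(b), and conjugation by c_p^* takes it nearly to α_p(b); under α_t
    -- this becomes α_q(b). There y_q y_p^* has almost no effect, and finally c_q takes α_q(b)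
    -- nearly to β_q(b) = β_t(a).
    set b := β.ext (-p) a with hb
    have hbK : b ∈ K₁ := AugFlow.mem_orbitSet ⟨by linarith, by linarith⟩ ha
    refine (norm_conj_mul_sub_le (y := α.ext q b) (hcp.mem q)).trans ?_
    have e1 : ‖c q * α.ext q b * star (c q) - β.ext t a‖ ≤ ε / 8 := by
      have := hcK q ⟨by linarith, by linarith⟩ b hbK
      rwa [hb, ← β.ext_add q (-p), show q + -p = t by rw [hp]; ring] at this
    have e2 : ‖α.ext q (y q * star (y p)) * α.ext q b * star (α.ext q (y q * star (y p))) -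
        α.ext q b‖ ≤ ε / 8 := by
      rw [← map_star, ← map_mul, ← map_mul, α.norm_ext_sub]
      have h1 : y q * star (y p) * b * star (y q * star (y p)) - b =
          y q * (star (y p) * b * y p - star (y q) * b * y q) * star (y q) := by
        have h2 : y q * (star (y q) * b * y q) * star (y q) = b := by
          rw [mul_assoc (star (y q)), augUnitary.mul_star_cancel (hyp.mem q), mul_assoc,
            augUnitary.mul_star_self (hyp.mem q), mul_one]
        rw [mul_sub, sub_mul, h2, star_mul, star_star]
        noncomm_ring
      rw [h1, augUnitary.norm_conj (hyp.mem q)]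
      refine hy'K b hbK _ _ ?_
      rw [show p - 2 * R - (q - 2 * R) = -t by rw [hp]; ring, abs_neg, abs_le]
      exact ⟨ht0, ht1⟩
    have e3 : ‖α.ext t (star (c p)) * α.ext t a * star (α.ext t (star (c p))) - α.ext q b‖ ≤ ε / 8 := by
      have h1 : α.ext q b = α.ext t (α.ext p b) := by
        rw [← α.ext_add]; congr 1; rw [hp]; ring_nf
      rw [h1, ← map_star, ← map_mul, ← map_mul, α.norm_ext_sub, star_star]
      have h2 := hcK p ⟨hp0, hpN⟩ b hbK
      rw [hb, β.ext_ext_neg, ← hb] at h2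
      have h3 : star (c p) * a * c p - α.ext p b =
          star (c p) * (a - c p * α.ext p b * star (c p)) * c p := by
        rw [mul_sub, sub_mul, mul_assoc (c p), augUnitary.star_mul_cancel (hcp.mem p), mul_assoc (α.ext p b),
          augUnitary.star_mul_self (hcp.mem p), mul_one]
      rw [h3, augUnitary.norm_star_conj (hcp.mem p), norm_sub_rev]
      exact h2
    have e4 := norm_conj_mul_sub_le (u := α.ext q (y q * star (y p))) (v := α.ext t (star (c p)))
      (x := α.ext t a) (y := α.ext q b) (z := α.ext q b)
      (α.ext_mem q (mul_mem (hyp.mem q) (augUnitary.star_mem (hyp.mem p))))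
    linarith
  have hev : ∀ᶠ p in iterLim, ∀ a ∈ F, ∀ t ∈ Icc (-R) R,
      ‖α.coboundary (V p) t * α.ext t a * star (α.coboundary (V p) t) - β.ext t a‖ ≤
        3 * ε / 8 + ε / 8 := by
    rw [Filter.eventually_all_finset]
    intro a ha
    exact hVb _ _ _ _ (α.continuous_ext a) (β.continuous_ext a)
      (fun t => by rw [α.map_ext, hK0 a (hFK a ha)]) (fun t => by rw [β.map_ext, hK0 a (hFK a ha)])
      (by positivity) (hD a (hFK a ha))
  obtain ⟨p, hp⟩ := hev.exists
  refine ⟨V p, hV p, fun a ha t ht => ?_⟩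
  obtain ⟨b, hb, hab⟩ := hF a ha
  have := norm_conj_sub_le_add (x := α.ext t a) (y := α.ext t b) (z := β.ext t a) (w := β.ext t b)
    (α.coboundary_mem (hV p) t)
  rw [α.norm_ext_sub, β.norm_ext_sub] at this
  linarith [hp b hb t ht]

/-- Approximate vanishing of approximately central coboundaries for Rokhlin flows. -/
theorem exists_central_unitary_coboundary_near {N : Prop} {C : ℝ} (hC0 : 0 ≤ C)
    (hC : HasCentralLength χ N C) (hα : α.HasRokhlin) {K : Set E} (hK : IsCompact K)
    (hK0 : ∀ a ∈ K, χ a = 0) {R ε : ℝ} (hR : 0 ≤ R) (hε : 0 < ε) :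
    ∃ δ : ℝ, 0 < δ ∧ ∃ G : Set E, IsCompact G ∧ (∀ a ∈ G, χ a = 0) ∧ ∃ R' : ℝ, 0 ≤ R' ∧
      ∀ v ∈ augUnitary χ, (∀ b ∈ G, ∀ t ∈ Icc (-R') R',
        ‖α.coboundary v t * b - b * α.coboundary v t‖ ≤ δ) →
        ∃ V ∈ augUnitary χ, (∀ a ∈ K, ‖V * a - a * V‖ ≤ ε) ∧
          (∀ a ∈ K, ∀ t ∈ Icc (-R) R, ‖(α.coboundary V t - α.coboundary v t) * a‖ ≤ ε) ∧
          (N → ∀ t ∈ Icc (-R) R, ‖α.coboundary V t - α.coboundary v t‖ ≤ ε) := by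
  obtain ⟨B, hB⟩ := hK.exists_map_eq_zero_norm_le hK0
  obtain ⟨S, hS0, hS⟩ := hC.exists_path hC0 (B := B) hR (show 0 < ε / 8 by positivity)
  -- Here c is a genuine coboundary, so any real T is admissible and the moving time T - 2R can be
  -- exactly S.
  set T := 2 * R + S with hT
  have hT0 : 0 < T := by positivity
  set K₁ := α.orbitSet (2 * R + T) K with hK₁
  have hK₁c : IsCompact K₁ := AugFlow.isCompact_orbitSet _ hK
  have hK₁B : ∀ a ∈ K₁, χ a = 0 ∧ ‖a‖ ≤ B := AugFlow.forall_mem_orbitSet hB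
  obtain ⟨δ₀, hδ₀, G₀, hG₀, hG₀u⟩ := hS K₁ hK₁c hK₁B
  -- The path that closes the loop is α_{-sT}(c_{sT}^*). It is approximately central on G₀ when
  -- c_{sT} is so on α_{sT}(G₀), which explains the orbit set.
  refine ⟨min δ₀ (ε / 8), by positivity, K₁ ∪ α.orbitSet T G₀,
    hK₁c.union (AugFlow.isCompact_orbitSet _ G₀.finite_toSet.isCompact), ?_, 2 * R + T, by positivity, ?_⟩
  · rintro a (ha | ha)
    · exact (hK₁B a ha).1
    · exact AugFlow.map_orbitSet_eq_zero (fun b hb => hG₀ b hb) a ha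
  intro v hv hvG
  set c := α.coboundary v with hc
  have hcp : IsUnitaryPath χ c := ⟨α.continuous_coboundary v, α.coboundary_mem hv⟩
  have hc0 : c 0 = 1 := α.coboundary_zero hv
  have hcK : ∀ b ∈ K₁, ∀ t ∈ Icc (-(2 * R + T)) (2 * R + T), ‖c t * b - b * c t‖ ≤ ε / 8 :=
    fun b hb t ht => (hvG b (Or.inl hb) t ht).trans (min_le_right _ _)
  obtain ⟨y', hy', hy'0, hy'1, hy'c, hy'K, hy'N⟩ := hG₀u (α.backPath c T)
    (AugFlow.isUnitaryPath_backPath hcp T) (AugFlow.backPath_zero hc0 T) (by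
      rintro b hb s ⟨hs0, hs1⟩
      have h0 : 0 ≤ s * T := by positivity
      have h1 : s * T ≤ T := mul_le_of_le_one_left hT0.le hs1
      have h2 := hvG _ (Or.inr (AugFlow.mem_orbitSet (α := α) (R := T) (t := s * T)
        ⟨by linarith, h1⟩ (Finset.mem_coe.2 hb))) (s * T) ⟨by linarith, by linarith⟩
      rw [← augUnitary.norm_commutator_star (hcp.mem _), ← α.norm_ext (-(s * T)), map_sub, map_mul,
        map_mul, α.ext_neg_ext] at h2
      exact h2.trans (min_le_left _ _))
  set y : ℝ → E := fun q => y' (q - 2 * R) with hy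
  have hyp : IsUnitaryPath χ y := hy'.comp (by fun_prop)
  obtain ⟨w, hw⟩ := hα T hT0
  have hZ : IsUnitaryPath χ (α.twist c y) := AugFlow.isUnitaryPath_twist hcp hyp
  obtain ⟨V, hV, hVa, -, hVb, hVc⟩ := exists_transfer hw hR (by linarith) hZ.continuous hZ.mem (by
    rintro q ⟨hq0, hq1⟩
    refine AugFlow.twist_add_eq hcp.mem (α.coboundary_add hv q T) ?_ ?_
    · simp only [hy]
      rw [hy'1 _ (by linarith), AugFlow.backPath_one]
    · simp only [hy]
      exact hy'0 _ (by linarith)) (fun q t => rfl)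
  have hyy : ∀ q t, t ∈ Icc (-R) R → |q - 2 * R - (q - t - 2 * R)| ≤ R := fun q t ht => by
    rw [show q - 2 * R - (q - t - 2 * R) = t by ring, abs_le]
    exact ht
  have hDc : ∀ q t, α.twist c y q * α.ext t (star (α.twist c y (q - t))) - c t =
      c q * (α.ext q (y q * star (y (q - t)) - 1) * α.ext t (star (c (q - t)))) := by
    intro q t
    have h1 : c q = c t * α.ext t (c (q - t)) := by
      rw [hc, ← α.coboundary_add hv]; congr 1; ring
    have h2 : c q * α.ext t (star (c (q - t))) = c t := by
      rw [h1, mul_assoc, ← map_mul, augUnitary.mul_star_self (hcp.mem _), map_one, mul_one]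
    rw [AugFlow.twist_mul_ext_star, map_sub, map_one, sub_mul, mul_sub, one_mul, h2]
  have hyn : ∀ q t, ‖y q * star (y (q - t)) - 1‖ = ‖y q - y (q - t)‖ := by
    intro q t
    rw [← augUnitary.norm_mul_right (hyp.mem (q - t)) (y q * star (y (q - t)) - 1), sub_mul, mul_assoc,
      augUnitary.star_mul_self (hyp.mem _), mul_one, one_mul]
  obtain ⟨F, hFK, hF⟩ := hK.exists_finset_net (show 0 < ε / 16 by positivity)
  have hD1 : ∀ a ∈ K, ∀ q ∈ Icc R (R + T), ‖α.twist c y q * a - a * α.twist c y q‖ ≤ ε / 4 := by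
    rintro a ha q ⟨hq0, hq1⟩
    refine (augUnitary.norm_commutator_mul_le (hcp.mem q) (α.ext_mem q (hyp.mem q)) a).trans ?_
    have h1 := hcK a (by
      have := AugFlow.mem_orbitSet (α := α) (R := 2 * R + T) (t := 0) ⟨by linarith, by linarith⟩ ha
      rwa [α.ext_zero] at this) q ⟨by linarith, by linarith⟩
    have h2 := hy'c _ (AugFlow.mem_orbitSet (α := α) (R := 2 * R + T) (t := -q)
      ⟨by linarith, by linarith⟩ ha) (q - 2 * R)
    rw [← α.norm_ext q, map_sub, map_mul, map_mul, α.ext_ext_neg] at h2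
    linarith
  have hD2 : ∀ a ∈ K, ∀ q ∈ Icc R (R + T), ∀ t ∈ Icc (-R) R,
      ‖(α.twist c y q * α.ext t (star (α.twist c y (q - t))) - c t) * a‖ ≤ 5 * ε / 8 := by
    rintro a ha q ⟨hq0, hq1⟩ t ht
    have htR := ht
    obtain ⟨ht0, ht1⟩ := ht
    set m := α.ext t (star (c (q - t))) with hm
    have hmm : m ∈ augUnitary χ := α.ext_mem t (augUnitary.star_mem (hcp.mem _))
    rw [hDc, ← hm, mul_assoc, augUnitary.norm_mul_left (hcp.mem q)]
    have h1 : ‖m * a - a * m‖ ≤ ε / 8 := by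
      have h2 := hcK _ (AugFlow.mem_orbitSet (α := α) (R := 2 * R + T) (t := -t)
        ⟨by linarith, by linarith⟩ ha) (q - t) ⟨by linarith, by linarith⟩
      rwa [← augUnitary.norm_commutator_star (hcp.mem _), ← α.norm_ext t, map_sub, map_mul,
        map_mul, α.ext_ext_neg] at h2
    set b := α.ext (-q) a with hb
    have hbK : b ∈ K₁ := AugFlow.mem_orbitSet ⟨by linarith, by linarith⟩ ha
    have h3 : ‖α.ext q (y q * star (y (q - t)) - 1) * a‖ ≤ 3 * (ε / 8) := by
      have h4 : α.ext q (y q * star (y (q - t)) - 1) * a = α.ext q ((y q * star (y (q - t)) - 1) * b) := by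
        rw [map_mul, hb, α.ext_ext_neg]
      -- The difference y_q - y_{q-t} is small only next to b, so b is first commuted past
      -- y_{q-t}^*.
      have h5 : (y q * star (y (q - t)) - 1) * b = (y q - y (q - t)) * (star (y (q - t)) * b -
          b * star (y (q - t))) + (y q - y (q - t)) * b * star (y (q - t)) := by
        have h6 : y (q - t) * (star (y (q - t)) * b) = b := augUnitary.mul_star_cancel (hyp.mem _) b
        calc (y q * star (y (q - t)) - 1) * b = y q * (star (y (q - t)) * b) - b := by noncomm_ring
          _ = y q * (star (y (q - t)) * b) - y (q - t) * (star (y (q - t)) * b) := by rw [h6]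
          _ = _ := by noncomm_ring
      have h7 := hy'c b hbK (q - t - 2 * R)
      have h8 := hy'K b hbK (q - 2 * R) (q - t - 2 * R) (hyy q t htR)
      rw [h4, α.norm_ext, h5]
      refine (norm_add_le _ _).trans ?_
      rw [augUnitary.norm_mul_right (augUnitary.star_mem (hyp.mem _))]
      have h9 : ‖(y q - y (q - t)) * (star (y (q - t)) * b - b * star (y (q - t)))‖ ≤ 2 * (ε / 8) := by
        refine (norm_mul_le _ _).trans (mul_le_mul (norm_sub_le_two (hyp.mem _) (hyp.mem _)) ?_
          (norm_nonneg _) zero_le_two)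
        rw [augUnitary.norm_commutator_star (hyp.mem _)]
        exact h7
      linarith
    set d := α.ext q (y q * star (y (q - t)) - 1) with hd
    have hd2 : ‖d‖ ≤ 2 := by
      rw [hd, α.norm_ext, hyn]
      exact norm_sub_le_two (hyp.mem _) (hyp.mem _)
    have h10 : d * m * a = d * (m * a - a * m) + d * a * m := by noncomm_ring
    rw [h10]
    refine (norm_add_le _ _).trans ?_
    rw [augUnitary.norm_mul_right hmm]
    have h11 : ‖d * (m * a - a * m)‖ ≤ 2 * (ε / 8) :=
      (norm_mul_le _ _).trans (mul_le_mul hd2 h1 (norm_nonneg _) zero_le_two)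
    linarith
  have hev : ∀ᶠ p in iterLim, (∀ a ∈ F, ‖V p * a - a * V p‖ ≤ ε / 4 + ε / 8) ∧
      (∀ a ∈ F, ∀ t ∈ Icc (-R) R, ‖(α.coboundary (V p) t - c t) * a‖ ≤ 5 * ε / 8 + ε / 8) ∧
      (N → ∀ t ∈ Icc (-R) R, ‖α.coboundary (V p) t - c t‖ ≤ ε / 8 + ε / 8) := by
    refine Filter.Eventually.and ?_ (Filter.Eventually.and ?_ ?_)
    · rw [Filter.eventually_all_finset]
      exact fun a ha => hVa _ _ _ (hK0 a (hFK a ha)) (by positivity) (hD1 a (hFK a ha))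
    · rw [Filter.eventually_all_finset]
      exact fun a ha => hVb _ (fun _ => a) _ _ hcp.continuous continuous_const (fun t => (hcp.mem t).2)
        (fun _ => hK0 a (hFK a ha)) (by positivity) (hD2 a (hFK a ha))
    · rw [Filter.eventually_imp_distrib_left]
      intro hN
      refine hVc _ _ _ hcp.continuous (fun t => (hcp.mem t).2) (by positivity) fun q hq t ht => ?_
      rw [hDc, augUnitary.norm_mul_left (hcp.mem q),
        augUnitary.norm_mul_right (α.ext_mem t (augUnitary.star_mem (hcp.mem _))), α.norm_ext, hyn]
      exact hy'N hN _ _ (hyy q t ht)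
  obtain ⟨p, hp1, hp2, hp3⟩ := hev.exists
  refine ⟨V p, hV p, fun a ha => ?_, fun a ha t ht => ?_, fun hN t ht => (hp3 hN t ht).trans (by linarith)⟩
  · obtain ⟨b, hb, hab⟩ := hF a ha
    have := norm_commutator_le_add (a := a) (b := b) (hV p)
    linarith [hp1 b hb]
  · obtain ⟨b, hb, hab⟩ := hF a ha
    have h1 : (α.coboundary (V p) t - c t) * a = (α.coboundary (V p) t - c t) * b +
      (α.coboundary (V p) t - c t) * (a - b) := by noncomm_ring
    have h2 : ‖(α.coboundary (V p) t - c t) * (a - b)‖ ≤ 2 * (ε / 16) :=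
      (norm_mul_le _ _).trans (mul_le_mul (norm_sub_le_two (α.coboundary_mem (hV p) t) (hcp.mem t)) hab
        (norm_nonneg _) zero_le_two)
    rw [h1]
    refine (norm_add_le _ _).trans ?_
    linarith [hp2 b hb t ht]

end Existence

/-! ### The Evans-Kishimoto intertwining -/

section Intertwining

variable {E : Type*} [CStarAlgebra E] {χ : E →⋆ₐ[ℂ] ℂ}

/-- The flow `Ad(X) ∘ θ_t ∘ Ad(X^*)`. -/
def AugFlow.conjFlow (θ : AugFlow χ) (X : E) (t : ℝ) (a : E) : E :=
  X * θ.ext t (star X * a * X) * star X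

theorem AugFlow.coboundary_conj (θ : AugFlow χ) (v a : E) (t : ℝ) :
    θ.coboundary v t * θ.ext t a * star (θ.coboundary v t) = θ.conjFlow v t a := by
  rw [coboundary, conjFlow, map_mul, map_mul, star_mul, ← map_star, star_star]
  noncomm_ring

theorem AugFlow.conjFlow_mul (θ : AugFlow χ) (X v a : E) (t : ℝ) :
    θ.conjFlow (X * v) t a = X * θ.conjFlow v t (star X * a * X) * star X := by
  simp only [conjFlow, star_mul, mul_assoc]

/-- The estimates for one step of the intertwining argument. -/
structure IntertwiningStep (θ : AugFlow χ) (N : Prop) (K : Finset E) (R ε : ℝ) (X S X' S' : E) :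
    Prop where
  conj : ∀ a ∈ K, ‖S' * a * star S' - S * a * star S‖ ≤ ε
  star_conj : ∀ a ∈ K, ‖star S' * a * S' - star S * a * S‖ ≤ ε
  coboundary : ∀ a ∈ K, ∀ t ∈ Icc (-R) R,
    ‖(θ.coboundary (star S' * X') t - θ.coboundary (star S * X) t) * a‖ ≤ ε
  norm_coboundary : N → ∀ t ∈ Icc (-R) R,
    ‖θ.coboundary (star S' * X') t - θ.coboundary (star S * X) t‖ ≤ ε

/-- With X' = X v, closeness of the two conjugated flows says that the coboundary of v is
approximately central, hence close to that of an approximately central V. Put S' = X V X^* S.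
Conjugation by S' is close to conjugation by S since X V X^* is approximately central, and S'^* X' =
(S^* X) V^* v, where V^* v has nearly trivial coboundary, so that the coboundary of S^* X hardly
changes. The element X S^* - 1 is recorded in G for the sake of `norm_coboundary_combination_sub`.
-/
theorem exists_intertwiningStep {θ : AugFlow χ} {N : Prop} {C : ℝ} (hC0 : 0 ≤ C)
    (hC : HasCentralLength χ N C) (hθ : θ.HasRokhlin) (K : Finset E) (hK : ∀ a ∈ K, χ a = 0) {R ε : ℝ}
    (hR : 0 ≤ R) (hε : 0 < ε) {X S : E} (hX : X ∈ augUnitary χ) (hS : S ∈ augUnitary χ) :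
    ∃ δ : ℝ, 0 < δ ∧ δ ≤ ε ∧ ∃ G : Set E, IsCompact G ∧ (∀ a ∈ G, χ a = 0) ∧ (∀ a ∈ K, a ∈ G) ∧
      X * star S - 1 ∈ G ∧ ∃ R' : ℝ, R ≤ R' ∧ ∀ X' ∈ augUnitary χ,
        (∀ a ∈ G, ∀ t ∈ Icc (-R') R', ‖θ.conjFlow X' t a - θ.conjFlow X t a‖ ≤ 2 * δ) →
        ∃ S' ∈ augUnitary χ, IntertwiningStep θ N K R ε X S X' S' := by
  set g := star S * X with hg
  have hgU : g ∈ augUnitary χ := mul_mem (augUnitary.star_mem hS) hX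
  have hKc : IsCompact (K : Set E) := K.finite_toSet.isCompact
  -- The first two pieces serve the estimates for conjugation by S' and by S'^*; the last two serve
  -- the coboundary estimate, where a has to be moved past V.
  set K' : Set E := ((fun a => star g * a * g) '' K ∪ (fun a => star X * a * X) '' K) ∪
    ((fun p : ℝ × E => star g * θ.ext (-p.1) p.2) '' (Icc (-R) R ×ˢ K) ∪
      (fun p : ℝ × E => θ.ext p.1 (star g) * p.2) '' (Icc (-R) R ×ˢ K)) with hK'
  have hK'c : IsCompact K' := by
    refine ((hKc.image ?_).union (hKc.image ?_)).union
      (((isCompact_Icc.prod hKc).image ?_).union ((isCompact_Icc.prod hKc).image ?_))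
    · fun_prop
    · fun_prop
    · exact continuous_const.mul (θ.continuous_ext_comp (by fun_prop) continuous_snd)
    · exact (θ.continuous_ext_comp continuous_fst continuous_const).mul continuous_snd
  have hK'0 : ∀ a ∈ K', χ a = 0 := by
    rintro _ ((⟨a, ha, rfl⟩ | ⟨a, ha, rfl⟩) | (⟨⟨t, a⟩, ⟨-, ha⟩, rfl⟩ | ⟨⟨t, a⟩, ⟨-, ha⟩, rfl⟩))
    · simp [hK a ha]
    · simp [hK a ha]
    · simp [θ.map_ext, hK a ha]
    · simp [hK a ha]
  obtain ⟨δ₀, hδ₀, G₀, hG₀c, hG₀, R₀, hR₀, hv⟩ := exists_central_unitary_coboundary_near hC0 hC hθ hK'c hK'0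
    hR (show 0 < ε / 3 by positivity)
  -- δ₀ is halved because the two conjugates of θ will be compared through a conjugate of the other
  -- flow, at a cost of δ on each side.
  refine ⟨min (δ₀ / 2) ε, by positivity, min_le_right _ _,
    ((K : Set E) ∪ {X * star S - 1}) ∪ (fun b => X * b * star X) '' θ.orbitSet R₀ G₀,
    (hKc.union isCompact_singleton).union ((AugFlow.isCompact_orbitSet R₀ hG₀c).image (by fun_prop)),
    ?_, fun a ha => Or.inl (Or.inl ha), Or.inl (Or.inr rfl), max R₀ R, le_max_right _ _,
    fun X' hX' hXX' => ?_⟩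
  · rintro _ ((ha | rfl) | ⟨b, hb, rfl⟩)
    · exact hK _ ha
    · rw [map_sub, (mul_mem hX (augUnitary.star_mem hS)).2, map_one, sub_self]
    · simp [AugFlow.map_orbitSet_eq_zero hG₀ b hb]
  set v := star X * X' with hvX
  have hvU : v ∈ augUnitary χ := mul_mem (augUnitary.star_mem hX) hX'
  obtain ⟨V, hV, hV1, hV2, hV3⟩ := hv v hvU (by
    intro b hb t ht
    have h1 := hXX' _ (Or.inr ⟨_, AugFlow.mem_orbitSet (α := θ) (R := R₀) (t := -t)
      ⟨by linarith [ht.2], by linarith [ht.1]⟩ hb, rfl⟩) t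
      ⟨by linarith [ht.1, le_max_left R₀ R], ht.2.trans (le_max_left _ _)⟩
    have h2 : X' = X * v := by rw [hvX, augUnitary.mul_star_cancel hX]
    have h3 : star X * (X * θ.ext (-t) b * star X) * X = θ.ext (-t) b := by
      rw [mul_assoc X, augUnitary.star_mul_cancel hX, mul_assoc, augUnitary.star_mul_self hX, mul_one]
    have h4 : θ.conjFlow X t (X * θ.ext (-t) b * star X) = X * b * star X := by
      rw [AugFlow.conjFlow, h3, θ.ext_ext_neg]
    rw [h4, h2, AugFlow.conjFlow_mul, h3, ← AugFlow.coboundary_conj, θ.ext_ext_neg, ← sub_mul, ← mul_sub,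
      augUnitary.norm_conj hX, augUnitary.norm_conj_sub (θ.coboundary_mem hvU t)] at h1
    refine h1.trans ?_
    linarith [min_le_left (δ₀ / 2) ε])
  set c := X * V * star X with hc
  have hcU : c ∈ augUnitary χ := mul_mem (mul_mem hX hV) (augUnitary.star_mem hX)
  have hcc : ∀ x, ‖c * x - x * c‖ = ‖V * (star X * x * X) - star X * x * X * V‖ := by
    intro x
    rw [← augUnitary.norm_star_conj hX (c * x - x * c)]
    congr 1
    have h1 : star X * c = V * star X := by
      rw [hc, mul_assoc, augUnitary.star_mul_cancel hX]
    have h2 : c * X = X * V := by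
      rw [hc, mul_assoc, augUnitary.star_mul_self hX, mul_one]
    calc star X * (c * x - x * c) * X = (star X * c) * x * X - star X * x * (c * X) := by noncomm_ring
      _ = _ := by rw [h1, h2]; noncomm_ring
  refine ⟨c * S, mul_mem hcU hS, ?_⟩
  have hg' : star (c * S) * X' = g * star V * v := by
    rw [hg, hc, hvX]
    simp only [star_mul, star_star, mul_assoc]
  have hco : ∀ t, θ.coboundary (star (c * S) * X') t - θ.coboundary g t =
      g * star V * ((θ.coboundary v t - θ.coboundary V t) * (θ.ext t V * θ.ext t (star g))) := by
    intro t
    have h1 : star V * θ.coboundary V t * (θ.ext t V * θ.ext t (star g)) = θ.ext t (star g) := by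
      rw [AugFlow.coboundary, ← mul_assoc (star V), augUnitary.star_mul_self hV, one_mul, ← map_mul,
        ← map_mul, augUnitary.star_mul_cancel hV]
    have h2 : θ.coboundary (g * star V * v) t =
        g * star V * (θ.coboundary v t * (θ.ext t V * θ.ext t (star g))) := by
      simp only [AugFlow.coboundary, star_mul, star_star, map_mul, mul_assoc]
    rw [hg', h2, sub_mul, mul_sub, mul_assoc g (star V) (θ.coboundary V t * _), ← mul_assoc (star V), h1]
    rfl
  have hgV : g * star V ∈ augUnitary χ := mul_mem hgU (augUnitary.star_mem hV)
  refine ⟨fun a ha => ?_, fun a ha => ?_, fun a ha t ht => ?_, fun hN t ht => ?_⟩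
  · have h1 : c * S * a * star (c * S) = c * (S * a * star S) * star c := by
      simp only [star_mul, mul_assoc]
    rw [h1, augUnitary.norm_conj_sub hcU, hcc]
    have h2 : star X * (S * a * star S) * X = star g * a * g := by
      rw [hg]; simp only [star_mul, star_star, mul_assoc]
    rw [h2]
    exact (hV1 _ (Or.inl (Or.inl ⟨a, ha, rfl⟩))).trans (by linarith)
  · have h1 : star (c * S) * a * (c * S) - star S * a * S = star S * (star c * a * c - a) * S := by
      rw [star_mul]; noncomm_ring
    rw [h1, augUnitary.norm_star_conj hS, augUnitary.norm_star_conj_sub hcU, hcc]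
    exact (hV1 _ (Or.inl (Or.inr ⟨a, ha, rfl⟩))).trans (by linarith)
  · rw [hco, mul_assoc, augUnitary.norm_mul_left hgV]
    set d := θ.coboundary v t - θ.coboundary V t with hd
    have hd2 : ‖d‖ ≤ 2 := norm_sub_le_two (θ.coboundary_mem hvU t) (θ.coboundary_mem hV t)
    have h1 : d * (θ.ext t V * θ.ext t (star g)) * a =
        d * θ.ext t (V * (star g * θ.ext (-t) a) - star g * θ.ext (-t) a * V) +
        d * (θ.ext t (star g) * a) * θ.ext t V := by
      simp only [map_sub, map_mul, θ.ext_ext_neg]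
      noncomm_ring
    have h2 := hV1 _ (Or.inr (Or.inl ⟨(t, a), ⟨ht, ha⟩, rfl⟩))
    have h3 := hV2 _ (Or.inr (Or.inr ⟨(t, a), ⟨ht, ha⟩, rfl⟩)) t ht
    dsimp only at h2 h3
    rw [← neg_sub (θ.coboundary v t), neg_mul, norm_neg, ← hd] at h3
    rw [h1]
    refine (norm_add_le _ _).trans ?_
    rw [augUnitary.norm_mul_right (θ.ext_mem t hV)]
    have h4 : ‖d * θ.ext t (V * (star g * θ.ext (-t) a) - star g * θ.ext (-t) a * V)‖ ≤ 2 * (ε / 3) :=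
      (norm_mul_le _ _).trans (mul_le_mul hd2 ((θ.norm_ext t _).le.trans h2) (norm_nonneg _) zero_le_two)
    linarith
  · rw [hco, augUnitary.norm_mul_left hgV,
      augUnitary.norm_mul_right (mul_mem (θ.ext_mem t hV) (θ.ext_mem t (augUnitary.star_mem hgU))),
      norm_sub_rev]
    exact (hV3 hN t ht).trans (by linarith)

theorem exists_conjFlow_near {θ θ' : AugFlow χ} {L : ℝ} (hL0 : 0 ≤ L) (hL : HasWeakInnerLength χ L)
    (hθ : θ.HasRokhlin) (hθθ : θ.CoactionEquiv θ') {G : Set E} (hG : IsCompact G)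
    (hG0 : ∀ a ∈ G, χ a = 0) {R ε : ℝ} (hR : 0 ≤ R) (hε : 0 < ε) {X : E} (hX : X ∈ augUnitary χ) :
    ∃ X' ∈ augUnitary χ, ∀ a ∈ G, ∀ t ∈ Icc (-R) R, ‖θ.conjFlow X' t a - θ'.conjFlow X t a‖ ≤ ε := by
  obtain ⟨v, hv, h⟩ := exists_unitary_conj_flow_near hL0 hL hθ hθθ
    (hG.image (f := fun a => star X * a * X) (by fun_prop)) (by
      rintro _ ⟨a, ha, rfl⟩
      simp [hG0 a ha]) hR hε
  refine ⟨X * v, mul_mem hX hv, fun a ha t ht => ?_⟩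
  have h1 := h _ ⟨a, ha, rfl⟩ t ht
  rw [AugFlow.coboundary_conj] at h1
  rw [AugFlow.conjFlow_mul, show θ'.conjFlow X t a = X * θ'.ext t (star X * a * X) * star X from rfl,
    ← sub_mul, ← mul_sub, augUnitary.norm_conj hX]
  exact h1

theorem exists_seq_of_forall_exists {σ : Type*} {P : ℕ → σ → Prop} {r : ℕ → σ → σ → Prop}
    (h0 : ∃ s, P 0 s) (h : ∀ n s, P n s → ∃ s', P (n + 1) s' ∧ r n s s') :
    ∃ s : ℕ → σ, (∀ n, P n (s n)) ∧ ∀ n, r n (s n) (s (n + 1)) := by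
  obtain ⟨s₀, hs₀⟩ := h0
  choose! f hf1 hf2 using h
  let s : ℕ → σ := fun n => Nat.rec s₀ (fun n x => f n x) n
  have hs : ∀ n, P n (s n) := fun n => by
    induction n with
    | zero => exact hs₀
    | succ n ih => exact hf1 n _ ih
  exact ⟨s, hs, fun n => hf2 n _ (hs n)⟩

/-- The sequences of unitaries of the intertwining argument. -/
theorem exists_intertwining {θ : ℕ → AugFlow χ} (hθ2 : ∀ n, θ (n + 2) = θ n)
    (hθ : ∀ n, (θ n).HasRokhlin) (hθθ : ∀ n, (θ (n + 1)).CoactionEquiv (θ n)) {L C : ℝ} {N : Prop}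
    (hL0 : 0 ≤ L) (hL : HasWeakInnerLength χ L) (hC0 : 0 ≤ C) (hC : HasCentralLength χ N C)
    {K : ℕ → Finset E} (hK : ∀ n, ∀ a ∈ K n, χ a = 0) {ε : ℕ → ℝ} (hε : ∀ n, 0 < ε n) :
    ∃ X S : ℕ → E, (∀ n, X n ∈ augUnitary χ) ∧ (∀ n, S n ∈ augUnitary χ) ∧
      (∀ n, ∀ a, a ∈ K n ∨ a = X n * star (S n) - 1 → ∀ t ∈ Icc (-(n : ℝ)) n,
        ‖(θ (n + 1)).conjFlow (X (n + 1)) t a - (θ n).conjFlow (X n) t a‖ ≤ ε n) ∧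
      ∀ n, IntertwiningStep (θ n) N (K n) n (ε n) (X n) (S n) (X (n + 2)) (S (n + 2)) := by
  have hstep : ∀ (n : ℕ) (x : augUnitary χ × augUnitary χ), _ := fun n x =>
    exists_intertwiningStep hC0 hC (hθ n) (K n) (hK n) (Nat.cast_nonneg n) (hε n) x.1.2 x.2.2
  choose δ hδ0 hδε G hGc hG0 hKG hXSG R hR hst using hstep
  -- A state consists of two consecutive pairs (X, S). The data δ, G, R of stage n are determined by
  -- the first pair, before the second pair is chosen to comply with them.
  obtain ⟨s, hs, hr⟩ := exists_seq_of_forall_exists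
    (σ := (augUnitary χ × augUnitary χ) × (augUnitary χ × augUnitary χ))
    (P := fun n s => ∀ a ∈ G n s.1, ∀ t ∈ Icc (-R n s.1) (R n s.1),
      ‖(θ (n + 1)).conjFlow s.2.1 t a - (θ n).conjFlow s.1.1 t a‖ ≤ δ n s.1)
    (r := fun n s s' => s'.1 = s.2 ∧ IntertwiningStep (θ n) N (K n) n (ε n) s.1.1 s.1.2 s'.2.1 s'.2.2)
    (by
      obtain ⟨X, hX, h⟩ := exists_conjFlow_near hL0 hL (hθ 1) (hθθ 0) (hGc 0 (1, 1)) (hG0 0 (1, 1))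
        ((Nat.cast_nonneg 0).trans (hR 0 (1, 1))) (hδ0 0 (1, 1)) (one_mem _)
      exact ⟨((1, 1), (⟨X, hX⟩, 1)), h⟩)
    (by
      rintro n ⟨x, x'⟩ hx
      dsimp only at hx
      -- The new X serves twice: close to stage n + 1 on the data of stage n, it permits the
      -- correction S; close on the data of stage n + 1, it continues the recursion.
      obtain ⟨X, hX, h⟩ := exists_conjFlow_near hL0 hL (hθ (n + 2)) (hθθ (n + 1))
        ((hGc n x).union (hGc (n + 1) x')) (by
          rintro a (ha | ha)
          exacts [hG0 n x a ha, hG0 (n + 1) x' a ha])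
        (((Nat.cast_nonneg n).trans (hR n x)).trans (le_max_left _ (R (n + 1) x')))
        (lt_min (hδ0 n x) (hδ0 (n + 1) x')) x'.1.2
      obtain ⟨S, hS, hSst⟩ := hst n x X hX (by
        intro a ha t ht
        have h1 := h a (Or.inl ha) t ⟨by linarith [ht.1, le_max_left (R n x) (R (n + 1) x')],
          ht.2.trans (le_max_left _ _)⟩
        have h2 := hx a ha t ht
        rw [hθ2] at h1
        have h3 := norm_sub_le_norm_sub_add_norm_sub ((θ n).conjFlow X t a)
          ((θ (n + 1)).conjFlow (x'.1 : E) t a) ((θ n).conjFlow (x.1 : E) t a)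
        linarith [min_le_left (δ n x) (δ (n + 1) x')])
      refine ⟨(x', (⟨X, hX⟩, ⟨S, hS⟩)), fun a ha t ht => ?_, rfl, hSst⟩
      exact (h a (Or.inr ha) t ⟨by linarith [ht.1, le_max_right (R n x) (R (n + 1) x')],
        ht.2.trans (le_max_right _ _)⟩).trans (min_le_right _ _))
  refine ⟨fun n => (s n).1.1, fun n => (s n).1.2, fun n => (s n).1.1.2, fun n => (s n).1.2.2,
    fun n a ha t ht => ?_, fun n => ?_⟩
  · dsimp only at ha ⊢
    rw [(hr n).1]
    refine (hs n a ?_ t ⟨by linarith [ht.1, hR n (s n).1], by linarith [ht.2, hR n (s n).1]⟩).trans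
      (hδε n (s n).1)
    rcases ha with ha | rfl
    exacts [hKG n (s n).1 a ha, hXSG n (s n).1]
  · have := (hr n).2
    dsimp only
    rw [(hr (n + 1)).1]
    exact this

end Intertwining

/-! ### Continuous convergence of sequences of maps -/

section ContConv

variable {X Y Z : Type*} [TopologicalSpace X]

/-- Continuous convergence of a sequence of functions. -/
def ContConv [TopologicalSpace Y] (F : ℕ → X → Y) (f : X → Y) : Prop :=
  ∀ x, Tendsto (fun p : ℕ × X => F p.1 p.2) (atTop ×ˢ 𝓝 x) (𝓝 (f x))

namespace ContConv

section Top

variable [TopologicalSpace Y] [TopologicalSpace Z]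

/-- Stability under composition, which plain pointwise convergence lacks, is the reason for working
with continuous convergence. -/
theorem comp {G : ℕ → Y → Z} {g : Y → Z} {F : ℕ → X → Y} {f : X → Y} (hG : ContConv G g)
    (hF : ContConv F f) : ContConv (fun n x => G n (F n x)) fun x => g (f x) := fun x =>
  (hG (f x)).comp (tendsto_fst.prodMk (hF x))

theorem prodMk {F : ℕ → X → Y} {f : X → Y} {G : ℕ → X → Z} {g : X → Z} (hF : ContConv F f)
    (hG : ContConv G g) : ContConv (fun n x => (F n x, G n x)) fun x => (f x, g x) := fun x =>
  (hF x).prodMk_nhds (hG x)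

theorem of_continuous {f : X → Y} (hf : Continuous f) : ContConv (fun _ => f) f := fun x =>
  (hf.tendsto x).comp tendsto_snd

theorem tendsto {F : ℕ → X → Y} {f : X → Y} (hF : ContConv F f) (x : X) :
    Tendsto (fun n => F n x) atTop (𝓝 (f x)) :=
  (hF x).comp (tendsto_id.prodMk tendsto_const_nhds)

theorem comp_tendsto {F : ℕ → X → Y} {f : X → Y} (hF : ContConv F f) {φ : ℕ → ℕ}
    (hφ : Tendsto φ atTop atTop) : ContConv (fun n => F (φ n)) f := fun x =>
  (hF x).comp ((hφ.comp tendsto_fst).prodMk tendsto_snd)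

theorem congr {F G : ℕ → X → Y} {f : X → Y} (hF : ContConv F f) (h : ∀ n x, G n x = F n x) :
    ContConv G f := by
  have : G = F := funext fun n => funext fun x => h n x
  rwa [this]

end Top

section Metric

variable [PseudoMetricSpace Y]

theorem continuous {F : ℕ → X → Y} {f : X → Y} (hF : ContConv F f) : Continuous f := by
  rw [continuous_iff_continuousAt]
  intro x
  refine Metric.tendsto_nhds.2 fun ε hε => ?_
  obtain ⟨p, hp, q, hq, hpq⟩ := eventually_prod_iff.1
    (Metric.tendsto_nhds.1 (hF x) (ε / 2) (half_pos hε))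
  filter_upwards [hq] with y hy
  have h1 : dist (f y) (f x) ≤ ε / 2 := by
    refine le_of_tendsto ((hF.tendsto y).dist tendsto_const_nhds) ?_
    filter_upwards [hp] with n hn
    exact (hpq hn hy).le
  linarith

theorem eventually_forall_dist_lt {F : ℕ → X → Y} {f : X → Y} (hF : ContConv F f) {K : Set X}
    (hK : IsCompact K) {ε : ℝ} (hε : 0 < ε) : ∀ᶠ n in atTop, ∀ x ∈ K, dist (F n x) (f x) < ε := by
  have h1 : TendstoLocallyUniformly F f atTop := by
    rw [tendstoLocallyUniformly_iff_forall_tendsto]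
    intro x
    have h2 := ((hF.continuous.tendsto x).comp (tendsto_snd (f := (atTop : Filter ℕ)) (g := 𝓝 x)))
    exact (h2.prodMk_nhds (hF x)).mono_right (nhds_le_uniformity (f x))
  have h2 := (tendstoLocallyUniformlyOn_iff_tendstoUniformlyOn_of_compact hK).1 h1.tendstoLocallyUniformlyOn
  filter_upwards [Metric.tendstoUniformlyOn_iff.1 h2 ε hε] with n hn x hx
  rw [dist_comm]
  exact hn x hx

theorem of_dist {F G : ℕ → X → Y} {f : X → Y} (hF : ContConv F f)
    (h : ContConv (fun n x => dist (F n x) (G n x)) fun _ => 0) : ContConv G f := fun x => by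
  rw [tendsto_iff_dist_tendsto_zero]
  have h1 := (tendsto_iff_dist_tendsto_zero.1 (hF x)).add (h x)
  rw [add_zero] at h1
  refine squeeze_zero (fun _ => dist_nonneg) (fun p => ?_) h1
  change dist (G p.1 p.2) (f x) ≤ dist (F p.1 p.2) (f x) + dist (F p.1 p.2) (G p.1 p.2)
  rw [add_comm, dist_comm (F p.1 p.2) (G p.1 p.2)]
  exact dist_triangle _ _ _

end Metric

end ContConv

/-- Summable increments on a dense sequence, uniform for t in bounded intervals, together with the
Lipschitz bound in a, make the sequence Cauchy uniformly near each point. Continuity of a single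
member then gives convergence jointly in the variables. -/
theorem exists_contConv {A : Type*} [NormedAddCommGroup A] [CompleteSpace A] {F : ℕ → ℝ × A → A}
    (hFc : ∀ n, Continuous (F n)) (hFl : ∀ n t a b, ‖F n (t, a) - F n (t, b)‖ ≤ ‖a - b‖)
    {d : ℕ → A} (hd : DenseRange d)
    (h : ∀ n : ℕ, ∀ k ≤ n, ∀ t ∈ Icc (-(n : ℝ)) n,
      ‖F (n + 1) (t, d k) - F n (t, d k)‖ ≤ (1 / 2 : ℝ) ^ n) :
    ∃ f, ContConv F f := by
  have key : ∀ (t₀ : ℝ) (a₀ : A) (ε : ℝ), 0 < ε → ∃ n₀ : ℕ, ∀ t a, |t - t₀| < 1 → ‖a - a₀‖ < ε →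
      ∀ n ≥ n₀, ∀ m ≥ n₀, ‖F n (t, a) - F m (t, a)‖ ≤ 10 * ε := by
    intro t₀ a₀ ε hε
    obtain ⟨k, hk⟩ := hd.exists_dist_lt a₀ hε
    rw [dist_eq_norm] at hk
    obtain ⟨n₁, hn₁⟩ := exists_nat_ge (|t₀| + 1)
    obtain ⟨n₂, hn₂⟩ := exists_pow_lt_of_lt_one hε (show (1 / 2 : ℝ) < 1 by norm_num)
    refine ⟨max k (max n₁ n₂), fun t a ht ha => ?_⟩
    have ht1 : |t| ≤ n₁ := by
      have := abs_sub_abs_le_abs_sub t t₀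
      linarith
    set n₀ := max k (max n₁ n₂) with hn₀
    have h1 : ∀ n, n₀ ≤ n → ‖F n (t, d k) - F n₀ (t, d k)‖ ≤ 2 * ε := by
      -- 2 - 2(1/2)^j is the partial sum of the geometric series of increments.
      have h2 : ∀ j : ℕ, ‖F (n₀ + j) (t, d k) - F n₀ (t, d k)‖ ≤ (2 - 2 * (1 / 2 : ℝ) ^ j) * ε := by
        intro j
        induction j with
        | zero => simp
        | succ j ih =>
          have hj1 : (n₁ : ℝ) ≤ (n₀ + j : ℕ) := by exact_mod_cast (by omega : n₁ ≤ n₀ + j)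
          have h3 := h (n₀ + j) k (by omega) t ⟨by linarith [neg_abs_le t], by linarith [le_abs_self t]⟩
          have h4 : (1 / 2 : ℝ) ^ (n₀ + j) ≤ ε * (1 / 2 : ℝ) ^ j := by
            rw [pow_add]
            gcongr
            refine le_trans ?_ hn₂.le
            exact pow_le_pow_of_le_one (by norm_num) (by norm_num) (by omega)
          have h5 := norm_sub_le_norm_sub_add_norm_sub (F (n₀ + (j + 1)) (t, d k)) (F (n₀ + j) (t, d k))
            (F n₀ (t, d k))
          rw [← add_assoc] at h5 ⊢
          rw [pow_succ]
          linarith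
      intro n hn
      obtain ⟨j, rfl⟩ := Nat.exists_eq_add_of_le hn
      refine (h2 j).trans ?_
      have : (0 : ℝ) ≤ (1 / 2 : ℝ) ^ j := by positivity
      nlinarith
    have had : ‖a - d k‖ ≤ 2 * ε := by
      have := norm_sub_le_norm_sub_add_norm_sub a a₀ (d k)
      linarith
    have h6 : ∀ n, n₀ ≤ n → ‖F n (t, a) - F n₀ (t, d k)‖ ≤ 4 * ε := by
      intro n hn
      have := norm_sub_le_norm_sub_add_norm_sub (F n (t, a)) (F n (t, d k)) (F n₀ (t, d k))
      linarith [hFl n t a (d k), h1 n hn]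
    intro n hn m hm
    have := norm_sub_le_norm_sub_add_norm_sub (F n (t, a)) (F n₀ (t, d k)) (F m (t, a))
    rw [norm_sub_rev (F n₀ (t, d k))] at this
    linarith [h6 n hn, h6 m hm]
  have hlim : ∀ p : ℝ × A, ∃ y, Tendsto (fun n => F n p) atTop (𝓝 y) := by
    rintro ⟨t, a⟩
    refine cauchySeq_tendsto_of_complete (Metric.cauchySeq_iff.2 fun ε hε => ?_)
    obtain ⟨n₀, hn₀⟩ := key t a (ε / 20) (by positivity)
    refine ⟨n₀, fun n hn m hm => ?_⟩
    rw [dist_eq_norm]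
    have := hn₀ t a (by simp) (by simpa using by positivity) n hn m hm
    linarith
  choose f hf using hlim
  refine ⟨f, ?_⟩
  rintro ⟨t₀, a₀⟩
  rw [Metric.tendsto_nhds]
  intro ε hε
  obtain ⟨n₀, hn₀⟩ := key t₀ a₀ (ε / 40) (by positivity)
  have hc := Metric.tendsto_nhds.1 ((hFc n₀).tendsto (t₀, a₀)) (ε / 4) (by positivity)
  have hn : ∀ᶠ p : ℝ × A in 𝓝 (t₀, a₀), |p.1 - t₀| < 1 ∧ ‖p.2 - a₀‖ < ε / 40 := by
    rw [nhds_prod_eq]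
    have h1 : ∀ᶠ t in 𝓝 t₀, |t - t₀| < 1 := Metric.ball_mem_nhds t₀ one_pos
    have h2 : ∀ᶠ a in 𝓝 a₀, ‖a - a₀‖ < ε / 40 := by
      filter_upwards [Metric.ball_mem_nhds a₀ (show 0 < ε / 40 by positivity)] with a ha
      rwa [mem_ball_iff_norm] at ha
    exact h1.prod_mk h2
  filter_upwards [(eventually_ge_atTop n₀).prod_mk (hc.and hn)] with ⟨n, t, a⟩ ⟨hn1, hc1, ht, ha⟩
  dsimp only at hn1 hc1 ht ha ⊢
  have h1 := hn₀ t a ht ha n hn1 n₀ le_rfl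
  have h2 : ‖F n₀ (t₀, a₀) - f (t₀, a₀)‖ ≤ 10 * (ε / 40) := by
    refine le_of_tendsto (tendsto_const_nhds.sub (hf (t₀, a₀))).norm ?_
    filter_upwards [eventually_ge_atTop n₀] with m hm
    exact hn₀ t₀ a₀ (by simp) (by simpa using by positivity) n₀ le_rfl m hm
  rw [dist_eq_norm] at hc1 ⊢
  have h3 := norm_sub_le_norm_sub_add_norm_sub (F n (t, a)) (F n₀ (t, a)) (f (t₀, a₀))
  have h4 := norm_sub_le_norm_sub_add_norm_sub (F n₀ (t, a)) (F n₀ (t₀, a₀)) (f (t₀, a₀))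
  linarith

end ContConv

/-! ### Realizations of the algebra as the kernel of a character -/

section Model

/-- A realization of `A` as the kernel of the character `χ`. -/
structure AugModel (A : Type*) [NonUnitalCStarAlgebra A] {E : Type*} [CStarAlgebra E]
    (χ : E →⋆ₐ[ℂ] ℂ) where
  /-- the inclusion -/
  j : A →⋆ₙₐ[ℂ] E
  norm_j (a : A) : ‖j a‖ = ‖a‖
  map_j (a : A) : χ (j a) = 0
  exists_j (x : E) : χ x = 0 → ∃ a, j a = x

variable {A : Type*} [NonUnitalCStarAlgebra A] {E : Type*} [CStarAlgebra E] {χ : E →⋆ₐ[ℂ] ℂ}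

namespace AugModel

variable (M : AugModel A χ)

theorem j_injective : Function.Injective M.j := fun a b h => by
  rw [← sub_eq_zero, ← norm_eq_zero, ← M.norm_j, map_sub, h, sub_self, norm_zero]

theorem norm_j_sub (a b : A) : ‖M.j a - M.j b‖ = ‖a - b‖ := by rw [← map_sub, M.norm_j]

theorem isometry_j : Isometry M.j := Isometry.of_dist_eq fun a b => by
  rw [dist_eq_norm, dist_eq_norm, M.norm_j_sub]

theorem continuous_of_comp {X : Type*} [TopologicalSpace X] {f : X → A}
    (h : Continuous fun x => M.j (f x)) : Continuous f :=
  M.isometry_j.isUniformInducing.isInducing.continuous_iff.2 h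

/-- The inverse of the inclusion. -/
noncomputable def res (x : E) : A := if h : χ x = 0 then (M.exists_j x h).choose else 0

theorem j_res {x : E} (hx : χ x = 0) : M.j (M.res x) = x := by
  rw [res, dif_pos hx]
  exact (M.exists_j x hx).choose_spec

theorem norm_res_sub {x y : E} (hx : χ x = 0) (hy : χ y = 0) : ‖M.res x - M.res y‖ = ‖x - y‖ := by
  rw [← M.norm_j_sub, M.j_res hx, M.j_res hy]

/-- Left multiplication by `x`. -/
noncomputable def act (x : E) (a : A) : A := M.res (x * M.j a)

@[simp] theorem j_act (x : E) (a : A) : M.j (M.act x a) = x * M.j a :=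
  M.j_res (by rw [map_mul, M.map_j, mul_zero])

/-- Conjugation by `u`. -/
noncomputable def conj (u : E) (a : A) : A := M.res (u * M.j a * star u)

@[simp] theorem j_conj (u : E) (a : A) : M.j (M.conj u a) = u * M.j a * star u :=
  M.j_res (by rw [map_mul, map_mul, M.map_j, mul_zero, zero_mul])

theorem act_mul (x y : E) (a : A) : M.act (x * y) a = M.act x (M.act y a) :=
  M.j_injective (by simp [mul_assoc])

theorem conj_mul (x y : E) (a : A) : M.conj (x * y) a = M.conj x (M.conj y a) :=
  M.j_injective (by simp [mul_assoc])

theorem norm_act_sub_act (x y : E) (a : A) : ‖M.act x a - M.act y a‖ ≤ ‖x - y‖ * ‖a‖ := by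
  rw [← M.norm_j_sub, j_act, j_act, ← sub_mul, ← M.norm_j a]
  exact norm_mul_le _ _

theorem norm_act_sub {u : E} (hu : u ∈ augUnitary χ) (a b : A) :
    ‖M.act u a - M.act u b‖ = ‖a - b‖ := by
  rw [← M.norm_j_sub, j_act, j_act, ← mul_sub, augUnitary.norm_mul_left hu, M.norm_j_sub]

theorem norm_act {u : E} (hu : u ∈ augUnitary χ) (a : A) : ‖M.act u a‖ = ‖a‖ := by
  rw [← M.norm_j, j_act, augUnitary.norm_mul_left hu, M.norm_j]

theorem norm_conj_sub {u : E} (hu : u ∈ augUnitary χ) (a b : A) :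
    ‖M.conj u a - M.conj u b‖ = ‖a - b‖ := by
  rw [← M.norm_j_sub, j_conj, j_conj, ← sub_mul, ← mul_sub, augUnitary.norm_conj hu, M.norm_j_sub]

theorem conj_star_conj {u : E} (hu : u ∈ augUnitary χ) (a : A) : M.conj (star u) (M.conj u a) = a := by
  rw [← conj_mul, augUnitary.star_mul_self hu]
  exact M.j_injective (by simp)

theorem conj_conj_star {u : E} (hu : u ∈ augUnitary χ) (a : A) : M.conj u (M.conj (star u) a) = a := by
  rw [← conj_mul, augUnitary.mul_star_self hu]
  exact M.j_injective (by simp)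

theorem conj_map_mul {u : E} (hu : u ∈ augUnitary χ) (a b : A) :
    M.conj u (a * b) = M.conj u a * M.conj u b := by
  refine M.j_injective ?_
  rw [map_mul, j_conj, j_conj, j_conj, map_mul]
  rw [mul_assoc (u * M.j a) (star u), mul_assoc u (M.j b), augUnitary.star_mul_cancel hu]
  simp only [mul_assoc]

/-- A pointwise limit of inner automorphisms whose inverses also converge. -/
theorem exists_starAlgEquiv {u : ℕ → E} (hu : ∀ n, u n ∈ augUnitary χ) {f g : A → A}
    (hf : ContConv (fun n a => M.conj (u n) a) f) (hg : ContConv (fun n a => M.conj (star (u n)) a) g) :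
    ∃ ψ : A ≃⋆ₐ[ℂ] A, (∀ a, ψ a = f a) ∧ ∀ a, ψ.symm a = g a := by
  have hgf : ∀ a, g (f a) = a := fun a =>
    tendsto_nhds_unique ((hg.comp hf).tendsto a)
      (tendsto_const_nhds.congr fun n => (M.conj_star_conj (hu n) a).symm)
  have hfg : ∀ a, f (g a) = a := fun a =>
    tendsto_nhds_unique ((hf.comp hg).tendsto a)
      (tendsto_const_nhds.congr fun n => (M.conj_conj_star (hu n) a).symm)
  refine ⟨{ toFun := f
            invFun := g
            left_inv := hgf
            right_inv := hfg
            map_mul' := fun a b => ?_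
            map_add' := fun a b => ?_
            map_star' := fun a => ?_
            map_smul' := fun c a => ?_ }, fun a => rfl, fun a => rfl⟩
  · exact tendsto_nhds_unique (hf.tendsto (a * b))
      (((hf.tendsto a).mul (hf.tendsto b)).congr fun n => (M.conj_map_mul (hu n) a b).symm)
  · refine tendsto_nhds_unique (hf.tendsto (a + b))
      (((hf.tendsto a).add (hf.tendsto b)).congr fun n => M.j_injective ?_)
    simp [mul_add, add_mul]
  · refine tendsto_nhds_unique (hf.tendsto (star a))
      (((hf.tendsto a).star).congr fun n => M.j_injective ?_)
    simp [map_star, mul_assoc]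
  · refine tendsto_nhds_unique (hf.tendsto (c • a))
      (((hf.tendsto a).const_smul c).congr fun n => M.j_injective ?_)
    simp [map_smul]

/-- The norm of a multiplier equals that of its left action, so the left action determines it. -/
theorem multiplier_ext {x y : 𝓜(ℂ, A)} (h : ∀ a, x.fst a = y.fst a) : x = y := by
  rw [← sub_eq_zero, ← norm_eq_zero, ← DoubleCentralizer.norm_fst, norm_eq_zero]
  ext a
  simp [h]

/-- Strict limits of unitaries define multipliers. -/
theorem exists_multiplier {u : ℕ → ℝ → E} (hu : ∀ n t, u n t ∈ augUnitary χ) {f g : ℝ × A → A}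
    (hf : ContConv (fun n p => M.act (u n p.1) p.2) f)
    (hg : ContConv (fun n p => M.act (star (u n p.1)) p.2) g) :
    ∃ w : ℝ → 𝓜(ℂ, A), (∀ t, w t ∈ unitary 𝓜(ℂ, A)) ∧ (∀ t a, (w t).fst a = f (t, a)) ∧
      ∀ t a, (w t).snd a = star (g (t, star a)) := by
  have hlin : ∀ {v : ℕ → ℝ → E}, (∀ n t, v n t ∈ augUnitary χ) → ∀ {f : ℝ × A → A},
      ContConv (fun n p => M.act (v n p.1) p.2) f → ∀ t, (∀ a b, f (t, a + b) = f (t, a) + f (t, b)) ∧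
        (∀ (c : ℂ) a, f (t, c • a) = c • f (t, a)) ∧ ∀ a, ‖f (t, a)‖ ≤ 1 * ‖a‖ := by
    intro v hv f hf t
    refine ⟨fun a b => ?_, fun c a => ?_, fun a => ?_⟩
    · refine tendsto_nhds_unique (hf.tendsto (t, a + b))
        (((hf.tendsto (t, a)).add (hf.tendsto (t, b))).congr fun n => M.j_injective ?_)
      simp [mul_add]
    · refine tendsto_nhds_unique (hf.tendsto (t, c • a))
        (((hf.tendsto (t, a)).const_smul c).congr fun n => M.j_injective ?_)
      simp [map_smul]
    · refine le_of_tendsto (hf.tendsto (t, a)).norm (Eventually.of_forall fun n => ?_)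
      rw [M.norm_act (hv n t), one_mul]
  have hu' : ∀ n t, star (u n t) ∈ augUnitary χ := fun n t => augUnitary.star_mem (hu n t)
  have h1 := fun t => hlin hu hf t
  have h2 := fun t => hlin hu' hg t
  let L : ℝ → A →L[ℂ] A := fun t => LinearMap.mkContinuous
    { toFun := fun a => f (t, a), map_add' := (h1 t).1, map_smul' := (h1 t).2.1 } 1 (h1 t).2.2
  -- Right multiplication by w is a ↦ (w^* a^*)^*, so it comes from the limit g of the adjoints.
  let R : ℝ → A →L[ℂ] A := fun t => LinearMap.mkContinuous
    { toFun := fun a => star (g (t, star a))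
      map_add' := fun a b => by rw [star_add, (h2 t).1, star_add]
      map_smul' := fun c a => by
        rw [star_smul, (h2 t).2.1, star_smul, star_star]; rfl } 1 (fun a => by
        change ‖star (g (t, star a))‖ ≤ _
        rw [norm_star, ← norm_star a]; exact (h2 t).2.2 _)
  let w : ℝ → 𝓜(ℂ, A) := fun t => ⟨(L t, R t), fun x y => by
    change star (g (t, star x)) * y = x * f (t, y)
    refine tendsto_nhds_unique (((hg.tendsto (t, star x)).star).mul_const y)
      (((hf.tendsto (t, y)).const_mul x).congr fun n => M.j_injective ?_)
    simp [map_star, mul_assoc]⟩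
  refine ⟨w, fun t => ?_, fun t a => rfl, fun t a => rfl⟩
  rw [Unitary.mem_iff]
  constructor
  · refine multiplier_ext fun a => ?_
    rw [DoubleCentralizer.mul_fst, DoubleCentralizer.one_fst, mul_apply_eq_comp,
      one_apply_eq_self, DoubleCentralizer.star_fst]
    change star (star (g (t, star (star (f (t, a)))))) = a
    rw [star_star, star_star]
    have h3 : ContConv (fun n a => M.act (star (u n t)) (M.act (u n t) a)) fun a => g (t, f (t, a)) :=
      (hg.comp ((ContConv.of_continuous continuous_const).prodMk (hf.comp
        ((ContConv.of_continuous continuous_const).prodMk (ContConv.of_continuous continuous_id)))))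
    refine tendsto_nhds_unique (h3.tendsto a) (tendsto_const_nhds.congr fun n => M.j_injective ?_)
    simp [augUnitary.star_mul_cancel (hu n t)]
  · refine multiplier_ext fun a => ?_
    rw [DoubleCentralizer.mul_fst, DoubleCentralizer.one_fst, mul_apply_eq_comp,
      one_apply_eq_self, DoubleCentralizer.star_fst]
    change f (t, star (star (g (t, star (star a))))) = a
    rw [star_star, star_star]
    have h3 : ContConv (fun n a => M.act (u n t) (M.act (star (u n t)) a)) fun a => f (t, g (t, a)) :=
      (hf.comp ((ContConv.of_continuous continuous_const).prodMk (hg.comp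
        ((ContConv.of_continuous continuous_const).prodMk (ContConv.of_continuous continuous_id)))))
    refine tendsto_nhds_unique (h3.tendsto a) (tendsto_const_nhds.congr fun n => M.j_injective ?_)
    simp [augUnitary.mul_star_cancel (hu n t)]

end AugModel

end Model

/-! ### Algebraic comparison of the two sides of the intertwining -/

section Combination

variable {E : Type*} [CStarAlgebra E] {χ : E →⋆ₐ[ℂ] ℂ} {α β : AugFlow χ}

theorem AugFlow.map_conjFlow {X a : E} (t : ℝ) (ha : χ a = 0) : χ (α.conjFlow X t a) = 0 := by
  simp [conjFlow, ha]

theorem AugFlow.conjFlow_sub (X a b : E) (t : ℝ) :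
    α.conjFlow X t (a - b) = α.conjFlow X t a - α.conjFlow X t b := by
  simp only [conjFlow, mul_sub, sub_mul, map_sub]

theorem AugFlow.norm_conjFlow {X : E} (hX : X ∈ augUnitary χ) (a : E) (t : ℝ) :
    ‖α.conjFlow X t a‖ = ‖a‖ := by
  rw [conjFlow, augUnitary.norm_conj hX, norm_ext, augUnitary.norm_star_conj hX]

theorem AugFlow.conjFlow_one {X : E} (hX : X ∈ augUnitary χ) (t : ℝ) : α.conjFlow X t 1 = 1 := by
  rw [conjFlow, mul_one, augUnitary.star_mul_self hX, map_one, mul_one, augUnitary.mul_star_self hX]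

theorem AugFlow.star_coboundary (g : E) (t : ℝ) :
    star (α.coboundary g t) = α.ext t (α.coboundary g (-t)) := by
  simp only [coboundary, star_mul, map_mul, ext_ext_neg, ← map_star, star_star]

variable {S X S' X' : E}

/-- The first term is the α-coboundary of S^* S' X'^* X. Both terms have the form S^* S' X'^* · k ·
S c, where c is the α-coboundary of S^* X and k is one of the two conjugated flows at X' S'^*. These
flows fix 1, so it is enough that they nearly agree on X' S'^* - 1, which lies in the ideal. -/
theorem norm_coboundary_combination_sub (hS : S ∈ augUnitary χ) (hX : X ∈ augUnitary χ)
    (hS' : S' ∈ augUnitary χ) (hX' : X' ∈ augUnitary χ) (t : ℝ) :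
    ‖α.coboundary (star S * S' * star (star S' * X') * star (star S * S') * (star S * X)) t -
      star S * S' * star (β.coboundary (star S' * X') t) * star (star S * S') *
        α.coboundary (star S * X) t‖ =
      ‖α.conjFlow X t (X' * star S' - 1) - β.conjFlow X' t (X' * star S' - 1)‖ := by
  have hl : star S * S' * star X' ∈ augUnitary χ :=
    mul_mem (mul_mem (augUnitary.star_mem hS) hS') (augUnitary.star_mem hX')
  have hr : S * α.coboundary (star S * X) t ∈ augUnitary χ :=
    mul_mem hS (α.coboundary_mem (mul_mem (augUnitary.star_mem hS) hX) t)
  have h1 : α.coboundary (star S * S' * star (star S' * X') * star (star S * S') * (star S * X)) t =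
      star S * S' * star X' * α.conjFlow X t (X' * star S') * (S * α.coboundary (star S * X) t) := by
    simp only [AugFlow.coboundary, AugFlow.conjFlow, star_mul, star_star, map_mul, map_star, mul_assoc,
      augUnitary.mul_star_cancel hS, augUnitary.star_mul_cancel hX, augUnitary.mul_star_cancel hS',
      augUnitary.mul_star_cancel (α.ext_mem t hX)]
  have h2 : star S * S' * star (β.coboundary (star S' * X') t) * star (star S * S') *
        α.coboundary (star S * X) t =
      star S * S' * star X' * β.conjFlow X' t (X' * star S') * (S * α.coboundary (star S * X) t) := by
    simp only [AugFlow.coboundary, AugFlow.conjFlow, star_mul, star_star, map_mul, map_star, mul_assoc,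
      augUnitary.mul_star_cancel hS, augUnitary.star_mul_cancel hX', augUnitary.mul_star_cancel hS']
  rw [h1, h2, ← sub_mul, ← mul_sub, augUnitary.norm_mul_right hr, augUnitary.norm_mul_left hl,
    AugFlow.conjFlow_sub, AugFlow.conjFlow_sub, AugFlow.conjFlow_one hX, AugFlow.conjFlow_one hX',
    sub_sub_sub_cancel_right]

/-- Both terms are conjugates, by one and the same unitary, of the conjugated flows evaluated at S a
S^*. In the limit, where these flows agree, this becomes the perturbation formula. -/
theorem norm_combination_conj_sub (hS : S ∈ augUnitary χ) (hS' : S' ∈ augUnitary χ) (hX' : X' ∈ augUnitary χ) (t : ℝ) (a : E) {m : E}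
    (hm : m = star S * S' * star (β.coboundary (star S' * X') t) * star (star S * S') *
        α.coboundary (star S * X) t) :
    ‖m * α.ext t a * star m - star S * S' * β.ext t (star (star S * S') * a * (star S * S')) *
        star (star S * S')‖ =
      ‖α.conjFlow X t (S * a * star S) - β.conjFlow X' t (S * a * star S)‖ := by
  have hw : star S * S' * star (β.coboundary (star S' * X') t) * star S' ∈ augUnitary χ :=
    mul_mem (mul_mem (mul_mem (augUnitary.star_mem hS) hS') (augUnitary.star_mem
      (β.coboundary_mem (mul_mem (augUnitary.star_mem hS') hX') t))) (augUnitary.star_mem hS')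
  set w := star S * S' * star (β.coboundary (star S' * X') t) * star S' with hwdef
  have h1 : m * α.ext t a * star m = w * α.conjFlow X t (S * a * star S) * star w := by
    rw [hm, hwdef]
    simp only [AugFlow.coboundary, AugFlow.conjFlow, star_mul, star_star, map_mul, map_star, mul_assoc,
      augUnitary.mul_star_cancel hS]
  have h2 : star S * S' * β.ext t (star (star S * S') * a * (star S * S')) * star (star S * S') =
      w * β.conjFlow X' t (S * a * star S) * star w := by
    rw [hwdef]
    simp only [AugFlow.coboundary, AugFlow.conjFlow, star_mul, star_star, map_mul, map_star, mul_assoc,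
      augUnitary.star_mul_cancel hX', augUnitary.mul_star_cancel hS',
      augUnitary.mul_star_cancel (β.ext_mem t hX')]
  rw [h1, h2, ← sub_mul, ← mul_sub, augUnitary.norm_conj hw]

end Combination

/-! ### Limits of conjugations, coboundaries and conjugated flows -/

section Limits

variable {A : Type*} [NonUnitalCStarAlgebra A] {E : Type*} [CStarAlgebra E] {χ : E →⋆ₐ[ℂ] ℂ}

namespace AugModel

variable (M : AugModel A χ)

/-- `α` extends the flow `αf`. -/
def Extends (αf : CStarFlow A) (α : AugFlow χ) : Prop := ∀ t a, α.ext t (M.j a) = M.j (αf.aut t a)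

variable {M} {αf : CStarFlow A} {α : AugFlow χ}

theorem Extends.continuous (h : M.Extends αf α) : Continuous fun p : ℝ × A => αf.aut p.1 p.2 := by
  refine M.continuous_of_comp ?_
  simp_rw [← h _ _]
  exact α.continuous_ext_comp continuous_fst (M.isometry_j.continuous.comp continuous_snd)

theorem Extends.act_ext (h : M.Extends αf α) (t : ℝ) (x : E) (a : A) :
    M.act (α.ext t x) (αf.aut t a) = αf.aut t (M.act x a) :=
  M.j_injective (by rw [j_act, ← h, ← h, j_act, map_mul])

theorem Extends.aut_aut_neg (h : M.Extends αf α) (t : ℝ) (a : A) : αf.aut t (αf.aut (-t) a) = a :=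
  M.j_injective (by rw [← h, ← h, AugFlow.ext_ext_neg])

variable (M)

theorem continuous_act {P : ℝ → E} (hP : Continuous P) : Continuous fun p : ℝ × A => M.act (P p.1) p.2 := by
  refine M.continuous_of_comp ?_
  simp_rw [j_act]
  exact (hP.comp continuous_fst).mul (M.isometry_j.continuous.comp continuous_snd)

theorem exists_contConv_conj {U : ℕ → E} (hU : ∀ n, U n ∈ augUnitary χ) {d : ℕ → A} (hd : DenseRange d)
    (h : ∀ n : ℕ, ∀ k ≤ n, ‖U (n + 1) * M.j (d k) * star (U (n + 1)) - U n * M.j (d k) * star (U n)‖ ≤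
      (1 / 2 : ℝ) ^ n) : ∃ f, ContConv (fun n a => M.conj (U n) a) f := by
  obtain ⟨f, hf⟩ := exists_contConv (F := fun n (p : ℝ × A) => M.conj (U n) p.2)
    (fun n => M.continuous_of_comp (by
      simp_rw [j_conj]
      exact (continuous_const.mul (M.isometry_j.continuous.comp continuous_snd)).mul continuous_const))
    (fun n t a b => (M.norm_conj_sub (hU n) a b).le) hd
    (fun n k hk t _ => by
      dsimp only
      rw [← M.norm_j_sub, j_conj, j_conj]
      exact h n k hk)
  have h0 : ContConv (fun (_ : ℕ) (a : A) => ((0 : ℝ), a)) fun a => ((0 : ℝ), a) :=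
    ContConv.of_continuous (continuous_const.prodMk continuous_id)
  exact ⟨fun a => f (0, a), (hf.comp h0 :)⟩

theorem exists_contConv_act {P : ℕ → ℝ → E} (hPc : ∀ n, Continuous (P n))
    (hP : ∀ n t, P n t ∈ augUnitary χ) {d : ℕ → A} (hd : DenseRange d)
    (h : ∀ n : ℕ, ∀ k ≤ n, ∀ t ∈ Icc (-(n : ℝ)) n,
      ‖(P (n + 1) t - P n t) * M.j (d k)‖ ≤ (1 / 2 : ℝ) ^ n) :
    ∃ f, ContConv (fun n (p : ℝ × A) => M.act (P n p.1) p.2) f :=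
  exists_contConv (F := fun n (p : ℝ × A) => M.act (P n p.1) p.2) (fun n => M.continuous_act (hPc n))
    (fun n t a b => (M.norm_act_sub (hP n t) a b).le) hd
    (fun n k hk t ht => by rw [← M.norm_j_sub, j_act, j_act, ← sub_mul]; exact h n k hk t ht)

theorem exists_contConv_res {P : ℕ → ℝ → E} (hPc : ∀ n, Continuous (P n))
    (hP : ∀ n t, P n t ∈ augUnitary χ) {d : ℕ → A} (hd : DenseRange d) (h : ∀ n : ℕ, ∀ t ∈ Icc (-(n : ℝ)) n,
      ‖P (n + 1) t - P n t‖ ≤ (1 / 2 : ℝ) ^ n) :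
    ∃ f : ℝ → A, ContConv (fun n t => M.res (P n t - 1)) f := by
  have h0 : ∀ n t, χ (P n t - 1) = 0 := fun n t => by rw [map_sub, (hP n t).2, map_one, sub_self]
  obtain ⟨f, hf⟩ := exists_contConv (F := fun n (p : ℝ × A) => M.res (P n p.1 - 1))
    (fun n => M.continuous_of_comp (by
      simp_rw [M.j_res (h0 n _)]
      exact ((hPc n).comp continuous_fst).sub continuous_const))
    (fun n t a b => by simp) hd
    (fun n k _ t ht => by
      dsimp only
      rw [M.norm_res_sub (h0 _ _) (h0 _ _), sub_sub_sub_cancel_right]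
      exact h n t ht)
  have h1 : ContConv (fun (_ : ℕ) (t : ℝ) => (t, (0 : A))) fun t => (t, (0 : A)) :=
    ContConv.of_continuous (continuous_id.prodMk continuous_const)
  exact ⟨fun t => f (t, 0), hf.comp h1⟩

/-- A coboundary satisfies c_t^* = α_t(c_{-t}), so convergence of the adjoints needs no separate
hypothesis. -/
theorem contConv_act_star_coboundary (hα : M.Extends αf α) {g : ℕ → E} {f : ℝ × A → A}
    (hf : ContConv (fun n (p : ℝ × A) => M.act (α.coboundary (g n) p.1) p.2) f) :
    ContConv (fun n (p : ℝ × A) => M.act (star (α.coboundary (g n) p.1)) p.2)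
      fun p => αf.aut p.1 (f (-p.1, αf.aut (-p.1) p.2)) := by
  have hc := hα.continuous
  have h1 : ContConv (fun _ (p : ℝ × A) => (-p.1, αf.aut (-p.1) p.2)) fun p => (-p.1, αf.aut (-p.1) p.2) :=
    ContConv.of_continuous ((continuous_neg.comp continuous_fst).prodMk
      (hc.comp ((continuous_neg.comp continuous_fst).prodMk continuous_snd)))
  refine ((ContConv.of_continuous hc).comp ((ContConv.of_continuous continuous_fst).prodMk
    (hf.comp h1))).congr fun n p => ?_
  dsimp only
  rw [AugFlow.star_coboundary, ← hα.act_ext, hα.aut_aut_neg]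

theorem exists_contConv_conjFlow {θ : ℕ → AugFlow χ} {X : ℕ → E} (hX : ∀ n, X n ∈ augUnitary χ)
    {d : ℕ → A} (hd : DenseRange d) (h : ∀ n : ℕ, ∀ k ≤ n, ∀ t ∈ Icc (-(n : ℝ)) n,
      ‖(θ (n + 1)).conjFlow (X (n + 1)) t (M.j (d k)) - (θ n).conjFlow (X n) t (M.j (d k))‖ ≤
        (1 / 2 : ℝ) ^ n) :
    ∃ γ, ContConv (fun n (p : ℝ × A) => M.res ((θ n).conjFlow (X n) p.1 (M.j p.2))) γ := by
  have h0 : ∀ n t a, χ ((θ n).conjFlow (X n) t (M.j a)) = 0 := fun n t a =>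
    AugFlow.map_conjFlow t (M.map_j a)
  refine exists_contConv (F := fun n (p : ℝ × A) => M.res ((θ n).conjFlow (X n) p.1 (M.j p.2)))
    (fun n => M.continuous_of_comp ?_) (fun n t a b => ?_) hd (fun n k hk t ht => ?_)
  · simp_rw [M.j_res (h0 n _ _)]
    have := M.isometry_j.continuous
    exact (continuous_const.mul ((θ n).continuous_ext_comp continuous_fst (by fun_prop))).mul
      continuous_const
  · dsimp only
    rw [M.norm_res_sub (h0 n t a) (h0 n t b), ← AugFlow.conjFlow_sub, AugFlow.norm_conjFlow (hX n),
      M.norm_j_sub]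
  · dsimp only
    rw [M.norm_res_sub (h0 _ _ _) (h0 _ _ _)]
    exact h n k hk t ht

end AugModel

end Limits

/-! ### The limit cocycle and the limit automorphism -/

section CocycleLimit

variable {A : Type*} [NonUnitalCStarAlgebra A] {E : Type*} [CStarAlgebra E] {χ : E →⋆ₐ[ℂ] ℂ}

theorem contConv_zero_of_le {f : ℕ → ℝ × A → ℝ} (hf : ∀ n p, 0 ≤ f n p) {e : ℕ → ℝ}
    (he : Tendsto e atTop (𝓝 0))
    (h : ∀ n : ℕ, ∀ p : ℝ × A, p.1 ∈ Icc (-(n : ℝ)) n → f n p ≤ e n * ‖p.2‖) :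
    ContConv f fun _ => 0 := by
  rintro ⟨t₀, a₀⟩
  have h1 : Tendsto (fun q : ℕ × (ℝ × A) => e q.1 * ‖q.2.2‖) (atTop ×ˢ 𝓝 (t₀, a₀)) (𝓝 (0 * ‖a₀‖)) :=
    (he.comp tendsto_fst).mul (((continuous_snd.norm).tendsto (t₀, a₀)).comp tendsto_snd)
  rw [zero_mul] at h1
  refine squeeze_zero' (Eventually.of_forall fun q => hf _ _) ?_ h1
  obtain ⟨n₀, hn₀⟩ := exists_nat_ge (|t₀| + 1)
  have h2 : ∀ᶠ p : ℝ × A in 𝓝 (t₀, a₀), |p.1 - t₀| < 1 :=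
    (continuous_fst.tendsto (t₀, a₀)).eventually (Metric.ball_mem_nhds t₀ one_pos)
  filter_upwards [(eventually_ge_atTop n₀).prod_mk h2] with ⟨n, p⟩ ⟨hn, hp⟩
  have h3 : (n₀ : ℝ) ≤ n := by exact_mod_cast hn
  have h4 := abs_sub_abs_le_abs_sub p.1 t₀
  dsimp only at hp
  exact h n p ⟨by linarith [neg_abs_le p.1], by linarith [le_abs_self p.1]⟩

namespace AugModel

variable {M : AugModel A χ} {αf βf : CStarFlow A} {α β : AugFlow χ}

/-- A strict limit of coboundaries is a cocycle. -/
theorem isFlowCocycle_of_contConv (hα : M.Extends αf α) {G : ℕ → E} (hG : ∀ n, G n ∈ augUnitary χ)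
    {f g : ℝ × A → A} (hf : ContConv (fun n (p : ℝ × A) => M.act (α.coboundary (G n) p.1) p.2) f)
    (hg : ContConv (fun n (p : ℝ × A) => M.act (star (α.coboundary (G n) p.1)) p.2) g)
    {w : ℝ → 𝓜(ℂ, A)} (hw : ∀ t, w t ∈ unitary 𝓜(ℂ, A)) (hwf : ∀ t a, (w t).fst a = f (t, a))
    (hwg : ∀ t a, (w t).snd a = star (g (t, star a))) : IsFlowCocycle αf w where
  mem_unitary := hw
  continuous_left a := by
    simp_rw [hwf]
    exact hf.continuous.comp (continuous_id.prodMk continuous_const)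
  continuous_right a := by
    simp_rw [hwg]
    exact (hg.continuous.comp (continuous_id.prodMk continuous_const)).star
  cocycle s t := by
    refine multiplier_ext fun a => ?_
    rw [DoubleCentralizer.mul_fst, mul_apply_eq_comp, hwf, hwf]
    change f (s, αf.aut s ((w t).fst ((αf.aut s).symm a))) = _
    rw [hwf]
    have hc : Continuous fun a => αf.aut s a :=
      hα.continuous.comp (continuous_const.prodMk continuous_id)
    have hct : ∀ r : ℝ, ContConv (fun (_ : ℕ) (a : A) => (r, a)) fun a => (r, a) := fun r =>
      ContConv.of_continuous (continuous_const.prodMk continuous_id)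
    have h0 : ContConv (fun n (a : A) => αf.aut s (M.act (α.coboundary (G n) t) a))
        fun a => αf.aut s (f (t, a)) :=
      ((ContConv.of_continuous hc).comp (hf.comp (hct t)) :)
    have h1 : ContConv (fun n (a : A) => M.act (α.coboundary (G n) s)
        (αf.aut s (M.act (α.coboundary (G n) t) a))) fun a => f (s, αf.aut s (f (t, a))) :=
      (hf.comp ((hct s).comp h0) :)
    refine tendsto_nhds_unique (h1.tendsto ((αf.aut s).symm a)) ?_
    refine (hf.tendsto (s + t, a)).congr fun n => ?_
    dsimp only
    rw [α.coboundary_add (hG n), act_mul, ← hα.act_ext, StarAlgEquiv.apply_symm_apply]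

/-- In the limit, σ⁻¹γσ is the perturbation of α by W, and σ'⁻¹γσ' that of β by V, with τ = σ⁻¹ and
τ' = σ'⁻¹. Put ρ = σ⁻¹σ' = lim Ad(R_n) and ψ = ρ⁻¹; then ρβρ⁻¹ is the perturbation of α by w_t =
ρ(V_t)^* W_t, the limit of the unitaries m_n. The combination estimate lets m_n be replaced by the
coboundaries of G_n, which makes w at once a cocycle and an approximate coboundary. -/
theorem exists_cocyclePerturbation {N : Prop} (hα : M.Extends αf α) (hβ : M.Extends βf β)
    {S X S' X' : ℕ → E} (hS : ∀ n, S n ∈ augUnitary χ) (hX : ∀ n, X n ∈ augUnitary χ)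
    (hS' : ∀ n, S' n ∈ augUnitary χ) (hX' : ∀ n, X' n ∈ augUnitary χ) {σ τ σ' τ' : A → A}
    (hσ : ContConv (fun n a => M.conj (S n) a) σ)
    (hτ : ContConv (fun n a => M.conj (star (S n)) a) τ)
    (hσ' : ContConv (fun n a => M.conj (S' n) a) σ')
    (hτ' : ContConv (fun n a => M.conj (star (S' n)) a) τ') {W V γ : ℝ × A → A}
    (hW : ContConv (fun n (p : ℝ × A) => M.act (α.coboundary (star (S n) * X n) p.1) p.2) W)
    (hV : ContConv (fun n (p : ℝ × A) => M.act (β.coboundary (star (S' n) * X' n) p.1) p.2) V)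
    (hγ : ContConv (fun n (p : ℝ × A) => M.res (α.conjFlow (X n) p.1 (M.j p.2))) γ)
    (hγ' : ContConv (fun n (p : ℝ × A) => M.res (β.conjFlow (X' n) p.1 (M.j p.2))) γ)
    {e : ℕ → ℝ} (he : Tendsto e atTop (𝓝 0))
    (hXS : ∀ n : ℕ, ∀ t ∈ Icc (-(n : ℝ)) n, ‖α.conjFlow (X n) t (X' n * star (S' n) - 1) -
      β.conjFlow (X' n) t (X' n * star (S' n) - 1)‖ ≤ e n)
    (hN : N → ∃ p q : ℝ → A,
      ContConv (fun n t => M.res (α.coboundary (star (S n) * X n) t - 1)) p ∧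
      ContConv (fun n t => M.res (β.coboundary (star (S' n) * X' n) t - 1)) q) :
    ∃ (ψ : A ≃⋆ₐ[ℂ] A) (w : ℝ → 𝓜(ℂ, A)), IsCocyclePerturbationVia αf βf ψ w ∧
      ∃ r g : ℕ → E, (∀ n, r n ∈ augUnitary χ) ∧ (∀ n, g n ∈ augUnitary χ) ∧
        (∀ a, Tendsto (fun n => M.conj (r n) a) atTop (𝓝 (ψ a))) ∧
        (∀ (a : A) (ε : ℝ), 0 < ε → ∀ᶠ n in atTop, ∀ t ∈ Icc (-1 : ℝ) 1,
          ‖M.act (α.coboundary (g n) t) a - (w t).fst a‖ ≤ ε) ∧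
        (N → ∀ ε : ℝ, 0 < ε → ∀ᶠ n in atTop, ∀ t ∈ Icc (-1 : ℝ) 1, ∀ a : A,
          ‖M.act (α.coboundary (g n) t) a - (w t).fst a‖ ≤ ε * ‖a‖) := by
  set R : ℕ → E := fun n => star (S n) * S' n with hR
  set P : ℕ → ℝ → E := fun n t => α.coboundary (star (S n) * X n) t with hP
  set Q : ℕ → ℝ → E := fun n t => β.coboundary (star (S' n) * X' n) t with hQ
  set m : ℕ → ℝ → E := fun n t => R n * star (Q n t) * star (R n) * P n t with hm
  set G : ℕ → E := fun n => R n * star (star (S' n) * X' n) * star (R n) * (star (S n) * X n) with hG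
  have hRU : ∀ n, R n ∈ augUnitary χ := fun n => mul_mem (augUnitary.star_mem (hS n)) (hS' n)
  have hPU : ∀ n t, P n t ∈ augUnitary χ := fun n t =>
    α.coboundary_mem (mul_mem (augUnitary.star_mem (hS n)) (hX n)) t
  have hQU : ∀ n t, Q n t ∈ augUnitary χ := fun n t =>
    β.coboundary_mem (mul_mem (augUnitary.star_mem (hS' n)) (hX' n)) t
  have hmU : ∀ n t, m n t ∈ augUnitary χ := fun n t =>
    mul_mem (mul_mem (mul_mem (hRU n) (augUnitary.star_mem (hQU n t))) (augUnitary.star_mem (hRU n)))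
      (hPU n t)
  have hGU : ∀ n, G n ∈ augUnitary χ := fun n =>
    mul_mem (mul_mem (mul_mem (hRU n) (augUnitary.star_mem (mul_mem (augUnitary.star_mem (hS' n))
      (hX' n)))) (augUnitary.star_mem (hRU n))) (mul_mem (augUnitary.star_mem (hS n)) (hX n))
  have hρ : ContConv (fun n a => M.conj (R n) a) fun a => τ (σ' a) :=
    (hτ.comp hσ').congr fun n a => M.conj_mul _ _ _
  have hρi : ContConv (fun n a => M.conj (star (R n)) a) fun a => τ' (σ a) :=
    (hτ'.comp hσ).congr fun n a => by
      rw [← M.conj_mul, hR]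
      simp only [star_mul, star_star]
  obtain ⟨ψ, hψ, hψi⟩ := M.exists_starAlgEquiv (fun n => augUnitary.star_mem (hRU n)) hρi
    (by simpa only [star_star] using hρ)
  have hfst : ContConv (fun (_ : ℕ) (p : ℝ × A) => p.1) fun p => p.1 :=
    ContConv.of_continuous continuous_fst
  have hsnd : ContConv (fun (_ : ℕ) (p : ℝ × A) => p.2) fun p => p.2 :=
    ContConv.of_continuous continuous_snd
  have hWs : ContConv (fun n (p : ℝ × A) => M.act (star (P n p.1)) p.2) _ :=
    M.contConv_act_star_coboundary hα hW
  have hVs : ContConv (fun n (p : ℝ × A) => M.act (star (Q n p.1)) p.2) _ :=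
    M.contConv_act_star_coboundary hβ hV
  -- R_n itself is not known to converge, but Ad(R_n) does. Acting by R Q^* R^* P on a is the same
  -- as applying P, Ad(R^*), Q^* and Ad(R) in turn, since the surplus R^* and R on the right cancel.
  obtain ⟨f, hmf⟩ : ∃ f, ContConv (fun n (p : ℝ × A) => M.act (m n p.1) p.2) f :=
    ⟨_, (hρ.comp (hVs.comp (hfst.prodMk (hρi.comp hW)))).congr fun n p => M.j_injective (by
      simp only [j_act, j_conj, star_star, hm, hP, mul_assoc, augUnitary.mul_star_self (hRU n), mul_one])⟩
  obtain ⟨g, hmg⟩ : ∃ g, ContConv (fun n (p : ℝ × A) => M.act (star (m n p.1)) p.2) g :=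
    ⟨_, (hWs.comp (hfst.prodMk (hρ.comp (hV.comp (hfst.prodMk (hρi.comp hsnd)))))).congr fun n p =>
      M.j_injective (by
        simp only [j_act, j_conj, star_star, star_mul, hm, hQ, mul_assoc,
          augUnitary.mul_star_self (hRU n), mul_one])⟩
  have hcm : ∀ n : ℕ, ∀ t ∈ Icc (-(n : ℝ)) n, ‖α.coboundary (G n) t - m n t‖ ≤ e n := fun n t ht => by
    refine le_of_eq_of_le ?_ (hXS n t ht)
    exact norm_coboundary_combination_sub (hS n) (hX n) (hS' n) (hX' n) t
  have hpert : ∀ n t a, ‖m n t * α.ext t a * star (m n t) -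
      R n * β.ext t (star (R n) * a * R n) * star (R n)‖ =
      ‖α.conjFlow (X n) t (S n * a * star (S n)) - β.conjFlow (X' n) t (S n * a * star (S n))‖ :=
    fun n t a => norm_combination_conj_sub (hS n) (hS' n) (hX' n) t a rfl
  change N → ∃ p q : ℝ → A, ContConv (fun n t => M.res (P n t - 1)) p ∧
    ContConv (fun n t => M.res (Q n t - 1)) q at hN
  clear hWs hVs
  clear_value m G R P Q
  have hcf : ContConv (fun n (p : ℝ × A) => M.act (α.coboundary (G n) p.1) p.2) f := by
    refine hmf.of_dist (contConv_zero_of_le (fun _ _ => dist_nonneg) he fun n p hp => ?_)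
    rw [dist_comm, dist_eq_norm]
    exact (M.norm_act_sub_act _ _ _).trans (by gcongr; exact hcm n _ hp)
  have hcg : ContConv (fun n (p : ℝ × A) => M.act (star (α.coboundary (G n) p.1)) p.2) g := by
    refine hmg.of_dist (contConv_zero_of_le (fun _ _ => dist_nonneg) he fun n p hp => ?_)
    rw [dist_comm, dist_eq_norm]
    refine (M.norm_act_sub_act _ _ _).trans ?_
    rw [← star_sub, norm_star]
    gcongr
    exact hcm n _ hp
  obtain ⟨w, hw, hwf, hwg⟩ := M.exists_multiplier
    (fun n t => α.coboundary_mem (hGU n) t) hcf hcg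
  refine ⟨ψ, w, ⟨isFlowCocycle_of_contConv hα hGU hcf hcg hw hwf hwg, fun t a => ?_⟩,
    fun n => star (R n), G, fun n => augUnitary.star_mem (hRU n), hGU, fun a => ?_, fun a ε hε => ?_,
    fun hN' ε hε => ?_⟩
  · refine multiplier_ext fun b => ?_
    rw [DoubleCentralizer.mul_fst, DoubleCentralizer.mul_fst, mul_apply_eq_comp, mul_apply_eq_comp,
      DoubleCentralizer.coe_fst, DoubleCentralizer.coe_fst, DoubleCentralizer.star_fst, hwf, hwg,
      star_star, star_star, ContinuousLinearMap.mul_apply', ContinuousLinearMap.mul_apply']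
    have hcβ : Continuous fun a => βf.aut t a :=
      hβ.continuous.comp (continuous_const.prodMk continuous_id)
    have h1 : Tendsto (fun n => M.conj (R n) (βf.aut t (M.conj (star (R n)) a))) atTop
        (𝓝 (τ (σ' (βf.aut t (τ' (σ a)))))) :=
      (hρ.comp ((ContConv.of_continuous hcβ).comp hρi)).tendsto a
    have hct : ContConv (fun (_ : ℕ) (_ : A) => t) fun _ => t := ContConv.of_continuous continuous_const
    -- The norm of this difference is that of the difference of the two conjugated flows at
    -- Ad(S_n)(a), and both flows tend to γ there.
    have h2 : Tendsto (fun n => M.conj (m n t) (αf.aut t a) -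
        M.conj (R n) (βf.aut t (M.conj (star (R n)) a))) atTop (𝓝 0) := by
      have h3 := ((hγ.comp (hct.prodMk hσ)).tendsto a).sub ((hγ'.comp (hct.prodMk hσ)).tendsto a)
      rw [sub_self] at h3
      rw [tendsto_zero_iff_norm_tendsto_zero] at h3 ⊢
      refine h3.congr fun n => ?_
      have h0 : χ (S n * M.j a * star (S n)) = 0 := by simp [M.map_j]
      dsimp only
      rw [j_conj, M.norm_res_sub (AugFlow.map_conjFlow t h0) (AugFlow.map_conjFlow t h0),
        ← M.norm_j_sub, j_conj, j_conj, ← hα, ← hβ, j_conj, star_star]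
      exact (hpert n t (M.j a)).symm
    have h4 := h2.add h1
    simp only [sub_add_cancel, zero_add] at h4
    rw [hψ, hψi]
    have h5 : Tendsto (fun n => M.act (m n t) (αf.aut t a * M.act (star (m n t)) b)) atTop
        (𝓝 (f (t, αf.aut t a * g (t, b)))) := by
      have h6 : ContConv (fun n b => αf.aut t a * M.act (star (m n t)) b) fun b => αf.aut t a * g (t, b) :=
        ((ContConv.of_continuous (continuous_const_mul (αf.aut t a))).comp
          (hmg.comp (hct.prodMk (ContConv.of_continuous continuous_id))) :)
      exact ((hmf.comp (hct.prodMk h6)).tendsto b :)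
    refine tendsto_nhds_unique (h4.mul_const b) (h5.congr fun n => M.j_injective ?_)
    simp [mul_assoc]
  · rw [hψ]
    exact hρi.tendsto a
  · have h1 := hcf.eventually_forall_dist_lt (isCompact_Icc.prod isCompact_singleton :
      IsCompact (Icc (-1 : ℝ) 1 ×ˢ {a})) hε
    filter_upwards [h1] with n hn t ht
    rw [hwf, ← dist_eq_norm]
    exact (hn (t, a) ⟨ht, rfl⟩).le
  · obtain ⟨p, q, hp, hq⟩ := hN hN'
    have hP0 : ∀ n t, χ (P n t - 1) = 0 := fun n t => by rw [map_sub, (hPU n t).2, map_one, sub_self]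
    have hQ0 : ∀ n t, χ (Q n t - 1) = 0 := fun n t => by rw [map_sub, (hQU n t).2, map_one, sub_self]
    have hm0 : ∀ n t, χ (m n t - 1) = 0 := fun n t => by rw [map_sub, (hmU n t).2, map_one, sub_self]
    have hq' : ContConv (fun n t => M.conj (R n) (star (M.res (Q n t - 1)))) fun t => τ (σ' (star (q t))) :=
      (hρ.comp ((ContConv.of_continuous continuous_star).comp hq) :)
    -- With x = Ad(R)((Q - 1)^*) and y = P - 1 one has m - 1 = x + y + xy, so norm convergence
    -- passes to m.
    obtain ⟨z, hz⟩ : ∃ z : ℝ → A, ContConv (fun n t => M.res (m n t - 1)) z := by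
      have hc : Continuous fun x : A × A => x.1 + x.2 + x.1 * x.2 := by fun_prop
      have h1 := (ContConv.of_continuous hc).comp (hq'.prodMk hp)
      refine ⟨_, h1.congr fun n t => M.j_injective ?_⟩
      rw [M.j_res (hm0 n t), map_add, map_add, map_mul, M.j_res (hP0 n t), j_conj, map_star, M.j_res (hQ0 n t)]
      simp only [hm, star_sub, star_one, mul_sub, sub_mul, mul_one, one_mul,
        augUnitary.mul_star_self (hRU n)]
      abel
    have hzf : ∀ t a, f (t, a) = a + z t * a := fun t a => by
      refine tendsto_nhds_unique (hmf.tendsto (t, a))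
        (((hz.tendsto t).mul_const a).const_add a |>.congr fun n => M.j_injective ?_)
      rw [map_add, map_mul, M.j_res (hm0 n t), j_act]
      noncomm_ring
    have h1 := hz.eventually_forall_dist_lt (isCompact_Icc : IsCompact (Icc (-1 : ℝ) 1)) (half_pos hε)
    filter_upwards [h1, he.eventually_le_const (half_pos hε), eventually_ge_atTop 1] with n hn hen hn1 t ht a
    have hn1' : (1 : ℝ) ≤ n := by exact_mod_cast hn1
    have h2 : ‖M.act (α.coboundary (G n) t) a - M.act (m n t) a‖ ≤ ε / 2 * ‖a‖ :=
      (M.norm_act_sub_act _ _ _).trans (by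
        gcongr
        exact (hcm n t ⟨by linarith [ht.1], by linarith [ht.2]⟩).trans hen)
    have h3 : ‖M.act (m n t) a - (w t).fst a‖ ≤ ε / 2 * ‖a‖ := by
      have h4 : M.act (m n t) a - (w t).fst a = (M.res (m n t - 1) - z t) * a := by
        rw [hwf, hzf]
        have h5 : M.act (m n t) a = a + M.res (m n t - 1) * a := M.j_injective (by
          rw [map_add, map_mul, M.j_res (hm0 n t), j_act]
          noncomm_ring)
        rw [h5]
        noncomm_ring
      rw [h4]
      refine (norm_mul_le _ _).trans ?_
      gcongr
      have := (hn t ht).le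
      rwa [dist_eq_norm] at this
    have h4 := norm_sub_le_norm_sub_add_norm_sub (M.act (α.coboundary (G n) t) a) (M.act (m n t) a)
      ((w t).fst a)
    linarith

end AugModel

end CocycleLimit

/-! ### From equivalent coactions to cocycle conjugacy -/

section Classification

variable {A : Type*} [NonUnitalCStarAlgebra A] {E : Type*} [CStarAlgebra E] {χ : E →⋆ₐ[ℂ] ℂ}

/-- α occupies the even and β the odd places of the intertwining, with finite sets that exhaust a
dense sequence and errors 2^{-n}. -/
theorem AugModel.exists_cocycleConjugacy (M : AugModel A χ) [TopologicalSpace.SeparableSpace A]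
    {αf βf : CStarFlow A} {α β : AugFlow χ} (hα : M.Extends αf α) (hβ : M.Extends βf β)
    (hαR : α.HasRokhlin) (hβR : β.HasRokhlin) (hαβ : α.CoactionEquiv β) {L C : ℝ} {N : Prop}
    (hL0 : 0 ≤ L) (hL : HasWeakInnerLength χ L) (hC0 : 0 ≤ C) (hC : HasCentralLength χ N C) :
    ∃ (ψ : A ≃⋆ₐ[ℂ] A) (w : ℝ → 𝓜(ℂ, A)), IsCocyclePerturbationVia αf βf ψ w ∧
      ∃ r g : ℕ → E, (∀ n, r n ∈ augUnitary χ) ∧ (∀ n, g n ∈ augUnitary χ) ∧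
        (∀ a, Tendsto (fun n => M.conj (r n) a) atTop (𝓝 (ψ a))) ∧
        (∀ (a : A) (ε : ℝ), 0 < ε → ∀ᶠ n in atTop, ∀ t ∈ Icc (-1 : ℝ) 1,
          ‖M.act (α.coboundary (g n) t) a - (w t).fst a‖ ≤ ε) ∧
        (N → ∀ ε : ℝ, 0 < ε → ∀ᶠ n in atTop, ∀ t ∈ Icc (-1 : ℝ) 1, ∀ a : A,
          ‖M.act (α.coboundary (g n) t) a - (w t).fst a‖ ≤ ε * ‖a‖) := by
  classical
  obtain ⟨d, hd⟩ := TopologicalSpace.exists_dense_seq A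
  set θ : ℕ → AugFlow χ := fun n => if Even n then α else β with hθ
  have hθe : ∀ n, θ (2 * n + 2) = α := fun n => if_pos ⟨n + 1, by ring⟩
  have hθo : ∀ n, θ (2 * n + 1) = β := fun n => if_neg (by simp)
  set K : ℕ → Finset E := fun n => (Finset.range (n + 1)).image fun k => M.j (d k) with hK
  have hKmem : ∀ n k, k ≤ n → M.j (d k) ∈ K n := fun n k hk =>
    Finset.mem_image.2 ⟨k, by simp; omega, rfl⟩
  obtain ⟨X, S, hX, hS, hXS, hst⟩ := exists_intertwining (θ := θ) (N := N) (K := K)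
    (ε := fun n => (1 / 2 : ℝ) ^ n)
    (fun n => by simp only [hθ, Nat.even_add, even_two, iff_true])
    (fun n => by by_cases h : Even n <;> simp only [hθ, h, if_true, if_false] <;> assumption)
    (fun n => by
      by_cases h : Even n
      · simpa [hθ, h, Nat.even_add_one] using hαβ.symm
      · simpa [hθ, h, Nat.even_add_one] using hαβ) hL0 hL hC0 hC
    (by
      intro n a ha
      obtain ⟨k, -, rfl⟩ := Finset.mem_image.1 ha
      exact M.map_j _) (fun n => by positivity)
  have hpow : ∀ n i : ℕ, n ≤ i → (1 / 2 : ℝ) ^ i ≤ (1 / 2 : ℝ) ^ n := fun n i h =>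
    pow_le_pow_of_le_one (by norm_num) (by norm_num) h
  have hIcc : ∀ {n i : ℕ}, n ≤ i → ∀ {t : ℝ}, t ∈ Icc (-(n : ℝ)) n → t ∈ Icc (-(i : ℝ)) i := by
    intro n i h t ht
    have : (n : ℝ) ≤ i := by exact_mod_cast h
    exact ⟨by linarith [ht.1], by linarith [ht.2]⟩
  have conv : ∀ φ : ℕ → ℕ, (∀ n, φ (n + 1) = φ n + 2) → (∀ n, n ≤ φ n) → ∀ θ' : AugFlow χ,
      (∀ n, θ (φ n) = θ') →
      (∃ σ, ContConv (fun n a => M.conj (S (φ n)) a) σ) ∧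
      (∃ σ, ContConv (fun n a => M.conj (star (S (φ n))) a) σ) ∧
      (∃ W, ContConv (fun n (p : ℝ × A) =>
        M.act (θ'.coboundary (star (S (φ n)) * X (φ n)) p.1) p.2) W) ∧
      (N → ∃ p : ℝ → A, ContConv (fun n t =>
        M.res (θ'.coboundary (star (S (φ n)) * X (φ n)) t - 1)) p) := by
    intro φ hφ hφn θ' hθ'
    have hst' : ∀ n, IntertwiningStep θ' N (K (φ n)) (φ n : ℕ) ((1 / 2 : ℝ) ^ (φ n)) (X (φ n)) (S (φ n))
        (X (φ (n + 1))) (S (φ (n + 1))) := fun n => by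
      rw [hφ, ← hθ' n]
      exact hst (φ n)
    have hgU : ∀ n, star (S (φ n)) * X (φ n) ∈ augUnitary χ := fun n =>
      mul_mem (augUnitary.star_mem (hS _)) (hX _)
    refine ⟨M.exists_contConv_conj (fun n => hS _) hd fun n k hk => ?_,
      M.exists_contConv_conj (fun n => augUnitary.star_mem (hS _)) hd fun n k hk => ?_,
      M.exists_contConv_act (fun n => θ'.continuous_coboundary _) (fun n t => θ'.coboundary_mem (hgU n) t)
        hd fun n k hk t ht => ?_, fun hN =>
      M.exists_contConv_res (fun n => θ'.continuous_coboundary _)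
        (fun n t => θ'.coboundary_mem (hgU n) t) hd fun n t ht => ?_⟩
    · exact ((hst' n).conj _ (hKmem _ k (hk.trans (hφn n)))).trans (hpow _ _ (hφn n))
    · rw [star_star, star_star]
      exact ((hst' n).star_conj _ (hKmem _ k (hk.trans (hφn n)))).trans (hpow _ _ (hφn n))
    · exact ((hst' n).coboundary _ (hKmem _ k (hk.trans (hφn n))) t (hIcc (hφn n) ht)).trans
        (hpow _ _ (hφn n))
    · exact ((hst' n).norm_coboundary hN t (hIcc (hφn n) ht)).trans (hpow _ _ (hφn n))
  -- The index 2n + 2 for α is paired with 2n + 1 for β, since stage 2n + 1 compares exactly these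
  -- two flows on X S^* - 1 with X and S of index 2n + 1.
  obtain ⟨⟨σ, hσ⟩, ⟨τ, hτ⟩, ⟨W, hW⟩, hN1⟩ := conv (fun n => 2 * n + 2) (fun n => by ring)
    (fun n => by omega) α hθe
  obtain ⟨⟨σ', hσ'⟩, ⟨τ', hτ'⟩, ⟨V, hV⟩, hN2⟩ := conv (fun n => 2 * n + 1) (fun n => by ring)
    (fun n => by omega) β hθo
  obtain ⟨γ, hγ⟩ := M.exists_contConv_conjFlow (θ := θ) hX hd
    fun n k hk t ht => hXS n _ (Or.inl (hKmem n k hk)) t ht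
  have ht2 : Tendsto (fun n : ℕ => 2 * n + 2) atTop atTop :=
    tendsto_atTop_mono (fun n => by omega : ∀ n : ℕ, n ≤ 2 * n + 2) tendsto_id
  have ht1 : Tendsto (fun n : ℕ => 2 * n + 1) atTop atTop :=
    tendsto_atTop_mono (fun n => by omega : ∀ n : ℕ, n ≤ 2 * n + 1) tendsto_id
  refine exists_cocyclePerturbation (S := fun n => S (2 * n + 2)) (X := fun n => X (2 * n + 2))
    (S' := fun n => S (2 * n + 1)) (X' := fun n => X (2 * n + 1)) hα hβ (fun n => hS _) (fun n => hX _)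
    (fun n => hS _) (fun n => hX _) hσ hτ hσ' hτ' hW hV (γ := γ) ?_ ?_
    (e := fun n => (1 / 2 : ℝ) ^ (2 * n + 1)) ?_ (fun n t ht => ?_) ?_
  · have := hγ.comp_tendsto ht2
    simpa only [hθe] using this
  · have := hγ.comp_tendsto ht1
    simpa only [hθo] using this
  · exact (tendsto_pow_atTop_nhds_zero_of_lt_one (by norm_num) (by norm_num)).comp ht1
  · have := hXS (2 * n + 1) _ (Or.inr rfl) t (hIcc (by omega) ht)
    rwa [hθo, show 2 * n + 1 + 1 = 2 * n + 2 from rfl, hθe] at this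
  · intro hN
    obtain ⟨p, hp⟩ := hN1 hN
    obtain ⟨q, hq⟩ := hN2 hN
    exact ⟨p, q, hp, hq⟩

end Classification

/-! ### Unitaries that agree with module isometries on prescribed elements -/

section StrictPaths

variable {A : Type*} [NonUnitalCStarAlgebra A]

/-- An additive isometry of the Hilbert module `A` over `A`. -/
structure IsModuleIsometry (T : A → A) : Prop where
  map_sub (a b : A) : T (a - b) = T a - T b
  map_mul (a b : A) : T (a * b) = T a * b
  inner (a b : A) : star (T a) * T b = star a * b

namespace IsModuleIsometry

variable {T T' : A → A}

theorem norm (hT : IsModuleIsometry T) (a : A) : ‖T a‖ = ‖a‖ := by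
  have h : ‖T a‖ * ‖T a‖ = ‖a‖ * ‖a‖ := by
    rw [← CStarRing.norm_star_mul_self, ← CStarRing.norm_star_mul_self, hT.inner]
  exact (mul_self_inj (norm_nonneg _) (norm_nonneg _)).1 h

theorem norm_sub (hT : IsModuleIsometry T) (a b : A) : ‖T a - T b‖ = ‖a - b‖ := by
  rw [← hT.map_sub, hT.norm]

theorem comp (hT : IsModuleIsometry T) (hT' : IsModuleIsometry T') :
    IsModuleIsometry fun a => T (T' a) :=
  ⟨fun a b => by rw [hT'.map_sub, hT.map_sub], fun a b => by rw [hT'.map_mul, hT.map_mul],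
    fun a b => by rw [hT.inner, hT'.inner]⟩

/-- `(T - 1) e + e' (T - 1) - e' (T - 1) e`, where `e' = T e T^*`. -/
def correction (T : A → A) (e : A) : A :=
  (T e - e) + (T e - T (star (T e))) - (T e - T (star (T e))) * e

theorem norm_correction_le (hT : IsModuleIsometry T) {e : A} (he : star e = e) (he1 : ‖e‖ ≤ 1)
    {η : ℝ} (h : ‖T e - e‖ ≤ η) : ‖correction T e‖ ≤ 3 * η := by
  have h1 : ‖T e - T (star (T e))‖ ≤ η := by
    rw [hT.norm_sub, ← norm_star, star_sub, star_star, he, norm_sub_rev]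
    exact h
  have h2 : ‖(T e - T (star (T e))) * e‖ ≤ η := by
    refine (norm_mul_le _ _).trans ?_
    nlinarith [norm_nonneg e, norm_nonneg (T e - T (star (T e)))]
  unfold correction
  have h3 := norm_sub_le ((T e - e) + (T e - T (star (T e)))) ((T e - T (star (T e))) * e)
  have h4 := norm_add_le (T e - e) (T e - T (star (T e)))
  linarith

/-- On y = e y the terms containing T e T^* cancel. They are there for the adjoint: with T e - e
alone, the adjoint of 1 + `correction T e` would not take T y back to y. -/
theorem correction_mul (hT : IsModuleIsometry T) {e y : A} (hy : e * y = y) :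
    y + correction T e * y = T y := by
  have h1 : T e * y = T y := by rw [← hT.map_mul, hy]
  simp only [correction, sub_mul, add_mul, mul_assoc, hy, h1]
  abel

theorem star_correction_mul (hT : IsModuleIsometry T) {e y : A} (he : star e = e) (hy : e * y = y) :
    T y + star (correction T e) * T y = y := by
  have h1 : T e * y = T y := by rw [← hT.map_mul, hy]
  have h2 : star (T e) * T y = y := by rw [hT.inner, he, hy]
  have h3 : star (T (star (T e))) * T y = T y := by rw [hT.inner, star_star, h1]
  simp only [correction, star_sub, star_add, star_mul, he, sub_mul, add_mul, mul_assoc, h2, h3, hy]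
  abel

end IsModuleIsometry

theorem eq_zero_of_forall_mul_eq_zero {z : A} (h : ∀ x : A, x * z = 0) : z = 0 :=
  CStarRing.star_mul_self_eq_zero_iff z |>.1 (h _)

theorem multiplier_fst_mul (m : 𝓜(ℂ, A)) (a b : A) : m.fst (a * b) = m.fst a * b := by
  rw [← sub_eq_zero]
  refine eq_zero_of_forall_mul_eq_zero fun x => ?_
  rw [mul_sub, ← m.central, ← mul_assoc x, ← m.central, mul_assoc, sub_self]

theorem isModuleIsometry_fst {m : 𝓜(ℂ, A)} (hm : m ∈ unitary 𝓜(ℂ, A)) :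
    IsModuleIsometry fun a => m.fst a where
  map_sub a b := map_sub m.fst a b
  map_mul a b := multiplier_fst_mul m a b
  inner a b := by
    have h1 := congrArg (fun x : 𝓜(ℂ, A) => x.fst a) (Unitary.star_mul_self_of_mem hm)
    simp only [DoubleCentralizer.mul_fst, mul_apply_eq_comp, DoubleCentralizer.star_fst,
      DoubleCentralizer.one_fst, one_apply_eq_self] at h1
    rw [← m.central, ← star_star (m.snd _), h1]

theorem star_fst_fst {m : 𝓜(ℂ, A)} (hm : m ∈ unitary 𝓜(ℂ, A)) (a : A) :
    (star m).fst (m.fst a) = a := by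
  have h1 := congrArg (fun x : 𝓜(ℂ, A) => x.fst a) (Unitary.star_mul_self_of_mem hm)
  simpa only [DoubleCentralizer.mul_fst, mul_apply_eq_comp, DoubleCentralizer.one_fst,
    one_apply_eq_self] using h1

theorem continuous_of_isometry_family {X : Type*} [TopologicalSpace X] {U : X → A → A}
    (hU : ∀ x a b, ‖U x a - U x b‖ = ‖a - b‖) (hc : ∀ a, Continuous fun x => U x a) :
    Continuous fun p : X × A => U p.1 p.2 := by
  rw [continuous_iff_continuousAt]
  rintro ⟨x, a⟩
  rw [ContinuousAt, tendsto_iff_norm_sub_tendsto_zero]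
  have h1 : Tendsto (fun p : X × A => ‖p.2 - a‖ + ‖U p.1 a - U x a‖) (𝓝 (x, a))
      (𝓝 (‖a - a‖ + ‖U x a - U x a‖)) :=
    ((continuous_snd.sub continuous_const).norm.add
      (((hc a).comp continuous_fst).sub continuous_const).norm).tendsto (x, a)
  simp only [sub_self, norm_zero, add_zero] at h1
  refine squeeze_zero (fun _ => norm_nonneg _) (fun p => ?_) h1
  have := norm_sub_le_norm_sub_add_norm_sub (U p.1 p.2) (U p.1 a) (U x a)
  rwa [hU] at this

section Local

variable {X : Type*} [TopologicalSpace X] [CompactSpace X] {E : Type*} [CStarAlgebra E]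
  {χ : E →⋆ₐ[ℂ] ℂ} (M : AugModel A χ)

/-- The composition of the character `χ` with the evaluation at `x`. -/
def evalCharacter (χ : E →⋆ₐ[ℂ] ℂ) (x : X) : C(X, E) →⋆ₐ[ℂ] ℂ where
  toFun f := χ (f x)
  map_one' := map_one χ
  map_mul' f g := map_mul χ (f x) (g x)
  map_zero' := map_zero χ
  map_add' f g := map_add χ (f x) (g x)
  commutes' c := by
    change χ (algebraMap ℂ E c) = algebraMap ℂ ℂ c
    exact AlgHomClass.commutes χ c
  map_star' f := map_star χ (f x)

/-- A family of module isometries that is close to the identity on `e` agrees with a family of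
unitaries on the elements fixed by `e`. -/
theorem AugModel.exists_augUnitary_eq (T : X → A → A) (hT : ∀ x, IsModuleIsometry (T x))
    (hTc : Continuous fun p : X × A => T p.1 p.2) {e y : X → A} (hec : Continuous e)
    (hyc : Continuous y) (he : ∀ x, star (e x) = e x) (he1 : ∀ x, ‖e x‖ ≤ 1)
    (hey : ∀ x, e x * y x = y x) (h : ∀ x, ‖T x (e x) - e x‖ ≤ 1 / 24) :
    ∃ v : C(X, E), (∀ x, v x ∈ augUnitary χ) ∧ ∀ x, v x * M.j (y x) = M.j (T x (y x)) := by
  have hjc := M.isometry_j.continuous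
  have h1 : Continuous fun x => T x (e x) := hTc.comp (continuous_id.prodMk hec)
  have h2 : Continuous fun x => T x (star (T x (e x))) := hTc.comp (continuous_id.prodMk h1.star)
  have hkc : Continuous fun x => IsModuleIsometry.correction (T x) (e x) :=
    ((h1.sub hec).add (h1.sub h2)).sub ((h1.sub h2).mul hec)
  set k : C(X, E) := ⟨fun x => M.j (IsModuleIsometry.correction (T x) (e x)), hjc.comp hkc⟩ with hk
  -- The factor 3 of `norm_correction_le` turns 1/24 into 1/8, which is small enough for the polar
  -- decomposition of 1 + k.
  have hkn : ‖k‖ ≤ 1 / 8 := by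
    rw [ContinuousMap.norm_le _ (by norm_num)]
    intro x
    refine (M.norm_j _).le.trans (((hT x).norm_correction_le (he x) (he1 x) (h x)).trans ?_)
    norm_num
  have hskn : ‖star k‖ ≤ 1 / 8 := by rwa [norm_star]
  have h3 : ‖star (1 + k) * (1 + k) - 1‖ ≤ 1 / 2 := by
    have : star (1 + k) * (1 + k) - 1 = star k + k + star k * k := by
      rw [star_add, star_one]; noncomm_ring
    rw [this]
    have h4 := norm_add_le (star k + k) (star k * k)
    have h5 := norm_add_le (star k) k
    have h6 := norm_mul_le (star k) k
    nlinarith [norm_nonneg k, norm_nonneg (star k)]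
  have h3' : ‖(1 + k) * star (1 + k) - 1‖ ≤ 1 / 2 := by
    have : (1 + k) * star (1 + k) - 1 = star k + k + k * star k := by
      rw [star_add, star_one]; noncomm_ring
    rw [this]
    have h4 := norm_add_le (star k + k) (k * star k)
    have h5 := norm_add_le (star k) k
    have h6 := norm_mul_le k (star k)
    nlinarith [norm_nonneg k, norm_nonneg (star k)]
  -- Polar decomposition is carried out in C(X, E), so that continuity in x is automatic;
  -- augmentation one is checked with the evaluation characters.
  obtain ⟨v, hv, hvχ, -, hve⟩ := exists_unitary_near h3 h3'
  refine ⟨v, fun x => ⟨?_, ?_⟩, ?_⟩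
  · rw [Unitary.mem_iff] at hv ⊢
    exact ⟨congrArg (fun f : C(X, E) => f x) hv.1, congrArg (fun f : C(X, E) => f x) hv.2⟩
  · refine hvχ (evalCharacter χ x) ?_
    change χ (1 + M.j _) = 1
    rw [map_add, map_one, M.map_j, add_zero]
  · have hT1 : ∀ x, (1 + k x) * M.j (y x) = M.j (T x (y x)) := fun x => by
      rw [add_mul, one_mul, ← (hT x).correction_mul (hey x), map_add, map_mul]
      rfl
    -- (1 + k)^*(1 + k) fixes y, hence the unitary part of 1 + k agrees with 1 + k on y.
    have h4 := hve ⟨fun x => M.j (y x), hjc.comp hyc⟩ (by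
      ext x
      change star (1 + k x) * (1 + k x) * M.j (y x) = M.j (y x)
      rw [mul_assoc, hT1, star_add, star_one, add_mul, one_mul]
      conv_rhs => rw [← (hT x).star_correction_mul (he x) (hey x), map_add, map_mul, map_star]
      rfl)
    intro x
    rw [← hT1]
    exact congrArg (fun f : C(X, E) => f x) h4

end Local

end StrictPaths

/-! ### Local units for compact sets -/

section LocalUnits

variable {A : Type*} [NonUnitalCStarAlgebra A]

/-- Functional calculus on a member e of an approximate unit: f₀ vanishes on [-η, η] and stays
within η of the identity function, while f₁ equals 1 off [-η, η]. Hence f₁ f₀ = f₀, an exact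
relation that members of an approximate unit need not satisfy. -/
theorem exists_local_unit {K : Set A} (hK : IsCompact K) {δ : ℝ} (hδ : 0 < δ) :
    ∃ e₀ e₁ : A, star e₀ = e₀ ∧ star e₁ = e₁ ∧ ‖e₀‖ ≤ 1 ∧ ‖e₁‖ ≤ 1 ∧ e₁ * e₀ = e₀ ∧
      ∀ y ∈ K, ‖e₀ * y - y‖ ≤ δ ∧ ‖y * e₀ - y‖ ≤ δ := by
  let _ := CStarAlgebra.spectralOrder A
  have := CStarAlgebra.spectralOrderedRing A
  have hl := CStarAlgebra.increasingApproximateUnit A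
  have := hl.neBot
  obtain ⟨B, hB⟩ : ∃ B : ℝ, ∀ y ∈ K, ‖y‖ ≤ B := hK.isBounded.exists_norm_le
  obtain ⟨F, hFK, hF⟩ := hK.exists_finset_net (show 0 < δ / 8 by positivity)
  have h1 : ∀ᶠ e in CStarAlgebra.approximateUnit A, ∀ y ∈ F, ‖e * y - y‖ < δ / 4 ∧ ‖y * e - y‖ < δ / 4 := by
    refine (Filter.eventually_all_finset F).2 fun y _ => ?_
    have h2 := Metric.tendsto_nhds.1 (hl.tendsto_mul_right y) (δ / 4) (by positivity)
    have h3 := Metric.tendsto_nhds.1 (hl.tendsto_mul_left y) (δ / 4) (by positivity)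
    filter_upwards [h2, h3] with e he he'
    rw [dist_eq_norm] at he he'
    exact ⟨he, he'⟩
  obtain ⟨e, heF, he0, he1⟩ := (h1.and (hl.eventually_nonneg.and hl.eventually_norm)).exists
  have hsa : IsSelfAdjoint e := IsSelfAdjoint.of_nonneg he0
  have heK : ∀ y ∈ K, ‖e * y - y‖ ≤ δ / 2 ∧ ‖y * e - y‖ ≤ δ / 2 := by
    intro y hy
    obtain ⟨x, hx, hyx⟩ := hF y hy
    obtain ⟨h2, h3⟩ := heF x hx
    constructor
    · have h4 : e * y - y = e * (y - x) + (e * x - x) - (y - x) := by noncomm_ring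
      rw [h4]
      have h5 := norm_sub_le (e * (y - x) + (e * x - x)) (y - x)
      have h6 := norm_add_le (e * (y - x)) (e * x - x)
      have h7 := norm_mul_le e (y - x)
      nlinarith [norm_nonneg e, norm_nonneg (y - x)]
    · have h4 : y * e - y = (y - x) * e + (x * e - x) - (y - x) := by noncomm_ring
      rw [h4]
      have h5 := norm_sub_le ((y - x) * e + (x * e - x)) (y - x)
      have h6 := norm_add_le ((y - x) * e) (x * e - x)
      have h7 := norm_mul_le (y - x) e
      nlinarith [norm_nonneg e, norm_nonneg (y - x)]
  set η : ℝ := δ / (2 * (|B| + 1)) with hη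
  have hη0 : 0 < η := by positivity
  have hηB : η * |B| ≤ δ / 2 := by
    rw [hη, div_mul_eq_mul_div, div_le_div_iff₀ (by positivity) (by positivity)]
    nlinarith [abs_nonneg B]
  let f₀ : ℝ → ℝ := fun t => t - max (-η) (min η t)
  let f₁ : ℝ → ℝ := fun t => min 1 (|t| / η)
  have hf₀c : Continuous f₀ := by fun_prop
  have hf₁c : Continuous f₁ := by fun_prop
  have hf₀0 : f₀ 0 = 0 := by simp [f₀, hη0.le]
  have hf₁0 : f₁ 0 = 0 := by simp [f₁]
  have hf₁₀ : (fun t => f₁ t * f₀ t) = f₀ := by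
    funext t
    by_cases ht : |t| ≤ η
    · have h2 : f₀ t = 0 := by
        obtain ⟨h3, h4⟩ := abs_le.1 ht
        simp only [f₀, min_eq_right h4, max_eq_right h3, sub_self]
      rw [h2, mul_zero]
    · have h2 : f₁ t = 1 := min_eq_left ((one_le_div hη0).2 (not_le.1 ht).le)
      rw [h2, one_mul]
  have hf₀t : ∀ t, |f₀ t - t| ≤ η := fun t => by
    simp only [f₀, sub_sub_cancel_left, abs_neg]
    exact abs_le.2 ⟨le_max_left _ _, max_le (by linarith) (min_le_left _ _)⟩
  have hf₀n : ∀ t, |f₀ t| ≤ |t| := fun t => by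
    simp only [f₀]
    rcases le_total 0 t with ht | ht
    · rw [max_eq_right (le_min (by linarith) (by linarith)), abs_of_nonneg ht,
        abs_of_nonneg (by linarith [min_le_right η t])]
      linarith [le_min hη0.le ht]
    · rw [min_eq_right (by linarith), abs_of_nonpos ht,
        abs_of_nonpos (by linarith [le_max_right (-η) t])]
      linarith [max_le (by linarith : -η ≤ 0) ht]
  have h0e : ‖cfcₙ f₀ e - e‖ ≤ η := by
    nth_rewrite 2 [← cfcₙ_id ℝ e hsa]
    rw [← cfcₙ_sub f₀ id e hf₀c.continuousOn hf₀0 continuous_id.continuousOn rfl]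
    exact norm_cfcₙ_le fun x _ => hf₀t x
  have h0n : ‖cfcₙ f₀ e‖ ≤ 1 := by
    refine norm_cfcₙ_le fun x hx => (hf₀n x).trans ?_
    have h2 := norm_apply_le_norm_cfcₙ (id : ℝ → ℝ) e hx
    rw [cfcₙ_id ℝ e hsa] at h2
    exact h2.trans he1
  refine ⟨cfcₙ f₀ e, cfcₙ f₁ e, (cfcₙ_predicate f₀ e).star_eq, (cfcₙ_predicate f₁ e).star_eq, h0n, ?_, ?_,
    fun y hy => ?_⟩
  · refine norm_cfcₙ_le fun x _ => ?_
    rw [Real.norm_eq_abs, abs_of_nonneg (le_min zero_le_one (by positivity))]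
    exact min_le_left _ _
  · rw [← cfcₙ_mul f₁ f₀ e hf₁c.continuousOn hf₁0 hf₀c.continuousOn hf₀0, hf₁₀]
  · have hyB : ‖y‖ ≤ |B| := (hB y hy).trans (le_abs_self B)
    have hm : ‖cfcₙ f₀ e - e‖ * ‖y‖ ≤ δ / 2 :=
      (mul_le_mul h0e hyB (norm_nonneg _) hη0.le).trans hηB
    obtain ⟨h2, h3⟩ := heK y hy
    constructor
    · have h4 : cfcₙ f₀ e * y - y = (cfcₙ f₀ e - e) * y + (e * y - y) := by noncomm_ring
      rw [h4]
      linarith [norm_add_le ((cfcₙ f₀ e - e) * y) (e * y - y), norm_mul_le (cfcₙ f₀ e - e) y]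
    · have h4 : y * cfcₙ f₀ e - y = y * (cfcₙ f₀ e - e) + (y * e - y) := by noncomm_ring
      rw [h4]
      linarith [norm_add_le (y * (cfcₙ f₀ e - e)) (y * e - y), norm_mul_le y (cfcₙ f₀ e - e)]

theorem norm_coe_multiplier (a : A) : ‖(a : 𝓜(ℂ, A))‖ = ‖a‖ := by
  rw [← DoubleCentralizer.norm_fst, DoubleCentralizer.coe_fst, ContinuousLinearMap.opNorm_mul_apply]

end LocalUnits

/-! ### Replacing paths of multipliers by paths of unitaries -/

section CocyclePath

variable {A : Type*} [NonUnitalCStarAlgebra A] {E : Type*} [CStarAlgebra E] {χ : E →⋆ₐ[ℂ] ℂ}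
  (M : AugModel A χ)

/-- The element in question is U e U^*. Since only U is at hand, self-adjointness is tested against
the range of U, which is everything. -/
theorem IsModuleIsometry.star_conj_eq {U : A → A} (hU : IsModuleIsometry U)
    (hs : Function.Surjective U) {e : A} (he : star e = e) :
    star (U (star (U e))) = U (star (U e)) := by
  rw [← sub_eq_zero]
  refine eq_zero_of_forall_mul_eq_zero fun x => ?_
  obtain ⟨b, hb⟩ := hs (star x)
  have h1 : star (U (star (U e))) * U b = U (e * b) := by rw [hU.inner, star_star, hU.map_mul]
  have h2 : U (star (U e)) * U b = U (e * b) := by rw [← hU.map_mul, hU.inner, he]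
  rw [← star_eq_zero, star_mul, ← hb, star_sub, star_star, sub_mul, h1, h2, sub_self]

/-- A strictly continuous path of unitary multipliers starting at `1` agrees on a prescribed element
with a path of unitaries. -/
theorem AugModel.exists_path_mul_eq {w : ℝ → 𝓜(ℂ, A)} (hw : ∀ t, w t ∈ unitary 𝓜(ℂ, A))
    (hwf : ∀ a, Continuous fun t => (w t).fst a) (hws : ∀ a, Continuous fun t => (w t).snd a)
    (hw0 : ∀ a, (w 0).fst a = a) {e₀ e₁ : A} (he : star e₁ = e₁) (he1 : ‖e₁‖ ≤ 1)
    (he10 : e₁ * e₀ = e₀) :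
    ∃ z : C(unitInterval, E), (∀ t, z t ∈ augUnitary χ) ∧
      ∀ t : unitInterval, z t * M.j e₀ = M.j ((w t).fst e₀) := by
  have hU : ∀ t, IsModuleIsometry fun a => (w t).fst a := fun t => isModuleIsometry_fst (hw t)
  have hU' : ∀ t, IsModuleIsometry fun a => (star (w t)).fst a := fun t =>
    isModuleIsometry_fst (Unitary.star_mem (hw t))
  have hUs : ∀ t a, (star (w t)).fst ((w t).fst a) = a := fun t a => star_fst_fst (hw t) a
  have hsU : ∀ t a, (w t).fst ((star (w t)).fst a) = a := fun t a => by
    have := star_fst_fst (Unitary.star_mem (hw t)) a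
    rwa [star_star] at this
  have hc : Continuous fun p : ℝ × A => (w p.1).fst p.2 :=
    continuous_of_isometry_family (fun t a b => (hU t).norm_sub a b) hwf
  have hc' : Continuous fun p : ℝ × A => (star (w p.1)).fst p.2 :=
    continuous_of_isometry_family (fun t a b => (hU' t).norm_sub a b) fun a => by
      simp_rw [DoubleCentralizer.star_fst]
      exact (hws (star a)).star
  -- H(a, b, t) is w_{at} e₁ w_{bt}^*; uniform continuity on the cube determines the number of
  -- steps.
  set H : ℝ × ℝ × ℝ → A := fun p => (w (p.1 * p.2.2)).fst (star ((w (p.2.1 * p.2.2)).fst e₁)) with hH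
  have hHc : Continuous H :=
    hc.comp ((by fun_prop : Continuous fun p : ℝ × ℝ × ℝ => p.1 * p.2.2).prodMk
      (hc.comp ((by fun_prop : Continuous fun p : ℝ × ℝ × ℝ => p.2.1 * p.2.2).prodMk
        continuous_const)).star)
  obtain ⟨δ, hδ, hHδ⟩ := Metric.uniformContinuousOn_iff.1
    ((isCompact_Icc.prod (isCompact_Icc.prod isCompact_Icc)).uniformContinuousOn_of_continuous
      (s := Icc (0 : ℝ) 1 ×ˢ Icc (0 : ℝ) 1 ×ˢ Icc (0 : ℝ) 1) hHc.continuousOn) (1 / 24) (by norm_num)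
  obtain ⟨N, hN⟩ := exists_nat_one_div_lt hδ
  have hNpos : (0 : ℝ) < N + 1 := by positivity
  have key : ∀ i : ℕ, i ≤ N + 1 → ∃ z : C(unitInterval, E), (∀ t, z t ∈ augUnitary χ) ∧
      ∀ t : unitInterval, z t * M.j e₀ = M.j ((w (i / (N + 1) * t)).fst e₀) := by
    intro i
    induction i with
    | zero =>
      intro _
      exact ⟨1, fun t => one_mem _, fun t => by simp [hw0]⟩
    | succ i ih =>
      intro hi
      obtain ⟨z, hz, hze⟩ := ih (by omega)
      have hi1 : ((i : ℝ) + 1) / (N + 1) ≤ 1 := by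
        rw [div_le_one hNpos]; exact_mod_cast hi
      have hi0 : (i : ℝ) / (N + 1) ≤ 1 :=
        le_trans (by gcongr; linarith) hi1
      set s : ℝ := i / (N + 1) with hs
      set s' : ℝ := ((i : ℝ) + 1) / (N + 1) with hs'
      have hs0 : 0 ≤ s := by positivity
      have hs'0 : 0 ≤ s' := by positivity
      have hss : |s' - s| < δ := by
        rw [hs, hs', ← sub_div, add_sub_cancel_left, abs_of_pos (by positivity)]
        exact hN
      -- Induction along s ↦ w_{st}, which deforms 1 into w_t. The new factor v agrees with w_{s't}
      -- w_{st}^* on w_{st} e₀; there w_{st} e₁ w_{st}^* serves as local unit, and the step s' - s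
      -- is so short that left multiplication by w_{s't} w_{st}^* moves it by at most 1/24.
      obtain ⟨v, hv, hve⟩ := M.exists_augUnitary_eq (X := unitInterval)
        (fun t a => (w (s' * t)).fst ((star (w (s * t))).fst a))
        (fun t => (hU (s' * t)).comp (hU' (s * t)))
        (hc.comp ((by fun_prop : Continuous fun p : unitInterval × A => s' * (p.1 : ℝ)).prodMk
          (hc'.comp ((by fun_prop : Continuous fun p : unitInterval × A => s * (p.1 : ℝ)).prodMk
            continuous_snd))))
        (e := fun t => H (s, s, t)) (y := fun t => (w (s * t)).fst e₀)
        (hHc.comp (by fun_prop))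
        ((hwf e₀).comp (by fun_prop : Continuous fun t : unitInterval => s * (t : ℝ)))
        (fun t => (hU (s * t)).star_conj_eq (fun a => ⟨_, hsU _ a⟩) he)
        (fun t => by
          simp only [hH]
          rw [(hU (s * t)).norm, norm_star, (hU (s * t)).norm]
          exact he1)
        (fun t => by
          simp only [hH]
          rw [← (hU (s * t)).map_mul, (hU (s * t)).inner, he, he10])
        (fun t => by
          simp only [hH]
          rw [hUs]
          have h1 := hHδ (s', s, t) ⟨⟨hs'0, hi1⟩, ⟨hs0, hi0⟩, t.2⟩ (s, s, t)
            ⟨⟨hs0, hi0⟩, ⟨hs0, hi0⟩, t.2⟩ (by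
              rw [Prod.dist_eq, dist_self, max_eq_left dist_nonneg, Real.dist_eq]
              exact hss)
          rw [dist_eq_norm] at h1
          exact h1.le)
      refine ⟨v * z, fun t => mul_mem (hv t) (hz t), fun t => ?_⟩
      rw [ContinuousMap.mul_apply, mul_assoc, hze, hve, hUs]
      push_cast
      rfl
  obtain ⟨z, hz, hze⟩ := key (N + 1) le_rfl
  refine ⟨z, hz, fun t => ?_⟩
  rw [hze]
  push_cast
  rw [div_self hNpos.ne', one_mul]

end CocyclePath

/-! ### Cocycle conjugacy implies equivalence of the coactions -/

section CocycleToPath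

variable {A : Type*} [NonUnitalCStarAlgebra A] {E : Type*} [CStarAlgebra E] {χ : E →⋆ₐ[ℂ] ℂ}
  {M : AugModel A χ} {αf βf : CStarFlow A} {α : AugFlow χ}

theorem CStarFlow.aut_zero (αf : CStarFlow A) (a : A) : αf.aut 0 a = a := by
  have h := αf.aut_add 0 0 a
  rw [add_zero] at h
  exact ((αf.aut 0).injective h).symm

theorem IsFlowCocycle.zero {w : ℝ → 𝓜(ℂ, A)} (hw : IsFlowCocycle αf w) : w 0 = 1 := by
  have h1 := hw.cocycle 0 0
  have h2 : multiplierExtend (αf.aut 0) (w 0) = w 0 := by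
    refine AugModel.multiplier_ext fun a => ?_
    change αf.aut 0 ((w 0).fst ((αf.aut 0).symm a)) = _
    have h3 : (αf.aut 0).symm a = a := by rw [StarAlgEquiv.symm_apply_eq, αf.aut_zero]
    rw [h3, αf.aut_zero]
  rw [h2, add_zero] at h1
  have h4 := congrArg (star (w 0) * ·) h1
  simpa only [← mul_assoc, Unitary.star_mul_self_of_mem (hw.mem_unitary 0), one_mul] using h4

/-- z and m agree on e, so Ad(z) and Ad(m) agree on e x e. Both are isometric, whence the factor 2.
-/
theorem norm_conj_sub_le_of_mul_eq {m : 𝓜(ℂ, A)} (hm : m ∈ unitary 𝓜(ℂ, A)) {z : E}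
    (hz : z ∈ augUnitary χ) {e x b : A} (he : star e = e) (hze : z * M.j e = M.j (m.fst e))
    (hb : (b : 𝓜(ℂ, A)) = m * (x : 𝓜(ℂ, A)) * star m) : ‖M.conj z x - b‖ ≤ 2 * ‖e * x * e - x‖ := by
  set b' := m.fst e * x * star (m.fst e) with hb'
  have h1 : ((m.fst e : A) : 𝓜(ℂ, A)) = m * (e : 𝓜(ℂ, A)) := by
    refine AugModel.multiplier_ext fun a => ?_
    rw [DoubleCentralizer.mul_fst, mul_apply_eq_comp, DoubleCentralizer.coe_fst,
      DoubleCentralizer.coe_fst, ContinuousLinearMap.mul_apply', ContinuousLinearMap.mul_apply',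
      multiplier_fst_mul]
  have hmul : ∀ a c : A, ((a * c : A) : 𝓜(ℂ, A)) = (a : 𝓜(ℂ, A)) * (c : 𝓜(ℂ, A)) :=
    fun a c => map_mul (DoubleCentralizer.coeHom (𝕜 := ℂ) (A := A)) a c
  have hstar : ∀ a : A, ((star a : A) : 𝓜(ℂ, A)) = star (a : 𝓜(ℂ, A)) :=
    fun a => map_star (DoubleCentralizer.coeHom (𝕜 := ℂ) (A := A)) a
  have hsub : ∀ a c : A, ((a - c : A) : 𝓜(ℂ, A)) = (a : 𝓜(ℂ, A)) - (c : 𝓜(ℂ, A)) :=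
    fun a c => map_sub (DoubleCentralizer.coeHom (𝕜 := ℂ) (A := A)) a c
  have h2 : ‖b' - b‖ = ‖e * x * e - x‖ := by
    have h3 : ((b' - b : A) : 𝓜(ℂ, A)) = m * ((e * x * e - x : A) : 𝓜(ℂ, A)) * star m := by
      rw [hsub, hsub, hb', hb, hmul, hmul, hmul, hmul, hstar, h1, star_mul, ← hstar, he]
      noncomm_ring
    rw [← norm_coe_multiplier, h3, CStarRing.norm_mul_mem_unitary _ (Unitary.star_mem hm),
      CStarRing.norm_mem_unitary_mul _ hm, norm_coe_multiplier]
  have h4 : M.conj z (e * x * e) = b' := by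
    refine M.j_injective ?_
    rw [M.j_conj, hb', map_mul, map_mul, map_mul, map_mul, map_star, ← hze, star_mul, ← map_star, he]
    noncomm_ring
  have h5 := norm_sub_le_norm_sub_add_norm_sub (M.conj z x) (M.conj z (e * x * e)) b
  rw [M.norm_conj_sub hz, h4, h2, norm_sub_rev x] at h5
  linarith

/-- Cocycle conjugate flows have approximately unitarily equivalent restricted coactions. -/
theorem AugModel.Extends.exists_path (hα : M.Extends αf α) {ψ : A ≃⋆ₐ[ℂ] A} {w : ℝ → 𝓜(ℂ, A)}
    (hw : IsCocyclePerturbationVia αf βf ψ w)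
    (hψ : ∀ (F : Finset A) (ε : ℝ), 0 < ε → ∃ s ∈ augUnitary χ, ∀ a ∈ F, ‖M.conj s a - ψ a‖ < ε)
    (F : Finset A) {ε : ℝ} (hε : 0 < ε) :
    ∃ u : C(unitInterval, E), (∀ t, u t ∈ augUnitary χ) ∧
      ∀ b ∈ F, ∀ t : unitInterval, ‖M.conj (u t) (αf.aut t b) - βf.aut t b‖ < ε := by
  classical
  have hcI : ∀ (γ : CStarFlow A) (b : A), IsCompact (range fun t : unitInterval => γ.aut t b) :=
    fun γ b => isCompact_range ((γ.continuous_aut b).comp continuous_subtype_val)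
  set K : Set A := ⋃ b ∈ F, range fun t : unitInterval => αf.aut t (ψ.symm b) with hK
  have hKc : IsCompact K := F.isCompact_biUnion fun b _ => hcI αf _
  set Y : Set A := ⋃ b ∈ F, (fun a => ψ.symm a) '' range fun t : unitInterval => βf.aut t b with hY
  have hψc : Continuous fun a => ψ.symm a := (starAlgAutCLM ψ.symm).continuous
  have hYc : IsCompact Y := F.isCompact_biUnion fun b _ => (hcI βf _).image hψc
  obtain ⟨e₀, e₁, he₀, he₁, hn₀, hn₁, he₁₀, heK⟩ := exists_local_unit hKc (show 0 < ε / 32 by positivity)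
  obtain ⟨F₁, -, hF₁⟩ := hYc.exists_finset_net (show 0 < ε / 32 by positivity)
  obtain ⟨s, hs, hsF⟩ := hψ (F₁ ∪ F.image fun b => ψ.symm b) (ε / 32) (by positivity)
  have hsY : ∀ y ∈ Y, ‖M.conj s y - ψ y‖ ≤ ε / 8 := by
    intro y hy
    obtain ⟨x, hx, hyx⟩ := hF₁ y hy
    have h1 := (hsF x (Finset.mem_union_left _ hx)).le
    have h2 := norm_sub_le_norm_sub_add_norm_sub (M.conj s y) (M.conj s x) (ψ y)
    have h3 := norm_sub_le_norm_sub_add_norm_sub (M.conj s x) (ψ x) (ψ y)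
    rw [M.norm_conj_sub hs] at h2
    have h4 : ‖ψ x - ψ y‖ = ‖x - y‖ := by rw [← map_sub, norm_starAlgAut_apply]
    rw [h4, norm_sub_rev x] at h3
    linarith
  obtain ⟨z, hz, hze⟩ := M.exists_path_mul_eq (e₀ := e₀) hw.1.mem_unitary hw.1.continuous_left
    hw.1.continuous_right (fun a => by rw [hw.1.zero]; rfl) he₁ hn₁ he₁₀
  -- Conjugation by α_t(s^*) turns α_t into α_t Ad(s^*) ≈ α_t ψ⁻¹; then z_t, acting like w_t, leads
  -- to ψ⁻¹ β_t, and Ad(s) ≈ ψ removes ψ⁻¹.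
  refine ⟨⟨fun t => s * z t * α.ext t (star s), (continuous_const.mul z.continuous).mul
    ((α.continuous_ext _).comp continuous_subtype_val)⟩,
    fun t => mul_mem (mul_mem hs (hz t)) (α.ext_mem t (augUnitary.star_mem hs)), fun b hb t => ?_⟩
  have h1 : ‖M.conj (star s) b - ψ.symm b‖ ≤ ε / 32 := by
    have h2 := (hsF _ (Finset.mem_union_right _ (Finset.mem_image_of_mem (fun b => ψ.symm b) hb))).le
    rw [StarAlgEquiv.apply_symm_apply] at h2
    rw [← M.norm_conj_sub hs, M.conj_conj_star hs, norm_sub_rev]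
    exact h2
  have h2 : M.conj (α.ext t (star s)) (αf.aut t b) = αf.aut t (M.conj (star s) b) := by
    refine M.j_injective ?_
    rw [M.j_conj, ← hα, ← hα, M.j_conj, map_mul, map_mul, ← map_star]
  set x := αf.aut t (ψ.symm b) with hx
  have hxK : x ∈ K := mem_iUnion₂.2 ⟨b, hb, t, rfl⟩
  have h3 : ‖M.conj (s * z t) (αf.aut t (M.conj (star s) b)) - M.conj (s * z t) x‖ ≤ ε / 32 := by
    rw [M.norm_conj_sub (mul_mem hs (hz t)), hx, ← map_sub, norm_starAlgAut_apply]
    exact h1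
  have h4 : ‖e₀ * x * e₀ - x‖ ≤ ε / 16 := by
    obtain ⟨h5, h6⟩ := heK x hxK
    have h7 : e₀ * x * e₀ - x = (e₀ * x - x) * e₀ + (x * e₀ - x) := by noncomm_ring
    rw [h7]
    have h8 := norm_add_le ((e₀ * x - x) * e₀) (x * e₀ - x)
    have h9 := norm_mul_le (e₀ * x - x) e₀
    nlinarith [norm_nonneg (e₀ * x - x), norm_nonneg e₀]
  have h5 : ‖M.conj (s * z t) x - M.conj s (ψ.symm (βf.aut t b))‖ ≤ ε / 8 := by
    rw [M.conj_mul, M.norm_conj_sub hs]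
    have h6 := hw.2 t (ψ.symm b)
    rw [StarAlgEquiv.apply_symm_apply] at h6
    have := norm_conj_sub_le_of_mul_eq (hw.1.mem_unitary t) (hz t) he₀ (hze t) h6
    linarith
  have h6 : ‖M.conj s (ψ.symm (βf.aut t b)) - βf.aut t b‖ ≤ ε / 8 := by
    have := hsY (ψ.symm (βf.aut t b)) (mem_iUnion₂.2 ⟨b, hb, _, ⟨t, rfl⟩, rfl⟩)
    rwa [StarAlgEquiv.apply_symm_apply] at this
  have h7 : M.conj (s * z t * α.ext t (star s)) (αf.aut t b) =
      M.conj (s * z t) (αf.aut t (M.conj (star s) b)) := by rw [M.conj_mul, h2]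
  change ‖M.conj (s * z t * α.ext t (star s)) (αf.aut t b) - _‖ < ε
  rw [h7]
  have h8 := norm_sub_le_norm_sub_add_norm_sub (M.conj (s * z t) (αf.aut t (M.conj (star s) b)))
    (M.conj (s * z t) x) (βf.aut t b)
  have h9 := norm_sub_le_norm_sub_add_norm_sub (M.conj (s * z t) x)
    (M.conj s (ψ.symm (βf.aut t b))) (βf.aut t b)
  linarith

end CocycleToPath

/-! ### The unitization as an augmented algebra and its length constants -/

section UnitizationModel

variable (A : Type*) [NonUnitalCStarAlgebra A]

/-- The scalar part as a character of the unitization. -/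
def scalarPart : Unitization ℂ A →⋆ₐ[ℂ] ℂ where
  toAlgHom := Unitization.fstHom ℂ A
  map_star' x := Unitization.fst_star x

/-- The unitization of `A` as an augmented algebra. -/
def unitizationModel : AugModel A (scalarPart A) where
  j := Unitization.inrNonUnitalStarAlgHom ℂ A
  norm_j a := Unitization.norm_inr (𝕜 := ℂ) a
  map_j a := Unitization.fst_inr ℂ a
  exists_j x hx := ⟨x.snd, Unitization.ext (by
    change (0 : ℂ) = x.fst
    exact hx.symm) rfl⟩

variable {A}

theorem Unitization.starMap_eq {B : Type*} [NonUnitalCStarAlgebra B] (φ : A →⋆ₙₐ[ℂ] B)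
    (x : Unitization ℂ A) :
    Unitization.starMap φ x = Unitization.inl x.fst + ((φ x.snd : B) : Unitization ℂ B) := by
  conv_lhs => rw [← Unitization.inl_fst_add_inr_snd_eq x]
  rw [map_add, Unitization.starMap_inl, Unitization.starMap_inr]
  rfl

/-- The canonical extension of a flow to the unitization. -/
def CStarFlow.unitization (α : CStarFlow A) : AugFlow (scalarPart A) where
  ext t := Unitization.starMap (α.aut t : A →⋆ₙₐ[ℂ] A)
  ext_add s t x := by
    simp only [Unitization.starMap_eq]
    refine Unitization.ext (by simp) ?_
    simp only [Unitization.snd_add, Unitization.snd_inl, Unitization.snd_inr, zero_add]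
    exact α.aut_add s t x.snd
  ext_zero x := by
    rw [Unitization.starMap_eq]
    refine Unitization.ext (by simp) ?_
    simp only [Unitization.snd_add, Unitization.snd_inl, Unitization.snd_inr, zero_add]
    exact α.aut_zero x.snd
  continuous_ext x := by
    simp_rw [Unitization.starMap_eq]
    exact continuous_const.add ((unitizationModel A).isometry_j.continuous.comp (α.continuous_aut x.snd))
  map_ext t x := by
    rw [Unitization.starMap_eq]
    change (Unitization.inl x.fst + ((α.aut t x.snd : A) : Unitization ℂ A)).fst = x.fst
    simp

theorem CStarFlow.extends_unitization (α : CStarFlow A) :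
    (unitizationModel A).Extends α α.unitization := fun t a => by
  change Unitization.starMap (α.aut t : A →⋆ₙₐ[ℂ] A) (a : Unitization ℂ A) = _
  rw [Unitization.starMap_eq]
  change _ = ((α.aut t a : A) : Unitization ℂ A)
  refine Unitization.ext ?_ ?_ <;> simp

/-- A path on the unit interval, extended to the real line as a constant on both sides. -/
noncomputable def extendPath (v : C(unitInterval, oneAddUnitary A)) (t : ℝ) : Unitization ℂ A :=
  v (projIcc 0 1 zero_le_one t)

theorem isUnitaryPath_extendPath (v : C(unitInterval, oneAddUnitary A)) :
    IsUnitaryPath (scalarPart A) (extendPath v) :=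
  ⟨continuous_subtype_val.comp (v.continuous.comp continuous_projIcc), fun _ => (v _).2⟩

theorem extendPath_of_le_zero {v : C(unitInterval, oneAddUnitary A)} (hv : v 0 = 1) {t : ℝ}
    (ht : t ≤ 0) : extendPath v t = 1 := by
  rw [extendPath, projIcc_of_le_left _ ht]
  exact congrArg Subtype.val hv

theorem extendPath_of_one_le (v : C(unitInterval, oneAddUnitary A)) {t : ℝ} (ht : 1 ≤ t) :
    extendPath v t = v 1 := by
  rw [extendPath, projIcc_of_right_le _ ht]
  rfl

theorem abs_projIcc_sub_projIcc_le (s t : ℝ) :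
    |(projIcc (0 : ℝ) 1 zero_le_one s : ℝ) - projIcc (0 : ℝ) 1 zero_le_one t| ≤ |s - t| :=
  abs_projIcc_sub_projIcc _

/-- The restriction of a path to the unit interval. -/
def IsUnitaryPath.restrict {u : ℝ → Unitization ℂ A} (hu : IsUnitaryPath (scalarPart A) u) :
    C(unitInterval, oneAddUnitary A) :=
  ⟨fun t => ⟨u t, hu.mem t⟩, (hu.continuous.comp continuous_subtype_val).subtype_mk _⟩

/-- The elements of the kernel of the scalar part, as elements of `A`. -/
theorem exists_finset_of_scalarPart_eq_zero {F : Finset (Unitization ℂ A)}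
    (hF : ∀ a ∈ F, scalarPart A a = 0) :
    ∃ F' : Finset A, (∀ a ∈ F', (a : Unitization ℂ A) ∈ F) ∧
      ∀ a ∈ F, ∃ a' ∈ F', (a' : Unitization ℂ A) = a := by
  classical
  have h : ∀ a ∈ F, ((a.snd : A) : Unitization ℂ A) = a := fun a ha =>
    Unitization.ext (hF a ha).symm rfl
  refine ⟨F.image fun a => a.snd, fun a ha => ?_, fun a ha => ⟨a.snd, Finset.mem_image_of_mem _ ha, h a ha⟩⟩
  obtain ⟨b, hb, rfl⟩ := Finset.mem_image.1 ha
  rwa [h b hb]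

theorem exists_hasWeakInnerLength (h : weakInnerLength A < ⊤) :
    ∃ L : ℝ, 0 ≤ L ∧ HasWeakInnerLength (scalarPart A) L := by
  obtain ⟨L, hL⟩ := ENNReal.lt_iff_exists_nnreal_btwn.1 h
  refine ⟨L, L.2, fun γ hγ hγ0 F hF ε hε => ?_⟩
  have hJ : Joined (1 : oneAddUnitary A) ⟨γ 1, hγ.mem 1⟩ := by
    refine ⟨⟨hγ.restrict, Subtype.ext hγ0, rfl⟩⟩
  have h1 : weakInnerLengthOf (⟨γ 1, hγ.mem 1⟩ : oneAddUnitary A) < L := by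
    refine lt_of_le_of_lt ?_ hL.1
    exact le_iSup₂ (f := fun (u : oneAddUnitary A) (_ : Joined 1 u) => weakInnerLengthOf u) _ hJ
  simp only [weakInnerLengthOf, iInf_lt_iff] at h1
  obtain ⟨L', -, hL', hLL⟩ := h1
  obtain ⟨F', hF'F, hFF'⟩ := exists_finset_of_scalarPart_eq_zero fun a ha => (hF a ha).1
  obtain ⟨v, hv0, hv1, hv⟩ := hL' F' (fun a ha => by
    rw [← Unitization.norm_inr (𝕜 := ℂ)]
    exact (hF _ (hF'F a ha)).2) ε hε
  refine ⟨extendPath v, isUnitaryPath_extendPath v, fun q hq => extendPath_of_le_zero hv0 hq,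
    fun q hq => ?_, fun a ha s t => ?_⟩
  · rw [extendPath_of_one_le v hq, hv1]
  · obtain ⟨a', ha', rfl⟩ := hFF' a ha
    refine (hv a' ha' _ _).trans ?_
    have h2 : (L' : ℝ) ≤ L := by exact_mod_cast (ENNReal.coe_lt_coe.1 hLL).le
    have h3 := mul_le_mul h2 (abs_projIcc_sub_projIcc_le s t) (abs_nonneg _) L.2
    change ε + (L' : ℝ) * |(projIcc (0 : ℝ) 1 zero_le_one s : ℝ) - projIcc (0 : ℝ) 1 zero_le_one t| ≤ _
    linarith

theorem pathCommutesUpTo_restrict {u : ℝ → Unitization ℂ A} (hu : IsUnitaryPath (scalarPart A) u)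
    [DecidableEq (Unitization ℂ A)] {G : Finset A} {δ : ℝ}
    (h : ∀ a ∈ G.image (fun a : A => (a : Unitization ℂ A)), ∀ t ∈ Icc (0 : ℝ) 1,
      ‖u t * a - a * u t‖ ≤ δ) : PathCommutesUpTo hu.restrict G δ := fun a ha t =>
  h a (Finset.mem_image_of_mem _ ha) t t.2

theorem exists_hasCentralLength_of_weakAcel (h : weakAcel A < ⊤) :
    ∃ C : ℝ, 0 ≤ C ∧ HasCentralLength (scalarPart A) False C := by
  classical
  simp only [weakAcel, iInf_lt_iff] at h
  obtain ⟨C, -, hC, -⟩ := h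
  refine ⟨C, C.2, fun ε hε F hF => ?_⟩
  obtain ⟨F', hF'F, hFF'⟩ := exists_finset_of_scalarPart_eq_zero fun a ha => (hF a ha).1
  obtain ⟨δ, hδ, G, -, hG⟩ := hC ε hε F' (fun a ha => by
    rw [← Unitization.norm_inr (𝕜 := ℂ)]
    exact (hF _ (hF'F a ha)).2)
  refine ⟨δ, hδ, G.image fun a : A => (a : Unitization ℂ A), ?_, fun u hu hu0 huG => ?_⟩
  · intro a ha
    obtain ⟨b, -, rfl⟩ := Finset.mem_image.1 ha
    exact Unitization.fst_inr ℂ b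
  · obtain ⟨v, hv0, hv1, hvF, hvl⟩ := hG hu.restrict (Subtype.ext hu0) (pathCommutesUpTo_restrict hu huG)
    refine ⟨extendPath v, isUnitaryPath_extendPath v, fun q hq => extendPath_of_le_zero hv0 hq,
      fun q hq => ?_, fun a ha t => ?_, fun a ha s t => ?_, False.elim⟩
    · rw [extendPath_of_one_le v hq, hv1]
      rfl
    · obtain ⟨a', ha', rfl⟩ := hFF' a ha
      exact hvF a' ha' _
    · obtain ⟨a', ha', rfl⟩ := hFF' a ha
      refine (hvl a' ha' _ _).trans ?_
      have h3 := mul_le_mul_of_nonneg_left (abs_projIcc_sub_projIcc_le s t) C.coe_nonneg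
      change ε + (C : ℝ) * |(projIcc (0 : ℝ) 1 zero_le_one s : ℝ) - projIcc (0 : ℝ) 1 zero_le_one t| ≤ _
      linarith

theorem exists_hasCentralLength_of_acel (h : acel A < ⊤) :
    ∃ C : ℝ, 0 ≤ C ∧ HasCentralLength (scalarPart A) True C := by
  classical
  simp only [acel, iInf_lt_iff] at h
  obtain ⟨C, -, hC, -⟩ := h
  have hC0 : (0 : ℝ) ≤ C := C.2
  -- The additional 1 absorbs 2η: one η is the slack in the length of v, the other the loss in the
  -- reparametrization.
  refine ⟨C + 1, by positivity, fun ε hε F hF => ?_⟩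
  set η : ℝ := min (ε / 2) (1 / 2) with hη
  have hη0 : 0 < η := by positivity
  have hηε : η ≤ ε / 2 := min_le_left _ _
  have hη1 : η ≤ 1 / 2 := min_le_right _ _
  obtain ⟨F', hF'F, hFF'⟩ := exists_finset_of_scalarPart_eq_zero fun a ha => (hF a ha).1
  obtain ⟨δ, hδ, G, -, hG⟩ := hC η hη0 F' (fun a ha => by
    rw [← Unitization.norm_inr (𝕜 := ℂ)]
    exact (hF _ (hF'F a ha)).2)
  refine ⟨δ, hδ, G.image fun a : A => (a : Unitization ℂ A), ?_, fun u hu hu0 huG => ?_⟩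
  · intro a ha
    obtain ⟨b, -, rfl⟩ := Finset.mem_image.1 ha
    exact Unitization.fst_inr ℂ b
  · obtain ⟨v, hv0, hv1, hvl, hvF⟩ := hG hu.restrict (Subtype.ext hu0) (pathCommutesUpTo_restrict hu huG)
    have hvar : eVariationOn (extendPath v) (Icc 0 1) ≤ ENNReal.ofReal (C + η) := by
      have h1 : eVariationOn ((fun x : unitInterval => (v x : Unitization ℂ A)) ∘
          projIcc (0 : ℝ) 1 zero_le_one) (Icc 0 1) ≤
          eVariationOn (fun x : unitInterval => (v x : Unitization ℂ A)) univ :=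
        eVariationOn.comp_le_of_monotoneOn _ _ ((monotone_projIcc _).monotoneOn _) fun _ _ => mem_univ _
      refine h1.trans (le_trans (le_of_eq rfl) (hvl.trans (le_of_eq ?_)))
      rw [ENNReal.ofReal_add hC0 hη0.le, ENNReal.ofReal_coe_nnreal]
    obtain ⟨φ, hφc, hφ0, hφ1, hφm, hφ⟩ := exists_reparam (isUnitaryPath_extendPath v).continuous
      (by positivity) hvar hη0
    have hpath : IsUnitaryPath (scalarPart A) fun q =>
        extendPath v (φ (projIcc (0 : ℝ) 1 zero_le_one q)) :=
      (isUnitaryPath_extendPath v).comp (hφc.comp (continuous_subtype_val.comp continuous_projIcc))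
    have hnorm : ∀ s t, ‖extendPath v (φ (projIcc (0 : ℝ) 1 zero_le_one s)) -
        extendPath v (φ (projIcc (0 : ℝ) 1 zero_le_one t))‖ ≤ ε + (C + 1) * |s - t| := by
      intro s t
      rw [← dist_eq_norm]
      refine (hφ _ (Subtype.property _) _ (Subtype.property _)).trans ?_
      have h3 := mul_le_mul (by linarith : (C : ℝ) + η + η ≤ C + 1) (abs_projIcc_sub_projIcc_le s t)
        (abs_nonneg _) (by positivity)
      linarith
    refine ⟨_, hpath, fun q hq => ?_, fun q hq => ?_, fun a ha t => ?_, fun a ha s t => ?_,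
      fun _ => hnorm⟩
    · rw [projIcc_of_le_left _ hq]
      change extendPath v (φ 0) = 1
      rw [hφ0, extendPath_of_le_zero hv0 le_rfl]
    · rw [projIcc_of_right_le _ hq]
      change extendPath v (φ 1) = _
      rw [hφ1, extendPath_of_one_le v le_rfl, hv1]
      rfl
    · obtain ⟨a', ha', rfl⟩ := hFF' a ha
      exact (hvF a' ha' _).trans (by linarith)
    · refine (norm_mul_le _ _).trans (le_trans ?_ (hnorm s t))
      exact mul_le_of_le_one_left (norm_nonneg _) (hF a ha).2

end UnitizationModel

/-! ### Equivalence of coactions in terms of paths of unitaries -/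

section CoactionPaths

variable {A : Type*} [NonUnitalCStarAlgebra A]

/-- Evaluation at a point of the unit interval. -/
def evalStarHom (A : Type*) [NonUnitalCStarAlgebra A] (t : unitInterval) :
    C(unitInterval, A) →⋆ₙₐ[ℂ] A where
  toFun f := f t
  map_smul' _ _ := rfl
  map_zero' := rfl
  map_add' _ _ := rfl
  map_mul' _ _ := rfl
  map_star' _ := rfl

/-- Evaluation at a point of the unit interval, on the unitizations. -/
def evalUnitization (t : unitInterval) :
    Unitization ℂ C(unitInterval, A) →⋆ₐ[ℂ] Unitization ℂ A :=
  Unitization.starMap (evalStarHom A t)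

theorem evalUnitization_eq (t : unitInterval) (x : Unitization ℂ C(unitInterval, A)) :
    evalUnitization t x = Unitization.inl x.fst + ((x.snd t : A) : Unitization ℂ A) :=
  Unitization.starMap_eq _ _

theorem evalUnitization_inr (t : unitInterval) (f : C(unitInterval, A)) :
    evalUnitization t (f : Unitization ℂ C(unitInterval, A)) = ((f t : A) : Unitization ℂ A) :=
  Unitization.starMap_inr _ _

theorem evalUnitization_ext {x y : Unitization ℂ C(unitInterval, A)}
    (h : ∀ t, evalUnitization t x = evalUnitization t y) : x = y := by
  simp only [evalUnitization_eq] at h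
  refine Unitization.ext ?_ ?_
  · simpa using congrArg (fun z => z.fst) (h 0)
  · ext t
    simpa using congrArg (fun z => z.snd) (h t)

theorem evalUnitization_mem {u : Unitization ℂ C(unitInterval, A)}
    (hu : u ∈ oneAddUnitary C(unitInterval, A)) (t : unitInterval) :
    evalUnitization t u ∈ oneAddUnitary A :=
  ⟨Unitary.map_mem (evalUnitization t) hu.1, by rw [evalUnitization_eq, hu.2]; simp⟩

theorem continuous_evalUnitization (x : Unitization ℂ C(unitInterval, A)) :
    Continuous fun t => evalUnitization t x := by
  simp_rw [evalUnitization_eq]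
  exact continuous_const.add ((unitizationModel A).isometry_j.continuous.comp x.snd.continuous)

theorem norm_lt_of_forall_evalUnitization {x : Unitization ℂ C(unitInterval, A)} (hx : x.fst = 0)
    {ε : ℝ} (hε : 0 < ε) (h : ∀ t, ‖evalUnitization t x‖ < ε) : ‖x‖ < ε := by
  have h1 : x = (x.snd : Unitization ℂ C(unitInterval, A)) := Unitization.ext hx rfl
  rw [h1, Unitization.norm_inr, ContinuousMap.norm_lt_iff _ hε]
  intro t
  have h2 := h t
  rwa [h1, evalUnitization_inr, Unitization.norm_inr] at h2

theorem exists_oneAddUnitary_eval_eq (v : C(unitInterval, Unitization ℂ A))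
    (hv : ∀ t, v t ∈ oneAddUnitary A) :
    ∃ u : oneAddUnitary C(unitInterval, A), ∀ t,
      evalUnitization t (u : Unitization ℂ C(unitInterval, A)) = v t := by
  have h1 : ∀ t, (((v t).snd : A) : Unitization ℂ A) = v t - 1 := fun t => by
    rw [eq_sub_iff_add_eq]
    exact Unitization.ext (by simp [(hv t).2]) (by simp)
  have hc : Continuous fun t => (v t).snd := by
    refine (unitizationModel A).continuous_of_comp ?_
    change Continuous fun t => (((v t).snd : A) : Unitization ℂ A)
    simp_rw [h1]
    exact v.continuous.sub continuous_const
  set u : Unitization ℂ C(unitInterval, A) := 1 + ((⟨_, hc⟩ : C(unitInterval, A)) :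
    Unitization ℂ C(unitInterval, A)) with hu
  have h2 : ∀ t, evalUnitization t u = v t := fun t => by
    rw [hu, map_add, map_one, evalUnitization_inr]
    change 1 + (((v t).snd : A) : Unitization ℂ A) = v t
    rw [h1, add_sub_cancel]
  refine ⟨⟨u, Unitary.mem_iff.2 ⟨?_, ?_⟩, by simp [hu]⟩, h2⟩
  · refine evalUnitization_ext fun t => ?_
    rw [map_mul, map_star, h2, map_one]
    exact Unitary.star_mul_self_of_mem (hv t).1
  · refine evalUnitization_ext fun t => ?_
    rw [map_mul, map_star, h2, map_one]
    exact Unitary.mul_star_self_of_mem (hv t).1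

theorem approxUnitarilyEquivalent_of_paths {α β : CStarFlow A}
    (h : ∀ (F : Finset A) (ε : ℝ), 0 < ε → ∃ u : C(unitInterval, Unitization ℂ A),
      (∀ t, u t ∈ augUnitary (scalarPart A)) ∧
      ∀ b ∈ F, ∀ t : unitInterval, ‖(unitizationModel A).conj (u t) (α.aut t b) - β.aut t b‖ < ε) :
    ApproxUnitarilyEquivalent α.restrictedCoaction β.restrictedCoaction := by
  intro F ε hε
  obtain ⟨v, hv, hvF⟩ := h F ε hε
  obtain ⟨u, hu⟩ := exists_oneAddUnitary_eval_eq v hv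
  have h0 : ∀ f : C(unitInterval, A), scalarPart C(unitInterval, A) f = 0 :=
    (unitizationModel C(unitInterval, A)).map_j
  refine ⟨u, fun a ha => norm_lt_of_forall_evalUnitization ?_ hε fun t => ?_⟩
  · have h1 : ∀ x, scalarPart C(unitInterval, A) x = x.fst := fun x => rfl
    rw [← h1, map_sub, map_mul, map_mul, h0, h0, mul_zero, zero_mul, sub_zero]
  rw [map_sub, map_mul, map_mul, map_star, hu, evalUnitization_inr, evalUnitization_inr]
  have h1 := hvF a ha t
  rwa [← (unitizationModel A).norm_j_sub, AugModel.j_conj] at h1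

/-- Evaluating a unitary over C([0,1], A) gives a path v. At time 0 both flows are trivial, so v_0
nearly commutes with the compact set in question, and v_s v_0^* does the same work while starting at
1. The compact set is enlarged to its orbit under α over [0, 1] because v_0 has to commute with
α_s(a). -/
theorem CStarFlow.coactionEquiv {α β : CStarFlow A}
    (h : ApproxUnitarilyEquivalent α.restrictedCoaction β.restrictedCoaction) :
    α.unitization.CoactionEquiv β.unitization := by
  intro K hK hK0 ε hε
  set K' : Set (Unitization ℂ A) :=
    (fun p : ℝ × Unitization ℂ A => α.unitization.ext p.1 p.2) '' (Icc (0 : ℝ) 1 ×ˢ K) with hK'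
  have hK'c : IsCompact K' := (isCompact_Icc.prod hK).image α.unitization.continuous_ext_prod
  have hK'0 : ∀ a ∈ K', scalarPart A a = 0 := by
    rintro _ ⟨⟨t, a⟩, ⟨-, ha⟩, rfl⟩
    exact (α.unitization.map_ext t a).trans (hK0 a ha)
  have hKK' : ∀ a ∈ K, a ∈ K' := fun a ha =>
    ⟨(0, a), ⟨⟨le_rfl, zero_le_one⟩, ha⟩, α.unitization.ext_zero a⟩
  obtain ⟨F, hFK, hF⟩ := hK'c.exists_finset_net (show 0 < ε / 8 by positivity)
  obtain ⟨F', -, hFF'⟩ := exists_finset_of_scalarPart_eq_zero fun a ha => hK'0 a (hFK a ha)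
  obtain ⟨u, hu⟩ := h F' (ε / 8) (by positivity)
  set v : ℝ → Unitization ℂ A := fun s => evalUnitization (projIcc 0 1 zero_le_one s)
    (u : Unitization ℂ C(unitInterval, A)) with hv
  have hvc : Continuous v := (continuous_evalUnitization _).comp continuous_projIcc
  have hvm : ∀ s, v s ∈ augUnitary (scalarPart A) := fun s => evalUnitization_mem u.2 _
  have hvK : ∀ s ∈ Icc (0 : ℝ) 1, ∀ a ∈ K',
      ‖v s * α.unitization.ext s a * star (v s) - β.unitization.ext s a‖ ≤ 3 * (ε / 8) := by
    intro s hs a ha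
    obtain ⟨b, hb, hab⟩ := hF a ha
    obtain ⟨b', hb', rfl⟩ := hFF' b hb
    have h1 : ‖v s * α.unitization.ext s b' * star (v s) - β.unitization.ext s b'‖ ≤ ε / 8 := by
      have h2 := NonUnitalStarAlgHom.norm_apply_le (evalUnitization (A := A) (projIcc 0 1 zero_le_one s))
        ((u : Unitization ℂ C(unitInterval, A)) * (α.restrictedCoaction b' : Unitization ℂ C(unitInterval, A))
          * star (u : Unitization ℂ C(unitInterval, A))
          - (β.restrictedCoaction b' : Unitization ℂ C(unitInterval, A)))
      rw [map_sub, map_mul, map_mul, map_star, evalUnitization_inr, evalUnitization_inr] at h2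
      have h3 : ∀ γ : CStarFlow A, ((γ.restrictedCoaction b' (projIcc 0 1 zero_le_one s) : A) :
          Unitization ℂ A) = γ.unitization.ext s b' := fun γ => by
        rw [projIcc_of_mem zero_le_one hs]
        exact (γ.extends_unitization s b').symm
      rw [h3, h3] at h2
      exact h2.trans (hu b' hb').le
    have h4 : v s * α.unitization.ext s a * star (v s) - β.unitization.ext s a =
        v s * α.unitization.ext s (a - b') * star (v s) +
          (v s * α.unitization.ext s b' * star (v s) - β.unitization.ext s b') -
          β.unitization.ext s (a - b') := by
      simp only [map_sub]; noncomm_ring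
    rw [h4]
    refine (norm_sub_le _ _).trans ?_
    have h5 := norm_add_le (v s * α.unitization.ext s (a - b') * star (v s))
      (v s * α.unitization.ext s b' * star (v s) - β.unitization.ext s b')
    rw [augUnitary.norm_conj (hvm s), AugFlow.norm_ext] at h5
    rw [AugFlow.norm_ext]
    linarith
  refine ⟨fun s => v s * star (v 0), ⟨hvc.mul continuous_const,
    fun s => mul_mem (hvm s) (augUnitary.star_mem (hvm 0))⟩, augUnitary.mul_star_self (hvm 0),
    fun s hs a ha => ?_⟩
  set b := α.unitization.ext s a with hb
  have hbK : b ∈ K' := ⟨(s, a), ⟨hs, ha⟩, rfl⟩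
  have h1 : ‖star (v 0) * b * v 0 - b‖ ≤ 3 * (ε / 8) := by
    have h2 := hvK 0 ⟨le_rfl, zero_le_one⟩ b hbK
    rw [AugFlow.ext_zero, AugFlow.ext_zero, augUnitary.norm_conj_sub (hvm 0)] at h2
    rwa [augUnitary.norm_star_conj_sub (hvm 0)]
  have h2 := hvK s hs a (hKK' a ha)
  have h3 : v s * star (v 0) * b * star (v s * star (v 0)) - β.unitization.ext s a =
      v s * (star (v 0) * b * v 0 - b) * star (v s) + (v s * b * star (v s) - β.unitization.ext s a) := by
    rw [star_mul, star_star]; noncomm_ring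
  dsimp only
  rw [h3]
  refine (norm_add_le _ _).trans ?_
  rw [augUnitary.norm_conj (hvm s)]
  linarith

end CoactionPaths

/-! ### Approximate units in the domain of the central sequence algebra -/

section RokhlinSequences

variable {A : Type*} [NonUnitalCStarAlgebra A]

theorem exists_approximate_unit_seq (A : Type*) [NonUnitalCStarAlgebra A]
    [TopologicalSpace.SeparableSpace A] :
    ∃ e : ℕ → A, (∀ n, ‖e n‖ ≤ 1) ∧ ∀ K : Set A, IsCompact K → ∀ ε : ℝ, 0 < ε →
      ∀ᶠ n in atTop, ∀ a ∈ K, ‖e n * a - a‖ ≤ ε ∧ ‖a * e n - a‖ ≤ ε := by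
  obtain ⟨d, hd⟩ := TopologicalSpace.exists_dense_seq A
  have h := fun n : ℕ => exists_local_unit (K := (Set.Iic n).image d)
    ((Set.finite_Iic n).image d).isCompact (show (0 : ℝ) < 1 / (n + 1) by positivity)
  choose e e' _ _ he _ _ hed using h
  have hlim : ∀ a, Tendsto (fun n => e n * a - a) atTop (𝓝 0) ∧ Tendsto (fun n => a * e n - a) atTop (𝓝 0) := by
    intro a
    have key : ∀ ε : ℝ, 0 < ε → ∀ᶠ n in atTop, ‖e n * a - a‖ < ε ∧ ‖a * e n - a‖ < ε := by
      intro ε hε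
      obtain ⟨k, hk⟩ := hd.exists_dist_lt a (show 0 < ε / 4 by positivity)
      rw [dist_eq_norm] at hk
      obtain ⟨n₀, hn₀⟩ := exists_nat_one_div_lt (show 0 < ε / 4 by positivity)
      filter_upwards [eventually_ge_atTop n₀, eventually_ge_atTop k] with n hn hnk
      have h1 : 1 / ((n : ℝ) + 1) ≤ 1 / ((n₀ : ℝ) + 1) := by gcongr
      obtain ⟨h2, h3⟩ := hed n (d k) ⟨k, hnk, rfl⟩
      constructor
      · have h4 : e n * a - a = e n * (a - d k) + (e n * d k - d k) - (a - d k) := by noncomm_ring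
        rw [h4]
        have h5 := norm_sub_le (e n * (a - d k) + (e n * d k - d k)) (a - d k)
        have h6 := norm_add_le (e n * (a - d k)) (e n * d k - d k)
        have h7 := norm_mul_le (e n) (a - d k)
        nlinarith [he n, norm_nonneg (a - d k)]
      · have h4 : a * e n - a = (a - d k) * e n + (d k * e n - d k) - (a - d k) := by noncomm_ring
        rw [h4]
        have h5 := norm_sub_le ((a - d k) * e n + (d k * e n - d k)) (a - d k)
        have h6 := norm_add_le ((a - d k) * e n) (d k * e n - d k)
        have h7 := norm_mul_le (a - d k) (e n)
        nlinarith [he n, norm_nonneg (a - d k)]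
    constructor
    · rw [Metric.tendsto_nhds]
      intro ε hε
      filter_upwards [key ε hε] with n hn
      rw [dist_zero_right]
      exact hn.1
    · rw [Metric.tendsto_nhds]
      intro ε hε
      filter_upwards [key ε hε] with n hn
      rw [dist_zero_right]
      exact hn.2
  refine ⟨e, he, fun K hK ε hε => ?_⟩
  have h1 := eventually_forall_mem_compact_norm_le hK (C := 2) (Φ := fun n a => e n * a - a)
    (fun n x y => by
      have h4 : e n * x - x - (e n * y - y) = e n * (x - y) - (x - y) := by noncomm_ring
      rw [h4]
      have h5 := norm_sub_le (e n * (x - y)) (x - y)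
      have h6 := norm_mul_le (e n) (x - y)
      nlinarith [he n, norm_nonneg (x - y)]) (fun x _ => (hlim x).1) hε
  have h2 := eventually_forall_mem_compact_norm_le hK (C := 2) (Φ := fun n a => a * e n - a)
    (fun n x y => by
      have h4 : x * e n - x - (y * e n - y) = (x - y) * e n - (x - y) := by noncomm_ring
      rw [h4]
      have h5 := norm_sub_le ((x - y) * e n) (x - y)
      have h6 := norm_mul_le (x - y) (e n)
      nlinarith [he n, norm_nonneg (x - y)]) (fun x _ => (hlim x).2) hε
  filter_upwards [h1, h2] with n hn hn' a ha
  exact ⟨hn a ha, hn' a ha⟩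

namespace CStarFlow

variable (α : CStarFlow A)

theorem aut_aut_neg (t : ℝ) (a : A) : α.aut t (α.aut (-t) a) = a := by
  rw [← α.aut_add, add_neg_cancel, α.aut_zero]

/-- The average of the orbit of `x` over the unit interval. -/
noncomputable def average (x : A) : A := ∫ t in (0 : ℝ)..1, α.aut t x

theorem intervalIntegrable_aut (x : A) (a b : ℝ) :
    IntervalIntegrable (fun t => α.aut t x) MeasureTheory.volume a b :=
  (α.continuous_aut x).intervalIntegrable a b

theorem aut_average (s : ℝ) (x : A) : α.aut s (α.average x) = ∫ t in s..(s + 1), α.aut t x := by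
  have h1 := ContinuousLinearMap.intervalIntegral_comp_comm (starAlgAutCLM (α.aut s))
    (α.intervalIntegrable_aut x 0 1)
  change _ = α.aut s (α.average x) at h1
  rw [← h1]
  change (∫ t in (0 : ℝ)..1, α.aut s (α.aut t x)) = _
  simp_rw [← α.aut_add]
  rw [intervalIntegral.integral_comp_add_left (fun t => α.aut t x), add_zero]

theorem norm_average_le (x : A) : ‖α.average x‖ ≤ ‖x‖ := by
  have := intervalIntegral.norm_integral_le_of_norm_le_const (f := fun t => α.aut t x) (a := 0) (b := 1)
    (C := ‖x‖) fun t _ => (norm_starAlgAut_apply _ _).le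
  simpa [average] using this

/-- Shifting the window of integration from [s, s + 1] to [t, t + 1] changes the integral only over
two intervals of length |t - s|. Averages of a bounded sequence are therefore equicontinuous along
the flow. -/
theorem norm_aut_average_sub_le (s t : ℝ) (x : A) :
    ‖α.aut t (α.average x) - α.aut s (α.average x)‖ ≤ 2 * ‖x‖ * |t - s| := by
  rw [aut_average, aut_average, intervalIntegral.integral_interval_sub_interval_comm
    (α.intervalIntegrable_aut x _ _) (α.intervalIntegrable_aut x _ _) (α.intervalIntegrable_aut x _ _)]
  have h1 := intervalIntegral.norm_integral_le_of_norm_le_const (f := fun t => α.aut t x) (a := t) (b := s)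
    (C := ‖x‖) fun t _ => (norm_starAlgAut_apply _ _).le
  have h2 := intervalIntegral.norm_integral_le_of_norm_le_const (f := fun t => α.aut t x) (a := t + 1)
    (b := s + 1) (C := ‖x‖) fun t _ => (norm_starAlgAut_apply _ _).le
  rw [add_sub_add_right_eq_sub, abs_sub_comm] at h2
  rw [abs_sub_comm] at h1
  refine (norm_sub_le _ _).trans ?_
  linarith

/-- Pulling α_t out of the integrand reduces the claim to the approximate unit property on the orbit
elements α_{-t}(a). -/
theorem norm_average_mul_sub_le {x a : A} {ε : ℝ}
    (h : ∀ t ∈ Icc (0 : ℝ) 1, ‖x * α.aut (-t) a - α.aut (-t) a‖ ≤ ε ∧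
      ‖α.aut (-t) a * x - α.aut (-t) a‖ ≤ ε) :
    ‖α.average x * a - a‖ ≤ ε ∧ ‖a * α.average x - a‖ ≤ ε := by
  have hconst : (∫ _ in (0 : ℝ)..1, a) = a := by simp
  constructor
  · have h1 := ContinuousLinearMap.intervalIntegral_comp_comm ((ContinuousLinearMap.mul ℂ A).flip a)
      (α.intervalIntegrable_aut x 0 1)
    have h2 : α.average x * a - a = ∫ t in (0 : ℝ)..1, (α.aut t x * a - a) := by
      have h0 : Continuous fun t => α.aut t x * a := (α.continuous_aut x).mul continuous_const
      rw [intervalIntegral.integral_sub (h0.intervalIntegrable _ _)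
        (continuous_const.intervalIntegrable _ _), hconst]
      congr 1
      exact h1.symm
    rw [h2]
    have h3 := intervalIntegral.norm_integral_le_of_norm_le_const (f := fun t => α.aut t x * a - a) (a := 0)
      (b := 1) (C := ε) fun t ht => by
        rw [uIoc_of_le zero_le_one] at ht
        have h4 : α.aut t x * a - a = α.aut t (x * α.aut (-t) a - α.aut (-t) a) := by
          rw [map_sub, map_mul, α.aut_aut_neg]
        rw [h4, norm_starAlgAut_apply]
        exact (h t ⟨ht.1.le, ht.2⟩).1
    simpa using h3
  · have h1 := ContinuousLinearMap.intervalIntegral_comp_comm (ContinuousLinearMap.mul ℂ A a)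
      (α.intervalIntegrable_aut x 0 1)
    have h2 : a * α.average x - a = ∫ t in (0 : ℝ)..1, (a * α.aut t x - a) := by
      have h0 : Continuous fun t => a * α.aut t x := continuous_const.mul (α.continuous_aut x)
      rw [intervalIntegral.integral_sub (h0.intervalIntegrable _ _)
        (continuous_const.intervalIntegrable _ _), hconst]
      congr 1
      exact h1.symm
    rw [h2]
    have h3 := intervalIntegral.norm_integral_le_of_norm_le_const (f := fun t => a * α.aut t x - a) (a := 0)
      (b := 1) (C := ε) fun t ht => by
        rw [uIoc_of_le zero_le_one] at ht
        have h4 : a * α.aut t x - a = α.aut t (α.aut (-t) a * x - α.aut (-t) a) := by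
          rw [map_sub, map_mul, α.aut_aut_neg]
        rw [h4, norm_starAlgAut_apply]
        exact (h t ⟨ht.1.le, ht.2⟩).2
    simpa using h3

/-- There is an approximate unit in the domain of the continuous central sequence algebra. -/
theorem exists_centralSeq_approximate_unit [TopologicalSpace.SeparableSpace A] :
    ∃ e : α.centralSeq, ∀ a : A, Tendsto (fun n => (e : BddSeq A) n * a) atTop (𝓝 a) ∧
      Tendsto (fun n => a * (e : BddSeq A) n) atTop (𝓝 a) := by
  obtain ⟨e, he1, he⟩ := exists_approximate_unit_seq A
  have hn : ∀ n, ‖α.average (e n)‖ ≤ 1 := fun n => (α.norm_average_le _).trans (he1 n)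
  have hlim : ∀ a : A, Tendsto (fun n => α.average (e n) * a) atTop (𝓝 a) ∧
      Tendsto (fun n => a * α.average (e n)) atTop (𝓝 a) := by
    intro a
    have hK : IsCompact ((fun t : ℝ => α.aut (-t) a) '' Icc 0 1) :=
      isCompact_Icc.image ((α.continuous_aut a).comp continuous_neg)
    have key : ∀ ε : ℝ, 0 < ε → ∀ᶠ n in atTop, ‖α.average (e n) * a - a‖ < ε ∧
        ‖a * α.average (e n) - a‖ < ε := by
      intro ε hε
      filter_upwards [he _ hK (ε / 2) (half_pos hε)] with n hn
      have := α.norm_average_mul_sub_le (x := e n) (a := a) fun t ht => hn _ ⟨t, ht, rfl⟩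
      exact ⟨this.1.trans_lt (half_lt_self hε), this.2.trans_lt (half_lt_self hε)⟩
    constructor
    · rw [Metric.tendsto_nhds]
      intro ε hε
      filter_upwards [key ε hε] with n hn
      rw [dist_eq_norm]
      exact hn.1
    · rw [Metric.tendsto_nhds]
      intro ε hε
      filter_upwards [key ε hε] with n hn
      rw [dist_eq_norm]
      exact hn.2
  let E' : BddSeq A := ⟨fun n => α.average (e n), memℓp_infty ⟨1, by rintro _ ⟨n, rfl⟩; exact hn n⟩⟩
  have hE : ∀ s t, dist (seqMap (α.aut s) E') (seqMap (α.aut t) E') ≤ 2 * dist s t := by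
    intro s t
    rw [dist_eq_norm, Real.dist_eq]
    refine lp.norm_le_of_forall_le (by positivity) fun n => ?_
    change ‖α.aut s (α.average (e n)) - α.aut t (α.average (e n))‖ ≤ _
    refine (α.norm_aut_average_sub_le t s (e n)).trans ?_
    have := he1 n
    gcongr
    linarith
  refine ⟨⟨E', (LipschitzWith.of_dist_le_mul (K := 2) hE).continuous, fun a => ?_⟩, hlim⟩
  have := (hlim a).1.sub (hlim a).2
  rwa [sub_self] at this

end CStarFlow

end RokhlinSequences

/-! ### Rokhlin sequences from the Rokhlin property -/

section RokhlinExtraction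

variable {A : Type*} [NonUnitalCStarAlgebra A]

theorem BddSeq.norm_apply_le (x : BddSeq A) (n : ℕ) : ‖x n‖ ≤ ‖x‖ :=
  lp.norm_apply_le_norm ENNReal.top_ne_zero x n

/-- A unit of the quotient is known only through its products with central sequences. Tested on a
central approximate unit e it gives y_n e_n a ≈ e_n a, and e_n a → a. -/
theorem CStarFlow.tendsto_mul_sub_of_isTwoSidedUnit {α : CStarFlow A}
    [TopologicalSpace.SeparableSpace A] {y : α.centralSeq}
    (hy : IsTwoSidedUnit (y : α.CentralSeqAlgebra)) (a : A) :
    Tendsto (fun n => (y : BddSeq A) n * a - a) atTop (𝓝 0) := by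
  obtain ⟨e, he⟩ := α.exists_centralSeq_approximate_unit
  have h1 : ((y * e : α.centralSeq) : α.CentralSeqAlgebra) = (e : α.CentralSeqAlgebra) :=
    (hy (e : α.CentralSeqAlgebra)).1
  have h2 := (α.centralCon.eq.1 h1 a).1
  have h3 : Tendsto (fun n => (e : BddSeq A) n * a - a) atTop (𝓝 0) := by
    have := (he a).1.sub_const a
    rwa [sub_self] at this
  have h4 : Tendsto (fun n => (y : BddSeq A) n * ((e : BddSeq A) n * a - a)) atTop (𝓝 0) := by
    have hb : IsBoundedUnder (· ≤ ·) atTop (norm ∘ fun n => (y : BddSeq A) n) :=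
      isBoundedUnder_of ⟨_, fun n => BddSeq.norm_apply_le (y : BddSeq A) n⟩
    exact isBoundedUnder_le_mul_tendsto_zero hb h3
  have h5 := (h2.add h3).sub h4
  rw [add_zero, sub_zero] at h5
  refine h5.congr fun n => ?_
  change ((y : BddSeq A) n * (e : BddSeq A) n - (e : BddSeq A) n) * a + _ - _ = _
  noncomm_ring

theorem CStarFlow.IsRokhlin.hasRokhlin {α : CStarFlow A} [TopologicalSpace.SeparableSpace A]
    (h : α.IsRokhlin) : α.unitization.HasRokhlin := by
  intro T hT
  -- The frequency p = 2π/T makes e^{ipt} the first character of the circle ℝ/Tℤ.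
  obtain ⟨u, hu1, hu2, hu⟩ := h (2 * Real.pi / T) (by positivity)
  obtain ⟨x, rfl⟩ := Quotient.exists_rep u
  have hb : ∀ n, ‖(x : BddSeq A) n‖ ≤ ‖(x : BddSeq A)‖ := BddSeq.norm_apply_le _
  have hj : ∀ {f : ℕ → A}, Tendsto f atTop (𝓝 0) →
      Tendsto (fun n => (unitizationModel A).j (f n)) atTop (𝓝 0) := fun hf => by
    have := ((unitizationModel A).isometry_j.continuous.tendsto 0).comp hf
    rwa [map_zero] at this
  refine ⟨fun n => (unitizationModel A).j ((x : BddSeq A) n), ⟨‖(x : BddSeq A)‖, fun n => ?_⟩,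
    fun n => (unitizationModel A).map_j _, fun b hb0 => ?_, fun b hb0 R ε hε => ?_⟩
  · rw [(unitizationModel A).norm_j]
    exact hb n
  · obtain ⟨a, rfl⟩ := (unitizationModel A).exists_j b hb0
    refine ⟨?_, ?_, ?_, ?_⟩
    · exact (hj (x.2.2 a)).congr fun n => by rw [map_sub, map_mul, map_mul]
    · exact (hj ((star x).2.2 a)).congr fun n => by
        rw [map_sub, map_mul, map_mul, ← map_star]; rfl
    · exact (hj (tendsto_mul_sub_of_isTwoSidedUnit (y := star x * x) hu1 a)).congr fun n => by
        rw [map_sub]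
        congr 1
        change (unitizationModel A).j (star ((x : BddSeq A) n) * (x : BddSeq A) n * a) = _
        rw [map_mul, map_mul, map_star]
    · exact (hj (tendsto_mul_sub_of_isTwoSidedUnit (y := x * star x) hu2 a)).congr fun n => by
        rw [map_sub]
        congr 1
        change (unitizationModel A).j ((x : BddSeq A) n * star ((x : BddSeq A) n) * a) = _
        rw [map_mul, map_mul, map_star]
  · obtain ⟨a, rfl⟩ := (unitizationModel A).exists_j b hb0
    set c : ℝ → ℂ := fun t => (fourier 1 (t : AddCircle T) : ℂ) with hc
    have hcc : Continuous c := (map_continuous (fourier 1)).comp (AddCircle.continuous_mk' T)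
    have hce : ∀ t : ℝ, c t = Complex.exp (Complex.I * (2 * Real.pi / T : ℝ) * t) := fun t => by
      rw [hc]
      dsimp only
      rw [fourier_coe_apply]
      congr 1
      push_cast
      ring
    -- The quotient gives the eigenvalue relation for each t separately. Norm continuity of t ↦ D(t)
    -- in ℓ^∞ makes it uniform for |t| ≤ R by compactness.
    set D : ℝ → BddSeq A := fun t => seqMap (α.aut t) (x : BddSeq A) - c t • (x : BddSeq A) with hD
    have hDc : Continuous D := x.2.1.sub (hcc.smul continuous_const)
    have hK : IsCompact (D '' Icc (-R) R) := isCompact_Icc.image hDc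
    have hlim : ∀ t, Tendsto (fun n => D t n * a) atTop (𝓝 0) ∧
        Tendsto (fun n => a * D t n) atTop (𝓝 0) := by
      intro t
      have h1 := hu t
      rw [← hce] at h1
      exact Quotient.exact h1 a
    have h1 := eventually_forall_mem_compact_norm_le hK (C := ‖a‖) (Φ := fun n z => z n * a)
      (fun n y z => by
        rw [← sub_mul, mul_comm ‖a‖]
        refine (norm_mul_le _ _).trans ?_
        gcongr
        exact BddSeq.norm_apply_le (y - z) n) (by rintro _ ⟨t, -, rfl⟩; exact (hlim t).1) hε
    have h2 := eventually_forall_mem_compact_norm_le hK (C := ‖a‖) (Φ := fun n z => a * z n)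
      (fun n y z => by
        rw [← mul_sub]
        refine (norm_mul_le _ _).trans ?_
        gcongr
        exact BddSeq.norm_apply_le (y - z) n) (by rintro _ ⟨t, -, rfl⟩; exact (hlim t).2) hε
    filter_upwards [h1, h2] with n hn hn' t ht
    have h3 : α.unitization.ext t ((unitizationModel A).j ((x : BddSeq A) n)) -
        c t • (unitizationModel A).j ((x : BddSeq A) n) = (unitizationModel A).j (D t n) := by
      rw [α.extends_unitization, ← map_smul, ← map_sub]
      rfl
    rw [h3, ← map_mul, ← map_mul, (unitizationModel A).norm_j, (unitizationModel A).norm_j]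
    exact ⟨hn _ ⟨t, ht, rfl⟩, hn' _ ⟨t, ht, rfl⟩⟩

end RokhlinExtraction

/-! ### Translation to multipliers and the final equivalences -/

section Equivalences

variable {A : Type*} [NonUnitalCStarAlgebra A]

theorem unitizationToMultiplier_fst (x : Unitization ℂ A) (a : A) :
    (unitizationToMultiplier A x).fst a = (unitizationModel A).act x a := by
  have h1 : unitizationToMultiplier A x =
      algebraMap ℂ 𝓜(ℂ, A) x.fst + ((x.snd : A) : 𝓜(ℂ, A)) := rfl
  refine (unitizationModel A).j_injective ?_
  rw [h1, DoubleCentralizer.add_fst, DoubleCentralizer.algebraMap_fst, DoubleCentralizer.coe_fst,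
    AugModel.j_act]
  conv_rhs => rw [← Unitization.inl_fst_add_inr_snd_eq x]
  change (((algebraMap ℂ (A →L[ℂ] A) x.fst) a + x.snd * a : A) : Unitization ℂ A) =
    (Unitization.inl x.fst + (x.snd : Unitization ℂ A)) * (a : Unitization ℂ A)
  rw [Algebra.algebraMap_eq_smul_one, add_mul, Unitization.inl_mul_inr, Unitization.inr_add,
    Unitization.inr_mul]
  rfl

theorem multiplierExtend_unitizationToMultiplier (α : CStarFlow A) (t : ℝ) (x : Unitization ℂ A) :
    multiplierExtend (α.aut t) (unitizationToMultiplier A x) =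
      unitizationToMultiplier A (α.unitization.ext t x) := by
  refine AugModel.multiplier_ext fun a => ?_
  change α.aut t ((unitizationToMultiplier A x).fst ((α.aut t).symm a)) = _
  rw [unitizationToMultiplier_fst, unitizationToMultiplier_fst, ← α.extends_unitization.act_ext,
    StarAlgEquiv.apply_symm_apply]

theorem unitizationToMultiplier_coboundary_fst (α : CStarFlow A) (t : ℝ) (x : Unitization ℂ A) (a : A) :
    (unitizationToMultiplier A x * multiplierExtend (α.aut t) (star (unitizationToMultiplier A x))).fst a =
      (unitizationModel A).act (α.unitization.coboundary x t) a := by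
  rw [← map_star, multiplierExtend_unitizationToMultiplier, ← map_mul, unitizationToMultiplier_fst]
  rfl

theorem unitizationToMultiplier_mem {x : Unitization ℂ A} (hx : x ∈ oneAddUnitary A) :
    unitizationToMultiplier A x ∈ unitary 𝓜(ℂ, A) :=
  Unitary.map_mem (unitizationToMultiplier A) hx.1

theorem isApproxInner_of_tendsto {ψ : A ≃⋆ₐ[ℂ] A} {r : ℕ → Unitization ℂ A}
    (hr : ∀ n, r n ∈ oneAddUnitary A)
    (h : ∀ a, Tendsto (fun n => (unitizationModel A).conj (r n) a) atTop (𝓝 (ψ a))) :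
    IsApproxInner ψ := by
  intro F ε hε
  have h1 : ∀ᶠ n in atTop, ∀ a ∈ F, dist ((unitizationModel A).conj (r n) a) (ψ a) < ε :=
    (Filter.eventually_all_finset F).2 fun a _ => Metric.tendsto_nhds.1 (h a) ε hε
  obtain ⟨n, hn⟩ := h1.exists
  refine ⟨⟨r n, hr n⟩, fun a ha => ?_⟩
  have h2 := hn a ha
  rw [dist_eq_norm, ← (unitizationModel A).norm_j_sub, AugModel.j_conj] at h2
  exact h2

theorem IsApproxInner.exists_conj_near {ψ : A ≃⋆ₐ[ℂ] A} (h : IsApproxInner ψ) (F : Finset A) (ε : ℝ)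
    (hε : 0 < ε) : ∃ s ∈ augUnitary (scalarPart A), ∀ a ∈ F,
      ‖(unitizationModel A).conj s a - ψ a‖ < ε := by
  obtain ⟨u, hu⟩ := h F ε hε
  refine ⟨u, u.2, fun a ha => ?_⟩
  rw [← (unitizationModel A).norm_j_sub, AugModel.j_conj]
  exact hu a ha

theorem NormStronglyCocycleConjugateVia.strongly {α β : CStarFlow A} {ψ : A ≃⋆ₐ[ℂ] A}
    (h : NormStronglyCocycleConjugateVia α β ψ) : StronglyCocycleConjugateVia α β ψ := by
  obtain ⟨w, hw, x, hx⟩ := h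
  refine ⟨w, hw, fun n => ⟨unitizationToMultiplier A (x n), unitizationToMultiplier_mem (x n).2⟩,
    fun a ε hε => ?_⟩
  filter_upwards [hx (ε / (‖a‖ + 1)) (by positivity)] with n hn t ht
  refine (ContinuousLinearMap.le_opNorm _ _).trans ?_
  rw [DoubleCentralizer.norm_fst]
  refine (mul_le_mul_of_nonneg_right (hn t ht) (norm_nonneg a)).trans ?_
  rw [div_mul_eq_mul_div, div_le_iff₀ (by positivity)]
  nlinarith [norm_nonneg a]

/-- Cocycle conjugate flows have approximately unitarily equivalent restricted coactions. -/
theorem CocycleConjugateVia.approxUnitarilyEquivalent {α β : CStarFlow A} {ψ : A ≃⋆ₐ[ℂ] A}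
    (h : CocycleConjugateVia α β ψ) (hψ : IsApproxInner ψ) :
    ApproxUnitarilyEquivalent α.restrictedCoaction β.restrictedCoaction := by
  obtain ⟨w, hw⟩ := h
  exact approxUnitarilyEquivalent_of_paths fun F ε hε =>
    α.extends_unitization.exists_path hw hψ.exists_conj_near F hε

variable [TopologicalSpace.SeparableSpace A] {α β : CStarFlow A}

theorem exists_stronglyCocycleConjugateVia (hwil : weakInnerLength A < ⊤) (hacelw : weakAcel A < ⊤)
    (hα : α.IsRokhlin) (hβ : β.IsRokhlin)
    (h : ApproxUnitarilyEquivalent α.restrictedCoaction β.restrictedCoaction) :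
    ∃ ψ : A ≃⋆ₐ[ℂ] A, IsApproxInner ψ ∧ StronglyCocycleConjugateVia α β ψ := by
  obtain ⟨L, hL0, hL⟩ := exists_hasWeakInnerLength hwil
  obtain ⟨C, hC0, hC⟩ := exists_hasCentralLength_of_weakAcel hacelw
  obtain ⟨ψ, w, hw, r, g, hr, hg, hψ, hgw, -⟩ := (unitizationModel A).exists_cocycleConjugacy
    α.extends_unitization β.extends_unitization hα.hasRokhlin hβ.hasRokhlin (CStarFlow.coactionEquiv h)
    hL0 hL hC0 hC
  refine ⟨ψ, isApproxInner_of_tendsto hr hψ, w, hw,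
    fun n => ⟨unitizationToMultiplier A (g n), unitizationToMultiplier_mem (hg n)⟩, fun a ε hε => ?_⟩
  filter_upwards [hgw a ε hε] with n hn t ht
  have h1 := hn t ht
  rw [← unitizationToMultiplier_coboundary_fst] at h1
  rw [DoubleCentralizer.sub_fst]
  exact h1

theorem exists_normStronglyCocycleConjugateVia (hwil : weakInnerLength A < ⊤) (hacel : acel A < ⊤)
    (hα : α.IsRokhlin) (hβ : β.IsRokhlin)
    (h : ApproxUnitarilyEquivalent α.restrictedCoaction β.restrictedCoaction) :
    ∃ ψ : A ≃⋆ₐ[ℂ] A, IsApproxInner ψ ∧ NormStronglyCocycleConjugateVia α β ψ := by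
  obtain ⟨L, hL0, hL⟩ := exists_hasWeakInnerLength hwil
  obtain ⟨C, hC0, hC⟩ := exists_hasCentralLength_of_acel hacel
  obtain ⟨ψ, w, hw, r, g, hr, hg, hψ, -, hgw⟩ := (unitizationModel A).exists_cocycleConjugacy
    α.extends_unitization β.extends_unitization hα.hasRokhlin hβ.hasRokhlin (CStarFlow.coactionEquiv h)
    hL0 hL hC0 hC
  refine ⟨ψ, isApproxInner_of_tendsto hr hψ, w, hw, fun n => ⟨g n, hg n⟩, fun ε hε => ?_⟩
  filter_upwards [hgw trivial ε hε] with n hn t ht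
  rw [← DoubleCentralizer.norm_fst]
  refine ContinuousLinearMap.opNorm_le_bound _ hε.le fun a => ?_
  have h1 := hn t ht a
  rw [← unitizationToMultiplier_coboundary_fst] at h1
  rw [DoubleCentralizer.sub_fst]
  exact h1

end Equivalences

theorem theorem3p6 {A : Type*} [NonUnitalCStarAlgebra A] [TopologicalSpace.SeparableSpace A]
    (hwil : weakInnerLength A < ⊤) (hacelw : weakAcel A < ⊤)
    (α β : CStarFlow A) (hα : α.IsRokhlin) (hβ : β.IsRokhlin) :
    List.TFAE [
      ∃ ψ : A ≃⋆ₐ[ℂ] A, IsApproxInner ψ ∧ StronglyCocycleConjugateVia α β ψ,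
      ∃ ψ : A ≃⋆ₐ[ℂ] A, IsApproxInner ψ ∧ CocycleConjugateVia α β ψ,
      ApproxUnitarilyEquivalent α.restrictedCoaction β.restrictedCoaction] ∧
    (acel A < ⊤ → List.TFAE [
      ∃ ψ : A ≃⋆ₐ[ℂ] A, IsApproxInner ψ ∧ StronglyCocycleConjugateVia α β ψ,
      ∃ ψ : A ≃⋆ₐ[ℂ] A, IsApproxInner ψ ∧ CocycleConjugateVia α β ψ,
      ApproxUnitarilyEquivalent α.restrictedCoaction β.restrictedCoaction,
      ∃ ψ : A ≃⋆ₐ[ℂ] A, IsApproxInner ψ ∧ NormStronglyCocycleConjugateVia α β ψ]) := by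
  have h12 : (∃ ψ : A ≃⋆ₐ[ℂ] A, IsApproxInner ψ ∧ StronglyCocycleConjugateVia α β ψ) →
      ∃ ψ : A ≃⋆ₐ[ℂ] A, IsApproxInner ψ ∧ CocycleConjugateVia α β ψ := by
    rintro ⟨ψ, hψ, w, hw, -⟩
    exact ⟨ψ, hψ, w, hw⟩
  have h23 : (∃ ψ : A ≃⋆ₐ[ℂ] A, IsApproxInner ψ ∧ CocycleConjugateVia α β ψ) →
      ApproxUnitarilyEquivalent α.restrictedCoaction β.restrictedCoaction := by
    rintro ⟨ψ, hψ, h⟩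
    exact h.approxUnitarilyEquivalent hψ
  have h31 := exists_stronglyCocycleConjugateVia hwil hacelw hα hβ
  refine ⟨?_, fun hacel => ?_⟩
  · tfae_have 1 → 2 := h12
    tfae_have 2 → 3 := h23
    tfae_have 3 → 1 := h31
    tfae_finish
  · have h34 := exists_normStronglyCocycleConjugateVia hwil hacel hα hβ
    tfae_have 1 → 2 := h12
    tfae_have 2 → 3 := h23
    tfae_have 3 → 4 := h34
    tfae_have 4 → 1 := by
      rintro ⟨ψ, hψ, h⟩
      exact ⟨ψ, hψ, h.strongly⟩
    tfae_finish
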